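/- All algebras are over $\mathbb{C}$, and all identities involving $u$ are identities of formal Laurent series in $u^{-1}$: rational functions of $u$ are expanded in $u^{-1}$ and infinite sums converge $u^{-1}$-adically. **Theorem.** *(1) Newton's formula for $\mathfrak{gl}_n$.* Let $n\ge 1$ and let $E=(E_{ij})$ be the $n\times n$ matrix formed by the standard basis elements of $\mathfrak{gl}_n$, regarded as elements of $\mathrm{U}(\mathfrak{gl}_n)$. Let $$C(u)=\sum_{p\in\mathfrak S_n}\operatorname{sgn}p\cdot(u+E)_{p(1),1}(u+E-1)_{p(2),2}\cdots(u+E-n+1)_{p(n),n}$$ be the Capelli determinant. Its coefficients are central in $\mathrm{U}(\mathfrak{gl}_n)$, it is invertible as a Laurent series in $u^{-1}$, and $$1+\sum_{k=0}^{\infty}\frac{(-1)^k\,\operatorname{tr}E^k}{(u-n+1)^{k+1}}=\frac{C(u+1)}{C(u)}.$$ *(2) Harish-Chandra images of the Gelfand invariants.* Let $\lambda_i$ stand for $E_{ii}$, identify $\mathrm{U}(\mathfrak h)$ (with $\mathfrak h$ the diagonal matrices) with $\mathbb{C}[\lambda_1,\dots,\lambda_n]$, let $\mathfrak n^{+}$,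 $\mathfrak n^-$ be the strictly upper and lower triangular matrices, and set $l_i=\lambda_i-i+1$. The Gelfand invariants $\operatorname{tr}E^k$ are central; for each $k\ge0$ there is exactly one $\chi(\operatorname{tr}E^k)\in\mathbb{C}[\lambda_1,\dots,\lambda_n]$ with $\operatorname{tr}E^k-\chi(\operatorname{tr}E^k)\in\mathfrak n^-\mathrm{U}(\mathfrak{gl}_n)+\mathrm{U}(\mathfrak{gl}_n)\mathfrak n^+$ (the Harish-Chandra image), and $$1+\sum_{k=0}^{\infty}\frac{(-1)^k\,\chi(\operatorname{tr}E^k)}{(u-n+1)^{k+1}}=\prod_{i=1}^n\Bigl(1+\frac1{u+l_i}\Bigr).$$ *(3) Newton's formula for $\mathfrak o_N$ and $\mathfrak{sp}_N$.* Let $N=2n$ or $N=2n+1$ with $N\ge1$, and number rows and columns of $N\times N$ matrices by $-n,\dots,n$, omitting $0$ if $N=2n$. Put $\theta_{ij}=1$ in the orthogonal case and $\theta_{ij}=\operatorname{sgn}i\cdot\operatorname{sgn}j$ in the symplectic case (where $N=2n$), let $F_{ij}=E_{ij}-\theta_{ij}E_{-j,-i}$, let $\mathfrak g_n\subset\mathfrak{gl}_N$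 be the Lie subalgebra spanned by the $F_{ij}$ (so $\mathfrak g_n=\mathfrak o_{2n},\mathfrak o_{2n+1}$ or $\mathfrak{sp}_{2n}$), and let $F=(F_{ij})$ with entries in $\mathrm{U}(\mathfrak g_n)$. For $i\ge1$ let $\rho_{-i}=-\rho_i$ be $i-1$, $i-\frac12$, $i$ for $\mathfrak o_{2n},\mathfrak o_{2n+1},\mathfrak{sp}_{2n}$ respectively, and $\rho_0=\frac12$ for $\mathfrak o_{2n+1}$. Define a map $p\mapsto p'$ from $\mathfrak S_N$ to $\mathfrak S_N$ as follows. To an arrangement $(p_1,\dots,p_N)$ of a family $\omega_1<\dots<\omega_N$ associate a sequence $(q_1,\dots,q_{N-1})$: it is empty for $N=1$ and equals $(\omega_1)$ for $N=2$. For $N>2$, $(q_1,q_{N-1})$ is the image of $(p_1,p_N)$ under $$(\omega_k,\omega_l)\mapsto(\omega_l,\omega_k)\ (k,l<N),\quad(\omega_k,\omega_N)\mapsto(\omega_{N-1},\omega_k),\quad(\omega_N,\omega_k)\mapsto(\omega_k,\omega_{N-1})\ (k<N-1),$$ $$(\omega_{N-1},\omega_N)\mapsto(\omega_{N-1},\omega_{N-2}),\quad(\omega_N,\omega_{N-1})\mapsto(\omega_{N-1},\omega_{N-2}),$$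 and $(q_2,\dots,q_{N-2})$ is the sequence associated with the arrangement $(p_2,\dots,p_{N-1})$. For $p\in\mathfrak S_N$ put $p'=(q_1,\dots,q_{N-1},N)$. For any permutation $(a_1,\dots,a_N)$ of the indices $-n,\dots,n$ let $$C(u)=(-1)^n\sum_{p\in\mathfrak S_N}\operatorname{sgn}pp'\cdot(u+\rho_{-n}+F)_{-a_{p(1)},a_{p'(1)}}\cdots(u+\rho_n+F)_{-a_{p(N)},a_{p'(N)}}.$$ The coefficients of $C(u)$ are central in $\mathrm{U}(\mathfrak g_n)$ and $C(u)$ is invertible as a Laurent series in $u^{-1}$. If $N=2n$ then $$1+\frac{2u+1}{2u+1\mp1}\sum_{k=0}^{\infty}\frac{(-1)^k\,\operatorname{tr}F^k}{(u+\rho_n)^{k+1}}=\frac{C(u+1)}{C(u)},$$ with the upper sign in the orthogonal case and the lower sign in the symplectic case. If $N=2n+1$ the same formula (with the upper sign) holds with $C(u)$ replaced by $\overline C(u)=\frac{2u}{2u+1}C(u)$. -/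

import Mathlib

open Matrix Polynomial

attribute [local instance 100] LieRing.ofAssociativeRing

noncomputable section

/-! ## Formal Laurent series in `u⁻¹` -/

namespace FormalSeries

/-- The formal variable `u`. Elements of `LaurentSeries A` are read as formal Laurent series in
`u⁻¹` with coefficients in `A`: the coefficient with index `d` belongs to `u ^ (-d)`. -/
def u (A : Type*) [Ring A] : LaurentSeries A := HahnSeries.single (-1) 1

/-- A scalar series (for example the expansion in `u⁻¹` of a rational function of `u`), viewed with
coefficients in a complex algebra `A`. -/
def scalar (A : Type*) [Ring A] [Algebra ℂ A] (x : LaurentSeries ℂ) : LaurentSeries A :=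
  HahnSeries.map x (algebraMap ℂ A)

/-- A polynomial in `u` as a Laurent series in `u⁻¹`. -/
def ofPoly {A : Type*} [Ring A] (p : A[X]) : LaurentSeries A :=
  p.eval₂ HahnSeries.C (u A)

/-- `∑ k, f k = s` in the `u⁻¹`-adic topology: up to any given order in `u⁻¹`, all sufficiently
long partial sums agree with `s`. -/
def HasFormalSum {A : Type*} [Ring A] (f : ℕ → LaurentSeries A) (s : LaurentSeries A) : Prop :=
  ∀ d : ℤ, ∃ K : ℕ, ∀ m : ℕ, K ≤ m → ∀ e : ℤ, e ≤ d →
    (∑ k ∈ Finset.range m, f k).coeff e = s.coeff e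

end FormalSeries

/-- The `(i, j)` entry of the matrix `X + c + M`, where `X` is a central indeterminate and `c` is a
scalar. -/
def shiftedEntry {ι A : Type*} [DecidableEq ι] [Ring A] [Algebra ℂ A]
    (M : Matrix ι ι A) (c : ℂ) (i j : ι) : A[X] :=
  (if i = j then X + C (algebraMap ℂ A c) else 0) + C (M i j)

/-! ## The general linear Lie algebra -/

namespace GenLin

/-- The universal enveloping algebra `U(𝔤𝔩ₙ)`. -/
abbrev U (n : ℕ) : Type := UniversalEnvelopingAlgebra ℂ (Matrix (Fin n) (Fin n) ℂ)

/-- The matrix `E` whose `(i, j)` entry is the basis element `E i j` of `𝔤𝔩ₙ` in `U(𝔤𝔩ₙ)`. -/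
def E (n : ℕ) : Matrix (Fin n) (Fin n) (U n) :=
  fun i j => UniversalEnvelopingAlgebra.ι ℂ (Matrix.single i j (1 : ℂ))

/-- The Gelfand invariant `tr E ^ k`. -/
def gelfand (n k : ℕ) : U n := (E n ^ k).trace

/-- The Capelli determinant
`C(u) = ∑ p, sgn p · (u + E)_{p(1),1} (u + E - 1)_{p(2),2} ⋯ (u + E - n + 1)_{p(n),n}`,
as a polynomial in `u`. The index `i : Fin n` runs over `0, …, n - 1`. -/
def capelli (n : ℕ) : (U n)[X] :=
  ∑ p : Equiv.Perm (Fin n), (Equiv.Perm.sign p : ℤ) •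
    (List.ofFn fun i : Fin n => shiftedEntry (E n) (-(i : ℂ)) (p i) i).prod

/-- The element of `U(𝔥) ⊆ U(𝔤𝔩ₙ)` given by a polynomial in the variables `λᵢ = E i i`, where `𝔥`
is the diagonal Cartan subalgebra. The elements `E i i` commute, so the order of the factors of a
monomial is immaterial. -/
def cartanElement (n : ℕ) (f : MvPolynomial (Fin n) ℂ) : U n :=
  ∑ m ∈ f.support, f.coeff m • (List.ofFn fun i : Fin n => E n i i ^ m i).prod

/-- The subspace `𝔫⁻ U + U 𝔫⁺` of `U = U(𝔤𝔩ₙ)`, where `𝔫⁺` and `𝔫⁻` are the subalgebras of strictly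
upper and strictly lower triangular matrices. -/
def triangularComplement (n : ℕ) : Submodule ℂ (U n) :=
  Submodule.span ℂ
    ({x | ∃ (i j : Fin n) (a : U n), j < i ∧ x = E n i j * a} ∪
     {x | ∃ (i j : Fin n) (a : U n), i < j ∧ x = a * E n i j})

/-- `f` is a Harish-Chandra image of `z`: `z - f ∈ 𝔫⁻ U + U 𝔫⁺`. -/
def IsHarishChandraImage (n : ℕ) (z : U n) (f : MvPolynomial (Fin n) ℂ) : Prop :=
  z - cartanElement n f ∈ triangularComplement n

/-- The Harish-Chandra image `χ(z)` of a central element `z`, as a polynomial in the variables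
`λᵢ`: the polynomial `f` with `z - f ∈ 𝔫⁻ U + U 𝔫⁺`. -/
def chi (n : ℕ) (z : U n) : MvPolynomial (Fin n) ℂ :=
  Classical.epsilon (IsHarishChandraImage n z)

/-- The shifted variable `lᵢ = λᵢ - i + 1` for `i = 1, …, n`; here the index is `i - 1 : Fin n`. -/
def l (n : ℕ) (i : Fin n) : MvPolynomial (Fin n) ℂ :=
  MvPolynomial.X i - MvPolynomial.C (i : ℂ)

end GenLin

/-! ## The permutation map `p ↦ p'` -/

namespace PermMap

variable {α : Type*} [LinearOrder α] [OrderBot α]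

/-- The map on ordered pairs of distinct indices of a family `ω₁ < ⋯ < ω_N` with `N ≥ 3`, where
`a = ω_N`, `b = ω_{N-1}` and `c = ω_{N-2}`. -/
def ordPair (a b c : α) (k l : α) : α × α :=
  if l = a then
    (if k = b then (b, c) else (b, k))
  else if k = a then
    (if l = b then (b, c) else (l, b))
  else (l, k)

/-- The largest element of a nonempty finite set. -/
def top1 (s : Finset α) : α := s.sup id

/-- The sequence `(q₁, …, q_{N-1})` attached to an arrangement `p = (p₁, …, p_N)` of a family of
indices, where `N` is written as `M + 1`. -/
def qSeq : (M : ℕ) → (Fin (M + 1) → α) → (Fin M → α)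
  | 0, _ => Fin.elim0
  | 1, p => fun _ => min (p 0) (p 1)
  | M + 2, p =>
    let s : Finset α := Finset.univ.image p
    let a := top1 s
    let b := top1 (s.erase a)
    let c := top1 ((s.erase a).erase b)
    let q := ordPair a b c (p 0) (p (Fin.last (M + 2)))
    Fin.cons (α := fun _ => α) q.1
      (Fin.snoc (α := fun _ => α) (qSeq M fun i => p i.succ.castSucc) q.2)

theorem top1_mem {s : Finset α} (h : s.Nonempty) : top1 s ∈ s := by
  obtain ⟨x, hx, hx'⟩ := Finset.exists_mem_eq_sup s h id
  rw [top1, hx']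
  exact hx

theorem le_top1 {s : Finset α} {x : α} (h : x ∈ s) : x ≤ top1 s :=
  Finset.le_sup (f := id) h

theorem ordPair_spec {s : Finset α} {k l : α} (hk : k ∈ s) (hl : l ∈ s) (hkl : k ≠ l)
    (h3 : ∃ x ∈ s, x ≠ k ∧ x ≠ l) (m : Finset α) (hm : ∀ x, x ∈ m ↔ x ∈ s ∧ x ≠ k ∧ x ≠ l) :
    let a := top1 s
    let b := top1 (s.erase a)
    let c := top1 ((s.erase a).erase b)
    let q := ordPair a b c k l
    q.1 ≠ q.2 ∧ q.1 ∈ s ∧ q.2 ∈ s ∧ q.1 ≠ a ∧ q.2 ≠ a ∧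
      (q.1 ∈ m → q.1 = top1 m) ∧ (q.2 ∈ m → q.2 = top1 m) ∧ (a ∈ m → a = top1 m) := by
  intro a b c q
  obtain ⟨x, hx, hxk, hxl⟩ := h3
  have ha : a ∈ s := top1_mem ⟨x, hx⟩
  have ha' : ∀ y ∈ s, y ≤ a := fun y hy => le_top1 hy
  have hb : b ∈ s.erase a := by
    apply top1_mem
    by_cases h : k = a
    · exact ⟨l, by grind⟩
    · exact ⟨k, by grind⟩
  have hb' : ∀ y ∈ s.erase a, y ≤ b := fun y hy => le_top1 hy
  have hc : c ∈ (s.erase a).erase b := by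
    apply top1_mem
    by_cases h : k = a ∨ k = b
    · by_cases h' : l = a ∨ l = b
      · exact ⟨x, by grind⟩
      · exact ⟨l, by grind⟩
    · exact ⟨k, by grind⟩
  have hc' : ∀ y ∈ (s.erase a).erase b, y ≤ c := fun y hy => le_top1 hy
  have ht : top1 m ∈ m := top1_mem ⟨x, by grind⟩
  have ht' : ∀ y ∈ m, y ≤ top1 m := fun y hy => le_top1 hy
  have key : ∀ y ∈ m, (∀ z ∈ m, z ≤ y) → y = top1 m := fun y hy hz =>
    le_antisymm (ht' y hy) (hz _ ht)
  simp only [Finset.mem_erase] at hb hb' hc hc'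
  clear_value a b c
  have hq : q = ordPair a b c k l := rfl
  clear_value q
  unfold ordPair at hq
  split_ifs at hq <;> subst hq <;> refine ⟨?_, ?_, ?_, ?_, ?_, ?_, ?_, ?_⟩ <;> grind

/-- For an arrangement `p` of pairwise distinct indices, `(q₁, …, q_{N-1})` is an arrangement of all
the indices except the largest one. -/
theorem qSeq_spec : ∀ (M : ℕ) (p : Fin (M + 1) → α), Function.Injective p →
    Function.Injective (qSeq M p) ∧
      ∀ i, (∃ j, qSeq M p i = p j) ∧ qSeq M p i ≠ top1 (Finset.univ.image p)
  | 0, _, _ => ⟨fun i => i.elim0, fun i => i.elim0⟩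
  | 1, p, hp => by
    refine ⟨fun i j _ => Subsingleton.elim i j, fun i => ⟨?_, ?_⟩⟩
    · rcases min_choice (p 0) (p 1) with h | h
      · exact ⟨0, h⟩
      · exact ⟨1, h⟩
    · intro h
      have h0 : p 0 ≤ min (p 0) (p 1) := by
        change _ ≤ qSeq 1 p i
        rw [h]
        exact le_top1 (by simp)
      have h1 : p 1 ≤ min (p 0) (p 1) := by
        change _ ≤ qSeq 1 p i
        rw [h]
        exact le_top1 (by simp)
      have := hp (le_antisymm (le_trans h0 (min_le_right _ _)) (le_trans h1 (min_le_left _ _)))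
      exact absurd this (by decide)
  | M + 2, p, hp => by
    have hp' : Function.Injective fun i : Fin (M + 1) => p i.succ.castSucc := fun i j h => by
      simpa using hp h
    obtain ⟨ih1, ih2⟩ := qSeq_spec M _ hp'
    have hmid : ∀ x, x ∈ Finset.univ.image (fun i : Fin (M + 1) => p i.succ.castSucc) ↔
        x ∈ Finset.univ.image p ∧ x ≠ p 0 ∧ x ≠ p (Fin.last (M + 2)) := by
      intro x
      simp only [Finset.mem_image, Finset.mem_univ, true_and]
      constructor
      · rintro ⟨i, rfl⟩
        refine ⟨⟨_, rfl⟩, fun h => ?_, fun h => ?_⟩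
        · have := congrArg Fin.val (hp h)
          simp at this
        · have := congrArg Fin.val (hp h)
          simp at this
          omega
      · rintro ⟨⟨j, rfl⟩, h1, h2⟩
        have h1' : (j : ℕ) ≠ 0 := fun h => h1 (congrArg p (Fin.ext h))
        have h2' : (j : ℕ) ≠ M + 2 := fun h => h2 (congrArg p (Fin.ext h))
        refine ⟨⟨j - 1, by omega⟩, congrArg p (Fin.ext ?_)⟩
        simp
        omega
    have hs := ordPair_spec (s := Finset.univ.image p) (k := p 0) (l := p (Fin.last (M + 2)))
      (by simp) (by simp)
      (fun h => by
        have := congrArg Fin.val (hp h)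
        simp at this)
      ⟨p (Fin.succ (Fin.castSucc 0)), ((hmid _).1 (Finset.mem_image_of_mem _ (Finset.mem_univ 0)))⟩
      _ hmid
    dsimp only at hs
    obtain ⟨h1, h2, h3, h4, h5, h6, h7, h8⟩ := hs
    have hq : ∀ i, qSeq M (fun i : Fin (M + 1) => p i.succ.castSucc) i ∈
        Finset.univ.image (fun i : Fin (M + 1) => p i.succ.castSucc) := fun i => by
      obtain ⟨j, hj⟩ := (ih2 i).1
      rw [hj]
      exact Finset.mem_image_of_mem _ (Finset.mem_univ j)
    constructor
    · rw [qSeq, Fin.cons_injective_iff, Fin.snoc_injective_iff]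
      refine ⟨?_, ih1, ?_⟩
      · rintro ⟨i, hi⟩
        induction i using Fin.lastCases with
        | last => exact h1 (by simpa using hi.symm)
        | cast i =>
          rw [Fin.snoc_castSucc] at hi
          exact (ih2 i).2 (hi.trans (h6 (hi ▸ hq i)))
      · rintro ⟨i, hi⟩
        exact (ih2 i).2 (hi.trans (h7 (hi ▸ hq i)))
    · intro i
      have hmem : ∀ x, x ∈ Finset.univ.image p → ∃ j, x = p j := fun x hx => by
        obtain ⟨j, -, hj⟩ := Finset.mem_image.1 hx
        exact ⟨j, hj.symm⟩
      rw [qSeq]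
      induction i using Fin.cases with
      | zero => exact ⟨hmem _ h2, h4⟩
      | succ i =>
        rw [Fin.cons_succ]
        induction i using Fin.lastCases with
        | last =>
          rw [Fin.snoc_last]
          exact ⟨hmem _ h3, h5⟩
        | cast i =>
          rw [Fin.snoc_castSucc]
          refine ⟨hmem _ ((hmid _).1 (hq i)).1, fun h => (ih2 i).2 (h.trans (h8 (h ▸ hq i)))⟩

/-- The map `𝔖_N → 𝔖_N`, `p ↦ p'`, where `p' = (q₁, …, q_{N-1}, N)`. -/
def primePerm : (N : ℕ) → Equiv.Perm (Fin N) → Equiv.Perm (Fin N)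
  | 0, _ => 1
  | M + 1, p =>
    Equiv.ofBijective (Fin.snoc (α := fun _ => Fin (M + 1)) (qSeq M p) (Fin.last M)) (by
      have h := qSeq_spec M p p.injective
      refine Finite.injective_iff_bijective.1 (Fin.snoc_injective_iff.2 ⟨h.1, ?_⟩)
      rintro ⟨i, hi⟩
      refine (h.2 i).2 (hi.trans (le_antisymm ?_ (Fin.le_last _)))
      exact le_top1 (Finset.mem_image.2 ⟨p.symm (Fin.last M), Finset.mem_univ _, by simp⟩))

end PermMap

/-! ## The orthogonal and symplectic Lie algebras -/

/-- The series `B`, `C`, `D` of classical Lie algebras: `𝔬_{2n+1}`, `𝔰𝔭_{2n}`, `𝔬_{2n}`. -/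
inductive ClassicalType
  | B
  | C
  | D

namespace ClassicalType

/-- The size `N` of the matrices. -/
@[reducible]
def size : ClassicalType → ℕ → ℕ
  | B, n => 2 * n + 1
  | C, n => 2 * n
  | D, n => 2 * n

/-- Rows and columns are numbered by `-n, …, -1, 0, 1, …, n` if `N = 2n + 1` and by
`-n, …, -1, 1, …, n` if `N = 2n`. This is the index standing at a given position; the index
`-i` stands at the reversed position, see `label_rev`. -/
def label (t : ClassicalType) (n : ℕ) (k : Fin (t.size n)) : ℤ :=
  match t with
  | B => (k : ℤ) - n
  | C => if (k : ℕ) < n then (k : ℤ) - n else (k : ℤ) - n + 1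
  | D => if (k : ℕ) < n then (k : ℤ) - n else (k : ℤ) - n + 1

theorem label_rev (t : ClassicalType) (n : ℕ) (k : Fin (t.size n)) :
    t.label n k.rev = -t.label n k := by
  have hk := k.isLt
  have hr := Fin.val_rev k
  cases t <;> simp only [size, label] at * <;> grind

/-- `θ i j`, equal to `1` in the orthogonal case and to `sgn i · sgn j` in the symplectic case. -/
def theta (t : ClassicalType) (n : ℕ) (i j : Fin (t.size n)) : ℂ :=
  match t with
  | C => ((label C n i).sign * (label C n j).sign : ℤ)
  | _ => 1

/-- The sign which is `+` in the orthogonal case and `-` in the symplectic case. -/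
def eps : ClassicalType → ℂ
  | C => -1
  | _ => 1

/-- The matrix `F i j = E i j - θ i j E (-j) (-i)` in `𝔤𝔩_N`. -/
def gen (t : ClassicalType) (n : ℕ) (i j : Fin (t.size n)) :
    Matrix (Fin (t.size n)) (Fin (t.size n)) ℂ :=
  Matrix.single i j 1 - t.theta n i j • Matrix.single j.rev i.rev 1

/-- The classical Lie algebra `𝔤ₙ ⊆ 𝔤𝔩_N` spanned by the `F i j` (their linear span is closed under
the bracket). -/
def lieAlg (t : ClassicalType) (n : ℕ) :
    LieSubalgebra ℂ (Matrix (Fin (t.size n)) (Fin (t.size n)) ℂ) :=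
  LieSubalgebra.lieSpan ℂ _ {x | ∃ i j, x = t.gen n i j}

/-- The universal enveloping algebra `U(𝔤ₙ)`. -/
abbrev U (t : ClassicalType) (n : ℕ) : Type := UniversalEnvelopingAlgebra ℂ (t.lieAlg n)

/-- The matrix `F` with entries in `U(𝔤ₙ)`. -/
def F (t : ClassicalType) (n : ℕ) : Matrix (Fin (t.size n)) (Fin (t.size n)) (t.U n) :=
  fun i j => UniversalEnvelopingAlgebra.ι ℂ
    (⟨t.gen n i j, LieSubalgebra.subset_lieSpan ⟨i, j, rfl⟩⟩ : t.lieAlg n)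

/-- For `i ≥ 1`, `ρ_{-i} = -ρ_i` is `i - 1` for `𝔬_{2n}`, `i - 1/2` for `𝔬_{2n+1}` and `i` for
`𝔰𝔭_{2n}`; moreover `ρ_0 = 1/2` for `𝔬_{2n+1}`. -/
def rho (t : ClassicalType) (i : ℤ) : ℂ :=
  let r : ℂ := match t with
    | B => (|i| : ℤ) - 1 / 2
    | C => (|i| : ℤ)
    | D => (|i| : ℤ) - 1
  if i < 0 then r else if i = 0 then 1 / 2 else -r

/-- The Capelli-type determinant
`C(u) = (-1)ⁿ ∑ p, sgn (p p') · (u + ρ_{-n} + F)_{-a_{p(1)}, a_{p'(1)}} ⋯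
(u + ρ_n + F)_{-a_{p(N)}, a_{p'(N)}}`, as a polynomial in `u`, where `a` is an arrangement of the
indices `-n, …, n`. -/
def capelli (t : ClassicalType) (n : ℕ) (a : Equiv.Perm (Fin (t.size n))) : (t.U n)[X] :=
  (-1) ^ n * ∑ p : Equiv.Perm (Fin (t.size n)),
    (Equiv.Perm.sign (p * PermMap.primePerm _ p) : ℤ) •
      (List.ofFn fun i : Fin (t.size n) => shiftedEntry (t.F n) (t.rho (t.label n i))
        (a (p i)).rev (a (PermMap.primePerm _ p i))).prod

/-- The series `C(u + c)` in the even case `N = 2n`, and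
`C̄(u + c)` with `C̄(u) = 2u / (2u + 1) · C(u)` in the odd case `N = 2n + 1`. -/
def capelliSeries (t : ClassicalType) (n : ℕ) (a : Equiv.Perm (Fin (t.size n))) (c : ℕ) :
    LaurentSeries (t.U n) :=
  match t with
  | B =>
    let v : LaurentSeries ℂ := FormalSeries.u ℂ + c
    FormalSeries.scalar _ (2 * v / (2 * v + 1)) *
      FormalSeries.ofPoly ((capelli B n a).comp (X + (c : (U B n)[X])))
  | C => FormalSeries.ofPoly ((capelli C n a).comp (X + (c : (U C n)[X])))
  | D => FormalSeries.ofPoly ((capelli D n a).comp (X + (c : (U D n)[X])))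

end ClassicalType

end

attribute [local instance 100] LieRing.ofAssociativeRing

noncomputable section

set_option linter.unusedSectionVars false

/-! ## Canonical anticommutation relations -/

namespace Fermion

/-! All Newton formulas come from one mechanism. On a Fock space with coefficients in an algebra
`A`, a matrix `F` over `A` gives the operators `η_b(v) = ∑ ψ_i (F_ib + v δ_ib)`. The relations of
`𝔤𝔩ₙ` imply `T_b(v) T_c(v-1) + T_c(v) T_b(v-1) = 0` for `T = η`. For the orthogonal and symplectic
relations this fails, and is restored by a correction ending in the annihilator `d_{-b}`: a multiple
of `Θ d_{-b}` with coefficient `1/(2(v-1))`, or of `ω d_{-b}` with constant coefficient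
(`orthT_anticomm`, `symplT_anticomm`). Hence `T_1(v) T_2(v-1) ⋯` is antisymmetric in its labels. Its
matrix element from the vacuum to the fully occupied state, `fockDet`, is a quantum determinant.

Expanding this element gives the explicit sums. For `𝔤𝔩ₙ` every factor is expanded from the left. In
the other cases a factor acting on the vacuum loses its correction, while a factor at the left end,
read on a component containing its label, acts like `η` with a shifted argument (`d_orthT`,
`d_symplT`). One therefore expands alternately from the two ends, and the bookkeeping of columns is
exactly the map `p ↦ p'` (`setProd_cre_vac`).

Deleting one label from the product gives cofactors with `cof · (F + v - n) = det`, where `N = n +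
1` (`IsDetFamily.sum_cof_mul_entry`). So `det⁻¹ tr cof` is the trace of the resolvent, that is the
geometric series of the `tr F^k`, and Newton's formula becomes a difference equation relating
`det(v+1)`, `det(v)` and `tr cof`.

To prove that equation, a second family of fermions `p, q` labels the columns. Then `T(v) = ∑ T_b(v)
p_b` satisfies: `T(v) ⋯ T(v-n)` has top coefficient `N! det`, and `T(v) ⋯ T(v-n+1) τ` with `τ = ∑
ψ_b p_b` has `n! tr cof`. For `𝔤𝔩ₙ` the `T(v)` commute and are affine in `v` with slope `τ`, so the
equation is immediate (`IsVacuum.genTot_newton`). In the other cases one uses that on the vacuum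
left multiplication `F` equals right multiplication `G`, that the functional is invariant under the
diagonal action `invGen`, and that the quadratic operators `annCre`, `creAnn` control the defect
(`IsVacuum.orthTot_newton`, `IsVacuum.symplTot_newton`). The same invariance gives centrality.
Finally `v` is specialised to `u` plus a constant in the field of scalar Laurent series, where it is
not an integer and all divisions are legitimate.

For the Harish-Chandra images, only the identity permutation of the Capelli determinant survives
modulo `𝔫⁻U + U𝔫⁺`, giving `∏ (u + l_i)`. Pairs (central element, image) form an algebra, so the
ratio of shifted determinants, and then every `tr E^k`, has an image. Uniqueness follows by
evaluating on highest weight vectors in exterior algebras of `ℂⁿ ⊗ ℂᵐ`, whose weights are Zariski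
dense. -/

/-- Creation operators `ψ i` and annihilation operators `d i` satisfying the canonical
anticommutation relations. -/
structure IsCAR {I R : Type*} [DecidableEq I] [Ring R] (ψ d : I → R) : Prop where
  psi_psi : ∀ i j, ψ i * ψ j = -(ψ j * ψ i)
  d_d : ∀ i j, d i * d j = -(d j * d i)
  d_psi : ∀ i j, d i * ψ j = (if i = j then 1 else 0) - ψ j * d i

variable {K R I : Type*} [Field K] [CharZero K] [Ring R] [Algebra K R] [Fintype I] [DecidableEq I]

/-- `η b = ∑ i, ψ i F i b`. -/
def eta (ψ : I → R) (F : I → I → R) (b : I) : R := ∑ i, ψ i * F i b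

/-- `η b (v) = ∑ i, ψ i (F i b + v δ i b)`. -/
def etaShift (ψ : I → R) (F : I → I → R) (b : I) (v : K) : R := eta ψ F b + v • ψ b

theorem eq_zero_of_eq_neg {x : R} (K : Type*) [Field K] [CharZero K] [Algebra K R]
    (h : x = -x) : x = 0 := by
  have h2 : (2 : K) • x = 0 := by rw [two_smul]; nth_rw 1 [h]; simp
  exact (smul_eq_zero_iff_right (two_ne_zero)).1 h2

section Single

variable {ψ d : I → R} {F : I → I → R} (h : IsCAR ψ d) (hψ : ∀ i j k, ψ i * F j k = F j k * ψ i)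
  (hd : ∀ i j k, d i * F j k = F j k * d i)
include h hψ

theorem eta_psi (b c : I) : eta ψ F b * ψ c = -(ψ c * eta ψ F b) := by
  simp only [eta, Finset.sum_mul, Finset.mul_sum, ← Finset.sum_neg_distrib]
  refine Finset.sum_congr rfl fun i _ => ?_
  rw [mul_assoc, ← hψ, ← mul_assoc, h.psi_psi, neg_mul, mul_assoc]

omit hψ in
include hd in
theorem d_eta (i b : I) : d i * eta ψ F b = F i b - eta ψ F b * d i := by
  simp only [eta, Finset.sum_mul, Finset.mul_sum]
  simp only [← mul_assoc, h.d_psi, sub_mul, Finset.sum_sub_distrib, ite_mul, one_mul, zero_mul]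
  simp only [mul_assoc, hd]
  simp

/-- Since the `ψ` anticommute and commute with the entries, swapping the two factors flips only the
sign of `ψ i * ψ k`; what remains is the commutator of entries. -/
theorem eta_eta (b c : I) : eta ψ F b * eta ψ F c + eta ψ F c * eta ψ F b =
    ∑ i, ∑ k, ψ i * ψ k * (F i b * F k c - F k c * F i b) := by
  have h1 : eta ψ F b * eta ψ F c = ∑ i, ∑ k, ψ i * ψ k * (F i b * F k c) := by
    simp only [eta, Finset.sum_mul_sum]
    refine Finset.sum_congr rfl fun i _ => Finset.sum_congr rfl fun k _ => ?_
    simp only [mul_assoc]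
    rw [← mul_assoc (F i b), ← hψ, mul_assoc]
  have h2 : eta ψ F c * eta ψ F b = ∑ i, ∑ k, -(ψ i * ψ k * (F k c * F i b)) := by
    simp only [eta, Finset.sum_mul_sum]
    rw [Finset.sum_comm]
    refine Finset.sum_congr rfl fun i _ => Finset.sum_congr rfl fun k _ => ?_
    rw [h.psi_psi i k]
    simp only [mul_assoc, neg_mul, neg_neg]
    rw [← mul_assoc (F k c), ← hψ, mul_assoc]
  rw [h1, h2, ← Finset.sum_add_distrib]
  refine Finset.sum_congr rfl fun i _ => ?_
  rw [← Finset.sum_add_distrib]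
  refine Finset.sum_congr rfl fun k _ => ?_
  noncomm_ring

end Single

/-! ## The general linear case -/

/-- The commutation relations of the matrix units. -/
def IsGenLin (F : I → I → R) : Prop := ∀ i j k l, F i j * F k l - F k l * F i j =
  (if j = k then F i l else 0) - (if i = l then F k j else 0)

/-- The anticommutator of `η_b` and `η_c` is `η_c ψ_b + η_b ψ_c`. Lowering the parameter of the
right factor by one produces the same terms with the opposite sign, because `ψ_b η_c = -η_c ψ_b`. -/
theorem etaShift_anticomm_of_isGenLin {ψ d : I → R} {F : I → I → R} (h : IsCAR ψ d)
    (hψ : ∀ i j k, ψ i * F j k = F j k * ψ i) (hF : IsGenLin F) (b c : I) (v : K) :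
    etaShift ψ F b v * etaShift ψ F c (v - 1) + etaShift ψ F c v * etaShift ψ F b (v - 1) = 0 := by
  have h1 := eta_eta h hψ b c
  simp only [hF _ _ _ _, mul_sub, mul_ite, mul_zero, Finset.sum_sub_distrib] at h1
  rw [Finset.sum_comm (f := fun x y => if x = c then _ else _)] at h1
  simp only [Finset.sum_ite_eq, Finset.sum_ite_eq', Finset.mem_univ, if_true] at h1
  have h2 : ∑ i, ψ i * ψ b * F i c = eta ψ F c * ψ b := by
    simp only [eta, Finset.sum_mul, mul_assoc, ← hψ]
  have h3 : ∑ i, ψ c * ψ i * F i b = -(eta ψ F b * ψ c) := by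
    rw [eta_psi h hψ, neg_neg]; simp only [eta, Finset.mul_sum, mul_assoc]
  rw [h2, h3] at h1
  have h4 := eta_psi h hψ b c
  have h5 := eta_psi h hψ c b
  simp only [etaShift]
  -- The coefficients act by left and right multiplication on the relations; the remaining identity
  -- is linear in noncommutative monomials, so `module` decides it after expansion.
  linear_combination (norm := skip) h1 + v • h4 + v • h5 + (v * (v - 1)) • h.psi_psi b c
  simp only [mul_add, add_mul, sub_smul, smul_mul_assoc, mul_smul_comm, mul_sub]
  module

/-! ## The orthogonal and symplectic cases -/

/-- The commutation relations of the standard generators of the orthogonal (`ε = 1`) and symplectic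
(`ε = -1`) Lie algebras with respect to the involution `ν` and the signs `s`. -/
structure IsClassical (ν : I → I) (s : I → K) (ε : K) (F : I → I → R) : Prop where
  invol : ∀ i, ν (ν i) = i
  s_sq : ∀ i, s i * s i = 1
  s_neg : ∀ i, s (ν i) = ε * s i
  symm : ∀ i j, F i j = -((s i * s j) • F (ν j) (ν i))
  comm : ∀ i j k l, F i j * F k l - F k l * F i j =
    (if j = k then F i l else 0) - (if i = l then F k j else 0) -
      (s i * s j) • ((if ν i = k then F (ν j) l else 0) - (if l = ν j then F k (ν i) else 0))

theorem IsClassical.eq_iff {ν : I → I} {s : I → K} {ε : K} {F : I → I → R}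
    (hF : IsClassical ν s ε F) (i j : I) : ν i = j ↔ i = ν j :=
  ⟨fun h => by rw [← h, hF.invol], fun h => by rw [h, hF.invol]⟩

theorem IsClassical.sum_neg {ν : I → I} {s : I → K} {ε : K} {F : I → I → R}
    (hF : IsClassical ν s ε F) {X : Type*} [AddCommMonoid X] (f : I → X) :
    ∑ i, f (ν i) = ∑ i, f i :=
  Fintype.sum_equiv ⟨ν, ν, hF.invol, hF.invol⟩ _ _ fun _ => rfl

section Classical

variable {ψ d : I → R} {F : I → I → R} {ν : I → I} {s : I → K} {ε : K}

/-- The second half of the commutation relations adds two terms to the `𝔤𝔩` case. In the orthogonal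
case the first vanishes and the second is `-Θ`; in the symplectic case the second vanishes and the
first gives `ω`. -/
theorem eta_eta_of_isClassical (h : IsCAR ψ d)
    (hψ : ∀ i j k, ψ i * F j k = F j k * ψ i) (hF : IsClassical ν s ε F) (b c : I) :
    eta ψ F b * eta ψ F c + eta ψ F c * eta ψ F b = eta ψ F c * ψ b + eta ψ F b * ψ c -
      s b • ((∑ i, s i • (ψ i * ψ (ν i))) * F (ν b) c) +
      (if c = ν b then s b • ∑ i, ∑ k, s i • (ψ i * ψ k * F k (ν i)) else 0) := by
  have h1 := eta_eta h hψ b c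
  simp only [hF.comm _ _ _ _, mul_sub, mul_ite, mul_zero, Finset.sum_sub_distrib, smul_sub,
    mul_smul_comm, smul_ite, smul_zero] at h1
  rw [Finset.sum_comm (f := fun x y => if x = c then _ else _)] at h1
  simp only [Finset.sum_ite_eq, Finset.sum_ite_eq', Finset.mem_univ, if_true] at h1
  have h2 : ∑ i, ψ i * ψ b * F i c = eta ψ F c * ψ b := by
    simp only [eta, Finset.sum_mul, mul_assoc, ← hψ]
  have h3 : ∑ i, ψ c * ψ i * F i b = -(eta ψ F b * ψ c) := by
    rw [eta_psi h hψ, neg_neg]; simp only [eta, Finset.mul_sum, mul_assoc]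
  rw [h2, h3] at h1
  rw [h1]
  have h4 : ∑ x, (s x * s b) • (ψ x * ψ (ν x) * F (ν b) c) =
      s b • ((∑ i, s i • (ψ i * ψ (ν i))) * F (ν b) c) := by
    simp only [Finset.sum_mul, Finset.smul_sum, smul_mul_assoc, smul_smul, mul_comm]
  have h5 : ∑ x, ∑ y, (if c = ν b then (s x * s b) • (ψ x * ψ y * F y (ν x)) else 0) =
      (if c = ν b then s b • ∑ i, ∑ k, s i • (ψ i * ψ k * F k (ν i)) else 0) := by
    split_ifs
    · simp only [Finset.smul_sum, smul_smul, mul_comm]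
    · simp
  rw [h4, h5]
  abel

/-! ### The orthogonal case -/

/-- `Θ = ∑ j, η (-j) ψ j`. -/
def orthTheta (ν : I → I) (ψ : I → R) (F : I → I → R) : R := ∑ j, eta ψ F (ν j) * ψ j

/-- The operator `T b (v)` in the orthogonal case. -/
def orthT (ν : I → I) (ψ d : I → R) (F : I → I → R) (b : I) (v : K) : R :=
  etaShift ψ F b v + (2 * (v - 1))⁻¹ • (orthTheta ν ψ F * d (ν b))

theorem sum_psi_psi_neg (h : IsCAR ψ d) (hF : IsClassical ν s 1 F) :
    ∑ i, s i • (ψ i * ψ (ν i)) = 0 := by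
  apply eq_zero_of_eq_neg K
  nth_rw 1 [← hF.sum_neg]
  rw [← Finset.sum_neg_distrib]
  refine Finset.sum_congr rfl fun i _ => ?_
  rw [hF.s_neg, hF.invol, h.psi_psi, one_mul, smul_neg]

theorem orthTheta_eq (h : IsCAR ψ d) (hψ : ∀ i j k, ψ i * F j k = F j k * ψ i) :
    orthTheta ν ψ F = -∑ i, ∑ k, ψ i * ψ k * F k (ν i) := by
  rw [orthTheta, ← Finset.sum_neg_distrib]
  refine Finset.sum_congr rfl fun j _ => ?_
  rw [eta_psi h hψ]
  simp only [eta, Finset.mul_sum, mul_assoc]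

theorem orth_eta_eta (h : IsCAR ψ d) (hψ : ∀ i j k, ψ i * F j k = F j k * ψ i)
    (hF : IsClassical ν (fun _ => (1 : K)) 1 F) (b c : I) :
    eta ψ F b * eta ψ F c + eta ψ F c * eta ψ F b = eta ψ F c * ψ b + eta ψ F b * ψ c -
      (if c = ν b then orthTheta ν ψ F else 0) := by
  have h0 := sum_psi_psi_neg h hF
  have h1 := eta_eta_of_isClassical h hψ hF b c
  rw [h0] at h1
  rw [h1, orthTheta_eq h hψ]
  simp only [one_smul, zero_mul, smul_zero, sub_zero]
  split_ifs <;> simp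

/-- Contracting `d b` with either creation operator in the terms of `Θ` contributes `-η_{-b}`; for
one of the two contractions this uses the antisymmetry of `F`. -/
theorem d_orthTheta (h : IsCAR ψ d) (hψ : ∀ i j k, ψ i * F j k = F j k * ψ i)
    (hd : ∀ i j k, d i * F j k = F j k * d i)
    (hF : IsClassical ν (fun _ => (1 : K)) 1 F) (b : I) :
    d b * orthTheta ν ψ F = orthTheta ν ψ F * d b - (2 : K) • eta ψ F (ν b) := by
  have h1 : ∀ j, d b * (eta ψ F (ν j) * ψ j) = F b (ν j) * ψ j
      - (if b = j then eta ψ F (ν j) else 0) + eta ψ F (ν j) * ψ j * d b := by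
    intro j
    rw [← mul_assoc, d_eta h hd, sub_mul, mul_assoc, h.d_psi, mul_sub, mul_ite, mul_one, mul_zero]
    simp only [mul_assoc]; abel
  have h2 : ∑ j, F b (ν j) * ψ j = -eta ψ F (ν b) := by
    rw [eta, ← Finset.sum_neg_distrib]
    refine Finset.sum_congr rfl fun j _ => ?_
    rw [hF.symm b, hF.invol, hψ]; simp
  simp only [orthTheta, Finset.mul_sum, h1, Finset.sum_add_distrib, Finset.sum_sub_distrib,
    Finset.sum_mul, h2]
  simp only [Finset.sum_ite_eq, Finset.mem_univ, if_true, two_smul]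
  abel

theorem psi_orthTheta (h : IsCAR ψ d) (hψ : ∀ i j k, ψ i * F j k = F j k * ψ i) (b : I) :
    ψ b * orthTheta ν ψ F = orthTheta ν ψ F * ψ b := by
  simp only [orthTheta, Finset.mul_sum, Finset.sum_mul]
  refine Finset.sum_congr rfl fun j _ => ?_
  rw [← mul_assoc, eq_neg_iff_add_eq_zero.1 (eta_psi h hψ (ν j) b) |> fun h => (eq_neg_of_add_eq_zero_right h), mul_assoc, h.psi_psi j b]
  noncomm_ring

theorem eta_orthTheta (h : IsCAR ψ d) (hψ : ∀ i j k, ψ i * F j k = F j k * ψ i)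
    (hF : IsClassical ν (fun _ => (1 : K)) 1 F) (b : I) :
    eta ψ F b * orthTheta ν ψ F =
      orthTheta ν ψ F * eta ψ F b - (2 : K) • (orthTheta ν ψ F * ψ b) := by
  have h1 : ∀ j, eta ψ F b * (eta ψ F (ν j) * ψ j) = eta ψ F (ν j) * ψ j * eta ψ F b
      - eta ψ F (ν j) * ψ j * ψ b + eta ψ F b * (ψ (ν j) * ψ j)
      - (if b = j then orthTheta ν ψ F * ψ j else 0) := by
    intro j
    have e1 := orth_eta_eta h hψ hF b (ν j)
    have e2 := eta_psi h hψ b j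
    have e3 := h.psi_psi b j
    have e4 : (if ν j = ν b then orthTheta ν ψ F else 0) * ψ j =
        if b = j then orthTheta ν ψ F * ψ j else 0 := by
      rw [ite_mul, zero_mul]
      congr 1
      simp only [eq_iff_iff]
      constructor
      · intro h; rw [← hF.invol b, ← h, hF.invol]
      · rintro rfl; rfl
    linear_combination (norm := noncomm_ring) e1 * ψ j - eta ψ F (ν j) * e2 +
      eta ψ F (ν j) * e3 - e4
  have h2 : ∑ j, ψ (ν j) * ψ j = 0 := by
    have := sum_psi_psi_neg h hF
    simp only [one_smul] at this
    rw [← hF.sum_neg] at this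
    simpa only [hF.invol] using this
  have h3 : ∑ j, eta ψ F b * (ψ (ν j) * ψ j) = 0 := by rw [← Finset.mul_sum, h2, mul_zero]
  nth_rw 1 [orthTheta]
  rw [Finset.mul_sum]
  simp only [h1, Finset.sum_add_distrib, Finset.sum_sub_distrib, h3, ← Finset.sum_mul]
  rw [← orthTheta]
  simp only [Finset.sum_ite_eq, Finset.mem_univ, if_true, two_smul]
  abel

/-- A parameter is generic if it is not an integer. -/
def Generic (v : K) : Prop := ∀ z : ℤ, v ≠ z

omit [CharZero K] in
theorem Generic.add_int {v : K} (hv : Generic v) (z : ℤ) : Generic (v + z) := fun y h =>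
  hv (y - z) (by push_cast; rw [← h]; ring)

omit [CharZero K] in
theorem Generic.sub_one {v : K} (hv : Generic v) : Generic (v - 1) := by
  simpa [sub_eq_add_neg] using hv.add_int (-1)

omit [CharZero K] in
theorem Generic.sub_natCast {v : K} (hv : Generic v) (n : ℕ) : Generic (v - n) := by
  simpa [sub_eq_add_neg] using hv.add_int (-n)

omit [CharZero K] in
theorem Generic.sub_int_ne {v : K} (hv : Generic v) (z : ℤ) : v - z ≠ 0 := fun h =>
  hv z (by linear_combination h)

omit [CharZero K] in
theorem Generic.ne_zero {v : K} (hv : Generic v) : v ≠ 0 := by simpa using hv 0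

/-- `η_b η_c + η_c η_b` differs from the `𝔤𝔩` expression by `-δ Θ`. Moving `Θ` to the left and `d`
to the right reduces everything to a comparison of coefficients, which the factor `1/(2(v-1))`
satisfies. -/
theorem orthT_anticomm (h : IsCAR ψ d) (hψ : ∀ i j k, ψ i * F j k = F j k * ψ i)
    (hd : ∀ i j k, d i * F j k = F j k * d i)
    (hF : IsClassical ν (fun _ => (1 : K)) 1 F) (b c : I) {v : K} (hv : Generic v) :
    orthT ν ψ d F b v * orthT ν ψ d F c (v - 1) + orthT ν ψ d F c v * orthT ν ψ d F b (v - 1) =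
      0 := by
  have c1 : v - 1 ≠ 0 := by simpa using hv.sub_int_ne 1
  have c2 : v - 1 - 1 ≠ 0 := hv.sub_one.sub_one.ne_zero
  have h1 := orth_eta_eta h hψ hF b c
  have hbc := eta_psi h hψ b c
  have hcb := eta_psi h hψ c b
  have hpp := h.psi_psi b c
  have eb := eta_orthTheta h hψ hF b
  have ec := eta_orthTheta h hψ hF c
  have pb := psi_orthTheta (ν := ν) h hψ b
  have pc := psi_orthTheta (ν := ν) h hψ c
  have db := d_orthTheta h hψ hd hF (ν b)
  have dc := d_orthTheta h hψ hd hF (ν c)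
  rw [hF.invol] at db dc
  have dbc := d_eta h hd (ν b) c
  have dcb := d_eta h hd (ν c) b
  have pbc := h.d_psi (ν b) c
  have pcb := h.d_psi (ν c) b
  have dd := h.d_d (ν b) (ν c)
  have hs := hF.symm (ν b) c
  simp only [hF.invol, one_mul, one_smul] at hs
  have i1 : (if ν b = c then (1 : R) else 0) = if c = ν b then 1 else 0 := by
    simp only [eq_comm]
  have i2 : (if ν c = b then (1 : R) else 0) = if c = ν b then 1 else 0 := by
    simp only [hF.eq_iff]
  have i3 : (if c = ν b then orthTheta ν ψ F else 0) =
    orthTheta ν ψ F * if c = ν b then 1 else 0 := by simp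
  rw [i1] at pbc
  rw [i2] at pcb
  rw [i3] at h1
  generalize (if c = ν b then (1 : R) else 0) = δ at *
  generalize hΘ : orthTheta ν ψ F = Θ at *
  simp only [orthT, etaShift, hΘ]
  -- `κ` and `κ'` are the coefficients of the correction at `v` and at `v - 1`. The three identities
  -- `k1'`, `k0'`, `kk` are all that the comparison of monomials needs.
  have k1 : (2 * (v - 1))⁻¹ * (v - 1) = (2 : K)⁻¹ := by field_simp
  have k0 : (2 * (v - 1 - 1))⁻¹ * (v - 1 - 1) = (2 : K)⁻¹ := by field_simp
  generalize hk1 : (2 * (v - 1))⁻¹ = κ at *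
  generalize hk0 : (2 * (v - 1 - 1))⁻¹ = κ' at *
  have k1' : κ * v = 2⁻¹ + κ := by linear_combination k1
  have k0' : κ' * v = 2⁻¹ + 2 * κ' := by linear_combination k0
  have kk : κ * κ' = 2⁻¹ * (κ' - κ) := by
    linear_combination κ' * k1 - κ * k0
  linear_combination (norm := skip) h1 + v • hbc + v • hcb + (v * (v - 1)) • hpp
    + κ' • (eb * d (ν c)) + κ' • (ec * d (ν b)) + (v * κ') • (pb * d (ν c))
    + (v * κ') • (pc * d (ν b)) + κ • (Θ * dbc) + κ • (Θ * dcb)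
    + (κ * (v - 1)) • (Θ * pbc) + (κ * (v - 1)) • (Θ * pcb)
    + (κ * κ') • (Θ * db * d (ν c)) + (κ * κ') • (Θ * dc * d (ν b))
    + (κ * κ') • (Θ * Θ * dd) + κ • (Θ * hs)
  simp only [mul_add, add_mul, sub_smul, smul_mul_assoc, mul_smul_comm, smul_smul, mul_sub,
    sub_mul, mul_assoc, mul_neg, smul_add, smul_sub, smul_neg]
  match_scalars <;>
    first
    | ring1
    | linear_combination 2 * k1'
    | linear_combination (-2) * kk
    | linear_combination k0' - k1'

/-- Passing `Θ` lowers `v` by two in `η_b(v)`, while the term from `d Θ` subtracts `Θ η_b / (v-1)`.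
The result is proportional to the operator with parameter `v - 1`; the factors telescope in long
products. -/
theorem orthT_orthTheta (h : IsCAR ψ d) (hψ : ∀ i j k, ψ i * F j k = F j k * ψ i)
    (hd : ∀ i j k, d i * F j k = F j k * d i)
    (hF : IsClassical ν (fun _ => (1 : K)) 1 F) (b : I) {v : K} (hv : Generic v) :
    (v - 1) • (orthT ν ψ d F b v * orthTheta ν ψ F) =
      (v - 2) • (orthTheta ν ψ F * orthT ν ψ d F b (v - 1)) := by
  have c1 : v - 1 ≠ 0 := by simpa using hv.sub_int_ne 1
  have c2 : v - 1 - 1 ≠ 0 := hv.sub_one.sub_one.ne_zero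
  have eb := eta_orthTheta h hψ hF b
  have pb := psi_orthTheta (ν := ν) h hψ b
  have db := d_orthTheta h hψ hd hF (ν b)
  rw [hF.invol] at db
  simp only [orthT, etaShift]
  generalize hΘ : orthTheta ν ψ F = Θ at *
  have k1 : (2 * (v - 1))⁻¹ * (v - 1) = (2 : K)⁻¹ := by field_simp
  have k0 : (2 * (v - 1 - 1))⁻¹ * (v - 1 - 1) = (2 : K)⁻¹ := by field_simp
  generalize hk1 : (2 * (v - 1))⁻¹ = κ at *
  generalize hk0 : (2 * (v - 1 - 1))⁻¹ = κ' at *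
  linear_combination (norm := skip) (v - 1) • eb + ((v - 1) * v) • pb + (1/2 : K) • (Θ * db)
  simp only [mul_add, add_mul, smul_mul_assoc, mul_smul_comm, mul_sub, mul_assoc]
  match_scalars <;>
    first
    | ring1
    | linear_combination k1
    | linear_combination -k1
    | linear_combination k0
    | linear_combination -k0

/-- Here `F_{-b,b} = 0` and `d_{-b}² = 0`, so the correction contributes only `-(v-1)⁻¹ η_b d_{-b} =
(v-1)⁻¹ d_{-b} η_b`. This turns the left factors of the determinant into plain `η` with shifted
argument. -/
theorem d_orthT (h : IsCAR ψ d) (hψ : ∀ i j k, ψ i * F j k = F j k * ψ i)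
    (hd : ∀ i j k, d i * F j k = F j k * d i)
    (hF : IsClassical ν (fun _ => (1 : K)) 1 F) (b : I) {v : K} (hv : Generic v) :
    d (ν b) * orthT ν ψ d F b v = (v / (v - 1)) • (d (ν b) * etaShift ψ F b (v - 1)) := by
  have c1 : v - 1 ≠ 0 := by simpa using hv.sub_int_ne 1
  have db := d_orthTheta h hψ hd hF (ν b)
  rw [hF.invol] at db
  have dbb := d_eta h hd (ν b) b
  have dd := h.d_d (ν b) (ν b)
  have hs := hF.symm (ν b) b
  simp only [hF.invol, one_mul, one_smul] at hs
  replace hs := eq_zero_of_eq_neg K hs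
  replace dd := eq_zero_of_eq_neg K dd
  rw [hs] at dbb
  simp only [orthT, etaShift]
  generalize hΘ : orthTheta ν ψ F = Θ at *
  linear_combination (norm := skip) ((2 * (v - 1))⁻¹) • (db * d (ν b)) +
    ((2 * (v - 1))⁻¹) • (Θ * dd) - (v - 1)⁻¹ • dbb
  simp only [mul_add, smul_mul_assoc, mul_smul_comm, sub_mul, mul_assoc, mul_zero, smul_zero]
  match_scalars <;> field_simp <;> ring

/-! ### The symplectic case -/

/-- `ω = ∑ j, s j ψ (-j) ψ j`. -/
def symplOmega (ν : I → I) (s : I → K) (ψ : I → R) : R := ∑ j, s j • (ψ (ν j) * ψ j)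

/-- The operator `T b (v)` in the symplectic case. -/
def symplT (ν : I → I) (s : I → K) (ψ d : I → R) (F : I → I → R) (b : I) (v : K) : R :=
  etaShift ψ F b v - (s b / 2) • (symplOmega ν s ψ * d (ν b))

theorem psi_symplOmega (h : IsCAR ψ d) (b : I) :
    ψ b * symplOmega ν s ψ = symplOmega ν s ψ * ψ b := by
  simp only [symplOmega, Finset.mul_sum, Finset.sum_mul]
  refine Finset.sum_congr rfl fun j _ => ?_
  rw [smul_mul_assoc, mul_smul_comm, ← mul_assoc, h.psi_psi b, mul_assoc, h.psi_psi j b]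
  noncomm_ring

theorem symplOmega_mul_comm {x : R} (hψx : ∀ i, x * ψ i = ψ i * x) :
    x * symplOmega ν s ψ = symplOmega ν s ψ * x := by
  simp only [symplOmega, Finset.mul_sum, Finset.sum_mul]
  refine Finset.sum_congr rfl fun j _ => ?_
  rw [mul_smul_comm, smul_mul_assoc, ← mul_assoc, hψx, mul_assoc, hψx, mul_assoc]

theorem eta_symplOmega (h : IsCAR ψ d) (hψ : ∀ i j k, ψ i * F j k = F j k * ψ i) (b : I) :
    eta ψ F b * symplOmega ν s ψ = symplOmega ν s ψ * eta ψ F b := by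
  simp only [eta, Finset.mul_sum, Finset.sum_mul]
  refine Finset.sum_congr rfl fun j _ => ?_
  rw [mul_assoc, symplOmega_mul_comm fun i => (hψ i j b).symm, ← mul_assoc, psi_symplOmega h,
    mul_assoc]

theorem d_symplOmega (h : IsCAR ψ d) (hF : IsClassical ν s (-1) F) (b : I) :
    d (ν b) * symplOmega ν s ψ = symplOmega ν s ψ * d (ν b) + (2 * s b) • ψ b := by
  have h1 : ∀ j, d (ν b) * (s j • (ψ (ν j) * ψ j)) = (if b = j then s j • ψ j else 0) -
      (if ν b = j then s j • ψ (ν j) else 0) + s j • (ψ (ν j) * ψ j) * d (ν b) := by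
    intro j
    have e1 := h.d_psi (ν b) (ν j)
    have e2 := h.d_psi (ν b) j
    have e3 : (if ν b = ν j then (1 : R) else 0) = if b = j then 1 else 0 := by
      congr 1; simp only [hF.eq_iff, hF.invol]
    rw [e3] at e1
    have i1 : (if b = j then s j • ψ j else 0) = s j • ((if b = j then 1 else 0) * ψ j) := by
      split_ifs <;> simp
    have i2 : (if ν b = j then s j • ψ (ν j) else 0) =
        s j • (ψ (ν j) * (if ν b = j then 1 else 0)) := by
      split_ifs <;> simp
    rw [i1, i2]
    linear_combination (norm := skip) s j • (e1 * ψ j) - s j • (ψ (ν j) * e2)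
    simp only [smul_mul_assoc, mul_smul_comm, mul_assoc, sub_mul, mul_sub]
    module
  rw [symplOmega, Finset.mul_sum]
  simp only [h1, Finset.sum_add_distrib, Finset.sum_sub_distrib, ← Finset.sum_mul]
  simp only [Finset.sum_ite_eq, Finset.mem_univ, if_true, hF.invol, hF.s_neg]
  module

/-- Exchanging the two summation indices changes the sign of `ψ i * ψ k`, whereas `s i • F k (ν i)`
is symmetric in `i` and `k`. -/
theorem sum_psi_psi_mul_F_eq_zero (h : IsCAR ψ d)
    (hF : IsClassical ν s (-1) F) : ∑ i, ∑ k, s i • (ψ i * ψ k * F k (ν i)) = 0 := by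
  apply eq_zero_of_eq_neg K
  nth_rw 1 [Finset.sum_comm]
  simp only [← Finset.sum_neg_distrib]
  refine Finset.sum_congr rfl fun i _ => Finset.sum_congr rfl fun k _ => ?_
  rw [h.psi_psi k i, hF.symm i (ν k), hF.invol, hF.s_neg]
  simp only [mul_neg, neg_mul, mul_smul_comm, smul_smul, neg_smul, smul_neg, neg_neg, one_mul]
  rw [mul_left_comm, hF.s_sq, mul_one]

theorem symplOmega_neg (hF : IsClassical ν s (-1) F) :
    ∑ i, s i • (ψ i * ψ (ν i)) = -symplOmega ν s ψ := by
  rw [symplOmega, ← Finset.sum_neg_distrib, ← hF.sum_neg]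
  refine Finset.sum_congr rfl fun i _ => ?_
  rw [hF.s_neg, hF.invol]
  module

theorem sympl_eta_eta (h : IsCAR ψ d) (hψ : ∀ i j k, ψ i * F j k = F j k * ψ i)
    (hF : IsClassical ν s (-1) F) (b c : I) :
    eta ψ F b * eta ψ F c + eta ψ F c * eta ψ F b = eta ψ F c * ψ b + eta ψ F b * ψ c +
      s b • (symplOmega ν s ψ * F (ν b) c) := by
  have h1 := eta_eta_of_isClassical h hψ hF b c
  rw [sum_psi_psi_mul_F_eq_zero h hF, symplOmega_neg hF] at h1
  rw [h1]
  simp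

/-- As in the orthogonal case, but `ω` contains no entries of `F` and commutes with every `η` and
`ψ`. The correction can therefore have a coefficient independent of `v`, and genericity is not
needed. -/
theorem symplT_anticomm (h : IsCAR ψ d) (hψ : ∀ i j k, ψ i * F j k = F j k * ψ i)
    (hd : ∀ i j k, d i * F j k = F j k * d i)
    (hF : IsClassical ν s (-1) F) (b c : I) (v : K) :
    symplT ν s ψ d F b v * symplT ν s ψ d F c (v - 1) +
      symplT ν s ψ d F c v * symplT ν s ψ d F b (v - 1) = 0 := by
  have h1 := sympl_eta_eta h hψ hF b c
  have hbc := eta_psi h hψ b c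
  have hcb := eta_psi h hψ c b
  have hpp := h.psi_psi b c
  have eb := eta_symplOmega (ν := ν) (s := s) h hψ b
  have ec := eta_symplOmega (ν := ν) (s := s) h hψ c
  have pb := psi_symplOmega (ν := ν) (s := s) h b
  have pc := psi_symplOmega (ν := ν) (s := s) h c
  have db := d_symplOmega h hF b
  have dc := d_symplOmega h hF c
  have dbc := d_eta h hd (ν b) c
  have dcb := d_eta h hd (ν c) b
  have pbc := h.d_psi (ν b) c
  have pcb := h.d_psi (ν c) b
  have dd := h.d_d (ν b) (ν c)
  have hs := hF.symm (ν b) c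
  simp only [hF.invol, hF.s_neg] at hs
  have sb := hF.s_sq b
  have sc := hF.s_sq c
  have i2 : (if ν c = b then (1 : R) else 0) = if ν b = c then 1 else 0 :=
    if_congr (by rw [hF.eq_iff, eq_comm]) rfl rfl
  -- When `c = -b` the two signs are opposite; this links the contributions of the two contractions
  -- `d ψ`.
  have i3 : s c • (if ν b = c then (1 : R) else 0) = -s b • if ν b = c then (1 : R) else 0 := by
    split_ifs with hbc
    · rw [← hbc, hF.s_neg]; simp
    · simp
  rw [i2] at pcb
  generalize (if ν b = c then (1 : R) else 0) = δ at *
  generalize hω : symplOmega ν s ψ = ω at *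
  simp only [symplT, etaShift, hω]
  linear_combination (norm := skip) h1 + v • hbc + v • hcb + (v * (v - 1)) • hpp
    - (s c / 2) • (eb * d (ν c)) - (s b / 2) • (ec * d (ν b)) - (v * s c / 2) • (pb * d (ν c))
    - (v * s b / 2) • (pc * d (ν b)) - (s b / 2) • (ω * dbc) - (s c / 2) • (ω * dcb)
    - (s b / 2 * (v - 1)) • (ω * pbc) - (s c / 2 * (v - 1)) • (ω * pcb)
    + (s b / 2 * (s c / 2)) • (ω * db * d (ν c)) + (s b / 2 * (s c / 2)) • (ω * dc * d (ν b))
    + (s b / 2 * (s c / 2)) • (ω * ω * dd) + (s b / 2) • (ω * hs)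
    - ((v - 1) / 2) • (ω * i3)
  simp only [mul_add, add_mul, sub_smul, smul_mul_assoc, mul_smul_comm, smul_smul, mul_sub,
    sub_mul, mul_assoc, mul_neg, smul_add, smul_sub, smul_neg]
  match_scalars <;>
    first
    | ring1
    | linear_combination (s c / 2) * sb
    | linear_combination (s b / 2) * sc

theorem symplT_symplOmega (h : IsCAR ψ d) (hψ : ∀ i j k, ψ i * F j k = F j k * ψ i)
    (hF : IsClassical ν s (-1) F) (b : I) (v : K) :
    symplT ν s ψ d F b v * symplOmega ν s ψ =
      symplOmega ν s ψ * symplT ν s ψ d F b (v - 1) := by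
  have eb := eta_symplOmega (ν := ν) (s := s) h hψ b
  have pb := psi_symplOmega (ν := ν) (s := s) h b
  have db := d_symplOmega h hF b
  have sb := hF.s_sq b
  simp only [symplT, etaShift]
  generalize symplOmega ν s ψ = ω at *
  linear_combination (norm := skip) eb + v • pb - (s b / 2) • (ω * db)
  simp only [mul_add, add_mul, smul_mul_assoc, mul_smul_comm, mul_sub, mul_assoc, sub_mul]
  match_scalars <;>
    first
    | ring1
    | linear_combination sb
    | linear_combination -sb

/-- Commuting `d_{-b}` past `ω` leaves `-ψ_b d_{-b}`, which equals `d_{-b} ψ_b` since `-b ≠ b`: the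
parameter goes up by one. -/
theorem d_symplT (h : IsCAR ψ d) (hF : IsClassical ν s (-1) F) (b : I) (v : K) :
    d (ν b) * symplT ν s ψ d F b v = d (ν b) * etaShift ψ F b (v + 1) := by
  have db := d_symplOmega h hF b
  have dd := eq_zero_of_eq_neg K (h.d_d (ν b) (ν b))
  have pb := h.d_psi (ν b) b
  have sb := hF.s_sq b
  -- A fixed index would have `s b = -s b`, contradicting `s b ^ 2 = 1`.
  have hb : ν b ≠ b := by
    intro hb
    have h1 := hF.s_neg b
    rw [hb] at h1
    have h2 : s b = 0 := by linear_combination (1 / 2 : K) * h1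
    simp [h2] at sb
  rw [if_neg hb] at pb
  simp only [symplT, etaShift]
  generalize symplOmega ν s ψ = ω at *
  linear_combination (norm := skip) (-(s b / 2)) • (db * d (ν b)) - (s b / 2) • (ω * dd) - pb
  simp only [mul_add, add_mul, smul_mul_assoc, mul_smul_comm, mul_sub, mul_assoc, mul_zero,
    smul_zero]
  match_scalars <;>
    first
    | ring1
    | linear_combination sb
    | linear_combination -sb

end Classical


/-! ## Fock space -/

/-! ### Signs for moving a label past a finite set -/

section Sign

variable {α : Type*} [LinearOrder α]

/-- `(-1) ^ #{x ∈ s | x < k}`. -/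
def sgnLt (k : α) (s : Finset α) : ℤ := ∏ x ∈ s, if x < k then -1 else 1

/-- `(-1) ^ #{x ∈ s | k < x}`. -/
def sgnGt (k : α) (s : Finset α) : ℤ := ∏ x ∈ s, if k < x then -1 else 1

theorem sgnLt_eq (k : α) (s : Finset α) : sgnLt k s = (-1) ^ (s.filter (· < k)).card := by
  rw [sgnLt, Finset.prod_ite]; simp

theorem sgnGt_eq (k : α) (s : Finset α) : sgnGt k s = (-1) ^ (s.filter (k < ·)).card := by
  rw [sgnGt, Finset.prod_ite]; simp

theorem sgnLt_mul_self (k : α) (s : Finset α) : sgnLt k s * sgnLt k s = 1 := by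
  rw [sgnLt_eq, ← mul_pow]; simp

theorem sgnLt_insert {j : α} {s : Finset α} (h : j ∉ s) (k : α) :
    sgnLt k (insert j s) = (if j < k then -1 else 1) * sgnLt k s := by
  rw [sgnLt, Finset.prod_insert h, sgnLt]

theorem sgnLt_erase {j : α} {s : Finset α} (h : j ∈ s) (k : α) :
    sgnLt k (s.erase j) = (if j < k then -1 else 1) * sgnLt k s := by
  rw [sgnLt, sgnLt, ← Finset.mul_prod_erase s _ h]
  split_ifs <;> simp

theorem sgnGt_erase {j : α} {s : Finset α} (h : j ∈ s) (k : α) :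
    sgnGt k (s.erase j) = (if k < j then -1 else 1) * sgnGt k s := by
  rw [sgnGt, sgnGt, ← Finset.mul_prod_erase s _ h]
  split_ifs <;> simp

/-- Every element other than `k` lies on exactly one side of `k` and contributes one sign. -/
theorem sgnLt_mul_sgnGt {k : α} {s : Finset α} (h : k ∈ s) :
    sgnLt k s * sgnGt k s = (-1) ^ (s.card - 1) := by
  rw [sgnLt, sgnGt, ← Finset.prod_mul_distrib, ← Finset.mul_prod_erase s _ h,
    ← Finset.card_erase_of_mem h, ← Finset.prod_const]
  simp only [lt_self_iff_false, if_false, mul_one, one_mul]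
  refine Finset.prod_congr rfl fun x hx => ?_
  rcases lt_or_gt_of_ne (Finset.ne_of_mem_erase hx) with h | h
  · simp [h, h.le]
  · simp [h, h.le]

end Sign

/-- The Fock space with coefficients in `B`, with one basis vector for every finite set. -/
def Fock (α B : Type*) : Type _ := Finset α → B

namespace Fock

variable {α B : Type*} [AddCommGroup B]

instance : AddCommGroup (Fock α B) := inferInstanceAs (AddCommGroup (Finset α → B))

instance (K : Type*) [Semiring K] [Module K B] : Module K (Fock α B) :=
  inferInstanceAs (Module K (Finset α → B))

@[ext] theorem ext {f g : Fock α B} (h : ∀ S, f S = g S) : f = g := funext h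

@[simp] theorem add_apply (f g : Fock α B) (S : Finset α) : (f + g) S = f S + g S := rfl
@[simp] theorem sub_apply (f g : Fock α B) (S : Finset α) : (f - g) S = f S - g S := rfl
@[simp] theorem neg_apply (f : Fock α B) (S : Finset α) : (-f) S = -f S := rfl
@[simp] theorem zero_apply (S : Finset α) : (0 : Fock α B) S = 0 := rfl
@[simp] theorem smul_apply {K : Type*} [Semiring K] [Module K B] (c : K) (f : Fock α B)
    (S : Finset α) : (c • f) S = c • f S := rfl
@[simp] theorem zsmul_apply (c : ℤ) (f : Fock α B) (S : Finset α) : (c • f) S = c • f S := rfl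
@[simp] theorem nsmul_apply (c : ℕ) (f : Fock α B) (S : Finset α) : (c • f) S = c • f S := rfl

/-- The coefficient of a basis vector, as a linear map. -/
def coeff (K : Type*) [Semiring K] [Module K B] (S : Finset α) : Fock α B →ₗ[K] B where
  toFun f := f S
  map_add' _ _ := rfl
  map_smul' _ _ := rfl

@[simp] theorem coeff_apply (K : Type*) [Semiring K] [Module K B] (S : Finset α) (f : Fock α B) :
    coeff K S f = f S := rfl

@[simp] theorem sum_apply {ι : Type*} (s : Finset ι) (f : ι → Fock α B) (S : Finset α) :
    (∑ i ∈ s, f i) S = ∑ i ∈ s, f i S :=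
  map_sum (coeff ℤ S) f s

end Fock

/-! ### Fermionic operators on the Fock space -/

section Model

variable (K : Type*) [Field K] {α : Type*} [LinearOrder α] (B : Type*) [AddCommGroup B] [Module K B]

/-- The creation operator on the Fock space. -/
def cre (k : α) : Module.End K (Fock α B) where
  toFun f := (fun S => if k ∈ S then sgnLt k S • f (S.erase k) else 0 : Finset α → B)
  map_add' f g := by
    ext S
    change (if k ∈ S then sgnLt k S • (f (S.erase k) + g (S.erase k)) else 0) =
      (if k ∈ S then sgnLt k S • f (S.erase k) else 0) +
        (if k ∈ S then sgnLt k S • g (S.erase k) else 0)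
    split_ifs <;> simp
  map_smul' c f := by
    ext S
    change (if k ∈ S then sgnLt k S • (c • f (S.erase k)) else 0) =
      c • (if k ∈ S then sgnLt k S • f (S.erase k) else 0)
    split_ifs
    · exact smul_comm _ _ _
    · simp

/-- The annihilation operator on the Fock space. -/
def ann (k : α) : Module.End K (Fock α B) where
  toFun f := (fun S => if k ∈ S then 0 else sgnLt k S • f (insert k S) : Finset α → B)
  map_add' f g := by
    ext S
    change (if k ∈ S then 0 else sgnLt k S • (f (insert k S) + g (insert k S))) =
      (if k ∈ S then 0 else sgnLt k S • f (insert k S)) +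
        (if k ∈ S then 0 else sgnLt k S • g (insert k S))
    split_ifs <;> simp
  map_smul' c f := by
    ext S
    change (if k ∈ S then 0 else sgnLt k S • (c • f (insert k S))) =
      c • (if k ∈ S then 0 else sgnLt k S • f (insert k S))
    split_ifs
    · simp
    · exact smul_comm _ _ _

/-- Pointwise action of operators. -/
def lift (α : Type*) (B : Type*) [AddCommGroup B] [Module K B] :
    Module.End K B →ₐ[K] Module.End K (Fock α B) where
  toFun g :=
    { toFun := fun f => (fun S => g (f S) : Finset α → B)
      map_add' := fun f f' => by ext S; exact map_add g (f S) (f' S)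
      map_smul' := fun c f => by ext S; exact map_smul g c (f S) }
  map_one' := rfl
  map_mul' _ _ := rfl
  map_zero' := rfl
  map_add' _ _ := rfl
  commutes' _ := rfl

variable {K B}

theorem cre_apply (k : α) (f : Fock α B) (S : Finset α) :
    cre K B k f S = if k ∈ S then sgnLt k S • f (S.erase k) else 0 := rfl

theorem ann_apply (k : α) (f : Fock α B) (S : Finset α) :
    ann K B k f S = if k ∈ S then 0 else sgnLt k S • f (insert k S) := rfl

@[simp] theorem lift_apply (g : Module.End K B) (f : Fock α B) (S : Finset α) :
    lift K α B g f S = g (f S) := rfl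

theorem cre_lift (k : α) (g : Module.End K B) :
    cre K B k * lift K α B g = lift K α B g * cre K B k := by
  ext f S
  simp only [Module.End.mul_apply, cre_apply, lift_apply]
  split_ifs <;> simp

theorem ann_lift (k : α) (g : Module.End K B) :
    ann K B k * lift K α B g = lift K α B g * ann K B k := by
  ext f S
  simp only [Module.End.mul_apply, ann_apply, lift_apply]
  split_ifs <;> simp

theorem isCAR_cre_ann : IsCAR (cre K B : α → _) (ann K B) where
  psi_psi j k := by
    ext f S
    simp only [Module.End.mul_apply, cre_apply, LinearMap.neg_apply, Fock.neg_apply,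
      Finset.mem_erase, Finset.erase_right_comm (a := j)]
    by_cases hj : j ∈ S
    · by_cases hk : k ∈ S
      · rcases lt_trichotomy j k with h | h | h
        · simp [hj, hk, h.ne, h.ne', smul_smul, sgnLt_erase, h, h.not_gt, mul_comm]
        · simp [h]
        · simp [hj, hk, h.ne, h.ne', smul_smul, sgnLt_erase, h, h.not_gt, mul_comm]
      · simp [hk]
    · simp [hj]
  d_d j k := by
    ext f S
    simp only [Module.End.mul_apply, ann_apply, LinearMap.neg_apply, Fock.neg_apply,
      Finset.mem_insert, Finset.insert_comm j]
    by_cases hj : j ∈ S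
    · simp [hj]
    · by_cases hk : k ∈ S
      · simp [hk]
      · rcases lt_trichotomy j k with h | h | h
        · simp [hj, hk, h.ne, h.ne', smul_smul, sgnLt_insert, h, h.not_gt, mul_comm]
        · simp [h]
        · simp [hj, hk, h.ne, h.ne', smul_smul, sgnLt_insert, h, h.not_gt, mul_comm]
  d_psi j k := by
    ext f S
    simp only [Module.End.mul_apply, ann_apply, cre_apply, LinearMap.sub_apply, Fock.sub_apply,
      Finset.mem_insert, Finset.mem_erase]
    by_cases hjk : j = k
    · subst hjk
      by_cases hj : j ∈ S
      · simp [hj, smul_smul, sgnLt_erase, sgnLt_mul_self]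
      · simp [hj, smul_smul, sgnLt_insert, sgnLt_mul_self]
    · by_cases hj : j ∈ S
      · simp [hj, hjk]
      · by_cases hk : k ∈ S
        · have e : (insert j S).erase k = insert j (S.erase k) :=
            Finset.erase_insert_of_ne hjk
          rcases lt_or_gt_of_ne hjk with h | h
          · simp [hj, hk, h.ne, h.ne', smul_smul, sgnLt_insert, sgnLt_erase, h, h.not_gt, e,
              mul_comm]
          · simp [hj, hk, h.ne, h.ne', smul_smul, sgnLt_insert, sgnLt_erase, h, h.not_gt, e,
              mul_comm]
        · simp [hj, hk, hjk, Ne.symm hjk]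

/-- The vacuum vector with coefficient `x`. -/
def vac (α : Type*) [DecidableEq α] (x : B) : Fock α B := fun S => if S = ∅ then x else 0

theorem ann_vac (k : α) (x : B) : ann K B k (vac α x) = 0 := by
  ext S
  simp [ann_apply, vac]

theorem lift_vac (g : Module.End K B) (x : B) : lift K α B g (vac α x) = vac α (g x) := by
  ext S
  simp only [lift_apply, vac]
  split_ifs <;> simp

end Model

/-- Composition with an injection of the index set preserves the anticommutation relations. -/
theorem IsCAR.comp {I J R : Type*} [DecidableEq I] [DecidableEq J] [Ring R] {ψ d : I → R}
    (h : IsCAR ψ d) {e : J → I} (he : Function.Injective e) :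
    IsCAR (fun j => ψ (e j)) (fun j => d (e j)) where
  psi_psi _ _ := h.psi_psi _ _
  d_d _ _ := h.d_d _ _
  d_psi i j := by rw [h.d_psi]; simp only [he.eq_iff]

theorem IsCAR.map {I R R' : Type*} [DecidableEq I] [Ring R] [Ring R'] {ψ d : I → R}
    (h : IsCAR ψ d) (f : R →+* R') : IsCAR (fun j => f (ψ j)) (fun j => f (d j)) where
  psi_psi _ _ := by rw [← map_mul, h.psi_psi, map_neg, map_mul]
  d_d _ _ := by rw [← map_mul, h.d_d, map_neg, map_mul]
  d_psi i j := by
    rw [← map_mul, h.d_psi, map_sub, map_mul]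
    split_ifs <;> simp

/-! ## Ordered products -/

section Ordered

variable {K R α : Type*} [Field K] [CharZero K] [Ring R] [Algebra K R]

/-- `T k₁ (v) T k₂ (v - 1) ⋯` for a list `k₁, k₂, …`. -/
def listProd (T : α → K → R) : List α → K → R
  | [], _ => 1
  | k :: L, v => T k v * listProd T L (v - 1)

variable {T : α → K → R}

theorem listProd_append (L₁ L₂ : List α) (v : K) :
    listProd T (L₁ ++ L₂) v = listProd T L₁ v * listProd T L₂ (v - L₁.length) := by
  induction L₁ generalizing v with
  | nil => simp [listProd]
  | cons k L ih =>
    simp only [List.cons_append, listProd, ih, mul_assoc, List.length_cons]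
    congr 3
    push_cast; ring

variable (hT : ∀ b c v, Generic v → T b v * T c (v - 1) + T c v * T b (v - 1) = 0)
include hT

/-- The parameters `v, v - 1, …` belong to positions and not to labels, so exchanging neighbouring
labels is exactly the exchange relation and costs one sign. -/
theorem listProd_move_front (L₁ L₂ : List α) (k : α) {v : K} (hv : Generic v) :
    listProd T (L₁ ++ k :: L₂) v =
      (-1 : ℤ) ^ L₁.length • (T k v * listProd T (L₁ ++ L₂) (v - 1)) := by
  induction L₁ generalizing v with
  | nil => simp [listProd]
  | cons a L ih =>
    simp only [List.cons_append, listProd, ih hv.sub_one, List.length_cons, pow_succ]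
    rw [mul_smul_comm, ← mul_assoc, ← mul_assoc, eq_neg_of_add_eq_zero_left (hT a k v hv)]
    simp

theorem listProd_move_back (L₁ L₂ : List α) (k : α) {v : K} (hv : Generic v) :
    listProd T (L₁ ++ k :: L₂) v =
      (-1 : ℤ) ^ L₂.length • (listProd T (L₁ ++ L₂) v * T k (v - (L₁.length + L₂.length : ℕ))) := by
  have h0 : ∀ (L : List α) {v : K}, Generic v → listProd T (k :: L) v =
      (-1 : ℤ) ^ L.length • (listProd T L v * T k (v - L.length)) := by
    intro L
    induction L with
    | nil => intro v _; simp [listProd]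
    | cons b L ih =>
      intro v hv
      have := ih hv.sub_one
      rw [listProd, listProd, ← mul_assoc, eq_neg_of_add_eq_zero_left (hT k b v hv), neg_mul,
        mul_assoc, ← listProd, this, mul_smul_comm, listProd, List.length_cons, pow_succ, ← mul_assoc]
      rw [show v - 1 - (L.length : K) = v - ((L.length + 1 : ℕ) : K) by push_cast; ring]
      simp
  rw [listProd_append, h0 L₂ (hv.sub_natCast _), listProd_append, mul_smul_comm, mul_assoc]
  congr 4
  push_cast; ring

theorem two_mul_self (k : α) {v : K} (hv : Generic v) : T k v * T k (v - 1) = 0 :=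
  eq_zero_of_eq_neg K (eq_neg_of_add_eq_zero_left (hT k k v hv))

omit hT
variable [LinearOrder α]

/-- The product `T k₁ (v) T k₂ (v - 1) ⋯` over the elements `k₁ < k₂ < ⋯` of a finite set. -/
def setProd (T : α → K → R) (s : Finset α) (v : K) : R := listProd T (s.sort (· ≤ ·)) v

omit [CharZero K] in
@[simp] theorem setProd_empty (v : K) : setProd T ∅ v = 1 := by simp [setProd, listProd]

theorem sort_eq_append {k : α} {s : Finset α} (h : k ∈ s) : s.sort (· ≤ ·) =
    (s.filter (· < k)).sort (· ≤ ·) ++ k :: (s.filter (k < ·)).sort (· ≤ ·) := by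
  apply List.Perm.eq_of_pairwise' (r := (· ≤ ·))
  · exact Finset.pairwise_sort _ _
  · rw [List.pairwise_append]
    refine ⟨Finset.pairwise_sort _ _, ?_, ?_⟩
    · rw [List.pairwise_cons]
      refine ⟨fun a ha => ?_, Finset.pairwise_sort _ _⟩
      simp at ha
      exact ha.2.le
    · intro a ha b hb
      simp at ha hb
      rcases hb with rfl | hb
      · exact ha.2.le
      · exact (ha.2.trans hb.2).le
  · rw [List.perm_ext_iff_of_nodup]
    · intro a
      simp
      grind
    · exact Finset.sort_nodup _ _
    · rw [List.nodup_append]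
      refine ⟨Finset.sort_nodup _ _, ?_, ?_⟩
      · rw [List.nodup_cons]
        exact ⟨by simp, Finset.sort_nodup _ _⟩
      · intro a ha b hb
        simp at ha hb
        rcases hb with rfl | hb
        · exact ha.2.ne
        · exact (ha.2.trans hb.2).ne

theorem sort_erase_eq_append {k : α} {s : Finset α} : (s.erase k).sort (· ≤ ·) =
    (s.filter (· < k)).sort (· ≤ ·) ++ (s.filter (k < ·)).sort (· ≤ ·) := by
  apply List.Perm.eq_of_pairwise' (r := (· ≤ ·))
  · exact Finset.pairwise_sort _ _
  · rw [List.pairwise_append]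
    refine ⟨Finset.pairwise_sort _ _, Finset.pairwise_sort _ _, ?_⟩
    intro a ha b hb
    simp at ha hb
    exact (ha.2.trans hb.2).le
  · rw [List.perm_ext_iff_of_nodup]
    · intro a
      simp
      grind
    · exact Finset.sort_nodup _ _
    · rw [List.nodup_append]
      refine ⟨Finset.sort_nodup _ _, Finset.sort_nodup _ _, ?_⟩
      intro a ha b hb
      simp at ha hb
      exact (ha.2.trans hb.2).ne

include hT

theorem setProd_front {k : α} {s : Finset α} (h : k ∈ s) {v : K} (hv : Generic v) :
    setProd T s v = sgnLt k s • (T k v * setProd T (s.erase k) (v - 1)) := by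
  rw [setProd, sort_eq_append h, listProd_move_front hT _ _ _ hv, setProd, sort_erase_eq_append,
    sgnLt_eq, Finset.length_sort]

theorem setProd_back {k : α} {s : Finset α} (h : k ∈ s) {v : K} (hv : Generic v) :
    setProd T s v = sgnGt k s • (setProd T (s.erase k) v * T k (v - (s.card - 1 : ℕ))) := by
  rw [setProd, sort_eq_append h, listProd_move_back hT _ _ _ hv, setProd, sort_erase_eq_append,
    sgnGt_eq]
  have h1 : (s.erase k).card = s.card - 1 := Finset.card_erase_of_mem h
  rw [← Finset.length_sort (s := s.erase k) (· ≤ ·), sort_erase_eq_append] at h1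
  rw [List.length_append] at h1
  rw [h1, Finset.length_sort]

/-- Moving `T k` to the end places it next to the extra factor `T k` with parameter one less, and
this product is its own negative. -/
theorem setProd_mul_self {k : α} {s : Finset α} (h : k ∈ s) {v : K} (hv : Generic v) :
    setProd T s v * T k (v - s.card) = 0 := by
  have h0 : v - s.card = v - (s.card - 1 : ℕ) - 1 := by
    have : 1 ≤ s.card := Finset.card_pos.2 ⟨k, h⟩
    push_cast [this]; ring
  rw [setProd_back hT h hv, smul_mul_assoc, mul_assoc, h0, two_mul_self hT k (hv.sub_natCast _)]
  simp

end Ordered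


/-! ## Column fermions -/

section Column

variable {K α B : Type*} [Field K] [CharZero K] [LinearOrder α] [Fintype α] [AddCommGroup B]
  [Module K B]

/-- `T (v) = ∑ b, T b (v) ψ* b`, where `ψ* b` are the creation operators of a second family of
fermions labelling the columns. -/
def colSum (T : α → K → Module.End K B) (v : K) : Module.End K (Fock α B) :=
  ∑ b, lift K α B (T b v) * cre K B b

/-- `T (v) T (v - 1) ⋯ T (v - m + 1)`. -/
def fallProd {R : Type*} [Monoid R] (T : K → R) : ℕ → K → R
  | 0, _ => 1
  | m + 1, v => T v * fallProd T m (v - 1)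

omit [CharZero K] in
theorem fallProd_succ' {R : Type*} [Monoid R] (T : K → R) (m : ℕ) (v : K) :
    fallProd T (m + 1) v = fallProd T m v * T (v - m) := by
  induction m generalizing v with
  | zero => simp [fallProd]
  | succ m ih =>
    rw [fallProd, ih, fallProd, mul_assoc]
    congr 3
    push_cast; ring

variable {T : α → K → Module.End K B}

omit [CharZero K] in
theorem colSum_cre (v : K) (y : α) : colSum T v * cre K B y = -(cre K B y * colSum T v) := by
  rw [colSum, Finset.sum_mul, Finset.mul_sum, ← Finset.sum_neg_distrib]
  refine Finset.sum_congr rfl fun b _ => ?_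
  rw [mul_assoc, isCAR_cre_ann.psi_psi, ← mul_assoc (cre K B y), cre_lift, mul_neg, mul_assoc]

omit [CharZero K] in
theorem fallProd_colSum_cre (m : ℕ) (v : K) (y : α) : fallProd (colSum T) m v * cre K B y =
    (-1 : ℤ) ^ m • (cre K B y * fallProd (colSum T) m v) := by
  induction m generalizing v with
  | zero => simp [fallProd]
  | succ m ih =>
    rw [fallProd, mul_assoc, ih, mul_smul_comm, ← mul_assoc, colSum_cre, pow_succ]
    simp [mul_assoc]

variable (hT : ∀ b c v, Generic v → T b v * T c (v - 1) + T c v * T b (v - 1) = 0)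
include hT

/-- Expanding the product yields one term for each ordering of `S`. The sign of the column fermions
cancels the sign from antisymmetry of the ordered product, so all `m!` terms agree. -/
theorem fallProd_colSum_vac (m : ℕ) {v : K} (hv : Generic v) (f : B) (S : Finset α) :
    fallProd (colSum T) m v (vac α f) S =
      if S.card = m then m.factorial • setProd T S v f else 0 := by
  induction m generalizing v S with
  | zero =>
    simp only [fallProd, Module.End.one_apply, vac, Finset.card_eq_zero]
    split_ifs with h
    · simp [h]
    · rfl
  | succ m ih =>
    simp only [fallProd, Module.End.mul_apply, colSum, LinearMap.sum_apply, Fock.sum_apply,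
      lift_apply, cre_apply]
    rw [← Finset.sum_subset (Finset.subset_univ S) (fun b _ hb => by simp [hb])]
    have h1 : ∀ b ∈ S, T b v (if b ∈ S then sgnLt b S • (fallProd (colSum T) m (v - 1)) (vac α f) (S.erase b) else 0) =
        if S.card = m + 1 then m.factorial • setProd T S v f else 0 := by
      intro b hb
      have := ih hv.sub_one (S.erase b)
      rw [if_pos hb, this, Finset.card_erase_of_mem hb, setProd_front hT hb hv]
      have hpos := Finset.card_pos.2 ⟨b, hb⟩
      have h2 : S.card - 1 = m ↔ S.card = m + 1 := by omega
      simp only [h2]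
      split_ifs
      · simp only [map_zsmul, map_nsmul, LinearMap.smul_apply, Module.End.mul_apply]
        exact smul_comm _ _ _
      · simp
    rw [Finset.sum_congr rfl h1, Finset.sum_const]
    split_ifs with h
    · rw [h, Nat.factorial_succ, mul_smul]
    · simp

theorem fallProd_colSum_univ {v : K} (hv : Generic v) (f : B) :
    fallProd (colSum T) (Fintype.card α) v (vac α f) Finset.univ =
      (Fintype.card α).factorial • setProd T Finset.univ v f := by
  rw [fallProd_colSum_vac hT _ hv, if_pos Finset.card_univ]

/-- If column `y` is already occupied, the remaining factors must carry all other labels: this is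
how cofactors arise from products that are one factor short. -/
theorem fallProd_colSum_sum_cre {m : ℕ} (hm : Fintype.card α = m + 1) {v : K} (hv : Generic v)
    (f : α → B) : fallProd (colSum T) m v (∑ y, cre K B y (vac α (f y))) Finset.univ =
      m.factorial • ∑ y, sgnGt y Finset.univ • setProd T (Finset.univ.erase y) v (f y) := by
  rw [map_sum, Fock.sum_apply, Finset.smul_sum]
  refine Finset.sum_congr rfl fun y _ => ?_
  rw [← Module.End.mul_apply, fallProd_colSum_cre]
  simp only [LinearMap.smul_apply, Module.End.mul_apply, Fock.zsmul_apply, cre_apply,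
    Finset.mem_univ, if_true]
  have hc : (Finset.univ.erase y : Finset α).card = m := by
    rw [Finset.card_erase_of_mem (Finset.mem_univ y), Finset.card_univ, hm]; rfl
  rw [fallProd_colSum_vac hT _ hv, if_pos hc]
  have h1 := sgnLt_mul_sgnGt (Finset.mem_univ y)
  rw [Finset.card_univ, hm, Nat.add_sub_cancel] at h1
  -- `(-1) ^ m` comes from moving the column operator to the left; the relation between the two
  -- signs converts it to `sgnGt`.
  rw [smul_smul, ← h1, mul_right_comm, sgnLt_mul_self, one_mul, smul_comm]

end Column


/-! ## Signs of arrangements -/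

section TupleSign

variable {α : Type*} [LinearOrder α]

/-- The sign of an arrangement, `(-1)` to the number of inversions. -/
def tupleSign {m : ℕ} (p : Fin m → α) : ℤ :=
  ∏ i, ∏ j ∈ Finset.Ioi i, if p i < p j then 1 else -1

theorem tupleSign_perm {m : ℕ} (σ : Equiv.Perm (Fin m)) :
    tupleSign σ = (Equiv.Perm.sign σ : ℤ) := by
  rw [Equiv.Perm.sign_eq_prod_prod_Ioi, tupleSign]
  simp only [Units.coe_prod]
  refine Finset.prod_congr rfl fun i _ => Finset.prod_congr rfl fun j _ => ?_
  split_ifs <;> rfl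

theorem tupleSign_cons {m : ℕ} (k : α) (p : Fin m → α) :
    tupleSign (Fin.cons k p : Fin (m + 1) → α) =
      (∏ j, if k < p j then 1 else -1) * tupleSign p := by
  rw [tupleSign, Fin.prod_univ_succ, Fin.prod_Ioi_zero, tupleSign]
  simp only [Fin.prod_Ioi_succ, Fin.cons_zero, Fin.cons_succ]

theorem tupleSign_snoc {m : ℕ} (p : Fin m → α) (l : α) :
    tupleSign (Fin.snoc p l : Fin (m + 1) → α) =
      tupleSign p * ∏ j, if p j < l then 1 else -1 := by
  induction m with
  | zero => simp [tupleSign]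
  | succ m ih =>
    obtain ⟨k, p, rfl⟩ : ∃ k p', p = Fin.cons k p' := ⟨p 0, Fin.tail p, (Fin.cons_self_tail p).symm⟩
    rw [← Fin.cons_snoc_eq_snoc_cons, tupleSign_cons, tupleSign_cons, ih, Fin.prod_univ_castSucc,
      Fin.prod_univ_succ (fun j : Fin (m + 1) => if (Fin.cons k p : Fin (m + 1) → α) j < l then
        (1 : ℤ) else -1)]
    simp only [Fin.cons_zero, Fin.cons_succ, Fin.snoc_last, Fin.snoc_castSucc]
    ring

/-- `p` is an arrangement of the elements of `s`. -/
def IsArr {m : ℕ} (s : Finset α) (p : Fin m → α) : Prop :=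
  Function.Injective p ∧ Finset.univ.image p = s

instance {m : ℕ} (s : Finset α) (p : Fin m → α) : Decidable (IsArr s p) :=
  inferInstanceAs (Decidable (_ ∧ _))

theorem isArr_cons {m : ℕ} {s : Finset α} {k : α} {p : Fin m → α} :
    IsArr s (Fin.cons k p : Fin (m + 1) → α) ↔ k ∈ s ∧ IsArr (s.erase k) p := by
  have himg : Finset.univ.image (Fin.cons k p : Fin (m + 1) → α) =
      insert k (Finset.univ.image p) := by
    rw [Fin.univ_succ]; ext x; simp [eq_comm]
  rw [IsArr, IsArr, himg, Fin.cons_injective_iff]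
  constructor
  · rintro ⟨⟨h1, h2⟩, rfl⟩
    refine ⟨by simp, h2, ?_⟩
    rw [Finset.erase_insert]
    simpa using h1
  · rintro ⟨h1, h2, h3⟩
    refine ⟨⟨?_, h2⟩, ?_⟩
    · intro hk
      have : k ∈ Finset.univ.image p := by simpa using hk
      rw [h3] at this
      simp at this
    · rw [h3, Finset.insert_erase h1]

theorem isArr_snoc {m : ℕ} {s : Finset α} {l : α} {p : Fin m → α} :
    IsArr s (Fin.snoc p l : Fin (m + 1) → α) ↔ l ∈ s ∧ IsArr (s.erase l) p := by
  have himg : Finset.univ.image (Fin.snoc p l : Fin (m + 1) → α) =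
      insert l (Finset.univ.image p) := by
    ext x
    simp only [Finset.mem_image, Finset.mem_univ, true_and, Finset.mem_insert]
    constructor
    · rintro ⟨i, hi⟩
      induction i using Fin.lastCases with
      | last => left; simpa using hi.symm
      | cast i => right; exact ⟨i, by simpa using hi⟩
    · rintro (rfl | ⟨i, rfl⟩)
      · exact ⟨Fin.last m, by simp⟩
      · exact ⟨i.castSucc, by simp⟩
  rw [IsArr, IsArr, himg, Fin.snoc_injective_iff]
  constructor
  · rintro ⟨⟨h2, h1⟩, rfl⟩
    refine ⟨by simp, h2, ?_⟩
    rw [Finset.erase_insert]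
    simpa using h1
  · rintro ⟨h1, h2, h3⟩
    refine ⟨⟨h2, ?_⟩, ?_⟩
    · intro hk
      have : l ∈ Finset.univ.image p := by simpa using hk
      rw [h3] at this
      simp at this
    · rw [h3, Finset.insert_erase h1]

theorem IsArr.prod_eq {m : ℕ} {s : Finset α} {p : Fin m → α} (h : IsArr s p) (f : α → ℤ) :
    ∏ j, f (p j) = ∏ x ∈ s, f x := by
  rw [← h.2, Finset.prod_image (fun i _ j _ hij => h.1 hij)]

theorem IsArr.tupleSign_cons {m : ℕ} {s : Finset α} {k : α} {p : Fin m → α} (hk : k ∈ s)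
    (h : IsArr (s.erase k) p) :
    tupleSign (Fin.cons k p : Fin (m + 1) → α) = sgnLt k s * tupleSign p := by
  rw [Fermion.tupleSign_cons, h.prod_eq fun x => if k < x then 1 else -1]
  congr 1
  have h1 : sgnLt k s = sgnLt k (s.erase k) := by rw [sgnLt_erase hk]; simp
  rw [h1, sgnLt]
  refine Finset.prod_congr rfl fun x hx => ?_
  rcases lt_or_gt_of_ne (Finset.ne_of_mem_erase hx) with h | h
  · simp [h, h.not_gt]
  · simp [h, h.not_gt]

theorem IsArr.tupleSign_snoc {m : ℕ} {s : Finset α} {l : α} {p : Fin m → α} (hl : l ∈ s)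
    (h : IsArr (s.erase l) p) :
    tupleSign (Fin.snoc p l : Fin (m + 1) → α) = tupleSign p * sgnGt l s := by
  rw [Fermion.tupleSign_snoc, h.prod_eq fun x => if x < l then 1 else -1]
  congr 1
  have h1 : sgnGt l s = sgnGt l (s.erase l) := by rw [sgnGt_erase hl]; simp
  rw [h1, sgnGt]
  refine Finset.prod_congr rfl fun x hx => ?_
  rcases lt_or_gt_of_ne (Finset.ne_of_mem_erase hx) with h | h
  · simp [h, h.not_gt]
  · simp [h, h.not_gt]

theorem sum_cons {X : Type*} [AddCommMonoid X] [Fintype α] {m : ℕ} (g : (Fin (m + 1) → α) → X) :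
    ∑ p, g p = ∑ k, ∑ p : Fin m → α, g (Fin.cons k p) := by
  rw [← Fintype.sum_prod_type']
  exact (Fintype.sum_equiv (Fin.consEquiv fun _ => α) _ _ fun _ => rfl).symm

theorem sum_snoc {X : Type*} [AddCommMonoid X] [Fintype α] {m : ℕ} (g : (Fin (m + 1) → α) → X) :
    ∑ p, g p = ∑ l, ∑ p : Fin m → α, g (Fin.snoc p l) := by
  rw [← Fintype.sum_prod_type']
  exact (Fintype.sum_equiv (Fin.snocEquiv fun _ => α) _ _ fun _ => rfl).symm

end TupleSign

/-! ## The map `p ↦ p'` -/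

section PrimeMap

open PermMap

variable {α : Type*} [LinearOrder α] [OrderBot α]

theorem top1_eq {s : Finset α} {x : α} (hx : x ∈ s) (h : ∀ y ∈ s, y ≤ x) : top1 s = x :=
  le_antisymm (h _ (top1_mem ⟨x, hx⟩)) (le_top1 hx)

/-- The first component of the pair map depends only on `l`. -/
def firstCol (s : Finset α) (l : α) : α :=
  if l = top1 s then top1 (s.erase (top1 s)) else l

/-- In the expansion of the determinant the left column has to be chosen before the row `k` is
summed over, so it may depend on `l` only. -/
theorem ordPair_fst {s : Finset α} {k l : α} :
    (ordPair (top1 s) (top1 (s.erase (top1 s))) (top1 ((s.erase (top1 s)).erase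
      (top1 (s.erase (top1 s))))) k l).1 = firstCol s l := by
  unfold ordPair firstCol
  split_ifs <;> simp_all

/-- After the rows `k`, `l` and the left column are used, the remaining columns are the remaining
rows without their maximum, together with one extra column, the second component of the pair.
Removing it restores the shape of the problem for the smaller set `t`. -/
theorem ordPair_snd {s : Finset α} {k l : α} (hk : k ∈ s) (hl : l ∈ s) (hkl : k ≠ l)
    (h3 : ∃ x ∈ s, x ≠ k ∧ x ≠ l) :
    let x := (ordPair (top1 s) (top1 (s.erase (top1 s))) (top1 ((s.erase (top1 s)).erase
      (top1 (s.erase (top1 s))))) k l).2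
    let r := (s.erase (top1 s)).erase (firstCol s l)
    let t := (s.erase k).erase l
    x ∈ r ∧ r.erase x = t.erase (top1 t) := by
  obtain ⟨x, hx, hxk, hxl⟩ := h3
  have ha : top1 s ∈ s := top1_mem ⟨x, hx⟩
  have ha' : ∀ y ∈ s, y ≤ top1 s := fun y hy => le_top1 hy
  set a := top1 s
  have hb : top1 (s.erase a) ∈ s.erase a := by
    apply top1_mem
    by_cases h : k = a
    · exact ⟨l, by grind⟩
    · exact ⟨k, by grind⟩
  have hb' : ∀ y ∈ s.erase a, y ≤ top1 (s.erase a) := fun y hy => le_top1 hy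
  set b := top1 (s.erase a)
  have hc : top1 ((s.erase a).erase b) ∈ (s.erase a).erase b := by
    apply top1_mem
    by_cases h : k = a ∨ k = b
    · by_cases h' : l = a ∨ l = b
      · exact ⟨x, by grind⟩
      · exact ⟨l, by grind⟩
    · exact ⟨k, by grind⟩
  have hc' : ∀ y ∈ (s.erase a).erase b, y ≤ top1 ((s.erase a).erase b) := fun y hy => le_top1 hy
  set c := top1 ((s.erase a).erase b)
  have hf : firstCol s l = if l = a then b else l := rfl
  have ht : top1 ((s.erase k).erase l) = if k ≠ a ∧ l ≠ a then a else
      if k ≠ b ∧ l ≠ b then b else c := by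
    simp only [Finset.mem_erase] at hb hb' hc hc'
    apply top1_eq
    · split_ifs <;> simp only [Finset.mem_erase] <;> grind
    · intro y hy
      simp only [Finset.mem_erase] at hy
      split_ifs <;> grind
  intro x r t
  simp only [x, r, t, ht, hf]
  simp only [Finset.mem_erase] at hb hb' hc hc'
  clear_value a b c
  unfold ordPair
  split_ifs <;> refine ⟨?_, ?_⟩ <;> first | (ext y; simp only [Finset.mem_erase]; grind) | grind

end PrimeMap


open PermMap

/-! ### Two-sided expansion of the ordered product -/

section Weights

variable {K α A : Type*} [Field K] [CharZero K] [LinearOrder α] [OrderBot α] [Fintype α]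
  [Ring A] [Algebra K A]

/-- The ordered product of the entries `L (p i) (q i)`, where `q = qSeq M p`; the argument of the
`i`-th factor is `v - i - ε` in the first half of the product and `v - i` in the second half. -/
def weight (L : α → α → K → A) (ε : K) : (M : ℕ) → K → (Fin (M + 1) → α) → A
  | 0, _, _ => 1
  | 1, v, p => L (p 0) (qSeq 1 p 0) (v - ε)
  | M + 2, v, p => L (p 0) (qSeq (M + 2) p 0) (v - ε) *
      weight L ε M (v - 1) (fun i => p i.succ.castSucc) *
      L (p (Fin.last (M + 1)).castSucc) (qSeq (M + 2) p (Fin.last (M + 1))) (v - (M + 1))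

/-- The product of the `γ (v - i)` over the first half of the positions. -/
def weightScalar (γ : K → K) : ℕ → K → K
  | 0, _ => 1
  | 1, v => γ v
  | M + 2, v => γ v * weightScalar γ M (v - 1)

theorem qSeq_isArr {M : ℕ} {s : Finset α} {p : Fin (M + 1) → α} (h : IsArr s p) :
    IsArr (s.erase (top1 s)) (qSeq M p) := by
  obtain ⟨h1, h2⟩ := qSeq_spec M p h.1
  refine ⟨h1, Finset.eq_of_subset_of_card_le ?_ ?_⟩
  · intro x hx
    obtain ⟨i, -, rfl⟩ := Finset.mem_image.1 hx
    obtain ⟨⟨j, hj⟩, h4⟩ := h2 i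
    rw [Finset.mem_erase, ← h.2]
    exact ⟨h4, hj ▸ Finset.mem_image_of_mem _ (Finset.mem_univ j)⟩
  · have h3 : s.card = M + 1 := by
      rw [← h.2, Finset.card_image_of_injective _ h.1, Finset.card_univ, Fintype.card_fin]
    rw [Finset.card_image_of_injective _ h1, Finset.card_univ, Fintype.card_fin,
      Finset.card_erase_of_mem (top1_mem (Finset.card_pos.1 (by omega))), h3]
    rfl

variable {T : α → K → Module.End K (Fock α A)}

theorem setProd_cre_of_notMem
    (hcre : ∀ k l v, k ≠ l → T l v * cre K A k = -(cre K A k * T l v))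
    {l : α} {s : Finset α} (hl : l ∉ s) (v : K) :
    setProd T s v * cre K A l = (-1 : ℤ) ^ s.card • (cre K A l * setProd T s v) := by
  have h : ∀ (c : List α) (v : K), l ∉ c →
      listProd T c v * cre K A l = (-1 : ℤ) ^ c.length • (cre K A l * listProd T c v) := by
    intro c
    induction c with
    | nil => simp [listProd]
    | cons x c ih =>
      intro v hx
      rw [List.mem_cons, not_or] at hx
      rw [listProd, mul_assoc, ih _ hx.2, mul_smul_comm, ← mul_assoc, hcre _ _ _ (Ne.symm (Ne.symm hx.1)),
        List.length_cons, pow_succ]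
      simp [mul_assoc]
  have := h (s.sort (· ≤ ·)) v (by simpa using hl)
  rwa [Finset.length_sort] at this

omit [OrderBot α] in
theorem setProd_comm_lift {g : Module.End K A}
    (hg : ∀ l v, Commute (T l v) (lift K α A g)) (s : Finset α) (v : K) :
    Commute (setProd T s v) (lift K α A g) := by
  rw [setProd]
  generalize s.sort (· ≤ ·) = c
  induction c generalizing v with
  | nil => exact Commute.one_left _
  | cons x c ih => exact (hg x v).mul_left (ih _)

variable (hT : ∀ b c v, Generic v → T b v * T c (v - 1) + T c v * T b (v - 1) = 0)
  {L : α → α → K → A} {γ : K → K} {ε : K}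
  (hcre : ∀ k l v, k ≠ l → T l v * cre K A k = -(cre K A k * T l v))
  (hcol : ∀ l v f S, Generic v → l ∈ S → T l v f S =
    γ v • ∑ k ∈ S, sgnLt k S • (L k l (v - ε) * f (S.erase k)))
include hT hcre hcol

/-- The column `firstCol s l` is moved to the front and expanded over rows `k`, which is allowed
because it lies in `s`. It is chosen so that the other columns avoid `l`; hence the creation
operator of `l` passes through them, and what remains is a vacuum matrix element on `s` without `k`
and `l`. -/
theorem setProd_cre_vac_first {s : Finset α} {l : α} (hl : l ∈ s) (hs : 2 ≤ s.card) {v : K}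
    (hv : Generic v) :
    setProd T (s.erase (top1 s)) v (cre K A l (vac α 1)) s = γ v • ∑ k ∈ s.erase l,
      (sgnLt k s * sgnGt l (s.erase k) * sgnLt (firstCol s l) (s.erase (top1 s))) •
        (L k (firstCol s l) (v - ε) * setProd T ((s.erase (top1 s)).erase (firstCol s l)) (v - 1)
          (vac α 1) ((s.erase k).erase l)) := by
  have ha : top1 s ∈ s := top1_mem ⟨l, hl⟩
  have hb' : top1 (s.erase (top1 s)) ∈ s.erase (top1 s) := by
    apply top1_mem
    rw [← Finset.card_pos, Finset.card_erase_of_mem ha]; omega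
  have hb : firstCol s l ∈ s.erase (top1 s) := by
    unfold firstCol; split_ifs with h
    · exact hb'
    · exact Finset.mem_erase.2 ⟨h, hl⟩
  have hlR : l ∉ (s.erase (top1 s)).erase (firstCol s l) := by
    unfold firstCol; split_ifs with h
    · rw [h]; simp
    · simp
  have hcard : ((s.erase (top1 s)).erase (firstCol s l)).card = s.card - 2 := by
    rw [Finset.card_erase_of_mem hb, Finset.card_erase_of_mem ha]; omega
  have hmove := LinearMap.congr_fun (setProd_cre_of_notMem hcre hlR (v - 1)) (vac α 1)
  rw [Module.End.mul_apply, hcard] at hmove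
  rw [setProd_front hT hb hv, LinearMap.smul_apply, Fock.zsmul_apply, Module.End.mul_apply,
    hmove, hcol _ _ _ _ hv (Finset.mem_of_mem_erase hb), smul_comm]
  congr 1
  rw [Finset.smul_sum, ← Finset.sum_erase_add _ _ hl]
  -- The term `k = l` drops out: the label `l` cannot be created in a state lacking it.
  have h0 : ∀ f : Fock α A, cre K A l f (s.erase l) = 0 := fun f => by simp [cre_apply]
  simp only [LinearMap.smul_apply, Module.End.mul_apply, Fock.zsmul_apply, h0, smul_zero, mul_zero,
    add_zero]
  refine Finset.sum_congr rfl fun k hk => ?_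
  obtain ⟨hkl, hks⟩ := Finset.mem_erase.1 hk
  have hlk : l ∈ s.erase k := Finset.mem_erase.2 ⟨hkl.symm, hl⟩
  rw [cre_apply, if_pos hlk]
  have h1 := sgnLt_mul_sgnGt hlk
  rw [Finset.card_erase_of_mem hks, show s.card - 1 - 1 = s.card - 2 by omega] at h1
  simp only [mul_smul_comm, smul_smul]
  congr 1
  rw [← h1]
  linear_combination (sgnLt (firstCol s l) (s.erase (top1 s)) * sgnLt k s * sgnGt l (s.erase k)) *
    sgnLt_mul_self l (s.erase k)

variable (hvac : ∀ l v x, T l v (vac α x) = ∑ k, cre K A k (vac α (L k l v * x)))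
  (hmul : ∀ l v x, Commute (T l v) (lift K α A (LinearMap.mulRight K x)))
include hvac hmul

-- Right multiplication commutes with all the operators, so a coefficient of the starting state
-- comes out on the right.
omit hT hcol hvac in
theorem setProd_cre_vac_mul (s t : Finset α) (c : α) (v : K) (x : A) :
    setProd T s v (cre K A c (vac α x)) t = setProd T s v (cre K A c (vac α 1)) t * x := by
  have h := congrArg (fun g : Module.End K (Fock α A) => g (cre K A c (vac α 1)) t)
    (setProd_comm_lift (fun l v => hmul l v x) s v).eq
  simp only [Module.End.mul_apply, lift_apply, LinearMap.mulRight_apply] at h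
  have h2 := LinearMap.congr_fun (cre_lift c (LinearMap.mulRight K x)) (vac α 1)
  rw [Module.End.mul_apply, Module.End.mul_apply, lift_vac, LinearMap.mulRight_apply, one_mul] at h2
  rw [← h, h2]

/-- One step uses both ends. The left factor is expanded by `setProd_cre_vac_first`; then a column
is moved to the right end, where it acts on the vacuum by plain entries and creates a row `c`. The
rest is the same matrix element for the set `t` and row `c`. The columns used are those of `qSeq`,
and `γ` is collected once per left factor. -/
theorem setProd_cre_vac : ∀ (M : ℕ) (s : Finset α) (l : α) (v : K), s.card = M + 1 → l ∈ s →
    Generic v → setProd T (s.erase (top1 s)) v (cre K A l (vac α 1)) s =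
      weightScalar γ M v • ∑ p : Fin (M + 1) → α,
        if IsArr s p ∧ p (Fin.last M) = l then
          (tupleSign p * tupleSign (qSeq M p)) • weight L ε M v p else 0
  | 0, s, l, v, hs, hl, hv => by
    obtain ⟨x, rfl⟩ := Finset.card_eq_one.1 hs
    obtain rfl := Finset.mem_singleton.1 hl
    have h1 : ({l} : Finset α).erase (top1 {l}) = ∅ := by
      rw [top1_eq (Finset.mem_singleton_self l) (by simp)]; simp
    rw [h1, setProd_empty, Module.End.one_apply, cre_apply,
      Finset.sum_eq_single_of_mem (fun _ => l) (Finset.mem_univ _)]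
    · rw [if_pos (Finset.mem_singleton_self l), if_pos]
      · simp [sgnLt, vac, weightScalar, tupleSign, weight]
      · exact ⟨⟨fun i j _ => Subsingleton.elim (α := Fin 1) i j, by ext; simp [eq_comm]⟩, rfl⟩
    · intro p _ hp
      refine if_neg fun h => hp (funext fun i => ?_)
      rw [← h.2]; congr 1; exact Subsingleton.elim (α := Fin 1) _ _
  | 1, s, l, v, hs, hl, hv => by
    rw [setProd_cre_vac_first hT hcre hcol hl (by omega) hv, weightScalar]
    congr 1
    rw [sum_cons, ← Finset.sum_subset (Finset.subset_univ (s.erase l))]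
    · refine Finset.sum_congr rfl fun k hk => ?_
      obtain ⟨hkl, hks⟩ := Finset.mem_erase.1 hk
      have hlk : l ∈ s.erase k := Finset.mem_erase.2 ⟨hkl.symm, hl⟩
      have he : (s.erase k).erase l = ∅ := by
        rw [← Finset.card_eq_zero, Finset.card_erase_of_mem hlk, Finset.card_erase_of_mem hks, hs]
      have hs' : s = {k, l} := by
        rw [← Finset.insert_erase hks, ← Finset.insert_erase hlk, he]; simp
      have harr0 : IsArr (s.erase k) (fun _ : Fin 1 => l) := by
        have : s.erase k = {l} := by
          rw [← Finset.insert_erase hlk, he]; simp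
        rw [this]
        exact ⟨fun i j _ => Subsingleton.elim (α := Fin 1) i j, by ext; simp [eq_comm]⟩
      have harr : IsArr s (Fin.cons k (fun _ : Fin 1 => l) : Fin 2 → α) :=
        isArr_cons.2 ⟨hks, harr0⟩
      have hmin : firstCol s l = min k l := by
        have h1 : top1 s = max k l := by
          rw [hs']; exact top1_eq (by rcases max_choice k l with h | h <;> simp [h]) (by simp)
        unfold firstCol
        rw [h1]
        rcases lt_or_gt_of_ne hkl with h | h
        · rw [max_eq_right h.le, min_eq_left h.le, if_pos rfl]
          refine top1_eq (by rw [hs']; simp [hkl]) ?_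
          rw [hs']; intro y; simp only [Finset.mem_erase, Finset.mem_insert, Finset.mem_singleton]
          rintro ⟨h3, h4 | h4⟩ <;> grind
        · rw [max_eq_left h.le, min_eq_right h.le, if_neg hkl.symm]
      have hR : (s.erase (top1 s)).erase (firstCol s l) = ∅ := by
        have := (qSeq_isArr harr).2
        rw [← this]
        ext y
        simp [qSeq, hmin]
      have hR' : s.erase (top1 s) = {firstCol s l} := by
        have := (qSeq_isArr harr).2
        rw [← this]
        ext y
        simp [qSeq, hmin]
      rw [hR, he, setProd_empty, Module.End.one_apply,
        Finset.sum_eq_single_of_mem (fun _ => l) (Finset.mem_univ _)]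
      · rw [if_pos ⟨harr, rfl⟩, IsArr.tupleSign_cons hks harr0, hR']
        have h1 : sgnGt l (s.erase k) = 1 := by
          rw [show s.erase k = {l} by rw [← Finset.insert_erase hlk, he]; simp]; simp [sgnGt]
        rw [h1]
        simp [sgnLt, vac, weight, tupleSign, qSeq, hmin]
        exact fun h h' => absurd h h'.not_gt
      · intro p _ hp
        refine if_neg fun h => hp (funext fun i => ?_)
        have h2 : p (Fin.last 0) = l := h.2
        rw [← h2]; congr 1; exact Subsingleton.elim (α := Fin 1) _ _
    · intro k _ hk
      refine Finset.sum_eq_zero fun p _ => if_neg fun h => hk ?_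
      have h1 := (isArr_cons.1 h.1)
      have h2 : p (Fin.last 0) = l := h.2
      refine Finset.mem_erase.2 ⟨?_, h1.1⟩
      rintro rfl
      have : p (Fin.last 0) ∈ s.erase k := by
        rw [← h1.2.2]; simp
      rw [h2] at this; simp at this
  | M + 2, s, l, v, hs, hl, hv => by
    rw [setProd_cre_vac_first hT hcre hcol hl (by omega) hv, weightScalar, mul_smul]
    congr 1
    rw [sum_cons, ← Finset.sum_subset (Finset.subset_univ (s.erase l)), Finset.smul_sum]
    · refine Finset.sum_congr rfl fun k hk => ?_
      obtain ⟨hkl, hks⟩ := Finset.mem_erase.1 hk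
      have hlk : l ∈ s.erase k := Finset.mem_erase.2 ⟨hkl.symm, hl⟩
      set t := (s.erase k).erase l with ht
      have htc : t.card = M + 1 := by
        rw [Finset.card_erase_of_mem hlk, Finset.card_erase_of_mem hks, hs]; rfl
      obtain ⟨y, hy⟩ : t.Nonempty := Finset.card_pos.1 (by omega)
      have h3 : ∃ x ∈ s, x ≠ k ∧ x ≠ l := ⟨y, by
        simp only [ht, Finset.mem_erase] at hy; exact ⟨hy.2.2, hy.2.1, hy.1⟩⟩
      obtain ⟨hx, hxt⟩ := ordPair_snd hks hl hkl h3
      have hfst := ordPair_fst (s := s) (k := k) (l := l)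
      set q := ordPair (top1 s) (top1 (s.erase (top1 s))) (top1 ((s.erase (top1 s)).erase
        (top1 (s.erase (top1 s))))) k l with hq
      set b := firstCol s l
      set R := (s.erase (top1 s)).erase b with hR
      have ha : top1 s ∈ s := top1_mem ⟨l, hl⟩
      have hRc : R.card = M + 1 := by
        have h5 := congrArg Finset.card hxt
        have hpos := Finset.card_pos.2 ⟨_, hx⟩
        rw [Finset.card_erase_of_mem hx, Finset.card_erase_of_mem (top1_mem ⟨y, hy⟩), htc] at h5
        omega
      have hbm : b ∈ s.erase (top1 s) := by
        by_contra hcon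
        have h6 := hRc
        rw [hR, Finset.erase_eq_of_notMem hcon, Finset.card_erase_of_mem ha, hs] at h6
        omega
      -- The right end: column `q.2` acts on the vacuum, and the remaining columns are `t` without
      -- its maximum, so the induction hypothesis applies.
      have hback : setProd T R (v - 1) (vac α 1) t = (sgnGt q.2 R * 1) •
          weightScalar γ M (v - 1) • ∑ p : Fin (M + 1) → α, if IsArr t p then
            (tupleSign p * tupleSign (qSeq M p)) •
              (weight L ε M (v - 1) p * L (p (Fin.last M)) q.2 (v - (M + 1))) else 0 := by
        rw [setProd_back hT hx hv.sub_one, LinearMap.smul_apply, Fock.zsmul_apply, mul_one,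
          Module.End.mul_apply, hRc, hvac, map_sum, Fock.sum_apply]
        congr 1
        have hw : v - 1 - ((M + 1 - 1 : ℕ) : K) = v - (M + 1) := by
          push_cast [Nat.add_sub_cancel]; ring
        have hterm : ∀ c, setProd T (R.erase q.2) (v - 1)
            (cre K A c (vac α (L c q.2 (v - 1 - ((M + 1 - 1 : ℕ) : K)) * 1))) t =
            weightScalar γ M (v - 1) • ∑ p : Fin (M + 1) → α,
              if IsArr t p ∧ p (Fin.last M) = c then (tupleSign p * tupleSign (qSeq M p)) •
              (weight L ε M (v - 1) p * L (p (Fin.last M)) q.2 (v - (M + 1))) else 0 := by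
          intro c
          rw [hw, mul_one, hxt]
          by_cases hc : c ∈ t
          · rw [setProd_cre_vac_mul hcre hmul,
              setProd_cre_vac M t c (v - 1) htc hc hv.sub_one, smul_mul_assoc, Finset.sum_mul]
            congr 1
            refine Finset.sum_congr rfl fun p _ => ?_
            by_cases h : IsArr t p ∧ p (Fin.last M) = c
            · rw [if_pos h, if_pos h, h.2, smul_mul_assoc]
            · rw [if_neg h, if_neg h, zero_mul]
          -- A row outside `t` contributes nothing: its creation operator passes to the left, where
          -- the component `t` cannot contain it.
          · have hc' : c ∉ t.erase (top1 t) := fun h => hc (Finset.mem_of_mem_erase h)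
            have hmove := LinearMap.congr_fun (setProd_cre_of_notMem hcre hc' (v - 1))
              (vac α (L c q.2 (v - (M + 1))))
            rw [Module.End.mul_apply] at hmove
            rw [hmove, LinearMap.smul_apply, Fock.zsmul_apply, Module.End.mul_apply, cre_apply,
              if_neg hc, smul_zero]
            rw [Finset.sum_eq_zero, smul_zero]
            intro p _
            refine if_neg fun h => hc ?_
            rw [← h.2, ← h.1.2]
            exact Finset.mem_image_of_mem _ (Finset.mem_univ _)
        rw [Finset.sum_congr rfl fun c _ => hterm c, ← Finset.smul_sum, Finset.sum_comm]
        congr 1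
        refine Finset.sum_congr rfl fun p _ => ?_
        by_cases h : IsArr t p
        · simp [h]
        · simp [h]
      rw [hback, sum_snoc (m := M + 1), Finset.sum_eq_single_of_mem l (Finset.mem_univ l)]
      · rw [mul_one, mul_smul_comm, mul_smul_comm, smul_smul,
          smul_comm _ (weightScalar γ M (v - 1)), Finset.mul_sum, Finset.smul_sum]
        congr 1
        refine Finset.sum_congr rfl fun p _ => ?_
        have harr : IsArr s (Fin.cons k (Fin.snoc p l : Fin (M + 2) → α) : Fin (M + 3) → α) ↔
            IsArr t p := by
          rw [isArr_cons, isArr_snoc]; simp [hks, hlk, ht]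
        have hlast : (Fin.cons k (Fin.snoc p l : Fin (M + 2) → α) : Fin (M + 3) → α)
            (Fin.last (M + 2)) = l := by
          rw [← Fin.succ_last, Fin.cons_succ, Fin.snoc_last]
        by_cases h : IsArr t p
        · have harr1 : IsArr (s.erase k) (Fin.snoc p l : Fin (M + 2) → α) :=
            isArr_snoc.2 ⟨hlk, h⟩
          have hs1 := (harr.2 h).2
          have hmid : (fun i : Fin (M + 1) => (Fin.cons k (Fin.snoc p l : Fin (M + 2) → α) :
              Fin (M + 3) → α) i.succ.castSucc) = p := by
            funext i
            rw [← Fin.succ_castSucc, Fin.cons_succ, Fin.snoc_castSucc]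
          have hqs : qSeq (M + 2) (Fin.cons k (Fin.snoc p l : Fin (M + 2) → α) : Fin (M + 3) → α) =
              Fin.cons (α := fun _ => α) b (Fin.snoc (α := fun _ => α) (qSeq M p) q.2) := by
            rw [qSeq, hs1, hlast, hmid, Fin.cons_zero, ← hq, hfst]
          have hqa : IsArr (R.erase q.2) (qSeq M p) := by
            rw [hxt]; exact qSeq_isArr h
          rw [if_pos h, if_pos ⟨harr.2 h, hlast⟩, IsArr.tupleSign_cons hks harr1,
            IsArr.tupleSign_snoc hlk h, weight, hqs, hmid,
            IsArr.tupleSign_cons hbm (isArr_snoc.2 ⟨hx, hqa⟩), IsArr.tupleSign_snoc hx hqa]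
          have h7 : (Fin.cons k (Fin.snoc p l : Fin (M + 2) → α) : Fin (M + 3) → α)
              (Fin.last (M + 1)).castSucc = p (Fin.last M) := by
            rw [← Fin.succ_last, ← Fin.succ_castSucc, Fin.cons_succ, Fin.snoc_castSucc]
          have h8 : (Fin.cons (α := fun _ => α) b (Fin.snoc (α := fun _ => α) (qSeq M p) q.2) :
              Fin (M + 2) → α) (Fin.last (M + 1)) = q.2 := by
            rw [← Fin.succ_last, Fin.cons_succ, Fin.snoc_last]
          rw [h7, h8, Fin.cons_zero, Fin.cons_zero, mul_smul_comm, smul_smul]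
          congr 1
          · ring
          · simp only [mul_assoc]
        · rw [if_neg h, if_neg fun h' => h (harr.1 h'.1), mul_zero, smul_zero]
      · intro c _ hc
        refine Finset.sum_eq_zero fun p _ => if_neg fun h => hc ?_
        rw [← h.2, ← Fin.succ_last, Fin.cons_succ, Fin.snoc_last]
    · intro k _ hk
      refine Finset.sum_eq_zero fun p _ => if_neg fun h => hk ?_
      have h1 := (isArr_cons.1 h.1)
      have h2 := h.2
      rw [← Fin.succ_last, Fin.cons_succ] at h2
      refine Finset.mem_erase.2 ⟨?_, h1.1⟩
      rintro rfl
      have : p (Fin.last (M + 1)) ∈ s.erase k := by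
        rw [← h1.2.2]; exact Finset.mem_image_of_mem _ (Finset.mem_univ _)
      rw [h2] at this; simp at this

end Weights


open PermMap

/-! ## Determinant formulas -/

section ClassicalDeterminant

variable {K A : Type*} [Field K] [CharZero K] [Ring A] [Algebra K A]

/-- The argument of the `i`-th factor. -/
def shiftArg (ε : K) (M : ℕ) (v : K) (i : ℕ) : K := if 2 * i < M then v - i - ε else v - i

theorem weight_eq_prod {α : Type*} [LinearOrder α] [OrderBot α] (L : α → α → K → A) (ε : K) :
    ∀ (M : ℕ) (v : K) (p : Fin (M + 1) → α), weight L ε M v p =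
      (List.ofFn fun i : Fin M => L (p i.castSucc) (qSeq M p i) (shiftArg ε M v i)).prod
  | 0, _, _ => by simp [weight]
  | 1, v, p => by simp [weight, shiftArg]
  | M + 2, v, p => by
    rw [weight, weight_eq_prod L ε M, List.ofFn_succ', List.concat_eq_append, List.prod_append,
      List.ofFn_succ, List.prod_cons, List.prod_singleton]
    congr 3
    · simp [shiftArg]
    · refine congrArg List.ofFn (funext fun i => ?_)
      have h1 : qSeq (M + 2) p i.succ.castSucc =
          qSeq M (fun i : Fin (M + 1) => p i.succ.castSucc) i := by
        rw [qSeq, ← Fin.succ_castSucc, Fin.cons_succ, Fin.snoc_castSucc]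
      have h2 : shiftArg ε (M + 2) v (i.succ.castSucc : Fin (M + 2)) = shiftArg ε M (v - 1) i := by
        simp only [shiftArg, Fin.val_castSucc, Fin.val_succ]
        have : 2 * ((i : ℕ) + 1) < M + 2 ↔ 2 * (i : ℕ) < M := by omega
        simp only [this]
        split_ifs <;> push_cast <;> ring
      rw [h1, h2]
      rfl
    · rw [shiftArg, if_neg (by simp; omega)]
      simp

variable {M : ℕ} {T : Fin (M + 1) → K → Module.End K (Fock (Fin (M + 1)) A)}
  (hT : ∀ b c v, Generic v → T b v * T c (v - 1) + T c v * T b (v - 1) = 0)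
  {L : Fin (M + 1) → Fin (M + 1) → K → A} {γ : K → K} {ε : K}
  (hcre : ∀ k l v, k ≠ l → T l v * cre K A k = -(cre K A k * T l v))
  (hcol : ∀ l v f S, Generic v → l ∈ S → T l v f S =
    γ v • ∑ k ∈ S, sgnLt k S • (L k l (v - ε) * f (S.erase k)))
  (hvac : ∀ l v x, T l v (vac _ x) = ∑ k, cre K A k (vac _ (L k l v * x)))
  (hmul : ∀ l v x, Commute (T l v) (lift K _ A (LinearMap.mulRight K x)))

theorem isArr_univ_iff {N : ℕ} {p : Fin N → Fin N} :
    IsArr Finset.univ p ↔ Function.Bijective p :=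
  ⟨fun h => Finite.injective_iff_bijective.1 h.1,
    fun h => ⟨h.1, Finset.image_univ_of_surjective h.2⟩⟩

theorem sum_isArr_univ {N : ℕ} {X : Type*} [AddCommMonoid X] (g : (Fin N → Fin N) → X) :
    (∑ p, if IsArr Finset.univ p then g p else 0) = ∑ p : Equiv.Perm (Fin N), g p := by
  rw [← Finset.sum_filter]
  refine (Finset.sum_bij (fun (p : Equiv.Perm (Fin N)) _ => (p : Fin N → Fin N)) ?_ ?_ ?_ ?_).symm
  · intro p _
    simpa using isArr_univ_iff.2 p.bijective
  · intro p _ q _ h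
    exact DFunLike.coe_injective h
  · intro p hp
    exact ⟨Equiv.ofBijective p (isArr_univ_iff.1 (by simpa using hp)), Finset.mem_univ _, rfl⟩
  · intro p _
    rfl

include hT hcre hcol hvac hmul in
-- The largest column is put at the right end and acts on the vacuum; this is the final entry `N` of
-- `p'`. The other columns are all labels except the maximum, the situation of `setProd_cre_vac`.
theorem setProd_univ_eq_sum_perm {v : K} (hv : Generic v) :
    setProd T Finset.univ v (vac _ 1) Finset.univ = weightScalar γ M v •
      ∑ p : Equiv.Perm (Fin (M + 1)), (Equiv.Perm.sign (p * primePerm _ p) : ℤ) •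
        (List.ofFn fun i => L (p i) (primePerm _ p i) (shiftArg ε M v i)).prod := by
  have htop : top1 (Finset.univ : Finset (Fin (M + 1))) = Fin.last M :=
    top1_eq (Finset.mem_univ _) fun y _ => Fin.le_last y
  rw [setProd_back hT (Finset.mem_univ (Fin.last M)) hv, LinearMap.smul_apply, Fock.zsmul_apply,
    Module.End.mul_apply, hvac, map_sum, Fock.sum_apply]
  have hs : sgnGt (Fin.last M) (Finset.univ : Finset (Fin (M + 1))) = 1 :=
    Finset.prod_eq_one fun x _ => if_neg (Fin.le_last x).not_gt
  have hc : ∀ c x, setProd T (Finset.univ.erase (Fin.last M)) v (cre K A c (vac _ x)) Finset.univ =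
      weightScalar γ M v • ∑ p : Equiv.Perm (Fin (M + 1)), if p (Fin.last M) = c then
        (tupleSign p * tupleSign (qSeq M p)) • (weight L ε M v p * x) else 0 := by
    intro c x
    have h1 := setProd_cre_vac hT hcre hcol hvac hmul M Finset.univ c v (by simp)
      (Finset.mem_univ c) hv
    simp only [htop, ite_and] at h1
    rw [setProd_cre_vac_mul hcre hmul, h1,
      sum_isArr_univ fun p => if p (Fin.last M) = c then _ else 0, smul_mul_assoc, Finset.sum_mul]
    simp only [ite_mul, zero_mul, smul_mul_assoc]
  simp only [hc, hs, one_smul, ← Finset.smul_sum]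
  rw [Finset.sum_comm]
  congr 1
  refine Finset.sum_congr rfl fun p _ => ?_
  rw [Finset.sum_ite_eq, if_pos (Finset.mem_univ _)]
  have hpr : (primePerm (M + 1) p : Fin (M + 1) → Fin (M + 1)) =
      Fin.snoc (α := fun _ => Fin (M + 1)) (qSeq M p) (Fin.last M) := rfl
  have hq : IsArr (Finset.univ.erase (Fin.last M)) (qSeq M p) := by
    rw [← htop]; exact qSeq_isArr (isArr_univ_iff.2 p.bijective)
  have hsign : (Equiv.Perm.sign (p * primePerm _ p) : ℤ) =
      tupleSign p * tupleSign (qSeq M p) := by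
    rw [Equiv.Perm.sign_mul, Units.val_mul, ← tupleSign_perm, ← tupleSign_perm, hpr,
      IsArr.tupleSign_snoc (Finset.mem_univ _) hq, hs, mul_one]
  rw [hsign, List.ofFn_succ', List.concat_eq_append, List.prod_append, List.prod_singleton,
    weight_eq_prod]
  simp only [hpr, Fin.snoc_castSucc, Fin.snoc_last, Fin.val_castSucc, Fin.val_last, mul_one,
    Finset.card_univ, Fintype.card_fin, Nat.add_sub_cancel]
  congr 5
  rw [shiftArg, if_neg (by omega)]

end ClassicalDeterminant

/-! ### The column determinant in the general linear case -/

section GenLinDeterminant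

variable {K α A : Type*} [Field K] [CharZero K] [LinearOrder α] [Fintype α] [Ring A] [Algebra K A]
  {T : α → K → Module.End K (Fock α A)} {L : α → α → K → A}

/-- Without a correction term each factor expands over rows on every component, so expanding from
the left alone suffices; the accumulated sign is that of the arrangement of rows. -/
theorem listProd_eq_sum
    (hcol : ∀ l v f S, T l v f S = ∑ k ∈ S, sgnLt k S • (L k l v * f (S.erase k))) :
    ∀ (m : ℕ) (c : Fin m → α) (v : K) (S : Finset α), listProd T (List.ofFn c) v (vac _ 1) S =
      ∑ p : Fin m → α, if IsArr S p then tupleSign p •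
        (List.ofFn fun i : Fin m => L (p i) (c i) (v - (i : ℕ))).prod else 0
  | 0, c, v, S => by
    simp [listProd, vac, IsArr, tupleSign, Function.Injective, eq_comm]
  | m + 1, c, v, S => by
    rw [List.ofFn_succ, listProd, Module.End.mul_apply, hcol, sum_cons,
      ← Finset.sum_subset (Finset.subset_univ S)]
    · refine Finset.sum_congr rfl fun k hk => ?_
      rw [listProd_eq_sum hcol m, Finset.mul_sum, Finset.smul_sum]
      refine Finset.sum_congr rfl fun p _ => ?_
      by_cases h : IsArr (S.erase k) p
      · rw [if_pos h, if_pos (isArr_cons.2 ⟨hk, h⟩), IsArr.tupleSign_cons hk h, mul_smul_comm,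
          smul_smul, List.ofFn_succ, List.prod_cons]
        simp only [Fin.cons_zero, Fin.cons_succ, Fin.val_zero, Nat.cast_zero, sub_zero,
          Fin.val_succ, Nat.cast_add, Nat.cast_one, sub_sub, add_comm (1 : K)]
      · rw [if_neg h, if_neg fun h' => h (isArr_cons.1 h').2, mul_zero, smul_zero]
    · intro k _ hk
      exact Finset.sum_eq_zero fun p _ => if_neg fun h => hk (isArr_cons.1 h).1

theorem setProd_univ_eq_sum_perm_of_col {N : ℕ}
    {T : Fin N → K → Module.End K (Fock (Fin N) A)} {L : Fin N → Fin N → K → A}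
    (hcol : ∀ l v f S, T l v f S = ∑ k ∈ S, sgnLt k S • (L k l v * f (S.erase k))) (v : K) :
    setProd T Finset.univ v (vac _ 1) Finset.univ =
      ∑ p : Equiv.Perm (Fin N), (Equiv.Perm.sign p : ℤ) •
        (List.ofFn fun i : Fin N => L (p i) i (v - (i : ℕ))).prod := by
  rw [setProd, Fin.sort_univ, ← List.ofFn_id, listProd_eq_sum hcol, sum_isArr_univ]
  simp only [tupleSign_perm, id]

end GenLinDeterminant


/-! ## Two commuting families of fermions -/

/-- Two families of fermions commuting with each other, together with two families of elements
commuting with them and with each other. -/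
structure IsDoubleCAR {I R : Type*} [DecidableEq I] [Ring R] (ψ d p q : I → R) (F G : I → I → R) :
    Prop where
  row : IsCAR ψ d
  col : IsCAR p q
  psi_p : ∀ i j, Commute (ψ i) (p j)
  psi_q : ∀ i j, Commute (ψ i) (q j)
  d_p : ∀ i j, Commute (d i) (p j)
  d_q : ∀ i j, Commute (d i) (q j)
  psi_F : ∀ i j k, Commute (ψ i) (F j k)
  d_F : ∀ i j k, Commute (d i) (F j k)
  p_F : ∀ i j k, Commute (p i) (F j k)
  q_F : ∀ i j k, Commute (q i) (F j k)
  psi_G : ∀ i j k, Commute (ψ i) (G j k)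
  d_G : ∀ i j k, Commute (d i) (G j k)
  p_G : ∀ i j k, Commute (p i) (G j k)
  q_G : ∀ i j k, Commute (q i) (G j k)
  F_G : ∀ i j k l, Commute (F i j) (G k l)

variable {K R I : Type*} [Field K] [CharZero K] [Ring R] [Algebra K R] [Fintype I] [DecidableEq I]

/-- `∑ b, r, ψ r p b X r b`. -/
def bos (ψ p : I → R) (X : I → I → R) : R := ∑ b, ∑ r, ψ r * p b * X r b

/-- `∑ b, ψ b p b`. -/
def tau (ψ p : I → R) : R := ∑ b, ψ b * p b

/-- `∑ b, s (-b) d (-b) p b`. -/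
def annCre (ν : I → I) (s : I → K) (d p : I → R) : R := ∑ b, s (ν b) • (d (ν b) * p b)

/-- `∑ x, s x ψ (-x) q x`. -/
def creAnn (ν : I → I) (s : I → K) (ψ q : I → R) : R := ∑ x, s x • (ψ (ν x) * q x)

/-- The difference of the number operators of the two families. -/
def numDiff (ψ d p q : I → R) : R := ∑ r, ψ r * d r - ∑ b, p b * q b

/-- `∑ b, r, s r p (-r) p b X r b`. -/
def pairing (ν : I → I) (s : I → K) (p : I → R) (X : I → I → R) : R :=
  ∑ b, ∑ r, s r • (p (ν r) * p b * X r b)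

theorem bos_eq_sum_eta {ψ p : I → R} {F : I → I → R}
    (h : ∀ i j k, Commute (p i) (F j k)) : bos ψ p F = ∑ b, eta ψ F b * p b := by
  simp only [bos, eta, Finset.sum_mul]
  refine Finset.sum_congr rfl fun b _ => Finset.sum_congr rfl fun r _ => ?_
  rw [mul_assoc, mul_assoc, (h b r b).eq]

theorem tau_eq_bos (ψ p : I → R) : tau ψ p = bos ψ p fun i j => if i = j then 1 else 0 := by
  simp [tau, bos]

theorem sum_comp_of_invol {X : Type*} [AddCommMonoid X] {ν : I → I} (hν : ∀ i, ν (ν i) = i)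
    (f : I → X) : ∑ i, f (ν i) = ∑ i, f i :=
  Fintype.sum_equiv ⟨ν, ν, hν, hν⟩ _ _ fun _ => rfl

theorem sum_mul_sum_of_commutator {ι κ μ : Type*} [Fintype ι] [Fintype κ] [Fintype μ] {x : ι → R}
    {y : κ → μ → R} {z : ι → κ → μ → R} (h : ∀ i b r, x i * y b r = y b r * x i + z i b r) :
    (∑ i, x i) * (∑ b, ∑ r, y b r) = (∑ b, ∑ r, y b r) * (∑ i, x i) + ∑ b, ∑ r, ∑ i, z i b r := by
  rw [Finset.mul_sum, Finset.sum_mul, ← Finset.sum_add_distrib]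
  refine Finset.sum_congr rfl fun b _ => ?_
  rw [Finset.mul_sum, Finset.sum_mul, ← Finset.sum_add_distrib]
  refine Finset.sum_congr rfl fun r _ => ?_
  rw [Finset.sum_mul, Finset.mul_sum, ← Finset.sum_add_distrib]
  exact Finset.sum_congr rfl fun i _ => h i b r

section Anticomm

variable {x y z w : R}

theorem commute_mul_of_anticomm (h : x * y = -(y * x)) (h' : x * z = -(z * x)) :
    Commute x (y * z) := by
  rw [Commute, SemiconjBy, ← mul_assoc, h, neg_mul, mul_assoc, h', mul_neg, neg_neg, mul_assoc]

end Anticomm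

section Double

variable {ψ d p q : I → R} {F G : I → I → R} (D : IsDoubleCAR ψ d p q F G) {ν : I → I}
  {s : I → K} {ε : K}
include D

/-- A row fermion times a column fermion behaves as a boson: the two signs cancel. -/
theorem IsDoubleCAR.psi_mul_p_commute (r b c e : I) : Commute (ψ r * p b) (ψ c * p e) := by
  have h1 := D.row.psi_psi r c
  have h2 := D.col.psi_psi b e
  have h3 := (D.psi_p r e).eq
  have h4 := (D.psi_p c b).eq
  rw [Commute, SemiconjBy]
  calc ψ r * p b * (ψ c * p e) = ψ r * (p b * ψ c) * p e := by noncomm_ring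
    _ = (ψ r * ψ c) * (p b * p e) := by rw [← h4]; noncomm_ring
    _ = ψ c * (ψ r * p e) * p b := by rw [h1, h2]; noncomm_ring
    _ = _ := by rw [h3]; noncomm_ring

theorem IsDoubleCAR.bos_commute {X Y : I → I → R} (hX : ∀ i j k, Commute (ψ i) (X j k))
    (hX' : ∀ i j k, Commute (p i) (X j k)) (hY : ∀ i j k, Commute (ψ i) (Y j k))
    (hY' : ∀ i j k, Commute (p i) (Y j k)) (hXY : ∀ i j k l, Commute (X i j) (Y k l)) :
    Commute (bos ψ p X) (bos ψ p Y) := by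
  refine Commute.sum_left _ _ _ fun b _ => Commute.sum_left _ _ _ fun r _ =>
    Commute.sum_right _ _ _ fun c _ => Commute.sum_right _ _ _ fun e _ => ?_
  refine Commute.mul_left (Commute.mul_right (D.psi_mul_p_commute _ _ _ _) ?_)
    (Commute.mul_right ?_ (hXY _ _ _ _))
  · exact (hY _ _ _).mul_left (hY' _ _ _)
  · exact ((hX _ _ _).symm).mul_right (hX' _ _ _).symm

theorem IsDoubleCAR.annCre_bos {X : I → I → R} (hν : ∀ i, ν (ν i) = i)
    (hX : ∀ i j k, Commute (d i) (X j k))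
    (hX' : ∀ i j k, Commute (p i) (X j k)) :
    annCre ν s d p * bos ψ p X = bos ψ p X * annCre ν s d p + pairing ν s p X := by
  have key : ∀ e b r, (s (ν e) • (d (ν e) * p e)) * (ψ r * p b * X r b) =
      (ψ r * p b * X r b) * (s (ν e) • (d (ν e) * p e)) +
        if e = ν r then s r • (p (ν r) * p b * X r b) else 0 := by
    intro e b r
    have e1 := D.row.d_psi (ν e) r
    have e2 := (D.psi_p r e).eq
    have e3 := D.col.psi_psi e b
    have e4 := (D.d_p (ν e) b).eq
    have e5 := (hX (ν e) r b).eq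
    have e6 := (hX' e r b).eq
    have h0 : (d (ν e) * p e) * (ψ r * p b * X r b) = (ψ r * p b * X r b) * (d (ν e) * p e) +
        (if ν e = r then 1 else 0) * p e * p b * X r b := by
      linear_combination (norm := noncomm_ring) e1 * (p e * p b * X r b) -
        ψ r * d (ν e) * e3 * X r b - d (ν e) * e2 * p b * X r b + ψ r * e4 * p e * X r b
        + ψ r * p b * e5 * p e + ψ r * p b * d (ν e) * e6
    rw [smul_mul_assoc, h0, mul_smul_comm, smul_add]
    congr 1
    by_cases h : e = ν r
    · subst h
      rw [hν, if_pos rfl, if_pos rfl, one_mul]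
    · rw [if_neg h, if_neg (fun h' => h (by rw [← h', hν]))]; simp
  rw [annCre, bos, sum_mul_sum_of_commutator key, pairing]
  simp only [Finset.sum_ite_eq', Finset.mem_univ, if_true]

theorem IsDoubleCAR.creAnn_bos {X : I → I → R} 
    (hX : ∀ i j k, Commute (ψ i) (X j k)) (hX' : ∀ i j k, Commute (q i) (X j k)) :
    creAnn ν s ψ q * bos ψ p X = bos ψ p X * creAnn ν s ψ q +
      ∑ b, ∑ r, s b • (ψ (ν b) * ψ r * X r b) := by
  have key : ∀ e b r, (s e • (ψ (ν e) * q e)) * (ψ r * p b * X r b) =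
      (ψ r * p b * X r b) * (s e • (ψ (ν e) * q e)) +
        if e = b then s b • (ψ (ν b) * ψ r * X r b) else 0 := by
    intro e b r
    have e1 := D.col.d_psi e b
    have e2 := (D.psi_q r e).eq
    have e3 := D.row.psi_psi (ν e) r
    have e4 := (D.psi_p (ν e) b).eq
    have e5 := (hX' e r b).eq
    have e6 := (hX (ν e) r b).eq
    have h0 : (ψ (ν e) * q e) * (ψ r * p b * X r b) = (ψ r * p b * X r b) * (ψ (ν e) * q e) +
        ψ (ν e) * ψ r * (if e = b then 1 else 0) * X r b := by
      linear_combination (norm := noncomm_ring) ψ (ν e) * ψ r * e1 * X r b -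
        ψ (ν e) * e2 * p b * X r b - e3 * p b * q e * X r b + ψ r * e4 * q e * X r b
        + ψ r * p b * ψ (ν e) * e5 + ψ r * p b * e6 * q e
    rw [smul_mul_assoc, h0, mul_smul_comm, smul_add]
    congr 1
    by_cases h : e = b
    · subst h
      rw [if_pos rfl, if_pos rfl, mul_one]
    · rw [if_neg h, if_neg h]; simp
  rw [creAnn, bos, sum_mul_sum_of_commutator key]
  simp only [Finset.sum_ite_eq', Finset.mem_univ, if_true]

/-- The parameter `c` allows two uses: `c = 1` for the matrix of right multiplications, and `c = -1`
for the Kronecker delta. -/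
theorem IsDoubleCAR.creAnn_pairing {X : I → I → R} {c : K} (hν : ∀ i, ν (ν i) = i)
    (hs : ∀ i, s i * s i = 1) (hsν : ∀ i, s (ν i) = ε * s i)
    (hX : ∀ i j k, Commute (ψ i) (X j k)) (hX' : ∀ i j k, Commute (q i) (X j k))
    (hsymm : ∀ i j, X i j = -((c * s i * s j) • X (ν j) (ν i))) :
    creAnn ν s ψ q * pairing ν s p X = pairing ν s p X * creAnn ν s ψ q +
      (ε + c) • bos ψ p X := by
  have key : ∀ e b r, (s e • (ψ (ν e) * q e)) * (s r • (p (ν r) * p b * X r b)) =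
      (s r • (p (ν r) * p b * X r b)) * (s e • (ψ (ν e) * q e)) +
        ((if e = ν r then ε • (ψ r * p b * X r b) else 0) -
        if e = b then (s r * s b) • (ψ (ν b) * p (ν r) * X r b) else 0) := by
    intro e b r
    have e1 := D.col.d_psi e b
    have e2 := D.col.d_psi e (ν r)
    have e3 := (D.psi_p (ν e) b).eq
    have e4 := (D.psi_p (ν e) (ν r)).eq
    have e5 := (hX' e r b).eq
    have e6 := (hX (ν e) r b).eq
    have h0 : (ψ (ν e) * q e) * (p (ν r) * p b * X r b) = (p (ν r) * p b * X r b) *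
        (ψ (ν e) * q e) + (if e = ν r then 1 else 0) * ψ (ν e) * p b * X r b -
        ψ (ν e) * p (ν r) * (if e = b then 1 else 0) * X r b := by
      have e7 : ψ (ν e) * (if e = ν r then 1 else 0) = (if e = ν r then 1 else 0) * ψ (ν e) := by
        split_ifs <;> simp
      linear_combination (norm := noncomm_ring) ψ (ν e) * e2 * p b * X r b -
        ψ (ν e) * p (ν r) * e1 * X r b + ψ (ν e) * p (ν r) * p b * e5 + e4 * p b * X r b * q e
        + p (ν r) * e3 * X r b * q e + p (ν r) * p b * e6 * q e + e7 * p b * X r b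
    have h1 : e = ν r → s e * s r = ε := by
      rintro rfl; rw [hsν, mul_assoc, hs, mul_one]
    rw [smul_mul_smul_comm, h0, smul_mul_smul_comm, mul_comm (s e), add_sub_assoc, smul_add,
      smul_sub]
    congr 2
    · split_ifs with h
      · rw [mul_comm, h1 h, h, hν, one_mul]
      · simp
    · split_ifs with h
      · rw [mul_one, h]
      · simp
  rw [creAnn, pairing, sum_mul_sum_of_commutator key]
  congr 1
  simp only [Finset.sum_sub_distrib, Finset.sum_ite_eq', Finset.mem_univ, if_true]
  rw [add_smul, bos, sub_eq_add_neg, Finset.smul_sum, Finset.smul_sum]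
  congr 1
  · simp only [Finset.smul_sum]
  · have h2 : ∀ b r, -((s r * s b) • (ψ (ν b) * p (ν r) * X r b)) =
        c • (ψ (ν b) * p (ν r) * X (ν b) (ν r)) := by
      intro b r
      rw [hsymm r b, mul_neg, smul_neg, neg_neg, mul_smul_comm, smul_smul]
      congr 1
      linear_combination c * s b ^ 2 * hs r + c * hs b
    simp only [← Finset.sum_neg_distrib, h2]
    rw [Finset.sum_comm]
    rw [sum_comp_of_invol hν fun r => ∑ b, c • (ψ (ν b) * p r * X (ν b) r)]
    refine Finset.sum_congr rfl fun r _ => ?_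
    rw [sum_comp_of_invol hν fun b => c • (ψ b * p r * X b r), Finset.smul_sum]

/-- The operators that exchange a row fermion with a column fermion have the difference of particle
numbers as commutator, an `𝔰𝔩₂` pattern. On vectors of definite weight `numDiff` is a scalar, which
is what makes the commutation past long products computable. -/
theorem IsDoubleCAR.creAnn_annCre (hν : ∀ i, ν (ν i) = i)
    (hs : ∀ i, s i * s i = 1) (hsν : ∀ i, s (ν i) = ε * s i) :
    creAnn ν s ψ q * annCre ν s d p = annCre ν s d p * creAnn ν s ψ q +
      ε • numDiff ψ d p q := by
  have key : ∀ e b, (s e • (ψ (ν e) * q e)) * (s (ν b) • (d (ν b) * p b)) =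
      (s (ν b) • (d (ν b) * p b)) * (s e • (ψ (ν e) * q e)) +
      if e = b then ε • (ψ (ν b) * d (ν b) - p b * q b) else 0 := by
    intro e b
    have e1 := D.col.d_psi e b
    have e2 := D.row.d_psi (ν b) (ν e)
    have e3 := (D.psi_p (ν e) b).eq
    have e4 := (D.d_q (ν b) e).eq
    have e5 : (if ν b = ν e then (1 : R) else 0) = if e = b then 1 else 0 := by
      refine if_congr ⟨fun h => ?_, fun h => by rw [h]⟩ rfl rfl
      rw [← hν e, ← h, hν]
    rw [e5] at e2
    have h0 : (ψ (ν e) * q e) * (d (ν b) * p b) = (d (ν b) * p b) * (ψ (ν e) * q e) +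
        (ψ (ν e) * d (ν b) * (if e = b then 1 else 0) - (if e = b then 1 else 0) * p b * q e) := by
      linear_combination (norm := noncomm_ring) -ψ (ν e) * e4 * p b + ψ (ν e) * d (ν b) * e1 +
        d (ν b) * e3 * q e - e2 * p b * q e
    rw [smul_mul_smul_comm, h0, smul_mul_smul_comm, mul_comm (s e), smul_add]
    congr 1
    split_ifs with h
    · subst h
      rw [hsν, mul_assoc, hs, mul_one, mul_one, one_mul]
    · simp
  have key2 := sum_mul_sum_of_commutator (μ := Unit) (y := fun b _ => s (ν b) • (d (ν b) * p b))
    fun e b _ => key e b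
  simp only [Finset.univ_unique, Finset.sum_singleton, Finset.sum_ite_eq', Finset.mem_univ,
    if_true] at key2
  rw [creAnn, annCre, key2, ← Finset.smul_sum, Finset.sum_sub_distrib,
    sum_comp_of_invol hν fun b => ψ b * d b, numDiff]

theorem IsDoubleCAR.numDiff_psi (r : I) :
    numDiff ψ d p q * ψ r = ψ r * numDiff ψ d p q + ψ r := by
  have h1 : ∀ i, ψ i * d i * ψ r = ψ r * (ψ i * d i) + if i = r then ψ r else 0 := by
    intro i
    have e : ψ i * (if i = r then 1 else 0) = if i = r then ψ r else 0 := by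
      split_ifs with h <;> simp [h]
    linear_combination (norm := noncomm_ring) ψ i * D.row.d_psi i r - D.row.psi_psi i r * d i + e
  have h2 : ∀ b, p b * q b * ψ r = ψ r * (p b * q b) := fun b =>
    ((D.psi_p r b).mul_right (D.psi_q r b)).eq.symm
  simp only [numDiff, sub_mul, mul_sub, Finset.sum_mul, Finset.mul_sum, h1, h2,
    Finset.sum_add_distrib, Finset.sum_ite_eq', Finset.mem_univ, if_true]
  abel

theorem IsDoubleCAR.numDiff_d (r : I) :
    numDiff ψ d p q * d r = d r * numDiff ψ d p q - d r := by
  have h1 : ∀ i, ψ i * d i * d r = d r * (ψ i * d i) - if r = i then d r else 0 := by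
    intro i
    have e : (if r = i then 1 else 0) * d i = if r = i then d r else 0 := by
      split_ifs with h <;> simp [h]
    linear_combination (norm := noncomm_ring) -D.row.d_psi r i * d i + ψ i * D.row.d_d i r - e
  have h2 : ∀ b, p b * q b * d r = d r * (p b * q b) := fun b =>
    ((D.d_p r b).mul_right (D.d_q r b)).eq.symm
  simp only [numDiff, sub_mul, mul_sub, Finset.sum_mul, Finset.mul_sum, h1, h2,
    Finset.sum_sub_distrib, Finset.sum_ite_eq, Finset.mem_univ, if_true]
  abel

theorem IsDoubleCAR.numDiff_p (r : I) :
    numDiff ψ d p q * p r = p r * numDiff ψ d p q - p r := by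
  have h1 : ∀ i, p i * q i * p r = p r * (p i * q i) + if i = r then p r else 0 := by
    intro i
    have e : p i * (if i = r then 1 else 0) = if i = r then p r else 0 := by
      split_ifs with h <;> simp [h]
    linear_combination (norm := noncomm_ring) p i * D.col.d_psi i r - D.col.psi_psi i r * q i + e
  have h2 : ∀ b, ψ b * d b * p r = p r * (ψ b * d b) := fun b =>
    ((D.psi_p b r).symm.mul_right (D.d_p b r).symm).eq.symm
  simp only [numDiff, sub_mul, mul_sub, Finset.sum_mul, Finset.mul_sum, h1, h2,
    Finset.sum_add_distrib, Finset.sum_ite_eq', Finset.mem_univ, if_true]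
  abel

end Double


/-! ## Invariance -/

variable {K R I : Type*} [Field K] [CharZero K] [Ring R] [Algebra K R] [Fintype I] [DecidableEq I]

/-- The generator of the diagonal action on both families of fermions and on the algebra. -/
def invGen (ν : I → I) (θ : K) (ψ d p q : I → R) (F G : I → I → R) (i j : I) : R :=
  F i j - G i j - ψ j * d i + θ • (ψ (ν i) * d (ν j)) + p i * q j - θ • (p (ν j) * q (ν i))

theorem commute_of_derivation_mul {x y z a b : R} (hy : x * y = y * x + a) (hz : x * z = z * x + b) :
    x * (y * z) = y * z * x + (a * z + y * b) := by
  rw [← mul_assoc, hy, add_mul, mul_assoc y x z, hz]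
  noncomm_ring

section Invariance

variable {ψ d p q : I → R} {F G : I → I → R} (D : IsDoubleCAR ψ d p q F G) (ν : I → I)
  (θ : K) (i j : I)
include D

theorem IsDoubleCAR.invGen_psi (r : I) :
    invGen ν θ ψ d p q F G i j * ψ r = ψ r * invGen ν θ ψ d p q F G i j +
      (θ • (if ν j = r then ψ (ν i) else 0) - if i = r then ψ j else 0) := by
  have e1 := (D.psi_F r i j).eq
  have e2 := (D.psi_G r i j).eq
  have e3 : ψ j * d i * ψ r = ψ r * (ψ j * d i) + if i = r then ψ j else 0 := by
    have e : ψ j * (if i = r then 1 else 0) = if i = r then ψ j else 0 := by split_ifs <;> simp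
    linear_combination (norm := noncomm_ring) ψ j * D.row.d_psi i r - D.row.psi_psi j r * d i + e
  have e4 : ψ (ν i) * d (ν j) * ψ r = ψ r * (ψ (ν i) * d (ν j)) +
      if ν j = r then ψ (ν i) else 0 := by
    have e : ψ (ν i) * (if ν j = r then 1 else 0) = if ν j = r then ψ (ν i) else 0 := by
      split_ifs <;> simp
    linear_combination (norm := noncomm_ring) ψ (ν i) * D.row.d_psi (ν j) r -
      D.row.psi_psi (ν i) r * d (ν j) + e
  have e5 := ((D.psi_p r i).mul_right (D.psi_q r j)).eq
  have e6 := ((D.psi_p r (ν j)).mul_right (D.psi_q r (ν i))).eq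
  simp only [invGen, sub_mul, add_mul, mul_sub, mul_add, smul_mul_assoc, mul_smul_comm, e1, e2, e3,
    e4, e5, e6, smul_add]
  abel

theorem IsDoubleCAR.invGen_d (r : I) :
    invGen ν θ ψ d p q F G i j * d r = d r * invGen ν θ ψ d p q F G i j +
      ((if j = r then d i else 0) - θ • if ν i = r then d (ν j) else 0) := by
  have e1 := (D.d_F r i j).eq
  have e2 := (D.d_G r i j).eq
  have e3 : ψ j * d i * d r = d r * (ψ j * d i) - if j = r then d i else 0 := by
    have e : (if r = j then 1 else 0) * d i = if j = r then d i else 0 := by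
      simp only [eq_comm (a := r)]; split_ifs <;> simp
    linear_combination (norm := noncomm_ring) -D.row.d_psi r j * d i + ψ j * D.row.d_d i r - e
  have e4 : ψ (ν i) * d (ν j) * d r = d r * (ψ (ν i) * d (ν j)) -
      if ν i = r then d (ν j) else 0 := by
    have e : (if r = ν i then 1 else 0) * d (ν j) = if ν i = r then d (ν j) else 0 := by
      simp only [eq_comm (a := r)]; split_ifs <;> simp
    linear_combination (norm := noncomm_ring) -D.row.d_psi r (ν i) * d (ν j) +
      ψ (ν i) * D.row.d_d (ν j) r - e
  have e5 := ((D.d_p r i).mul_right (D.d_q r j)).eq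
  have e6 := ((D.d_p r (ν j)).mul_right (D.d_q r (ν i))).eq
  simp only [invGen, sub_mul, add_mul, mul_sub, mul_add, smul_mul_assoc, mul_smul_comm, e1, e2, e3,
    e4, e5, e6, smul_sub]
  abel

theorem IsDoubleCAR.invGen_p (r : I) :
    invGen ν θ ψ d p q F G i j * p r = p r * invGen ν θ ψ d p q F G i j +
      ((if j = r then p i else 0) - θ • if ν i = r then p (ν j) else 0) := by
  have e1 := (D.p_F r i j).eq
  have e2 := (D.p_G r i j).eq
  have e3 : p i * q j * p r = p r * (p i * q j) + if j = r then p i else 0 := by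
    have e : p i * (if j = r then 1 else 0) = if j = r then p i else 0 := by split_ifs <;> simp
    linear_combination (norm := noncomm_ring) p i * D.col.d_psi j r - D.col.psi_psi i r * q j + e
  have e4 : p (ν j) * q (ν i) * p r = p r * (p (ν j) * q (ν i)) +
      if ν i = r then p (ν j) else 0 := by
    have e : p (ν j) * (if ν i = r then 1 else 0) = if ν i = r then p (ν j) else 0 := by
      split_ifs <;> simp
    linear_combination (norm := noncomm_ring) p (ν j) * D.col.d_psi (ν i) r -
      D.col.psi_psi (ν j) r * q (ν i) + e
  have e5 := ((D.psi_p j r).symm.mul_right (D.d_p i r).symm).eq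
  have e6 := ((D.psi_p (ν i) r).symm.mul_right (D.d_p (ν j) r).symm).eq
  simp only [invGen, sub_mul, add_mul, mul_sub, mul_add, smul_mul_assoc, mul_smul_comm, e1, e2, e3,
    e4, e5, e6, smul_add]
  abel

theorem IsDoubleCAR.invGen_F (hF : ∀ k l, F i j * F k l - F k l * F i j =
      (if j = k then F i l else 0) - (if i = l then F k j else 0) -
        θ • ((if ν i = k then F (ν j) l else 0) - (if l = ν j then F k (ν i) else 0))) (k l : I) :
    invGen ν θ ψ d p q F G i j * F k l = F k l * invGen ν θ ψ d p q F G i j +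
      ((if j = k then F i l else 0) - (if i = l then F k j else 0) -
        θ • ((if ν i = k then F (ν j) l else 0) - (if l = ν j then F k (ν i) else 0))) := by
  have e2 := (D.F_G k l i j).eq
  have e3 := ((D.psi_F j k l).symm.mul_right (D.d_F i k l).symm).eq
  have e4 := ((D.psi_F (ν i) k l).symm.mul_right (D.d_F (ν j) k l).symm).eq
  have e5 := ((D.p_F i k l).symm.mul_right (D.q_F j k l).symm).eq
  have e6 := ((D.p_F (ν j) k l).symm.mul_right (D.q_F (ν i) k l).symm).eq
  rw [← hF]
  simp only [invGen, sub_mul, add_mul, mul_sub, mul_add, smul_mul_assoc, mul_smul_comm, e2, e3,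
    e4, e5, e6]
  abel

/-- Rows and columns transform by dual representations, so the full contraction is invariant. The
same cancellation of index terms gives the other invariants below. -/
theorem IsDoubleCAR.invGen_tau :
    Commute (invGen ν θ ψ d p q F G i j) (tau ψ p) := by
  have key : ∀ b, invGen ν θ ψ d p q F G i j * (ψ b * p b) = ψ b * p b *
      invGen ν θ ψ d p q F G i j +
        ((if ν j = b then θ • (ψ (ν i) * p b) else 0) - (if i = b then ψ j * p b else 0) +
        (if j = b then ψ b * p i else 0) - if ν i = b then θ • (ψ b * p (ν j)) else 0) := by
    intro b
    rw [commute_of_derivation_mul (D.invGen_psi ν θ i j b) (D.invGen_p ν θ i j b)]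
    congr 1
    simp only [sub_mul, mul_sub, smul_mul_assoc, mul_smul_comm, ite_mul, mul_ite, zero_mul,
      mul_zero, smul_ite, smul_zero]
    abel
  rw [Commute, SemiconjBy, tau, Finset.mul_sum, Finset.sum_mul]
  simp only [key, Finset.sum_add_distrib, Finset.sum_sub_distrib, Finset.sum_ite_eq,
    Finset.mem_univ, if_true]
  abel

theorem IsDoubleCAR.invGen_bos (hF : ∀ k l, F i j * F k l - F k l * F i j =
      (if j = k then F i l else 0) - (if i = l then F k j else 0) -
        θ • ((if ν i = k then F (ν j) l else 0) - (if l = ν j then F k (ν i) else 0))) :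
    Commute (invGen ν θ ψ d p q F G i j) (bos ψ p F) := by
  have key : ∀ b r, invGen ν θ ψ d p q F G i j * (ψ r * p b * F r b) = ψ r * p b * F r b *
      invGen ν θ ψ d p q F G i j +
        ((if ν j = r then θ • (ψ (ν i) * p b * F r b) else 0) -
        (if i = r then ψ j * p b * F r b else 0) +
        (if j = b then ψ r * p i * F r b else 0) -
        (if ν i = b then θ • (ψ r * p (ν j) * F r b) else 0) +
        (if j = r then ψ r * p b * F i b else 0) - (if i = b then ψ r * p b * F r j else 0) -
        (if ν i = r then θ • (ψ r * p b * F (ν j) b) else 0) +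
        (if ν j = b then θ • (ψ r * p b * F r (ν i)) else 0)) := by
    intro b r
    rw [commute_of_derivation_mul (commute_of_derivation_mul (D.invGen_psi ν θ i j r)
      (D.invGen_p ν θ i j b)) (D.invGen_F ν θ i j hF r b)]
    congr 1
    simp only [sub_mul, mul_sub, add_mul, smul_mul_assoc, mul_smul_comm, ite_mul, mul_ite, zero_mul,
      mul_zero, smul_ite, smul_zero, smul_sub, eq_comm (a := b) (b := ν j)]
    abel
  rw [Commute, SemiconjBy, bos, Finset.mul_sum, Finset.sum_mul]
  simp only [Finset.mul_sum, Finset.sum_mul, key, Finset.sum_add_distrib, Finset.sum_sub_distrib,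
    Finset.sum_ite_eq, Finset.mem_univ, if_true]
  have hc : ∀ (c : I) (f : I → R), (∑ x, ∑ y, if c = x then f y else 0) = ∑ y, f y := by
    intro c f
    rw [Finset.sum_comm]; simp
  have hc' : ∀ (c : I) (f : I → I → R), (∑ x, ∑ y, if c = x then f x y else 0) = ∑ y, f c y := by
    intro c f
    rw [Finset.sum_comm]; simp
  rw [hc' j fun b r => ψ r * p i * F r b, hc' (ν i) fun b r => θ • (ψ r * p (ν j) * F r b),
    hc' i fun b r => ψ r * p b * F r j, hc' (ν j) fun b r => θ • (ψ r * p b * F r (ν i))]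
  abel

theorem IsDoubleCAR.invGen_annCre {s : I → K} {ε : K} (hν : ∀ i, ν (ν i) = i)
    (hs : ∀ i, s i * s i = 1) (hsν : ∀ i, s (ν i) = ε * s i) (hθ : θ = s i * s j) :
    Commute (invGen ν θ ψ d p q F G i j) (annCre ν s d p) := by
  have key : ∀ b, invGen ν θ ψ d p q F G i j * (s (ν b) • (d (ν b) * p b)) =
      s (ν b) • (d (ν b) * p b) * invGen ν θ ψ d p q F G i j +
        ((if ν j = b then s (ν b) • (d i * p b) else 0) -
          (if i = b then (θ * s (ν b)) • (d (ν j) * p b) else 0) +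
        (if j = b then s (ν b) • (d (ν b) * p i) else 0) -
          if ν i = b then (θ * s (ν b)) • (d (ν b) * p (ν j)) else 0) := by
    intro b
    have e1 : (j = ν b) ↔ (ν j = b) := ⟨fun h => by rw [h, hν], fun h => by rw [← h, hν]⟩
    have e2 : (ν i = ν b) ↔ (i = b) := ⟨fun h => by rw [← hν i, h, hν], fun h => by rw [h]⟩
    rw [mul_smul_comm, commute_of_derivation_mul (D.invGen_d ν θ i j (ν b)) (D.invGen_p ν θ i j b),
      smul_mul_assoc, smul_add]
    congr 1
    simp only [e1, e2, sub_mul, mul_sub, smul_mul_assoc, mul_smul_comm, ite_mul, mul_ite, zero_mul,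
      mul_zero, smul_ite, smul_zero, smul_add, smul_sub, smul_smul, mul_comm θ]
    abel
  rw [Commute, SemiconjBy, annCre, Finset.mul_sum, Finset.sum_mul]
  simp only [key, Finset.sum_add_distrib, Finset.sum_sub_distrib, Finset.sum_ite_eq,
    Finset.mem_univ, if_true, hν]
  have e1 : θ * s (ν i) = s (ν j) := by
    rw [hθ, hsν, hsν]; linear_combination ε * s j * hs i
  have e2 : θ * s i = s j := by
    rw [hθ]; linear_combination s j * hs i
  rw [e1, e2]
  abel

theorem IsDoubleCAR.invGen_symplOmega {s : I → K} {ε : K} (hν : ∀ i, ν (ν i) = i)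
    (hs : ∀ i, s i * s i = 1) (hsν : ∀ i, s (ν i) = ε * s i) (hθ : θ = s i * s j) :
    Commute (invGen ν θ ψ d p q F G i j) (symplOmega ν s ψ) := by
  have key : ∀ b, invGen ν θ ψ d p q F G i j * (s b • (ψ (ν b) * ψ b)) =
      s b • (ψ (ν b) * ψ b) * invGen ν θ ψ d p q F G i j +
        ((if j = b then (θ * s b) • (ψ (ν i) * ψ b) else 0) -
          (if ν i = b then s b • (ψ j * ψ b) else 0) +
        (if ν j = b then (θ * s b) • (ψ (ν b) * ψ (ν i)) else 0) -
          if i = b then s b • (ψ (ν b) * ψ j) else 0) := by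
    intro b
    have e1 : (ν j = ν b) ↔ (j = b) := ⟨fun h => by rw [← hν j, h, hν], fun h => by rw [h]⟩
    have e2 : (i = ν b) ↔ (ν i = b) := ⟨fun h => by rw [h, hν], fun h => by rw [← h, hν]⟩
    rw [mul_smul_comm, commute_of_derivation_mul (D.invGen_psi ν θ i j (ν b))
      (D.invGen_psi ν θ i j b), smul_mul_assoc, smul_add]
    congr 1
    simp only [e1, e2, sub_mul, mul_sub, smul_mul_assoc, mul_smul_comm, ite_mul, mul_ite, zero_mul,
      mul_zero, smul_ite, smul_zero, smul_add, smul_sub, smul_smul, mul_comm θ]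
    abel
  rw [Commute, SemiconjBy, symplOmega, Finset.mul_sum, Finset.sum_mul]
  simp only [key, Finset.sum_add_distrib, Finset.sum_sub_distrib, Finset.sum_ite_eq,
    Finset.mem_univ, if_true, hν]
  have e1 : θ * s j = s i := by
    rw [hθ]; linear_combination s i * hs j
  have e2 : θ * s (ν j) = s (ν i) := by
    rw [hθ, hsν, hsν]; linear_combination ε * s i * hs j
  rw [e1, e2]
  abel

theorem IsDoubleCAR.invGen_orthTheta (hν : ∀ i, ν (ν i) = i)
    (hF : ∀ k l, F i j * F k l - F k l * F i j =
      (if j = k then F i l else 0) - (if i = l then F k j else 0) -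
        (1 : K) • ((if ν i = k then F (ν j) l else 0) - (if l = ν j then F k (ν i) else 0))) :
    Commute (invGen ν (1 : K) ψ d p q F G i j) (orthTheta ν ψ F) := by
  have key : ∀ b r, invGen ν (1 : K) ψ d p q F G i j * (ψ r * F r (ν b) * ψ b) =
      ψ r * F r (ν b) * ψ b * invGen ν (1 : K) ψ d p q F G i j +
        ((if ν j = r then ψ (ν i) * F r (ν b) * ψ b else 0) -
        (if i = r then ψ j * F r (ν b) * ψ b else 0) +
        (if j = r then ψ r * F i (ν b) * ψ b else 0) -
        (if ν i = b then ψ r * F r j * ψ b else 0) -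
        (if ν i = r then ψ r * F (ν j) (ν b) * ψ b else 0) +
        (if j = b then ψ r * F r (ν i) * ψ b else 0) +
        (if ν j = b then ψ r * F r (ν b) * ψ (ν i) else 0) -
        (if i = b then ψ r * F r (ν b) * ψ j else 0)) := by
    intro b r
    have e1 : (ν b = ν j) ↔ (j = b) := ⟨fun h => by rw [← hν j, ← h, hν], fun h => by rw [h]⟩
    have e2 : (i = ν b) ↔ (ν i = b) := ⟨fun h => by rw [h, hν], fun h => by rw [← h, hν]⟩
    rw [commute_of_derivation_mul (commute_of_derivation_mul (D.invGen_psi ν 1 i j r)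
      (D.invGen_F ν 1 i j hF r (ν b))) (D.invGen_psi ν 1 i j b)]
    congr 1
    simp only [e1, e2, one_smul, sub_mul, mul_sub, add_mul, ite_mul, mul_ite, zero_mul, mul_zero]
    abel
  have hΘ : orthTheta ν ψ F = ∑ b, ∑ r, ψ r * F r (ν b) * ψ b := by
    simp only [orthTheta, eta, Finset.sum_mul]
  rw [Commute, SemiconjBy, hΘ, Finset.mul_sum, Finset.sum_mul]
  simp only [Finset.mul_sum, Finset.sum_mul, key, Finset.sum_add_distrib, Finset.sum_sub_distrib,
    Finset.sum_ite_eq, Finset.mem_univ, if_true]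
  have hc' : ∀ (c : I) (f : I → I → R), (∑ x, ∑ y, if c = x then f x y else 0) = ∑ y, f c y := by
    intro c f
    rw [Finset.sum_comm]; simp
  rw [hc' (ν i) fun b r => ψ r * F r j * ψ b, hc' j fun b r => ψ r * F r (ν i) * ψ b,
    hc' (ν j) fun b r => ψ r * F r (ν b) * ψ (ν i), hc' i fun b r => ψ r * F r (ν b) * ψ j]
  simp only [hν]
  abel

/-- Solve the definition of `invGen` for `F - G`, multiply by `ψ r * p b` and sum. On a vector
killed by `invGen` and `numDiff` only the last two quadratic terms can separate left from right
multiplication. -/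
theorem IsDoubleCAR.bos_sub_bos (s : I → K) (t : K) :
    bos ψ p F - bos ψ p G = (∑ b, ∑ r, ψ r * p b *
      invGen ν (t * (s r * s b)) ψ d p q F G r b) - tau ψ p * numDiff ψ d p q -
      t • ((∑ r, s r • (ψ r * ψ (ν r))) * (∑ b, s b • (d (ν b) * p b)) -
        (∑ b, s b • (p b * p (ν b))) * (∑ r, s r • (ψ r * q (ν r)))) := by
  have key : ∀ b r, ψ r * p b * invGen ν (t * (s r * s b)) ψ d p q F G r b =
      ψ r * p b * F r b - ψ r * p b * G r b + (ψ b * p b) * (ψ r * d r) -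
        (ψ r * p r) * (p b * q b) + t • ((s r • (ψ r * ψ (ν r))) * (s b • (d (ν b) * p b)) -
        (s b • (p b * p (ν b))) * (s r • (ψ r * q (ν r)))) := by
    intro b r
    have e1 : ψ r * p b * (ψ b * d r) = -((ψ b * p b) * (ψ r * d r)) := by
      linear_combination (norm := noncomm_ring) -ψ r * (D.psi_p b b).eq * d r +
        D.row.psi_psi r b * p b * d r - ψ b * (D.psi_p r b).eq * d r
    have e2 : ψ r * p b * (p r * q b) = -((ψ r * p r) * (p b * q b)) := by
      linear_combination (norm := noncomm_ring) ψ r * D.col.psi_psi b r * q b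
    have e3 : ψ r * p b * (ψ (ν r) * d (ν b)) = ψ r * ψ (ν r) * (d (ν b) * p b) := by
      linear_combination (norm := noncomm_ring) -ψ r * (D.psi_p (ν r) b).eq * d (ν b) -
        ψ r * ψ (ν r) * (D.d_p (ν b) b).eq
    have e4 : ψ r * p b * (p (ν b) * q (ν r)) = p b * p (ν b) * (ψ r * q (ν r)) := by
      linear_combination (norm := noncomm_ring) (D.psi_p r b).eq * p (ν b) * q (ν r) +
        p b * (D.psi_p r (ν b)).eq * q (ν r)
    simp only [invGen, mul_sub, mul_add, mul_smul_comm, e1, e2, e3, e4, smul_mul_assoc, smul_sub,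
      smul_smul, mul_comm (s b)]
    abel
  have h1 : (∑ r, s r • (ψ r * ψ (ν r))) * (∑ b, s b • (d (ν b) * p b)) =
      ∑ b, ∑ r, (s r • (ψ r * ψ (ν r))) * (s b • (d (ν b) * p b)) := by
    simp only [Finset.mul_sum, Finset.sum_mul]
  have h2 : (∑ b, s b • (p b * p (ν b))) * (∑ r, s r • (ψ r * q (ν r))) =
      ∑ b, ∑ r, (s b • (p b * p (ν b))) * (s r • (ψ r * q (ν r))) := by
    simp only [Finset.sum_mul_sum]
  have h3 : tau ψ p * numDiff ψ d p q = (∑ b, ∑ r, (ψ b * p b) * (ψ r * d r)) -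
      ∑ b, ∑ r, (ψ r * p r) * (p b * q b) := by
    rw [tau, numDiff, mul_sub, Finset.sum_mul_sum, Finset.mul_sum]
    simp only [Finset.sum_mul]
  simp only [key, h1, h2, h3, bos, Finset.sum_add_distrib, Finset.sum_sub_distrib, smul_sub,
    Finset.smul_sum]
  abel

end Invariance


variable {K R I : Type*} [Field K] [CharZero K] [Ring R] [Algebra K R] [Fintype I] [DecidableEq I]

/-! ## The total operators -/

/-- `∑ b, η b (v) p b`. -/
def genTot (ψ p : I → R) (F : I → I → R) (v : K) : R := bos ψ p F + v • tau ψ p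

/-- `∑ b, T b (v) p b` in the orthogonal case. -/
def orthTot (ν : I → I) (ψ d p : I → R) (F : I → I → R) (v : K) : R :=
  genTot ψ p F v +
    (2 * (v - 1))⁻¹ • (orthTheta ν ψ F * annCre ν (fun _ => (1 : K)) d p)

/-- `∑ b, T b (v) p b` in the symplectic case. -/
def symplTot (ν : I → I) (s : I → K) (ψ d p : I → R) (F : I → I → R) (v : K) : R :=
  genTot ψ p F v + (2⁻¹ : K) • (symplOmega ν s ψ * annCre ν s d p)

theorem sum_psi_neg_psi (K : Type*) [Field K] [CharZero K] [Algebra K R] {ψ d : I → R} (h : IsCAR ψ d) {ν : I → I} (hν : ∀ i, ν (ν i) = i) :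
    ∑ i, ψ (ν i) * ψ i = 0 := by
  refine eq_zero_of_eq_neg K ?_
  nth_rw 1 [← sum_comp_of_invol hν]
  rw [← Finset.sum_neg_distrib]
  refine Finset.sum_congr rfl fun i _ => ?_
  rw [hν, h.psi_psi]

section Double

variable {ψ d p q : I → R} {F G : I → I → R} (D : IsDoubleCAR ψ d p q F G) {ν : I → I}
  {s : I → K} {ε : K}
include D

theorem IsDoubleCAR.sum_etaShift_mul (v : K) :
    ∑ b, etaShift ψ F b v * p b = genTot ψ p F v := by
  simp only [etaShift, add_mul, smul_mul_assoc, Finset.sum_add_distrib, genTot,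
    bos_eq_sum_eta D.p_F, tau, Finset.smul_sum]

theorem IsDoubleCAR.sum_orthT_mul (v : K) :
    ∑ b, orthT ν ψ d F b v * p b = orthTot ν ψ d p F v := by
  simp only [orthT, add_mul, Finset.sum_add_distrib, D.sum_etaShift_mul, orthTot, annCre, one_smul,
    Finset.mul_sum, Finset.smul_sum, smul_mul_assoc, mul_assoc]

theorem IsDoubleCAR.sum_symplT_mul (hsν : ∀ i, s (ν i) = -1 * s i) (v : K) :
    ∑ b, symplT ν s ψ d F b v * p b = symplTot ν s ψ d p F v := by
  simp only [symplT, sub_mul, Finset.sum_sub_distrib, D.sum_etaShift_mul, symplTot, annCre,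
    Finset.mul_sum, Finset.smul_sum, smul_mul_assoc, mul_assoc, hsν, mul_smul_comm, smul_smul]
  rw [sub_eq_add_neg, ← Finset.sum_neg_distrib]
  congr 1
  refine Finset.sum_congr rfl fun b _ => ?_
  rw [← neg_smul]; congr 1; ring

theorem IsDoubleCAR.bos_tau : Commute (bos ψ p F) (tau ψ p) := by
  rw [tau_eq_bos]
  refine D.bos_commute D.psi_F D.p_F ?_ ?_ ?_ <;> intros <;> split_ifs <;> simp

theorem IsDoubleCAR.bos_bos : Commute (bos ψ p F) (bos ψ p G) :=
  D.bos_commute D.psi_F D.p_F D.psi_G D.p_G D.F_G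

theorem IsDoubleCAR.tau_bos : Commute (tau ψ p) (bos ψ p G) := by
  rw [tau_eq_bos]
  refine D.bos_commute ?_ ?_ D.psi_G D.p_G ?_ <;> intros <;> split_ifs <;> simp

theorem IsDoubleCAR.genTot_tau (v : K) : Commute (genTot ψ p F v) (tau ψ p) :=
  D.bos_tau.add_left ((Commute.refl _).smul_left v)

theorem IsDoubleCAR.genTot_bos (v : K) : Commute (genTot ψ p F v) (bos ψ p G) :=
  D.bos_bos.add_left (D.tau_bos.smul_left v)

theorem IsDoubleCAR.genTot_genTot (v w : K) : Commute (genTot ψ p F v) (genTot ψ p F w) := by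
  refine Commute.add_right (Commute.add_left (Commute.refl _) ?_) ((D.genTot_tau v).smul_right w)
  exact D.bos_tau.symm.smul_left v

theorem IsDoubleCAR.commute_genTot {x : R} (hψ : ∀ i, Commute x (ψ i)) (hp : ∀ i, Commute x (p i))
    (hF : ∀ i j, Commute x (F i j)) (v : K) : Commute x (genTot ψ p F v) := by
  refine Commute.add_right ?_ (Commute.smul_right ?_ v)
  · exact Commute.sum_right _ _ _ fun b _ => Commute.sum_right _ _ _ fun r _ =>
      ((hψ r).mul_right (hp b)).mul_right (hF r b)
  · exact Commute.sum_right _ _ _ fun b _ => (hψ b).mul_right (hp b)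

theorem IsDoubleCAR.commute_annCre {x : R} (hd : ∀ i, Commute x (d i)) (hp : ∀ i, Commute x (p i)) :
    Commute x (annCre ν s d p) :=
  Commute.sum_right _ _ _ fun b _ => ((hd _).mul_right (hp b)).smul_right _

theorem IsDoubleCAR.commute_creAnn {x : R} (hψ : ∀ i, Commute x (ψ i))
    (hq : ∀ i, Commute x (q i)) : Commute x (creAnn ν s ψ q) :=
  Commute.sum_right _ _ _ fun b _ => ((hψ _).mul_right (hq b)).smul_right _

theorem IsDoubleCAR.orthTheta_commute {x : R} (hψ : ∀ i, Commute x (ψ i))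
    (hF : ∀ i j, Commute x (F i j)) : Commute (orthTheta ν ψ F) x :=
  (Commute.symm (Commute.sum_right _ _ _ fun b _ => Commute.mul_right
    (Commute.sum_right _ _ _ fun r _ => (hψ r).mul_right (hF r _)) (hψ b)))

theorem IsDoubleCAR.symplOmega_commute {x : R} (hψ : ∀ i, Commute x (ψ i)) :
    Commute (symplOmega ν s ψ) x :=
  (Commute.symm (Commute.sum_right _ _ _ fun b _ => ((hψ _).mul_right (hψ b)).smul_right _))

theorem IsDoubleCAR.orthTheta_psi (i : I) : Commute (orthTheta ν ψ F) (ψ i) :=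
  (psi_orthTheta D.row (fun i j k => (D.psi_F i j k).eq) i).symm

theorem IsDoubleCAR.symplOmega_psi (i : I) : Commute (symplOmega ν s ψ) (ψ i) :=
  (psi_symplOmega D.row i).symm

theorem IsDoubleCAR.orthTheta_p (i : I) : Commute (orthTheta ν ψ F) (p i) :=
  D.orthTheta_commute (fun j => (D.psi_p j i).symm) (fun j k => D.p_F i j k)

theorem IsDoubleCAR.orthTheta_q (i : I) : Commute (orthTheta ν ψ F) (q i) :=
  D.orthTheta_commute (fun j => (D.psi_q j i).symm) (fun j k => D.q_F i j k)

theorem IsDoubleCAR.orthTheta_G (i j : I) : Commute (orthTheta ν ψ F) (G i j) :=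
  D.orthTheta_commute (fun k => (D.psi_G k i j).symm) (fun k l => (D.F_G k l i j).symm)

theorem IsDoubleCAR.symplOmega_p (i : I) : Commute (symplOmega ν s ψ) (p i) :=
  D.symplOmega_commute fun j => (D.psi_p j i).symm

theorem IsDoubleCAR.symplOmega_q (i : I) : Commute (symplOmega ν s ψ) (q i) :=
  D.symplOmega_commute fun j => (D.psi_q j i).symm

theorem IsDoubleCAR.symplOmega_G (i j : I) : Commute (symplOmega ν s ψ) (G i j) :=
  D.symplOmega_commute fun k => (D.psi_G k i j).symm

theorem IsDoubleCAR.commute_tau {x : R} (hψ : ∀ i, Commute x (ψ i)) (hp : ∀ i, Commute x (p i)) :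
    Commute x (tau ψ p) :=
  Commute.sum_right _ _ _ fun b _ => (hψ b).mul_right (hp b)

theorem IsDoubleCAR.commute_bos {x : R} {X : I → I → R} (hψ : ∀ i, Commute x (ψ i))
    (hp : ∀ i, Commute x (p i)) (hX : ∀ i j, Commute x (X i j)) : Commute x (bos ψ p X) :=
  Commute.sum_right _ _ _ fun b _ => Commute.sum_right _ _ _ fun r _ =>
    ((hψ r).mul_right (hp b)).mul_right (hX r b)

theorem IsDoubleCAR.annCre_tau (hν : ∀ i, ν (ν i) = i) :
    annCre ν s d p * tau ψ p = tau ψ p * annCre ν s d p + symplOmega ν s p := by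
  rw [tau_eq_bos, D.annCre_bos hν]
  · congr 1
    simp [pairing, symplOmega]
  all_goals intros; split_ifs <;> simp

theorem IsDoubleCAR.creAnn_tau :
    creAnn ν s ψ q * tau ψ p = tau ψ p * creAnn ν s ψ q + symplOmega ν s ψ := by
  rw [tau_eq_bos, D.creAnn_bos]
  · congr 1
    simp [symplOmega]
  all_goals intros; split_ifs <;> simp

theorem IsDoubleCAR.pairing_commute_tot {x : R} (hp : ∀ i j, Commute x (p i * p j))
    (hG : ∀ i j, Commute x (G i j)) : Commute x (pairing ν s p G) :=
  Commute.sum_right _ _ _ fun _ _ => Commute.sum_right _ _ _ fun _ _ =>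
    ((hp _ _).mul_right (hG _ _)).smul_right _

theorem IsDoubleCAR.p_mul_p (i j k : I) : Commute (p i) (p j * p k) :=
  commute_mul_of_anticomm (D.col.psi_psi i j) (D.col.psi_psi i k)

theorem IsDoubleCAR.genTot_pairing (v : K) :
    Commute (genTot ψ p F v) (pairing ν s p G) := by
  refine (D.commute_genTot ?_ ?_ ?_ v).symm
  · exact fun i => (D.pairing_commute_tot (fun j k => (D.psi_p i j).mul_right (D.psi_p i k))
      (fun j k => D.psi_G i j k)).symm
  · exact fun i => (D.pairing_commute_tot (fun j k => D.p_mul_p i j k)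
      (fun j k => D.p_G i j k)).symm
  · exact fun i l => (D.pairing_commute_tot (fun j k => ((D.p_F j i l).mul_left
      (D.p_F k i l)).symm) (fun j k => D.F_G i l j k)).symm

theorem IsDoubleCAR.annCre_pairing : Commute (annCre ν s d p) (pairing ν s p G) := by
  refine (D.commute_annCre ?_ ?_).symm
  · exact fun i => (D.pairing_commute_tot (fun j k => (D.d_p i j).mul_right (D.d_p i k))
      (fun j k => D.d_G i j k)).symm
  · exact fun i => (D.pairing_commute_tot (fun j k => D.p_mul_p i j k)
      (fun j k => D.p_G i j k)).symm

theorem IsDoubleCAR.numDiff_F (i j : I) : Commute (numDiff ψ d p q) (F i j) := by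
  refine Commute.sub_left ?_ ?_ <;> refine Commute.sum_left _ _ _ fun b _ => ?_
  · exact (D.psi_F b i j).mul_left (D.d_F b i j)
  · exact (D.p_F b i j).mul_left (D.q_F b i j)

theorem IsDoubleCAR.numDiff_G (i j : I) : Commute (numDiff ψ d p q) (G i j) := by
  refine Commute.sub_left ?_ ?_ <;> refine Commute.sum_left _ _ _ fun b _ => ?_
  · exact (D.psi_G b i j).mul_left (D.d_G b i j)
  · exact (D.p_G b i j).mul_left (D.q_G b i j)

theorem IsDoubleCAR.numDiff_psi_p (i j : I) : Commute (numDiff ψ d p q) (ψ i * p j) := by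
  rw [Commute, SemiconjBy, commute_of_derivation_mul (b := -p j) (D.numDiff_psi i)
    (by rw [D.numDiff_p, sub_eq_add_neg])]
  noncomm_ring

theorem IsDoubleCAR.numDiff_genTot (v : K) : Commute (numDiff ψ d p q) (genTot ψ p F v) := by
  refine Commute.add_right ?_ (Commute.smul_right ?_ v)
  · exact Commute.sum_right _ _ _ fun b _ => Commute.sum_right _ _ _ fun r _ =>
      (D.numDiff_psi_p r b).mul_right (D.numDiff_F r b)
  · exact Commute.sum_right _ _ _ fun b _ => D.numDiff_psi_p b b

theorem IsDoubleCAR.numDiff_annCre :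
    numDiff ψ d p q * annCre ν s d p = annCre ν s d p * numDiff ψ d p q -
      (2 : K) • annCre ν s d p := by
  simp only [annCre, Finset.mul_sum, Finset.sum_mul, Finset.smul_sum]
  rw [← Finset.sum_sub_distrib]
  refine Finset.sum_congr rfl fun b _ => ?_
  rw [mul_smul_comm, commute_of_derivation_mul (a := -d (ν b)) (b := -p b)
    (by rw [D.numDiff_d, sub_eq_add_neg]) (by rw [D.numDiff_p, sub_eq_add_neg]), smul_mul_assoc,
    smul_add, neg_mul, mul_neg]
  module

theorem IsDoubleCAR.numDiff_orthTheta :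
    numDiff ψ d p q * orthTheta ν ψ F = orthTheta ν ψ F * numDiff ψ d p q +
      (2 : K) • orthTheta ν ψ F := by
  simp only [orthTheta, Finset.mul_sum, Finset.sum_mul, Finset.smul_sum, eta]
  simp only [← Finset.sum_add_distrib]
  refine Finset.sum_congr rfl fun b _ => Finset.sum_congr rfl fun r _ => ?_
  rw [commute_of_derivation_mul (commute_of_derivation_mul (D.numDiff_psi r)
    (b := 0) (by rw [add_zero, (D.numDiff_F r (ν b)).eq])) (D.numDiff_psi b)]
  simp only [mul_zero, add_zero]
  module

theorem IsDoubleCAR.numDiff_symplOmega :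
    numDiff ψ d p q * symplOmega ν s ψ = symplOmega ν s ψ * numDiff ψ d p q +
      (2 : K) • symplOmega ν s ψ := by
  simp only [symplOmega, Finset.mul_sum, Finset.sum_mul, Finset.smul_sum]
  simp only [← Finset.sum_add_distrib]
  refine Finset.sum_congr rfl fun b _ => ?_
  rw [mul_smul_comm, commute_of_derivation_mul (D.numDiff_psi (ν b)) (D.numDiff_psi b),
    smul_mul_assoc]
  module

theorem IsDoubleCAR.numDiff_p_mul_p (i j : I) :
    numDiff ψ d p q * (p i * p j) = p i * p j * numDiff ψ d p q - (2 : K) • (p i * p j) := by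
  rw [commute_of_derivation_mul (a := -p i) (b := -p j) (by rw [D.numDiff_p, sub_eq_add_neg])
    (by rw [D.numDiff_p, sub_eq_add_neg]), neg_mul, mul_neg]
  module

theorem IsDoubleCAR.numDiff_pairing :
    numDiff ψ d p q * pairing ν s p G = pairing ν s p G * numDiff ψ d p q -
      (2 : K) • pairing ν s p G := by
  simp only [pairing, Finset.mul_sum, Finset.sum_mul, Finset.smul_sum]
  simp only [← Finset.sum_sub_distrib]
  refine Finset.sum_congr rfl fun b _ => Finset.sum_congr rfl fun r _ => ?_
  rw [mul_smul_comm, commute_of_derivation_mul (a := -((2 : K) • (p (ν r) * p b))) (b := 0)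
    (by rw [D.numDiff_p_mul_p (K := K), sub_eq_add_neg]) (by rw [add_zero, (D.numDiff_G r b).eq])]
  rw [mul_zero, add_zero, neg_mul, smul_add, smul_neg, smul_mul_assoc, smul_mul_assoc]
  module

theorem IsDoubleCAR.numDiff_symplOmega_p :
    numDiff ψ d p q * symplOmega ν s p = symplOmega ν s p * numDiff ψ d p q -
      (2 : K) • symplOmega ν s p := by
  simp only [symplOmega, Finset.mul_sum, Finset.sum_mul, Finset.smul_sum]
  simp only [← Finset.sum_sub_distrib]
  refine Finset.sum_congr rfl fun b _ => ?_
  rw [mul_smul_comm, D.numDiff_p_mul_p (K := K), smul_mul_assoc]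
  module

/-! ### The orthogonal case -/

section Orth

theorem IsDoubleCAR.numDiff_orthTot (v : K) :
    Commute (numDiff ψ d p q) (orthTot ν ψ d p F v) := by
  refine Commute.add_right (D.numDiff_genTot v) (Commute.smul_right ?_ _)
  rw [Commute, SemiconjBy, commute_of_derivation_mul
    (a := (2 : K) • orthTheta ν ψ F)
    (b := -((2 : K) • annCre ν (fun _ => (1 : K)) d p)) D.numDiff_orthTheta
    (by rw [D.numDiff_annCre, sub_eq_add_neg])]
  rw [mul_neg, smul_mul_assoc, mul_smul_comm, add_neg_cancel, add_zero]

/-- The only obstruction is `∑ p_{-b} p_b`, which vanishes since the involution swaps anticommuting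
factors without a sign. -/
theorem IsDoubleCAR.orthTot_tau (hν : ∀ i, ν (ν i) = i) (v : K) :
    Commute (orthTot ν ψ d p F v) (tau ψ p) := by
  refine Commute.add_left (D.genTot_tau v) (Commute.smul_left (Commute.mul_left ?_ ?_) _)
  · exact D.commute_tau D.orthTheta_psi D.orthTheta_p
  · rw [Commute, SemiconjBy, D.annCre_tau hν]
    simp [symplOmega, sum_psi_neg_psi K D.col hν]

/-- Only `annCre` fails to commute with `bos ψ p G`, and its defect is the pairing of `G`. -/
theorem IsDoubleCAR.orthTot_bos (hν : ∀ i, ν (ν i) = i) (v : K) :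
    orthTot ν ψ d p F v * bos ψ p G = bos ψ p G * orthTot ν ψ d p F v +
      (2 * (v - 1))⁻¹ • (orthTheta ν ψ F * pairing ν (fun _ => (1 : K)) p G) := by
  have h1 := (D.genTot_bos v).eq
  have h2 := (D.commute_bos (X := G) (D.orthTheta_psi (ν := ν)) D.orthTheta_p D.orthTheta_G).eq
  have h3 := D.annCre_bos (s := fun _ => (1 : K)) (X := G) hν D.d_G D.p_G
  rw [orthTot, add_mul, mul_add, h1, smul_mul_assoc, mul_assoc, h3, mul_smul_comm, mul_add,
    ← mul_assoc, h2, mul_assoc, smul_add, add_assoc]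

theorem IsDoubleCAR.orthTot_pairing (v : K) :
    Commute (orthTot ν ψ d p F v) (pairing ν (fun _ => (1 : K)) p G) := by
  refine Commute.add_left (D.genTot_pairing v) (Commute.smul_left (Commute.mul_left ?_
    D.annCre_pairing) _)
  exact D.pairing_commute_tot (fun i j => (D.orthTheta_p i).mul_right (D.orthTheta_p j))
    D.orthTheta_G

theorem IsDoubleCAR.orthTot_orthTheta (hF : IsClassical ν (fun _ => (1 : K)) 1 F) {v : K}
    (hv : Generic v) : orthTot ν ψ d p F v * orthTheta ν ψ F =
      ((v - 2) / (v - 1)) • (orthTheta ν ψ F * orthTot ν ψ d p F (v - 1)) := by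
  have hv1 : v - 1 ≠ 0 := hv.sub_one.ne_zero
  rw [← D.sum_orthT_mul, ← D.sum_orthT_mul, Finset.sum_mul, Finset.mul_sum,
    Finset.smul_sum]
  refine Finset.sum_congr rfl fun b _ => ?_
  have h1 := orthT_orthTheta D.row (fun i j k => (D.psi_F i j k).eq)
    (fun i j k => (D.d_F i j k).eq) hF b hv
  rw [mul_assoc, ← (D.orthTheta_p b).eq, ← mul_assoc, ← mul_assoc, ← smul_mul_assoc]
  congr 1
  rw [div_eq_inv_mul, mul_smul, ← h1, inv_smul_smul₀ hv1]

theorem IsDoubleCAR.creAnn_orthTot (hν : ∀ i, ν (ν i) = i) (v : K) :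
    creAnn ν (fun _ => (1 : K)) ψ q * orthTot ν ψ d p F v =
      orthTot ν ψ d p F v * creAnn ν (fun _ => (1 : K)) ψ q - orthTheta ν ψ F +
      (2 * (v - 1))⁻¹ • (orthTheta ν ψ F * numDiff ψ d p q) := by
  have h1 := D.creAnn_bos (s := fun _ => (1 : K)) (ν := ν) D.psi_F D.q_F
  have h1' : ∑ b, ∑ r, (1 : K) • (ψ (ν b) * ψ r * F r b) = -orthTheta ν ψ F := by
    simp only [orthTheta, eta, Finset.sum_mul, one_smul]
    rw [← sum_comp_of_invol hν, ← Finset.sum_neg_distrib]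
    refine Finset.sum_congr rfl fun b _ => ?_
    rw [← Finset.sum_neg_distrib]
    refine Finset.sum_congr rfl fun r _ => ?_
    rw [hν, D.row.psi_psi, neg_mul, mul_assoc, mul_assoc, (D.psi_F b r (ν b)).eq]
  have h2 := D.creAnn_tau (s := fun _ => (1 : K)) (ν := ν)
  have h2' : symplOmega ν (fun _ => (1 : K)) ψ = 0 := by
    simp [symplOmega, sum_psi_neg_psi K D.row hν]
  have h3 := (D.commute_creAnn (s := fun _ => (1 : K)) (ν := ν) (D.orthTheta_psi (ν := ν))
    D.orthTheta_q).eq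
  have h4 := D.creAnn_annCre (ε := (1 : K)) (s := fun _ => (1 : K)) hν (by simp) (by simp)
  rw [h1'] at h1
  rw [h2', add_zero] at h2
  rw [one_smul] at h4
  rw [orthTot, genTot, mul_add, mul_add, h1, mul_smul_comm, h2, mul_smul_comm, ← mul_assoc, ← h3,
    mul_assoc, h4]
  simp only [add_mul, smul_mul_assoc, mul_add, smul_add, mul_assoc]
  abel

end Orth

end Double


variable {K R I : Type*} [Field K] [CharZero K] [Ring R] [Algebra K R] [Fintype I] [DecidableEq I]

section Double

variable {ψ d p q : I → R} {F G : I → I → R} (D : IsDoubleCAR ψ d p q F G) {ν : I → I}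
  {s : I → K} {ε : K}
include D

/-! ### The symplectic case -/

section Sympl

theorem IsDoubleCAR.numDiff_symplTot (v : K) :
    Commute (numDiff ψ d p q) (symplTot ν s ψ d p F v) := by
  refine Commute.add_right (D.numDiff_genTot v) (Commute.smul_right ?_ _)
  rw [Commute, SemiconjBy, commute_of_derivation_mul (a := (2 : K) • symplOmega ν s ψ)
    (b := -((2 : K) • annCre ν s d p)) D.numDiff_symplOmega
    (by rw [D.numDiff_annCre, sub_eq_add_neg])]
  rw [mul_neg, smul_mul_assoc, mul_smul_comm, add_neg_cancel, add_zero]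

/-- Replacing `(b, r)` by `(-r, -b)` reverses the sign of each term under the symplectic symmetry of
`G`. -/
theorem IsDoubleCAR.pairing_eq_zero (hν : ∀ i, ν (ν i) = i) (hsν : ∀ i, s (ν i) = -1 * s i)
    (hs : ∀ i, s i * s i = 1) (hG : ∀ i j, G i j = -((s i * s j) • G (ν j) (ν i))) :
    pairing ν s p G = 0 := by
  refine eq_zero_of_eq_neg K ?_
  have h1 : ∀ b r, s r • (p (ν r) * p b * G r b) =
      -(s (ν b) • (p (ν (ν b)) * p (ν r) * G (ν b) (ν r))) := by
    intro b r
    rw [hG r b, D.col.psi_psi (ν r) b, hsν b, hν, neg_mul_neg, mul_smul_comm, smul_smul, ← neg_smul]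
    congr 1
    linear_combination s b * hs r
  rw [pairing]
  refine (Finset.sum_congr rfl fun b _ => Finset.sum_congr rfl fun r _ => h1 b r).trans ?_
  simp only [Finset.sum_neg_distrib]
  rw [Finset.sum_comm, sum_comp_of_invol hν fun b => ∑ r, s (ν r) • (p (ν (ν r)) * p b * G (ν r) b)]
  congr 1
  exact Finset.sum_congr rfl fun b _ =>
    sum_comp_of_invol hν fun r => s r • (p (ν r) * p b * G r b)

/-- Compared with the orthogonal case `τ` and `bos ψ p G` exchange roles: the latter commutes with
the total operator, and `τ` acquires a defect. -/
theorem IsDoubleCAR.symplTot_tau (hν : ∀ i, ν (ν i) = i) (v : K) :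
    symplTot ν s ψ d p F v * tau ψ p = tau ψ p * symplTot ν s ψ d p F v +
      (2⁻¹ : K) • (symplOmega ν s ψ * symplOmega ν s p) := by
  have h1 := (D.genTot_tau v).eq
  have h2 := (D.commute_tau (D.symplOmega_psi (ν := ν) (s := s)) D.symplOmega_p).eq
  have h3 := D.annCre_tau (s := s) hν
  rw [symplTot, add_mul, mul_add, h1, smul_mul_assoc, mul_assoc, h3, mul_smul_comm, mul_add,
    ← mul_assoc, h2, mul_assoc, smul_add, add_assoc]

theorem IsDoubleCAR.symplTot_bos (hν : ∀ i, ν (ν i) = i) (hsν : ∀ i, s (ν i) = -1 * s i)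
    (hs : ∀ i, s i * s i = 1) (hG : ∀ i j, G i j = -((s i * s j) • G (ν j) (ν i))) (v : K) :
    Commute (symplTot ν s ψ d p F v) (bos ψ p G) := by
  refine Commute.add_left (D.genTot_bos v) (Commute.smul_left (Commute.mul_left ?_ ?_) _)
  · exact D.commute_bos D.symplOmega_psi D.symplOmega_p D.symplOmega_G
  · rw [Commute, SemiconjBy, D.annCre_bos hν D.d_G D.p_G, D.pairing_eq_zero hν hsν hs hG, add_zero]

theorem IsDoubleCAR.symplTot_symplOmega_p (v : K) :
    Commute (symplTot ν s ψ d p F v) (symplOmega ν s p) := by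
  have h : ∀ x : R, (∀ i j, Commute x (p i * p j)) → Commute x (symplOmega ν s p) := fun x hx =>
    Commute.sum_right _ _ _ fun b _ => (hx _ _).smul_right _
  refine Commute.add_left ?_ (Commute.smul_left (Commute.mul_left ?_ ?_) _)
  · refine (D.commute_genTot ?_ ?_ ?_ v).symm
    · exact fun i => (h _ fun j k => (D.psi_p i j).mul_right (D.psi_p i k)).symm
    · exact fun i => (h _ fun j k => D.p_mul_p i j k).symm
    · exact fun i l => (h _ fun j k => ((D.p_F j i l).mul_left (D.p_F k i l)).symm).symm
  · exact h _ fun j k => (D.symplOmega_p j).mul_right (D.symplOmega_p k)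
  · refine (D.commute_annCre ?_ ?_).symm
    · exact fun i => (h _ fun j k => (D.d_p i j).mul_right (D.d_p i k)).symm
    · exact fun i => (h _ fun j k => D.p_mul_p i j k).symm

theorem IsDoubleCAR.symplTot_symplOmega (hF : IsClassical ν s (-1) F) (v : K) :
    symplTot ν s ψ d p F v * symplOmega ν s ψ =
      symplOmega ν s ψ * symplTot ν s ψ d p F (v - 1) := by
  rw [← D.sum_symplT_mul hF.s_neg, ← D.sum_symplT_mul hF.s_neg, Finset.sum_mul, Finset.mul_sum]
  refine Finset.sum_congr rfl fun b _ => ?_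
  have h1 := symplT_symplOmega D.row (fun i j k => (D.psi_F i j k).eq) (d := d) hF b v
  rw [mul_assoc, ← (D.symplOmega_p b).eq, ← mul_assoc, ← mul_assoc, h1]

theorem IsDoubleCAR.creAnn_symplTot (hF : IsClassical ν s (-1) F) (v : K) :
    creAnn ν s ψ q * symplTot ν s ψ d p F v =
      symplTot ν s ψ d p F v * creAnn ν s ψ q + v • symplOmega ν s ψ -
      (2⁻¹ : K) • (symplOmega ν s ψ * numDiff ψ d p q) := by
  have h1 := D.creAnn_bos (s := s) (ν := ν) D.psi_F D.q_F
  have h1' : ∑ b, ∑ r, s b • (ψ (ν b) * ψ r * F r b) = 0 := by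
    have h5 := sum_psi_psi_mul_F_eq_zero D.row hF
    rw [← sum_comp_of_invol hF.invol] at h5
    simp only [hF.invol, hF.s_neg, neg_one_mul, neg_smul, Finset.sum_neg_distrib,
      neg_eq_zero] at h5
    exact h5
  have h2 := D.creAnn_tau (s := s) (ν := ν)
  have h3 := (D.commute_creAnn (s := s) (ν := ν) (D.symplOmega_psi (ν := ν) (s := s))
    D.symplOmega_q).eq
  have h4 := D.creAnn_annCre (ε := (-1 : K)) (s := s) hF.invol hF.s_sq hF.s_neg
  rw [h1', add_zero] at h1
  rw [symplTot, genTot, mul_add, mul_add, h1, mul_smul_comm, h2, mul_smul_comm, ← mul_assoc, ← h3,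
    mul_assoc, h4]
  simp only [add_mul, smul_mul_assoc, mul_add, smul_add, mul_assoc, neg_smul, one_smul, mul_neg,
    smul_neg]
  abel

theorem IsDoubleCAR.creAnn_symplOmega_p (hν : ∀ i, ν (ν i) = i) (hsν : ∀ i, s (ν i) = -1 * s i)
    (hs : ∀ i, s i * s i = 1) : creAnn ν s ψ q * symplOmega ν s p =
      symplOmega ν s p * creAnn ν s ψ q - (2 : K) • tau ψ p := by
  have h := D.creAnn_pairing (s := s) (ν := ν) (ε := -1) (c := -1)
    (X := fun i j => if i = j then 1 else 0) hν hs hsν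
    (by intros; split_ifs <;> simp) (by intros; split_ifs <;> simp) (by
      intro i j
      have e : (ν j = ν i) ↔ (i = j) := ⟨fun h => by rw [← hν i, ← h, hν], fun h => by rw [h]⟩
      simp only [e]
      split_ifs with h
      · subst h
        rw [mul_assoc, hs]; simp
      · simp)
  have h2 : pairing ν s p (fun i j => if i = j then 1 else 0) = symplOmega ν s p := by
    simp [pairing, symplOmega]
  rw [h2, ← tau_eq_bos] at h
  rw [h, sub_eq_add_neg, ← neg_smul]
  congr 2
  norm_num

theorem IsDoubleCAR.annCre_symplOmega (hF : IsClassical ν s (-1) F) :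
    annCre ν s d p * symplOmega ν s ψ = symplOmega ν s ψ * annCre ν s d p -
      (2 : K) • tau ψ p := by
  simp only [annCre, tau, Finset.sum_mul, Finset.mul_sum, Finset.smul_sum]
  rw [← Finset.sum_sub_distrib]
  refine Finset.sum_congr rfl fun b _ => ?_
  rw [smul_mul_assoc, mul_assoc, ← (D.symplOmega_p b).eq, ← mul_assoc, d_symplOmega D.row hF,
    add_mul, smul_add, mul_smul_comm, mul_assoc, smul_mul_assoc, smul_smul, hF.s_neg, sub_eq_add_neg,
    ← neg_smul]
  congr 2
  linear_combination -2 * hF.s_sq b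

end Sympl

/-! ### Invariance of the total operators -/

theorem IsDoubleCAR.invGen_genTot (θ : K) (i j : I)
    (hF : ∀ k l, F i j * F k l - F k l * F i j =
      (if j = k then F i l else 0) - (if i = l then F k j else 0) -
        θ • ((if ν i = k then F (ν j) l else 0) - (if l = ν j then F k (ν i) else 0))) (v : K) :
    Commute (invGen ν θ ψ d p q F G i j) (genTot ψ p F v) :=
  (D.invGen_bos ν θ i j hF).add_right ((D.invGen_tau ν θ i j).smul_right v)

theorem IsDoubleCAR.invGen_orthTot (hF : IsClassical ν (fun _ => (1 : K)) 1 F) (i j : I) (v : K) :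
    Commute (invGen ν (1 : K) ψ d p q F G i j) (orthTot ν ψ d p F v) := by
  have hF' := hF.comm i j
  simp only [mul_one] at hF'
  exact (D.invGen_genTot 1 i j hF' v).add_right (((D.invGen_orthTheta ν i j hF.invol hF').mul_right
    (D.invGen_annCre ν 1 i j hF.invol hF.s_sq hF.s_neg (by simp))).smul_right _)

theorem IsDoubleCAR.invGen_symplTot (hF : IsClassical ν s ε F) (i j : I) (v : K) :
    Commute (invGen ν (s i * s j) ψ d p q F G i j) (symplTot ν s ψ d p F v) :=
  (D.invGen_genTot _ i j (hF.comm i j) v).add_right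
    (((D.invGen_symplOmega ν _ i j hF.invol hF.s_sq hF.s_neg rfl).mul_right
    (D.invGen_annCre ν _ i j hF.invol hF.s_sq hF.s_neg rfl)).smul_right _)

end Double

theorem commute_fallProd {T : K → R} {x : R} (h : ∀ v, Commute x (T v)) (m : ℕ) (v : K) :
    Commute x (fallProd T m v) := by
  induction m generalizing v with
  | zero => exact Commute.one_right x
  | succ m ih => exact (h v).mul_right (ih _)

/-! ## Vacuum expectations -/

section Expectation

variable {V W : Type*} [AddCommGroup V] [Module R V] [Module K V] [IsScalarTower K R V]
  [SMulCommClass K R V] [AddCommGroup W] [Module K W]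

/-- A vacuum vector and a functional vanishing on the images of the annihilation operators. -/
structure IsVacuum (ψ d p q : I → R) (F G : I → I → R) (Ω : V) (φ : V →ₗ[K] W) : Prop where
  d_vac : ∀ i, d i • Ω = 0
  q_vac : ∀ i, q i • Ω = 0
  F_vac : ∀ i j, F i j • Ω = G i j • Ω
  map_d : ∀ i x, φ (d i • x) = 0
  map_q : ∀ i x, φ (q i • x) = 0

variable {ψ d p q : I → R} {F G : I → I → R} (D : IsDoubleCAR ψ d p q F G) {ν : I → I}
  {s : I → K} {ε : K} {Ω : V} {φ : V →ₗ[K] W} (hΩ : IsVacuum ψ d p q F G Ω φ)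
include D hΩ

theorem IsVacuum.invGen_vac (θ : K) (i j : I) : invGen ν θ ψ d p q F G i j • Ω = 0 := by
  simp only [invGen, sub_smul, add_smul, mul_smul, hΩ.d_vac, hΩ.q_vac, hΩ.F_vac, smul_assoc,
    smul_zero, sub_self, add_zero]

theorem IsVacuum.numDiff_vac : numDiff ψ d p q • Ω = 0 := by
  simp only [numDiff, sub_smul, Finset.sum_smul, mul_smul, hΩ.d_vac, hΩ.q_vac, smul_zero,
    Finset.sum_const_zero, sub_self]

theorem IsVacuum.creAnn_vac : creAnn ν s ψ q • Ω = 0 := by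
  simp only [creAnn, Finset.sum_smul, smul_assoc, mul_smul, hΩ.q_vac, smul_zero,
    Finset.sum_const_zero]

theorem IsVacuum.annCre_vac : annCre ν s d p • Ω = 0 := by
  simp only [annCre, Finset.sum_smul, smul_assoc, (D.d_p _ _).eq, mul_smul, hΩ.d_vac, smul_zero,
    Finset.sum_const_zero]

theorem IsVacuum.bos_vac : bos ψ p F • Ω = bos ψ p G • Ω := by
  simp only [bos, Finset.sum_smul, mul_smul, hΩ.F_vac]

theorem IsVacuum.map_creAnn (x : V) : φ (creAnn ν s ψ q • x) = 0 := by
  simp only [creAnn, Finset.sum_smul, smul_assoc, (D.psi_q _ _).eq, mul_smul, map_sum, map_smul,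
    hΩ.map_q, smul_zero, Finset.sum_const_zero]

theorem IsVacuum.map_annCre (x : V) : φ (annCre ν s d p • x) = 0 := by
  simp only [annCre, Finset.sum_smul, smul_assoc, mul_smul, map_sum, map_smul,
    hΩ.map_d, smul_zero, Finset.sum_const_zero]

theorem IsVacuum.map_psi_d (i j : I) (x : V) :
    φ ((ψ j * d i) • x) = if i = j then φ x else 0 := by
  have h : ψ j * d i = (if i = j then 1 else 0) - d i * ψ j := by rw [D.row.d_psi]; abel
  rw [h, sub_smul, map_sub, mul_smul, hΩ.map_d, sub_zero]
  split_ifs <;> simp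

theorem IsVacuum.map_p_q (i j : I) (x : V) :
    φ ((p i * q j) • x) = if i = j then φ x else 0 := by
  have h : p i * q j = (if j = i then 1 else 0) - q j * p i := by rw [D.col.d_psi]; abel
  rw [h, sub_smul, map_sub, mul_smul, hΩ.map_q, sub_zero]
  simp only [eq_comm (a := j)]
  split_ifs <;> simp

/-- Under the functional `ψ_j d_i` and `p_i q_j` both act as `δ_ij`, because images of annihilators
are killed. The row and column contributions to `invGen` then cancel, leaving `F - G`. -/
theorem IsVacuum.map_F_eq_map_G {θ : K} (hν : ∀ i, ν (ν i) = i) {i j : I} {x : V}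
    (hx : invGen ν θ ψ d p q F G i j • x = 0) : φ (F i j • x) = φ (G i j • x) := by
  have h := congrArg φ hx
  have e' : (ν j = ν i) ↔ (i = j) := ⟨fun h => by rw [← hν i, ← h, hν], fun h => by rw [h]⟩
  simp only [invGen, sub_smul, add_smul, smul_assoc, map_sub, map_add, map_smul,
    hΩ.map_psi_d D, hΩ.map_p_q D, map_zero, e'] at h
  rw [← sub_eq_zero, ← h]
  abel

/-- The row operator `x` may be replaced by `y` under the functional. -/
theorem IsVacuum.map_congr {ν : I → I} {x y : I → R} {c : K}
    (h : ∀ b, d (ν b) * x b = c • (d (ν b) * y b)) (z : I → V) :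
    φ (∑ b, x b • z b) = c • φ (∑ b, y b • z b) := by
  rw [map_sum, map_sum, Finset.smul_sum]
  refine Finset.sum_congr rfl fun b _ => ?_
  have h1 : ∀ z : V, φ z = φ ((ψ (ν b) * d (ν b)) • z) := fun z => by
    rw [hΩ.map_psi_d D, if_pos rfl]
  rw [h1 (x b • z b), h1 (y b • z b), ← mul_smul, ← mul_smul, mul_assoc, mul_assoc, h, mul_smul_comm,
    smul_assoc, map_smul]

/-! ### The general linear case -/

/-- The total operators commute, so the factor at `v + 1` can be moved to the end and replaced by
the one at `v - n` plus `(n + 1) τ`. -/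
theorem IsVacuum.genTot_newton (n : ℕ) (v : K) :
    φ (fallProd (genTot ψ p F) (n + 1) (v + 1) • Ω) =
      φ (fallProd (genTot ψ p F) (n + 1) v • Ω) +
      ((n : K) + 1) • φ (fallProd (genTot ψ p F) n v • tau ψ p • Ω) := by
  have h1 : fallProd (genTot ψ p F) (n + 1) (v + 1) =
      fallProd (genTot ψ p F) n v * genTot ψ p F (v + 1) := by
    rw [fallProd, add_sub_cancel_right]
    exact (commute_fallProd (fun w => D.genTot_genTot _ w) n v).eq
  have h2 : genTot ψ p F (v + 1) = genTot ψ p F (v - n) + ((n : K) + 1) • tau ψ p := by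
    simp only [genTot]; module
  rw [h1, h2, fallProd_succ', mul_add, add_smul, map_add, mul_smul_comm, smul_assoc, φ.map_smul,
    mul_smul (fallProd (genTot ψ p F) n v) (tau ψ p) Ω]

end Expectation


variable {K R I : Type*} [Field K] [CharZero K] [Ring R] [Algebra K R] [Fintype I] [DecidableEq I]

section Expectation

variable {V W : Type*} [AddCommGroup V] [Module R V] [Module K V] [IsScalarTower K R V]
  [SMulCommClass K R V] [AddCommGroup W] [Module K W]
  {ψ d p q : I → R} {F G : I → I → R} (D : IsDoubleCAR ψ d p q F G) {ν : I → I}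
  {s : I → K} {ε : K} {Ω : V} {φ : V →ₗ[K] W} (hΩ : IsVacuum ψ d p q F G Ω φ)
include D hΩ

omit hΩ in
theorem IsVacuum.smul_numDiff {T : K → R} (hT : ∀ v, Commute (numDiff ψ d p q) (T v)) (m : ℕ) (v : K)
    {y : V} {c : K} (hy : numDiff ψ d p q • y = c • y) :
    numDiff ψ d p q • fallProd T m v • y = c • fallProd T m v • y := by
  rw [← mul_smul, (commute_fallProd hT m v).eq, mul_smul, hy, smul_comm]

theorem IsVacuum.invGen_fallProd {T : K → R} {θ : K} {i j : I}
    (hT : ∀ v, Commute (invGen ν θ ψ d p q F G i j) (T v)) (m : ℕ) (v : K) :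
    invGen ν θ ψ d p q F G i j • fallProd T m v • Ω = 0 := by
  rw [← mul_smul, (commute_fallProd hT m v).eq, mul_smul, hΩ.invGen_vac D, smul_zero]

theorem IsVacuum.numDiff_fallProd {T : K → R} (hT : ∀ v, Commute (numDiff ψ d p q) (T v)) (m : ℕ)
    (v : K) : numDiff ψ d p q • fallProd T m v • Ω = 0 := by
  rw [← mul_smul, (commute_fallProd hT m v).eq, mul_smul, hΩ.numDiff_vac D, smul_zero]

/-! ### The orthogonal case -/

section Orth

variable (hF : IsClassical ν (fun _ => (1 : K)) 1 F)
include hF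

omit hΩ in
theorem IsDoubleCAR.orthTot_orthTheta_fallProd (m : ℕ) {v : K} (hv : Generic v) :
    orthTot ν ψ d p F v * (orthTheta ν ψ F * fallProd (orthTot ν ψ d p F) m (v - 1 - 1)) =
      ((v - 2) / (v - 1)) • (orthTheta ν ψ F * fallProd (orthTot ν ψ d p F) (m + 1) (v - 1)) := by
  rw [← mul_assoc, D.orthTot_orthTheta hF hv, smul_mul_assoc, mul_assoc, fallProd]

omit hΩ in
-- Each of the `m` factors contributes a defect with `Θ` on the left and the pairing on the right.
-- Moving `Θ` past a factor multiplies by `(v-2)/(v-1)`, which just converts the coefficient at `v -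
-- 1` into that at `v`; hence all contributions are equal.
theorem IsDoubleCAR.fallProd_orthTot_bos (m : ℕ) {v : K} (hv : Generic v) :
    fallProd (orthTot ν ψ d p F) m v * bos ψ p G = bos ψ p G * fallProd (orthTot ν ψ d p F) m v +
      (m * (2 * (v - 1))⁻¹) • (orthTheta ν ψ F * fallProd (orthTot ν ψ d p F) (m - 1) (v - 1) *
        pairing ν (fun _ => (1 : K)) p G) := by
  induction m generalizing v with
  | zero => simp [fallProd]
  | succ m ih =>
    have c1 : v - 1 ≠ 0 := hv.sub_one.ne_zero
    have c2 : v - 1 - 1 ≠ 0 := hv.sub_one.sub_one.ne_zero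
    have h1 := (commute_fallProd (fun w => (D.orthTot_pairing (ν := ν) w).symm) m (v - 1)).eq
    have h2 := D.orthTot_bos hF.invol v
    have h3 : orthTot ν ψ d p F v * ((m * (2 * (v - 1 - 1))⁻¹) • (orthTheta ν ψ F *
        fallProd (orthTot ν ψ d p F) (m - 1) (v - 1 - 1) * pairing ν (fun _ => (1 : K)) p G)) =
        (m * (2 * (v - 1))⁻¹) • (orthTheta ν ψ F * fallProd (orthTot ν ψ d p F) m (v - 1) *
          pairing ν (fun _ => (1 : K)) p G) := by
      rcases m with _ | m
      · simp
      · rw [mul_smul_comm, ← mul_assoc, Nat.add_sub_cancel, D.orthTot_orthTheta_fallProd hF m hv,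
          smul_mul_assoc, smul_smul]
        congr 1
        have c3 : v - 2 ≠ 0 := by rwa [sub_sub, one_add_one_eq_two] at c2
        rw [show v - 1 - 1 = v - 2 by ring]
        field_simp
    rw [fallProd, mul_assoc, ih hv.sub_one, mul_add, h3, ← mul_assoc, h2, add_mul, mul_assoc,
      smul_mul_assoc, mul_assoc (orthTheta ν ψ F), h1, ← mul_assoc (orthTheta ν ψ F),
      Nat.add_sub_cancel, add_assoc, ← add_smul]
    congr 2
    push_cast; ring

omit hΩ in
-- Every total operator preserves the weight `-2` of `y`, so the term `Θ * numDiff` of each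
-- commutator becomes a scalar multiple of `Θ`; the defects again collect at the left.
theorem IsDoubleCAR.creAnn_fallProd_orthTot {y : V} (hy : numDiff ψ d p q • y = (-2 : K) • y)
    (m : ℕ) {v : K} (hv : Generic v) :
    creAnn ν (fun _ => (1 : K)) ψ q • fallProd (orthTot ν ψ d p F) m v • y =
      fallProd (orthTot ν ψ d p F) m v • creAnn ν (fun _ => (1 : K)) ψ q • y -
      (m * (v - (m - 1) / 2) / (v - 1)) • ((orthTheta ν ψ F *
        fallProd (orthTot ν ψ d p F) (m - 1) (v - 1)) • y) := by
  induction m generalizing v with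
  | zero => simp [fallProd]
  | succ m ih =>
    have c1 : v - 1 ≠ 0 := hv.sub_one.ne_zero
    have c2 : v - 1 - 1 ≠ 0 := hv.sub_one.sub_one.ne_zero
    have hz := IsVacuum.smul_numDiff D (D.numDiff_orthTot (ν := ν)) m (v - 1) hy
    set z := fallProd (orthTot ν ψ d p F) m (v - 1) • y with hzd
    have h3 : orthTot ν ψ d p F v • ((m * (v - 1 - (m - 1) / 2) / (v - 1 - 1)) •
        ((orthTheta ν ψ F * fallProd (orthTot ν ψ d p F) (m - 1) (v - 1 - 1)) • y)) =
        (m * (v - 1 - (m - 1) / 2) / (v - 1)) • orthTheta ν ψ F • z := by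
      rcases m with _ | m
      · simp
      · rw [smul_comm, ← mul_smul (orthTot _ _ _ _ _ _), Nat.add_sub_cancel,
          D.orthTot_orthTheta_fallProd hF m hv, smul_assoc,
          mul_smul (orthTheta _ _ _), ← hzd, smul_smul]
        congr 1
        have c3 : v - 2 ≠ 0 := by rwa [sub_sub, one_add_one_eq_two] at c2
        rw [show v - 1 - 1 = v - 2 by ring]
        field_simp
    rw [fallProd, mul_smul, ← hzd, ← mul_smul (creAnn _ _ _ _), D.creAnn_orthTot hF.invol, add_smul,
      sub_smul, mul_smul (orthTot _ _ _ _ _ _) (creAnn _ _ _ _), hzd, ih hv.sub_one, ← hzd,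
      smul_sub, h3, smul_assoc, mul_smul (orthTheta _ _ _) (numDiff _ _ _ _), hz,
      Nat.add_sub_cancel, mul_smul (orthTheta _ _ _) (fallProd _ _ _), ← hzd,
      smul_comm (orthTheta ν ψ F) (-2 : K), ← mul_smul]
    generalize orthTheta ν ψ F • z = a
    generalize (orthTot ν ψ d p F v * fallProd (orthTot ν ψ d p F) m (v - 1)) • (_ : V) = b
    push_cast
    match_scalars
    · ring
    · field_simp; ring

theorem IsVacuum.map_bos_eq_orth {x : V} (hx : ∀ i j, invGen ν (1 : K) ψ d p q F G i j • x = 0)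
    (hx' : numDiff ψ d p q • x = 0) : φ (bos ψ p F • x) = φ (bos ψ p G • x) := by
  have h := D.bos_sub_bos ν (fun _ => (1 : K)) 1
  have h1 : ∑ r, (1 : K) • (ψ r * ψ (ν r)) = 0 := by
    rw [← sum_psi_neg_psi K D.row hF.invol, ← sum_comp_of_invol hF.invol]
    simp [hF.invol]
  have h2 : ∑ r, (1 : K) • (p r * p (ν r)) = 0 := by
    rw [← sum_psi_neg_psi K D.col hF.invol, ← sum_comp_of_invol hF.invol]
    simp [hF.invol]
  rw [h1, h2] at h
  have h3 := congrArg (fun r => φ (r • x)) h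
  simp only [mul_one, zero_mul, sub_zero, smul_zero, sub_smul, Finset.sum_smul, mul_smul, hx,
    hx', Finset.sum_const_zero, map_zero, map_sub] at h3
  simpa [sub_eq_zero] using h3

/-- With `f = T(v) ⋯ T(v-n+1)`, the product at `v` ends in `T(v-n) Ω = (bos G + (v-n) τ) Ω`, and
under the functional the product at `v + 1` begins with a multiple of `bos F + v τ`, where `F` may
be replaced by `G` by invariance. It remains to compare `f (bos G) Ω` with `(bos G) f Ω`. Their
difference is a multiple of one unknown `Y`, and a second linear relation for `Y` comes from
`creAnn`, whose images the functional kills. -/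
theorem IsVacuum.orthTot_newton (hG : ∀ i j, G i j = -G (ν j) (ν i)) (n : ℕ) {v u : K}
    (hv : Generic v) (hu : v = u + (n + 1) / 2) (hu0 : u ≠ 0) (hu1 : u + 1 ≠ 0) :
    φ (fallProd (orthTot ν ψ d p F) (n + 1) (v + 1) • Ω) =
      ((v + 1) / v * (u / (u + 1))) • (φ (fallProd (orthTot ν ψ d p F) (n + 1) v • Ω) +
      ((n + 1) * (2 * u + 1) / (2 * u)) •
        φ (fallProd (orthTot ν ψ d p F) n v • tau ψ p • Ω)) := by
  have c0 : v ≠ 0 := hv.ne_zero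
  have c1 : v - 1 ≠ 0 := hv.sub_one.ne_zero
  set f := fallProd (orthTot ν ψ d p F) n v with hf
  have h1 : φ (fallProd (orthTot ν ψ d p F) (n + 1) v • Ω) =
      φ (f • bos ψ p G • Ω) + (v - n) • φ (f • tau ψ p • Ω) := by
    rw [fallProd_succ', ← hf, mul_smul, orthTot, genTot, add_smul, add_smul, hΩ.bos_vac D,
      smul_assoc, smul_assoc, mul_smul (orthTheta _ _ _), hΩ.annCre_vac D, smul_zero, smul_zero,
      add_zero, smul_add, map_add, smul_comm f (v - n : K), φ.map_smul]
  have h2 : f • tau ψ p • Ω = tau ψ p • f • Ω := by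
    rw [← mul_smul, ← (commute_fallProd (fun w => (D.orthTot_tau hF.invol w).symm) n v).eq, mul_smul]
  have h3 : φ (f • bos ψ p G • Ω) = φ (bos ψ p G • f • Ω) + (n * (2 * (v - 1))⁻¹) •
      φ ((orthTheta ν ψ F * fallProd (orthTot ν ψ d p F) (n - 1) (v - 1)) •
        pairing ν (fun _ => (1 : K)) p G • Ω) := by
    rw [← mul_smul, D.fallProd_orthTot_bos hF n hv, add_smul, map_add, mul_smul, smul_assoc,
      φ.map_smul, mul_smul (_ * _) (pairing _ _ _ _)]
  -- Apply `creAnn` to `f` times the pairing on the vacuum: the functional gives zero, and on the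
  -- right end `creAnn` turns the pairing into `2 bos G`.
  have h4 : (2 : K) • φ (f • bos ψ p G • Ω) = (n * (v - (n - 1) / 2) / (v - 1)) •
      φ ((orthTheta ν ψ F * fallProd (orthTot ν ψ d p F) (n - 1) (v - 1)) •
        pairing ν (fun _ => (1 : K)) p G • Ω) := by
    have hy : numDiff ψ d p q • pairing ν (fun _ => (1 : K)) p G • Ω =
        (-2 : K) • pairing ν (fun _ => (1 : K)) p G • Ω := by
      rw [← mul_smul, D.numDiff_pairing, sub_smul, mul_smul, hΩ.numDiff_vac D, smul_zero, zero_sub,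
        smul_assoc, neg_smul]
    have h5 := congrArg φ (D.creAnn_fallProd_orthTot hF hy n hv)
    have h6 := D.creAnn_pairing (ε := (1 : K)) (c := 1) (X := G) (s := fun _ => (1 : K)) hF.invol
      hF.s_sq hF.s_neg D.psi_G D.q_G (by simpa using hG)
    rw [hΩ.map_creAnn D, ← mul_smul (creAnn _ _ _ _), h6, add_smul, mul_smul, hΩ.creAnn_vac D,
      smul_zero, zero_add, smul_assoc, smul_comm f, map_sub, φ.map_smul, φ.map_smul,
      one_add_one_eq_two] at h5
    exact (sub_eq_zero.1 h5.symm)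
  -- The functional sees only `ψ_{-b} d_{-b}` of the leftmost factor, so `d_orthT` at `v + 1`
  -- replaces `T_b` by `η_b(v)`.
  have h7 : φ (fallProd (orthTot ν ψ d p F) (n + 1) (v + 1) • Ω) =
      ((v + 1) / v) • φ (genTot ψ p F v • f • Ω) := by
    rw [fallProd, add_sub_cancel_right, ← hf, mul_smul, ← D.sum_orthT_mul,
      ← D.sum_etaShift_mul, Finset.sum_smul, Finset.sum_smul]
    simp only [mul_smul]
    refine hΩ.map_congr D (ν := ν) (fun b => ?_) fun b => p b • f • Ω
    have := d_orthT D.row (fun i j k => (D.psi_F i j k).eq) (fun i j k => (D.d_F i j k).eq) hF b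
      (v := v + 1) (by simpa using hv.add_int 1)
    simpa using this
  have h8 : φ (bos ψ p F • f • Ω) = φ (bos ψ p G • f • Ω) :=
    hΩ.map_bos_eq_orth D hF (fun i j => hΩ.invGen_fallProd D (D.invGen_orthTot hF i j) n v)
      (hΩ.numDiff_fallProd D D.numDiff_orthTot n v)
  rw [h7, h1, genTot, add_smul, map_add, h8, smul_assoc, φ.map_smul, h2]
  rw [h2] at h1
  set x := φ (f • bos ψ p G • Ω)
  set Z := φ (bos ψ p G • f • Ω)
  set t := φ (tau ψ p • f • Ω)
  set Y := φ ((orthTheta ν ψ F * fallProd (orthTot ν ψ d p F) (n - 1) (v - 1)) •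
        pairing ν (fun _ => (1 : K)) p G • Ω)
  have h9 : (n * (2 * (v - 1))⁻¹) • Y = (u + 1)⁻¹ • x := by
    rw [← sub_eq_zero]
    have h10 := congrArg (fun w => (2 * (u + 1))⁻¹ • w) h4
    simp only [smul_smul] at h10
    have e1 : (2 * (u + 1))⁻¹ * 2 = (u + 1)⁻¹ := by field_simp
    have e2 : (2 * (u + 1))⁻¹ * (n * (v - (n - 1) / 2) / (v - 1)) = n * (2 * (v - 1))⁻¹ := by
      -- This is the origin of the shift by `(n + 1) / 2` between `v` and `u`.
      have : v - (n - 1) / 2 = u + 1 := by rw [hu]; ring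
      rw [this]; field_simp
    rw [e1, e2] at h10
    rw [h10, sub_self]
  rw [h9] at h3
  have hZ : Z = x - (u + 1)⁻¹ • x := by rw [eq_sub_iff_add_eq]; exact h3.symm
  rw [hZ]
  clear_value x t
  match_scalars
  · field_simp; ring
  · field_simp; rw [hu]; ring

end Orth

/-! ### The symplectic case -/

section Sympl

variable (hF : IsClassical ν s (-1) F)
include hF

omit hΩ in
theorem IsDoubleCAR.symplTot_symplOmega_fallProd (m : ℕ) (v : K) :
    symplTot ν s ψ d p F v * (symplOmega ν s ψ * fallProd (symplTot ν s ψ d p F) m (v - 1 - 1)) =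
      symplOmega ν s ψ * fallProd (symplTot ν s ψ d p F) (m + 1) (v - 1) := by
  rw [← mul_assoc, D.symplTot_symplOmega hF, mul_assoc, fallProd]

omit hΩ in
-- Here `ω` passes each factor with no scalar, only lowering the parameter, so the `m` equal defects
-- add up to `m / 2`.
theorem IsDoubleCAR.fallProd_symplTot_tau (m : ℕ) (v : K) :
    fallProd (symplTot ν s ψ d p F) m v * tau ψ p = tau ψ p * fallProd (symplTot ν s ψ d p F) m v +
      ((m : K) / 2) • (symplOmega ν s ψ * fallProd (symplTot ν s ψ d p F) (m - 1) (v - 1) *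
        symplOmega ν s p) := by
  induction m generalizing v with
  | zero => simp [fallProd]
  | succ m ih =>
    have h1 := (commute_fallProd (fun w => (D.symplTot_symplOmega_p (ν := ν) (s := s) w).symm) m
      (v - 1)).eq
    have h2 := D.symplTot_tau (s := s) hF.invol v
    have h3 : symplTot ν s ψ d p F v * (((m : K) / 2) • (symplOmega ν s ψ *
        fallProd (symplTot ν s ψ d p F) (m - 1) (v - 1 - 1) * symplOmega ν s p)) =
        ((m : K) / 2) • (symplOmega ν s ψ * fallProd (symplTot ν s ψ d p F) m (v - 1) *
          symplOmega ν s p) := by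
      rcases m with _ | m
      · simp
      · rw [mul_smul_comm, ← mul_assoc, Nat.add_sub_cancel, D.symplTot_symplOmega_fallProd hF m]
    rw [fallProd, mul_assoc, ih, mul_add, h3, ← mul_assoc, h2, add_mul, mul_assoc,
      smul_mul_assoc, mul_assoc (symplOmega ν s ψ), h1, ← mul_assoc (symplOmega ν s ψ),
      Nat.add_sub_cancel, add_assoc, ← add_smul]
    congr 2
    push_cast; ring

omit hΩ in
theorem IsDoubleCAR.creAnn_fallProd_symplTot {y : V} (hy : numDiff ψ d p q • y = (-2 : K) • y)
    (m : ℕ) (v : K) :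
    creAnn ν s ψ q • fallProd (symplTot ν s ψ d p F) m v • y =
      fallProd (symplTot ν s ψ d p F) m v • creAnn ν s ψ q • y +
      (m * (v + 1 - (m - 1) / 2)) • ((symplOmega ν s ψ *
        fallProd (symplTot ν s ψ d p F) (m - 1) (v - 1)) • y) := by
  induction m generalizing v with
  | zero => simp [fallProd]
  | succ m ih =>
    have hz := IsVacuum.smul_numDiff D (D.numDiff_symplTot (ν := ν) (s := s)) m (v - 1) hy
    set z := fallProd (symplTot ν s ψ d p F) m (v - 1) • y with hzd
    have h3 : symplTot ν s ψ d p F v • ((m * (v - 1 + 1 - (m - 1) / 2)) •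
        ((symplOmega ν s ψ * fallProd (symplTot ν s ψ d p F) (m - 1) (v - 1 - 1)) • y)) =
        (m * (v - 1 + 1 - (m - 1) / 2)) • symplOmega ν s ψ • z := by
      rcases m with _ | m
      · simp
      · rw [smul_comm, ← mul_smul (symplTot _ _ _ _ _ _ _), Nat.add_sub_cancel,
          D.symplTot_symplOmega_fallProd hF m, mul_smul (symplOmega _ _ _), ← hzd]
    rw [fallProd, mul_smul, ← hzd, ← mul_smul (creAnn _ _ _ _), D.creAnn_symplTot hF, sub_smul,
      add_smul, mul_smul (symplTot _ _ _ _ _ _ _) (creAnn _ _ _ _), hzd, ih, ← hzd,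
      smul_add, h3, smul_assoc, smul_assoc, mul_smul (symplOmega _ _ _) (numDiff _ _ _ _), hz,
      Nat.add_sub_cancel, mul_smul (symplOmega _ _ _) (fallProd _ _ _), ← hzd,
      smul_comm (symplOmega ν s ψ) (-2 : K), ← mul_smul]
    generalize symplOmega ν s ψ • z = a
    generalize (symplTot ν s ψ d p F v * fallProd (symplTot ν s ψ d p F) m (v - 1)) • (_ : V) = b
    push_cast
    match_scalars
    · ring
    · field_simp; ring

/-- The two quadratic terms do not vanish here. Reordered so that `annCre` and `creAnn` stand on the
left, where the functional kills them, each leaves `2 τ`, and these cancel. -/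
theorem IsVacuum.map_bos_eq_sympl {x : V}
    (hx : ∀ i j, invGen ν (s i * s j) ψ d p q F G i j • x = 0)
    (hx' : numDiff ψ d p q • x = 0) : φ (bos ψ p F • x) = φ (bos ψ p G • x) := by
  have h := D.bos_sub_bos ν s 1
  have h1 : ∑ b, s b • (d (ν b) * p b) = -annCre ν s d p := by
    rw [annCre, ← Finset.sum_neg_distrib]
    refine Finset.sum_congr rfl fun b _ => ?_
    rw [hF.s_neg]; module
  have h2 : ∑ r, s r • (ψ r * q (ν r)) = -creAnn ν s ψ q := by
    rw [creAnn, ← Finset.sum_neg_distrib, ← sum_comp_of_invol hF.invol]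
    refine Finset.sum_congr rfl fun b _ => ?_
    rw [hF.s_neg, hF.invol]; module
  have h4 : symplOmega ν s ψ * annCre ν s d p = annCre ν s d p * symplOmega ν s ψ +
      (2 : K) • tau ψ p := by
    rw [D.annCre_symplOmega hF, sub_add_cancel]
  have h5 : symplOmega ν s p * creAnn ν s ψ q = creAnn ν s ψ q * symplOmega ν s p +
      (2 : K) • tau ψ p := by
    rw [D.creAnn_symplOmega_p hF.invol hF.s_neg hF.s_sq, sub_add_cancel]
  rw [h1, h2, symplOmega_neg hF, symplOmega_neg hF, neg_mul_neg, neg_mul_neg, one_smul, h4, h5,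
    add_sub_add_right_eq_sub] at h
  have h3 := congrArg (fun r => φ (r • x)) h
  simp only [one_mul, sub_smul, Finset.sum_smul, mul_smul, hx, smul_zero,
    hx', Finset.sum_const_zero, map_zero, map_sub, hΩ.map_annCre D, hΩ.map_creAnn D, sub_zero] at h3
  exact sub_eq_zero.1 h3

/-- The argument of the orthogonal case with `τ` and `bos G` exchanged: `bos G` commutes with `f`,
and the discrepancy between `f τ Ω` and `τ f Ω` is eliminated through `creAnn`. -/
theorem IsVacuum.symplTot_newton (hG : ∀ i j, G i j = -((s i * s j) • G (ν j) (ν i))) (n : ℕ)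
    {v u : K} (hu : v + 1 = u + (n + 1) / 2) (hu1 : u + 1 ≠ 0) :
    φ (fallProd (symplTot ν s ψ d p F) (n + 1) (v + 1) • Ω) =
      φ (fallProd (symplTot ν s ψ d p F) (n + 1) v • Ω) +
      ((n + 1) * (2 * u + 1) / (2 * (u + 1))) •
        φ (fallProd (symplTot ν s ψ d p F) n v • tau ψ p • Ω) := by
  set f := fallProd (symplTot ν s ψ d p F) n v with hf
  have h1 : φ (fallProd (symplTot ν s ψ d p F) (n + 1) v • Ω) =
      φ (f • bos ψ p G • Ω) + (v - n) • φ (f • tau ψ p • Ω) := by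
    rw [fallProd_succ', ← hf, mul_smul, symplTot, genTot, add_smul, add_smul, hΩ.bos_vac D,
      smul_assoc, smul_assoc, mul_smul (symplOmega _ _ _), hΩ.annCre_vac D, smul_zero, smul_zero,
      add_zero, smul_add, map_add, smul_comm f (v - n : K), φ.map_smul]
  have h2 : f • bos ψ p G • Ω = bos ψ p G • f • Ω := by
    rw [← mul_smul, ← (commute_fallProd (fun w =>
      (D.symplTot_bos hF.invol hF.s_neg hF.s_sq hG w).symm) n v).eq, mul_smul]
  have h3 : φ (f • tau ψ p • Ω) = φ (tau ψ p • f • Ω) + ((n : K) / 2) •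
      φ ((symplOmega ν s ψ * fallProd (symplTot ν s ψ d p F) (n - 1) (v - 1)) •
        symplOmega ν s p • Ω) := by
    rw [← mul_smul, D.fallProd_symplTot_tau hF n v, add_smul, map_add, mul_smul, smul_assoc,
      φ.map_smul, mul_smul (_ * _) (symplOmega _ _ _)]
  have h4 : (2 : K) • φ (f • tau ψ p • Ω) = (n * (v + 1 - (n - 1) / 2)) •
      φ ((symplOmega ν s ψ * fallProd (symplTot ν s ψ d p F) (n - 1) (v - 1)) •
        symplOmega ν s p • Ω) := by
    have hy : numDiff ψ d p q • symplOmega ν s p • Ω = (-2 : K) • symplOmega ν s p • Ω := by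
      rw [← mul_smul, D.numDiff_symplOmega_p, sub_smul, mul_smul, hΩ.numDiff_vac D, smul_zero,
        zero_sub, smul_assoc, neg_smul]
    have h5 := congrArg φ (D.creAnn_fallProd_symplTot hF hy n v)
    rw [hΩ.map_creAnn D, ← mul_smul (creAnn _ _ _ _),
      D.creAnn_symplOmega_p hF.invol hF.s_neg hF.s_sq, sub_smul, mul_smul, hΩ.creAnn_vac D,
      smul_zero, zero_sub, smul_assoc, smul_neg, smul_comm f, map_add, map_neg, φ.map_smul,
      φ.map_smul] at h5
    rw [← neg_add_eq_zero]
    exact h5.symm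
  -- By `d_symplT` the leftmost factor at `v + 1` acts as `η` at `v + 2`.
  have h7 : φ (fallProd (symplTot ν s ψ d p F) (n + 1) (v + 1) • Ω) =
      φ (genTot ψ p F (v + 2) • f • Ω) := by
    rw [fallProd, add_sub_cancel_right, ← hf, mul_smul, ← D.sum_symplT_mul hF.s_neg,
      ← D.sum_etaShift_mul, Finset.sum_smul, Finset.sum_smul]
    simp only [mul_smul]
    have := hΩ.map_congr D (x := fun b => symplT ν s ψ d F b (v + 1))
      (y := fun b => etaShift ψ F b (v + 2)) (c := (1 : K)) (ν := ν) (fun b => by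
        have := d_symplT D.row hF b (v + 1)
        rw [add_assoc, one_add_one_eq_two] at this
        rw [this, one_smul]) fun b => p b • f • Ω
    rw [this, one_smul]
  have h8 : φ (bos ψ p F • f • Ω) = φ (bos ψ p G • f • Ω) :=
    hΩ.map_bos_eq_sympl D hF (fun i j => hΩ.invGen_fallProd D (D.invGen_symplTot hF i j) n v)
      (hΩ.numDiff_fallProd D D.numDiff_symplTot n v)
  rw [h7, h1, genTot, add_smul, map_add, h8, smul_assoc, φ.map_smul, h2]
  set x := φ (f • tau ψ p • Ω)
  set Z := φ (tau ψ p • f • Ω)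
  set t := φ (bos ψ p G • f • Ω)
  set Y := φ ((symplOmega ν s ψ * fallProd (symplTot ν s ψ d p F) (n - 1) (v - 1)) •
        symplOmega ν s p • Ω)
  have h9 : ((n : K) / 2) • Y = (u + 1)⁻¹ • x := by
    have h10 := congrArg (fun w => (2 * (u + 1))⁻¹ • w) h4
    simp only [smul_smul] at h10
    have e1 : (2 * (u + 1))⁻¹ * 2 = (u + 1)⁻¹ := by field_simp
    have e2 : (2 * (u + 1))⁻¹ * (n * (v + 1 - (n - 1) / 2)) = (n : K) / 2 := by
      have : v + 1 - ((n : K) - 1) / 2 = u + 1 := by rw [hu]; ring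
      rw [this]; field_simp
    rw [e1, e2] at h10
    exact h10.symm
  rw [h9] at h3
  have hZ : Z = x - (u + 1)⁻¹ • x := by rw [eq_sub_iff_add_eq]; exact h3.symm
  have hv : v = u + (n + 1) / 2 - 1 := by rw [← hu]; ring
  rw [hZ]
  clear_value x t
  match_scalars
  · ring
  · rw [hv]; field_simp; ring

end Sympl

end Expectation


/-! ## Functoriality -/

section Map

variable {K R R' I : Type*} [Field K] [CharZero K] [Ring R] [Algebra K R] [Ring R'] [Algebra K R']
  [Fintype I] [DecidableEq I] (f : R →ₐ[K] R')

theorem IsGenLin.map {F : I → I → R} (hF : IsGenLin F) : IsGenLin fun i j => f (F i j) := by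
  intro i j k l
  rw [← map_mul, ← map_mul, ← map_sub, hF]
  simp only [map_sub, apply_ite f, map_zero]

theorem IsClassical.map {ν : I → I} {s : I → K} {ε : K} {F : I → I → R}
    (hF : IsClassical ν s ε F) : IsClassical ν s ε fun i j => f (F i j) where
  invol := hF.invol
  s_sq := hF.s_sq
  s_neg := hF.s_neg
  symm i j := by rw [hF.symm i j, map_neg, map_smul]
  comm i j k l := by
    rw [← map_mul, ← map_mul, ← map_sub, hF.comm]
    simp only [map_sub, apply_ite f, map_zero, map_smul]

theorem map_eta (ψ : I → R) (F : I → I → R) (b : I) :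
    f (eta ψ F b) = eta (fun i => f (ψ i)) (fun i j => f (F i j)) b := by
  simp only [eta, map_sum, map_mul]

theorem map_etaShift (ψ : I → R) (F : I → I → R) (b : I) (v : K) :
    f (etaShift ψ F b v) = etaShift (fun i => f (ψ i)) (fun i j => f (F i j)) b v := by
  simp only [etaShift, map_add, map_smul, map_eta]

theorem map_orthT (ν : I → I) (ψ d : I → R) (F : I → I → R) (b : I) (v : K) :
    f (orthT ν ψ d F b v) =
      orthT ν (fun i => f (ψ i)) (fun i => f (d i)) (fun i j => f (F i j)) b v := by
  simp only [orthT, map_add, map_smul, map_etaShift, map_mul, orthTheta, map_sum, map_eta]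

theorem map_symplT (ν : I → I) (s : I → K) (ψ d : I → R) (F : I → I → R) (b : I) (v : K) :
    f (symplT ν s ψ d F b v) =
      symplT ν s (fun i => f (ψ i)) (fun i => f (d i)) (fun i j => f (F i j)) b v := by
  simp only [symplT, map_sub, map_smul, map_etaShift, map_mul, symplOmega, map_sum]

end Map

/-! ## The Fock space over an algebra -/

section FockAlgebra

variable {K A α I : Type*} [Field K] [CharZero K] [Ring A] [Algebra K A] [LinearOrder α]
  [Fintype α] [Fintype I] [DecidableEq I]

section Rows

variable (K A)

/-- Creation operators for the rows. -/
def rowCre (κ : I ≃ α) (ν : I → I) (i : I) : Module.End K (Fock α A) := cre K A (κ (ν i))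

/-- Annihilation operators for the rows. -/
def rowAnn (κ : I ≃ α) (ν : I → I) (i : I) : Module.End K (Fock α A) := ann K A (κ (ν i))

variable {A} (α)

/-- Left multiplication by the entries of a matrix. -/
def rowMul (F : I → I → A) (i j : I) : Module.End K (Fock α A) :=
  lift K α A (Algebra.lmul K A (F i j))

/-- Right multiplication by the entries of a matrix. -/
def rowMulRight (F : I → I → A) (i j : I) : Module.End K (Fock α A) :=
  lift K α A (LinearMap.mulRight K (F i j))

end Rows

variable (κ : I ≃ α) (ν : I → I) (F : I → I → A)

theorem rowCre_rowMul (i j k : I) :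
    rowCre K A κ ν i * rowMul K α F j k = rowMul K α F j k * rowCre K A κ ν i :=
  cre_lift _ _

theorem rowAnn_rowMul (i j k : I) :
    rowAnn K A κ ν i * rowMul K α F j k = rowMul K α F j k * rowAnn K A κ ν i :=
  ann_lift _ _

theorem rowAnn_vac (i : I) (x : A) : rowAnn K A κ ν i (vac α x) = 0 := ann_vac _ _

variable {ν} (hν : ∀ i, ν (ν i) = i)
include hν

theorem isCAR_row : IsCAR (rowCre K A κ ν) (rowAnn K A κ ν) :=
  isCAR_cre_ann.comp (e := fun i => κ (ν i))
    (κ.injective.comp (Function.LeftInverse.injective hν))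

/-- The two families of fermions on the double Fock space. -/
theorem isDoubleCAR_fock : IsDoubleCAR (R := Module.End K (Fock α (Fock α A)))
    (fun i => lift K α _ (rowCre K A κ ν i)) (fun i => lift K α _ (rowAnn K A κ ν i))
    (fun b => cre K (Fock α A) (κ b)) (fun b => ann K (Fock α A) (κ b))
    (fun i j => lift K α _ (rowMul K α F i j)) (fun i j => lift K α _ (rowMulRight K α F i j)) where
  row := (isCAR_row κ hν).map (lift K α (Fock α A)).toRingHom
  col := isCAR_cre_ann.comp κ.injective
  psi_p i j := (cre_lift _ _).symm
  psi_q i j := (ann_lift _ _).symm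
  d_p i j := (cre_lift _ _).symm
  d_q i j := (ann_lift _ _).symm
  psi_F i j k := Commute.map (rowCre_rowMul κ ν F i j k) (lift K α (Fock α A))
  d_F i j k := Commute.map (rowAnn_rowMul κ ν F i j k) (lift K α (Fock α A))
  p_F i j k := cre_lift _ _
  q_F i j k := ann_lift _ _
  psi_G i j k := Commute.map (cre_lift (κ (ν i)) (LinearMap.mulRight K (F j k)))
    (lift K α (Fock α A))
  d_G i j k := Commute.map (ann_lift (κ (ν i)) (LinearMap.mulRight K (F j k)))
    (lift K α (Fock α A))
  p_G i j k := cre_lift _ _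
  q_G i j k := ann_lift _ _
  F_G i j k l := by
    refine Commute.map (Commute.map ?_ (lift K α A)) (lift K α (Fock α A))
    ext x
    simp [mul_assoc]

/-- The coefficient of the fully occupied state. -/
def topCoeff (K α A : Type*) [Field K] [Fintype α] [Ring A] [Algebra K A] :
    Fock α (Fock α A) →ₗ[K] A :=
  Fock.coeff K Finset.univ ∘ₗ Fock.coeff K Finset.univ

/-- Left and right multiplication agree on the vacuum because its coefficient is `1`. An annihilator
never has a fully occupied component, so the top coefficient kills its image. -/
theorem isVacuum_fock : IsVacuum (R := Module.End K (Fock α (Fock α A)))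
    (fun i => lift K α _ (rowCre K A κ ν i)) (fun i => lift K α _ (rowAnn K A κ ν i))
    (fun b => cre K (Fock α A) (κ b)) (fun b => ann K (Fock α A) (κ b))
    (fun i j => lift K α _ (rowMul K α F i j)) (fun i j => lift K α _ (rowMulRight K α F i j))
    (vac α (vac α (1 : A))) (topCoeff K α A) where
  d_vac i := by
    rw [Module.End.smul_def, lift_vac, rowAnn_vac]
    ext S; simp [vac]
  q_vac i := ann_vac _ _
  F_vac i j := by
    simp only [Module.End.smul_def, rowMul, rowMulRight, lift_vac]
    simp
  map_d i x := by
    simp [topCoeff, Module.End.smul_def, rowAnn, ann_apply]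
  map_q i x := by
    simp [topCoeff, Module.End.smul_def, ann_apply]

end FockAlgebra

/-! ## Determinants and cofactors -/

section Determinant

variable {K A α I : Type*} [Field K] [CharZero K] [Ring A] [Algebra K A] [LinearOrder α]
  [Fintype α] [Fintype I] [DecidableEq I]

/-- The entry `F i j + v δ i j`. -/
def entry (F : I → I → A) (i j : I) (v : K) : A := F i j + if i = j then algebraMap K A v else 0

/-- The coefficient of the fully occupied state in the ordered product of the `T k`. -/
def fockDet (T : α → K → Module.End K (Fock α A)) (v : K) : A :=
  setProd T Finset.univ v (vac α 1) Finset.univ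

/-- The cofactors of `fockDet`. -/
def fockCof (κ : I ≃ α) (ν : I → I) (T : α → K → Module.End K (Fock α A)) (v : K) (b c : I) : A :=
  sgnGt (κ b) Finset.univ • setProd T (Finset.univ.erase (κ b)) v
    (rowCre K A κ ν c (vac α 1)) Finset.univ

/-- The common properties of the three families of operators. -/
structure IsDetFamily (κ : I ≃ α) (ν : I → I) (F : I → I → A)
    (T : α → K → Module.End K (Fock α A)) : Prop where
  anticomm : ∀ b c v, Generic v → T b v * T c (v - 1) + T c v * T b (v - 1) = 0
  apply_vac : ∀ x v y, T (κ x) v (vac α y) = ∑ c, rowCre K A κ ν c (vac α (entry F c x v * y))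
  commute_mulRight : ∀ l v x, Commute (T l v) (lift K α A (LinearMap.mulRight K x))

variable {κ : I ≃ α} {ν : I → I} {F : I → I → A} {T : α → K → Module.End K (Fock α A)}
  (hT : IsDetFamily κ ν F T)
include hT

theorem IsDetFamily.setProd_cre_vac_mul (s t : Finset α) (c : I) (v : K) (x : A) :
    setProd T s v (rowCre K A κ ν c (vac α x)) t =
      setProd T s v (rowCre K A κ ν c (vac α 1)) t * x := by
  have h := congrArg (fun g : Module.End K (Fock α A) => g (rowCre K A κ ν c (vac α 1)) t)
    (setProd_comm_lift (fun l v => hT.commute_mulRight l v x) s v).eq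
  simp only [Module.End.mul_apply, lift_apply, LinearMap.mulRight_apply] at h
  have h2 := LinearMap.congr_fun (cre_lift (κ (ν c)) (LinearMap.mulRight K x)) (vac α 1)
  rw [Module.End.mul_apply, Module.End.mul_apply, lift_vac, LinearMap.mulRight_apply, one_mul] at h2
  rw [← h, rowCre, h2]

/-- Laplace expansion along the last factor: `T (κ x)` on the vacuum creates the column of entries.
If `x = b` it supplies the missing label; otherwise the label `κ x` occurs twice and the product is
zero. The last position has parameter `v - n`. -/
theorem IsDetFamily.sum_cof_mul_entry {n : ℕ} (hn : Fintype.card α = n + 1) {v : K}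
    (hv : Generic v) (b x : I) : ∑ c, fockCof κ ν T v b c * entry F c x (v - n) =
      if b = x then fockDet T v else 0 := by
  have h1 : ∑ c, fockCof κ ν T v b c * entry F c x (v - n) = sgnGt (κ b) Finset.univ •
      (setProd T (Finset.univ.erase (κ b)) v * T (κ x) (v - n)) (vac α 1) Finset.univ := by
    rw [Module.End.mul_apply, hT.apply_vac, map_sum, Fock.sum_apply, Finset.smul_sum]
    refine Finset.sum_congr rfl fun c _ => ?_
    rw [hT.setProd_cre_vac_mul, fockCof, smul_mul_assoc, mul_one]
  rw [h1]
  split_ifs with h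
  · subst h
    rw [fockDet, setProd_back hT.anticomm (Finset.mem_univ (κ b)) hv, Finset.card_univ, hn,
      Nat.add_sub_cancel]
    rfl
  · have h2 : κ x ∈ Finset.univ.erase (κ b) :=
      Finset.mem_erase.2 ⟨fun h' => h (κ.injective h').symm, Finset.mem_univ _⟩
    have h3 := setProd_mul_self hT.anticomm h2 hv
    rw [Finset.card_erase_of_mem (Finset.mem_univ _), Finset.card_univ, hn,
      Nat.add_sub_cancel] at h3
    rw [h3]; simp

theorem IsDetFamily.topCoeff_fallProd {v : K} (hv : Generic v) :
    topCoeff K α A (fallProd (colSum T) (Fintype.card α) v • vac α (vac α 1)) =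
      ((Fintype.card α).factorial : K) • fockDet T v := by
  have h := fallProd_colSum_univ hT.anticomm hv (vac α (1 : A))
  rw [Nat.cast_smul_eq_nsmul K]
  exact congrArg (fun f : Fock α A => f Finset.univ) h

/-- `τ` creates row `b` and column `b` together with coefficient one, so the factor it replaces
contributes the diagonal cofactors. -/
theorem IsDetFamily.topCoeff_fallProd_tau {n : ℕ} (hn : Fintype.card α = n + 1) {v : K}
    (hv : Generic v) :
    topCoeff K α A (fallProd (colSum T) n v • tau (R := Module.End K (Fock α (Fock α A)))
      (fun i => lift K α _ (rowCre K A κ ν i)) (fun b => cre K (Fock α A) (κ b)) •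
        vac α (vac α 1)) = (n.factorial : K) • ∑ b, fockCof κ ν T v b b := by
  have h := fallProd_colSum_sum_cre hT.anticomm hn hv
    (fun k => rowCre K A κ ν (κ.symm k) (vac α (1 : A)))
  have h2 : tau (R := Module.End K (Fock α (Fock α A)))
      (fun i => lift K α _ (rowCre K A κ ν i)) (fun b => cre K (Fock α A) (κ b)) •
        vac α (vac α (1 : A)) =
      ∑ k, cre K (Fock α A) k (vac α (rowCre K A κ ν (κ.symm k) (vac α (1 : A)))) := by
    rw [tau, Finset.sum_smul, ← Equiv.sum_comp κ]
    refine Finset.sum_congr rfl fun b _ => ?_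
    rw [Equiv.symm_apply_apply, ← cre_lift, mul_smul, Module.End.smul_def, Module.End.smul_def,
      lift_vac]
  rw [h2, Module.End.smul_def, Nat.cast_smul_eq_nsmul K]
  refine (congrArg (fun f : Fock α A => f Finset.univ) h).trans ?_
  simp only [Fock.nsmul_apply, Fock.sum_apply, Fock.zsmul_apply]
  congr 1
  rw [← Equiv.sum_comp κ]
  simp only [Equiv.symm_apply_apply, fockCof]

end Determinant


/-! ### Commutation of the operators with outside elements -/

section Commute

variable {K R I : Type*} [Field K] [CharZero K] [Ring R] [Algebra K R] [Fintype I] [DecidableEq I]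
  {ψ d : I → R} {F : I → I → R} {ν : I → I} {s : I → K} {x : R}

theorem commute_etaShift (hψ : ∀ i, Commute x (ψ i)) (hF : ∀ i j, Commute x (F i j)) (b : I)
    (v : K) : Commute x (etaShift ψ F b v) :=
  (Commute.sum_right _ _ _ fun i _ => (hψ i).mul_right (hF i b)).add_right ((hψ b).smul_right v)

theorem commute_orthT (hψ : ∀ i, Commute x (ψ i)) (hd : ∀ i, Commute x (d i))
    (hF : ∀ i j, Commute x (F i j)) (b : I) (v : K) : Commute x (orthT ν ψ d F b v) :=
  (commute_etaShift hψ hF b v).add_right (Commute.smul_right (Commute.mul_right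
    (Commute.sum_right _ _ _ fun j _ => Commute.mul_right
      (Commute.sum_right _ _ _ fun i _ => (hψ i).mul_right (hF i _)) (hψ j)) (hd _)) _)

theorem commute_symplT (hψ : ∀ i, Commute x (ψ i)) (hd : ∀ i, Commute x (d i))
    (hF : ∀ i j, Commute x (F i j)) (b : I) (v : K) : Commute x (symplT ν s ψ d F b v) :=
  (commute_etaShift hψ hF b v).sub_right (Commute.smul_right (Commute.mul_right
    (Commute.sum_right _ _ _ fun j _ => Commute.smul_right ((hψ _).mul_right (hψ j)) _) (hd _)) _)

theorem etaShift_psi (h : IsCAR ψ d) (hψ : ∀ i j k, ψ i * F j k = F j k * ψ i) (b c : I) (v : K) :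
    etaShift ψ F b v * ψ c = -(ψ c * etaShift ψ F b v) := by
  rw [etaShift, add_mul, mul_add, eta_psi h hψ, smul_mul_assoc, h.psi_psi b c, mul_smul_comm]
  module

theorem orthT_psi (h : IsCAR ψ d) (hψ : ∀ i j k, ψ i * F j k = F j k * ψ i) {b c : I}
    (hbc : ν b ≠ c) (v : K) : orthT ν ψ d F b v * ψ c = -(ψ c * orthT ν ψ d F b v) := by
  have h1 : d (ν b) * ψ c = -(ψ c * d (ν b)) := by rw [h.d_psi, if_neg hbc, zero_sub]
  rw [orthT, add_mul, mul_add, etaShift_psi h hψ, smul_mul_assoc, mul_assoc, h1, mul_smul_comm,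
    ← mul_assoc (ψ c), psi_orthTheta h hψ, mul_assoc, mul_neg]
  module

theorem symplT_psi (h : IsCAR ψ d) (hψ : ∀ i j k, ψ i * F j k = F j k * ψ i) {b c : I}
    (hbc : ν b ≠ c) (v : K) : symplT ν s ψ d F b v * ψ c = -(ψ c * symplT ν s ψ d F b v) := by
  have h1 : d (ν b) * ψ c = -(ψ c * d (ν b)) := by rw [h.d_psi, if_neg hbc, zero_sub]
  rw [symplT, sub_mul, mul_sub, etaShift_psi h hψ, smul_mul_assoc, mul_assoc, h1, mul_smul_comm,
    ← mul_assoc (ψ c), psi_symplOmega h, mul_assoc, mul_neg]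
  module

end Commute

/-! ### The three families on the Fock space -/

section Families

variable {K A α I : Type*} [Field K] [CharZero K] [Ring A] [Algebra K A] [LinearOrder α]
  [Fintype α] [Fintype I] [DecidableEq I] (κ : I ≃ α) {ν : I → I} (hν : ∀ i, ν (ν i) = i)
  (F : I → I → A) {s : I → K}

/-- The operators `η (v)` on the Fock space. -/
def genFamily (ν : I → I) (k : α) (v : K) : Module.End K (Fock α A) :=
  etaShift (rowCre K A κ ν) (rowMul K α F) (κ.symm k) v

/-- The operators `T (v)` on the Fock space in the orthogonal case. -/
def orthFamily (ν : I → I) (k : α) (v : K) : Module.End K (Fock α A) :=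
  orthT ν (rowCre K A κ ν) (rowAnn K A κ ν) (rowMul K α F) (κ.symm k) v

/-- The operators `T (v)` on the Fock space in the symplectic case. -/
def symplFamily (ν : I → I) (s : I → K) (k : α) (v : K) : Module.End K (Fock α A) :=
  symplT ν s (rowCre K A κ ν) (rowAnn K A κ ν) (rowMul K α F) (κ.symm k) v

theorem etaShift_row_eq (ν : I → I) (b : I) (v : K) :
    etaShift (rowCre K A κ ν) (rowMul K α F) b v =
      ∑ c, rowCre K A κ ν c * lift K α A (Algebra.lmul K A (entry F c b v)) := by
  have h : ∀ c, rowCre K A κ ν c * lift K α A (Algebra.lmul K A (entry F c b v)) =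
      rowCre K A κ ν c * rowMul K α F c b + if c = b then v • rowCre K A κ ν b else 0 := by
    intro c
    rw [entry, map_add, map_add, mul_add, rowMul]
    congr 1
    split_ifs with h
    · rw [h, AlgHom.commutes, AlgHom.commutes, ← Algebra.commutes, Algebra.smul_def]
    · simp
  simp only [h, Finset.sum_add_distrib, Finset.sum_ite_eq', Finset.mem_univ, if_true, etaShift, eta]

theorem etaShift_row_vac (ν : I → I) (b : I) (v : K) (y : A) :
    etaShift (rowCre K A κ ν) (rowMul K α F) b v (vac α y) =
      ∑ c, rowCre K A κ ν c (vac α (entry F c b v * y)) := by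
  rw [etaShift_row_eq, LinearMap.sum_apply]
  refine Finset.sum_congr rfl fun c _ => ?_
  rw [Module.End.mul_apply, lift_vac]
  rfl

include hν in
theorem etaShift_row_apply (b : I) (v : K) (f : Fock α A) (S : Finset α) :
    etaShift (rowCre K A κ ν) (rowMul K α F) b v f S =
      ∑ k ∈ S, sgnLt k S • (entry F (ν (κ.symm k)) b v * f (S.erase k)) := by
  rw [etaShift_row_eq, LinearMap.sum_apply, Fock.sum_apply]
  have h : ∀ c, (rowCre K A κ ν c * lift K α A (Algebra.lmul K A (entry F c b v))) f S =
      if κ (ν c) ∈ S then sgnLt (κ (ν c)) S • (entry F c b v * f (S.erase (κ (ν c)))) else 0 :=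
    fun c => rfl
  simp only [h]
  rw [← sum_comp_of_invol hν]
  simp only [hν]
  rw [Finset.sum_ite, Finset.sum_const_zero, add_zero]
  refine Finset.sum_bij (fun c _ => κ c) ?_ ?_ ?_ ?_
  · intro c hc; simpa using hc
  · intro c _ e _ h; exact κ.injective h
  · intro k hk; exact ⟨κ.symm k, by simpa using hk, by simp⟩
  · intro c _; simp

include hν in
-- The annihilator `rowAnn (ν b)` removes the label `κ b`, so it retains precisely the components
-- containing that label.
theorem apply_eq_of_ann_mul {T : Module.End K (Fock α A)} {T' : Module.End K (Fock α A)} {b : I}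
    {c : K} (h : rowAnn K A κ ν (ν b) * T = c • (rowAnn K A κ ν (ν b) * T')) (f : Fock α A)
    {S : Finset α} (hS : κ b ∈ S) : T f S = c • T' f S := by
  have h1 := congrArg (fun g : Fock α A => g (S.erase (κ b))) (LinearMap.congr_fun h f)
  simp only [rowAnn, hν, Module.End.mul_apply, LinearMap.smul_apply, Fock.smul_apply, ann_apply,
    Finset.notMem_erase, if_false, Finset.insert_erase hS] at h1
  have h2 := congrArg (fun y => sgnLt (κ b) (S.erase (κ b)) • y) h1
  simp only [smul_comm _ c, smul_smul, sgnLt_mul_self, one_smul] at h2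
  exact h2

/-! ### Determinant families -/

theorem isDetFamily_genFamily (hF : IsGenLin F) : IsDetFamily κ id F (genFamily (K := K) κ F id) where
  anticomm b c v hv := etaShift_anticomm_of_isGenLin (isCAR_row κ fun _ => rfl)
    (rowCre_rowMul κ id F) (hF.map ((lift K α A).comp (Algebra.lmul K A))) _ _ _
  apply_vac x v y := by rw [genFamily, Equiv.symm_apply_apply, etaShift_row_vac]
  commute_mulRight l v x := (commute_etaShift (fun i => (cre_lift _ _).symm) (fun i j => by
    refine Commute.map ?_ (lift K α A)
    ext y; simp [mul_assoc]) _ _).symm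

theorem isDetFamily_orthFamily (hF : IsClassical ν (fun _ => (1 : K)) 1 F) :
    IsDetFamily κ ν F (orthFamily (K := K) κ F ν) where
  anticomm b c v hv := orthT_anticomm (isCAR_row κ hF.invol) (rowCre_rowMul κ ν F)
    (rowAnn_rowMul κ ν F) (hF.map ((lift K α A).comp (Algebra.lmul K A))) _ _ hv
  apply_vac x v y := by
    rw [orthFamily, Equiv.symm_apply_apply, orthT, LinearMap.add_apply, LinearMap.smul_apply,
      Module.End.mul_apply, rowAnn_vac, map_zero, smul_zero, add_zero, etaShift_row_vac]
  commute_mulRight l v x := (commute_orthT (fun i => (cre_lift _ _).symm)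
    (fun i => (ann_lift _ _).symm) (fun i j => by
      refine Commute.map ?_ (lift K α A)
      ext y; simp [mul_assoc]) _ _).symm

theorem isDetFamily_symplFamily (hF : IsClassical ν s (-1) F) :
    IsDetFamily κ ν F (symplFamily κ F ν s) where
  anticomm b c v hv := symplT_anticomm (isCAR_row κ hF.invol) (rowCre_rowMul κ ν F)
    (rowAnn_rowMul κ ν F) (hF.map ((lift K α A).comp (Algebra.lmul K A))) _ _ _
  apply_vac x v y := by
    rw [symplFamily, Equiv.symm_apply_apply, symplT, LinearMap.sub_apply, LinearMap.smul_apply,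
      Module.End.mul_apply, rowAnn_vac, map_zero, smul_zero, sub_zero, etaShift_row_vac]
  commute_mulRight l v x := (commute_symplT (fun i => (cre_lift _ _).symm)
    (fun i => (ann_lift _ _).symm) (fun i j => by
      refine Commute.map ?_ (lift K α A)
      ext y; simp [mul_assoc]) _ _).symm

theorem colSum_eq (T : I → K → Module.End K (Fock α A)) (v : K) :
    colSum (fun k => T (κ.symm k)) v = ∑ b, lift K α _ (T b v) * cre K (Fock α A) (κ b) := by
  rw [colSum, ← Equiv.sum_comp κ]
  simp only [Equiv.symm_apply_apply]

theorem colSum_genFamily : colSum (genFamily (K := K) κ F id) = genTot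
    (R := Module.End K (Fock α (Fock α A))) (fun i => lift K α _ (rowCre K A κ id i))
    (fun b => cre K (Fock α A) (κ b)) (fun i j => lift K α _ (rowMul K α F i j)) := by
  funext v
  rw [← (isDoubleCAR_fock (K := K) (ν := id) κ F fun _ => rfl).sum_etaShift_mul]
  refine (colSum_eq κ (etaShift (rowCre K A κ id) (rowMul K α F)) v).trans ?_
  simp only [map_etaShift]

theorem colSum_orthFamily (hν : ∀ i, ν (ν i) = i) : colSum (orthFamily (K := K) κ F ν) = orthTot ν
    (R := Module.End K (Fock α (Fock α A))) (fun i => lift K α _ (rowCre K A κ ν i))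
    (fun i => lift K α _ (rowAnn K A κ ν i)) (fun b => cre K (Fock α A) (κ b))
    (fun i j => lift K α _ (rowMul K α F i j)) := by
  funext v
  rw [← (isDoubleCAR_fock (K := K) κ F hν).sum_orthT_mul]
  refine (colSum_eq κ (orthT ν (rowCre K A κ ν) (rowAnn K A κ ν) (rowMul K α F)) v).trans ?_
  simp only [map_orthT]

theorem colSum_symplFamily (hF : IsClassical ν s (-1) F) : colSum (symplFamily κ F ν s) =
    symplTot ν s (R := Module.End K (Fock α (Fock α A))) (fun i => lift K α _ (rowCre K A κ ν i))
    (fun i => lift K α _ (rowAnn K A κ ν i)) (fun b => cre K (Fock α A) (κ b))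
    (fun i j => lift K α _ (rowMul K α F i j)) := by
  funext v
  rw [← (isDoubleCAR_fock (K := K) κ F hF.invol).sum_symplT_mul hF.s_neg]
  refine (colSum_eq κ (symplT ν s (rowCre K A κ ν) (rowAnn K A κ ν) (rowMul K α F)) v).trans ?_
  simp only [map_symplT]

/-! ### Centrality -/

/-- `invGen` kills the vacuum and commutes with the total operators, hence kills the whole product
applied to the vacuum. Left and right multiplication by `F i j` then agree on the top coefficient,
which is a nonzero multiple of the determinant. -/
theorem commute_fockDet_of_invGen {T : α → K → Module.End K (Fock α A)} (hT : IsDetFamily κ ν F T)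
    {i j : I} {θ : K} (h : ∀ v, Commute (invGen ν θ (R := Module.End K (Fock α (Fock α A)))
      (fun i => lift K α _ (rowCre K A κ ν i))
      (fun i => lift K α _ (rowAnn K A κ ν i)) (fun b => cre K (Fock α A) (κ b))
      (fun b => ann K (Fock α A) (κ b)) (fun i j => lift K α _ (rowMul K α F i j))
      (fun i j => lift K α _ (rowMulRight K α F i j)) i j) (colSum T v)) (hν : ∀ i, ν (ν i) = i)
    {v : K} (hv : Generic v) : Commute (F i j) (fockDet T v) := by
  have D := isDoubleCAR_fock (K := K) κ F hν
  have hΩ := isVacuum_fock (K := K) κ F hν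
  have h1 := hΩ.map_F_eq_map_G D hν (hΩ.invGen_fallProd D h (Fintype.card α) v)
  have h2 : ∀ x : Fock α (Fock α A), topCoeff K α A (lift K α _ (rowMul K α F i j) • x) =
      F i j * topCoeff K α A x := fun _ => rfl
  have h3 : ∀ x : Fock α (Fock α A), topCoeff K α A (lift K α _ (rowMulRight K α F i j) • x) =
      topCoeff K α A x * F i j := fun _ => rfl
  rw [h2, h3, hT.topCoeff_fallProd hv, mul_smul_comm, smul_mul_assoc] at h1
  have h4 : ((Fintype.card α).factorial : K) ≠ 0 := by exact_mod_cast Nat.factorial_ne_zero _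
  exact smul_right_injective A h4 h1

theorem commute_fockDet_genFamily (hF : IsGenLin F) (i j : I) {v : K} (hv : Generic v) :
    Commute (F i j) (fockDet (genFamily (K := K) κ F id) v) := by
  refine commute_fockDet_of_invGen κ F (isDetFamily_genFamily κ F hF) (θ := 0) (fun w => ?_)
    (fun _ => rfl) hv
  rw [colSum_genFamily]
  refine (isDoubleCAR_fock (K := K) κ F fun _ => rfl).invGen_genTot 0 i j (fun k l => ?_) w
  rw [zero_smul, sub_zero]
  exact hF.map ((lift K α (Fock α A)).comp ((lift K α A).comp (Algebra.lmul K A))) i j k l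

theorem commute_fockDet_orthFamily (hF : IsClassical ν (fun _ => (1 : K)) 1 F) (i j : I) {v : K}
    (hv : Generic v) : Commute (F i j) (fockDet (orthFamily (K := K) κ F ν) v) := by
  refine commute_fockDet_of_invGen κ F (isDetFamily_orthFamily κ F hF) (θ := 1) (fun w => ?_)
    hF.invol hv
  rw [colSum_orthFamily κ F hF.invol]
  exact (isDoubleCAR_fock (K := K) κ F hF.invol).invGen_orthTot
    (hF.map ((lift K α (Fock α A)).comp ((lift K α A).comp (Algebra.lmul K A)))) i j w

theorem commute_fockDet_symplFamily (hF : IsClassical ν s (-1) F) (i j : I) {v : K}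
    (hv : Generic v) : Commute (F i j) (fockDet (symplFamily κ F ν s) v) := by
  refine commute_fockDet_of_invGen κ F (isDetFamily_symplFamily κ F hF) (θ := s i * s j)
    (fun w => ?_) hF.invol hv
  rw [colSum_symplFamily κ F hF]
  exact (isDoubleCAR_fock (K := K) κ F hF.invol).invGen_symplTot
    (hF.map ((lift K α (Fock α A)).comp ((lift K α A).comp (Algebra.lmul K A)))) i j w

/-! ### The difference equations -/

theorem lift_rowMulRight_eq {i j k l : I} {c : K} (h : F i j = -(c • F k l)) :
    lift K α (Fock α A) (rowMulRight K α F i j) =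
      -(c • lift K α (Fock α A) (rowMulRight K α F k l)) := by
  have h' : (LinearMap.mulRight K (F i j) : Module.End K A) =
      -(c • LinearMap.mulRight K (F k l) : Module.End K A) := by
    ext x
    simp [h]
  rw [rowMulRight, rowMulRight, h', map_neg (lift K α A), map_neg (lift K α (Fock α A)),
    map_smul (lift K α A), map_smul (lift K α (Fock α A))]

variable {n : ℕ} (hn : Fintype.card α = n + 1)
include hn

theorem fockDet_genFamily_add_one (hF : IsGenLin F) {v : K} (hv : Generic v) :
    fockDet (genFamily (K := K) κ F id) (v + 1) = fockDet (genFamily κ F id) v +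
      ∑ b, fockCof κ id (genFamily κ F id) v b b := by
  have hT := isDetFamily_genFamily (K := K) κ F hF
  have D := isDoubleCAR_fock (K := K) (ν := id) κ F fun _ => rfl
  have hΩ := isVacuum_fock (K := K) (ν := id) κ F fun _ => rfl
  have h1 := hΩ.genTot_newton D n v
  rw [← colSum_genFamily, hT.topCoeff_fallProd_tau hn hv, ← hn, hT.topCoeff_fallProd hv,
    hT.topCoeff_fallProd (by simpa using hv.add_int 1), smul_smul] at h1
  have h4 : ((Fintype.card α).factorial : K) ≠ 0 := by exact_mod_cast Nat.factorial_ne_zero _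
  refine smul_right_injective A h4 ?_
  dsimp only
  rw [h1, smul_add, hn, Nat.factorial_succ]
  push_cast
  rfl

theorem fockDet_orthFamily_add_one (hF : IsClassical ν (fun _ => (1 : K)) 1 F) {v u : K}
    (hv : Generic v) (hu : v = u + (n + 1) / 2) (hu0 : u ≠ 0) (hu1 : u + 1 ≠ 0) :
    fockDet (orthFamily (K := K) κ F ν) (v + 1) = ((v + 1) / v * (u / (u + 1))) •
      (fockDet (orthFamily κ F ν) v + ((2 * u + 1) / (2 * u)) •
      ∑ b, fockCof κ ν (orthFamily κ F ν) v b b) := by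
  have hT := isDetFamily_orthFamily (K := K) κ F hF
  have D := isDoubleCAR_fock (K := K) κ F hF.invol
  have hΩ := isVacuum_fock (K := K) κ F hF.invol
  have h1 := hΩ.orthTot_newton D
    (hF.map ((lift K α (Fock α A)).comp ((lift K α A).comp (Algebra.lmul K A))))
    (fun i j => by
      have := hF.symm i j
      rw [one_mul, one_smul] at this
      simpa using lift_rowMulRight_eq F (c := (1 : K)) (by simpa using this)) n hv hu hu0 hu1
  have h5 := colSum_orthFamily (K := K) κ F hF.invol
  have h6 := hT.topCoeff_fallProd (v := v + 1) (by simpa using hv.add_int 1)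
  have h7 := hT.topCoeff_fallProd hv
  have h8 := hT.topCoeff_fallProd_tau hn hv
  rw [h5] at h6 h7 h8
  rw [hn] at h6 h7
  rw [h6, h7, h8] at h1
  have h4 : ((n + 1).factorial : K) ≠ 0 := by exact_mod_cast Nat.factorial_ne_zero _
  refine smul_right_injective A h4 ?_
  dsimp only
  rw [h1, smul_comm _ ((v + 1) / v * (u / (u + 1))), smul_add _ (fockDet _ v), smul_smul,
    smul_smul]
  congr 3
  rw [Nat.factorial_succ]
  push_cast
  ring

theorem fockDet_symplFamily_add_one (hF : IsClassical ν s (-1) F) {v u : K}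
    (hv : Generic v) (hu : v + 1 = u + (n + 1) / 2) (hu1 : u + 1 ≠ 0) :
    fockDet (symplFamily κ F ν s) (v + 1) = fockDet (symplFamily κ F ν s) v +
      ((2 * u + 1) / (2 * (u + 1))) • ∑ b, fockCof κ ν (symplFamily κ F ν s) v b b := by
  have hT := isDetFamily_symplFamily κ F hF
  have D := isDoubleCAR_fock (K := K) κ F hF.invol
  have hΩ := isVacuum_fock (K := K) κ F hF.invol
  have h1 := hΩ.symplTot_newton D
    (hF.map ((lift K α (Fock α A)).comp ((lift K α A).comp (Algebra.lmul K A))))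
    (fun i j => lift_rowMulRight_eq F (hF.symm i j)) n hu hu1
  have h5 := colSum_symplFamily κ F hF
  have h6 := hT.topCoeff_fallProd (v := v + 1) (by simpa using hv.add_int 1)
  have h7 := hT.topCoeff_fallProd hv
  have h8 := hT.topCoeff_fallProd_tau hn hv
  rw [h5] at h6 h7 h8
  rw [hn] at h6 h7
  rw [h6, h7, h8] at h1
  have h4 : ((n + 1).factorial : K) ≠ 0 := by exact_mod_cast Nat.factorial_ne_zero _
  refine smul_right_injective A h4 ?_
  dsimp only
  rw [h1, smul_add, smul_smul, smul_smul]
  congr 2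
  rw [Nat.factorial_succ]
  push_cast
  ring

end Families


open PermMap

/-! ## Determinant formulas for the three families -/

section DeterminantFormulas

variable {K A I : Type*} [Field K] [CharZero K] [Ring A] [Algebra K A] [Fintype I] [DecidableEq I]
  {F : I → I → A}

theorem fockDet_genFamily {N : ℕ} (κ : I ≃ Fin N) (F : I → I → A) (v : K) :
    fockDet (genFamily κ F id) v = ∑ p : Equiv.Perm (Fin N), (Equiv.Perm.sign p : ℤ) •
      (List.ofFn fun i : Fin N => entry F (κ.symm (p i)) (κ.symm i) (v - (i : ℕ))).prod :=
  setProd_univ_eq_sum_perm_of_col (L := fun k l w => entry F (κ.symm k) (κ.symm l) w)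
    (fun l w f S => etaShift_row_apply κ (fun _ => rfl) F (κ.symm l) w f S) v

/-- The factors `v / (v - 1)` telescope; `(M + 1) / 2` counts the positions of the first half. -/
theorem weightScalar_div : ∀ (M : ℕ) {v : K}, Generic v →
    weightScalar (fun v => v / (v - 1)) M v = v / (v - ((M + 1) / 2 : ℕ))
  | 0, v, hv => by simp [weightScalar, hv.ne_zero]
  | 1, v, hv => by simp [weightScalar]
  | M + 2, v, hv => by
    have h1 := hv.sub_one.ne_zero
    have h2 : (M + 2 + 1) / 2 = (M + 1) / 2 + 1 := by omega
    rw [weightScalar, weightScalar_div M hv.sub_one, h2, div_mul_div_cancel₀ h1]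
    push_cast
    ring

theorem weightScalar_one : ∀ (M : ℕ) (v : K), weightScalar (fun _ => (1 : K)) M v = 1
  | 0, v => rfl
  | 1, v => rfl
  | M + 2, v => by rw [weightScalar, weightScalar_one M, one_mul]

section Classical

variable {ν : I → I} {M : ℕ} (κ : I ≃ Fin (M + 1)) (hν : ∀ i, ν (ν i) = i)
include hν

theorem IsDetFamily.apply_vac_fin {T : Fin (M + 1) → K → Module.End K (Fock (Fin (M + 1)) A)}
    (hT : IsDetFamily κ ν F T) (l : Fin (M + 1)) (v : K) (x : A) :
    T l v (vac _ x) =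
      ∑ k, cre K A k (vac _ (entry F (ν (κ.symm k)) (κ.symm l) v * x)) := by
  have h := hT.apply_vac (κ.symm l) v x
  rw [Equiv.apply_symm_apply] at h
  rw [h, ← sum_comp_of_invol hν, ← Equiv.sum_comp κ]
  simp [rowCre, hν]

theorem rowCre_symm (k : Fin (M + 1)) : rowCre K A κ ν (ν (κ.symm k)) = cre K A k := by
  rw [rowCre, hν, Equiv.apply_symm_apply]

omit hν in
theorem fockDet_orthFamily (hF : IsClassical ν (fun _ => (1 : K)) 1 F) {v : K} (hv : Generic v) :
    fockDet (orthFamily κ F ν) v = (v / (v - ((M + 1) / 2 : ℕ))) •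
      ∑ p : Equiv.Perm (Fin (M + 1)), (Equiv.Perm.sign (p * primePerm _ p) : ℤ) •
        (List.ofFn fun i : Fin (M + 1) => entry F (ν (κ.symm (p i)))
          (κ.symm (primePerm _ p i)) (shiftArg 1 M v i)).prod := by
  have hT := isDetFamily_orthFamily (K := K) κ F hF
  rw [← weightScalar_div M hv]
  refine setProd_univ_eq_sum_perm hT.anticomm
    (L := fun k l w => entry F (ν (κ.symm k)) (κ.symm l) w) (fun k l w hkl => ?_)
    (fun l w f S hw hl => ?_) (hT.apply_vac_fin κ hF.invol) hT.commute_mulRight hv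
  · rw [← rowCre_symm (ν := ν) κ hF.invol]
    exact orthT_psi (isCAR_row κ hF.invol) (rowCre_rowMul κ ν F)
      (fun h => hkl (κ.symm.injective (Function.LeftInverse.injective hF.invol h)).symm) w
  · rw [← etaShift_row_apply κ hF.invol]
    exact apply_eq_of_ann_mul κ hF.invol (d_orthT (isCAR_row κ hF.invol) (rowCre_rowMul κ ν F)
      (rowAnn_rowMul κ ν F) (hF.map ((lift K _ A).comp (Algebra.lmul K A))) _ hw) f (by simpa)

omit hν in
theorem fockDet_symplFamily {s : I → K} (hF : IsClassical ν s (-1) F) {v : K} (hv : Generic v) :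
    fockDet (symplFamily κ F ν s) v =
      ∑ p : Equiv.Perm (Fin (M + 1)), (Equiv.Perm.sign (p * primePerm _ p) : ℤ) •
        (List.ofFn fun i : Fin (M + 1) => entry F (ν (κ.symm (p i)))
          (κ.symm (primePerm _ p i)) (shiftArg (-1) M v i)).prod := by
  have hT := isDetFamily_symplFamily (K := K) κ F hF
  refine (setProd_univ_eq_sum_perm hT.anticomm (γ := fun _ => 1) (ε := -1)
    (L := fun k l w => entry F (ν (κ.symm k)) (κ.symm l) w) (fun k l w hkl => ?_)
    (fun l w f S hw hl => ?_) (hT.apply_vac_fin κ hF.invol) hT.commute_mulRight hv).trans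
    (by rw [weightScalar_one, one_smul])
  · rw [← rowCre_symm (ν := ν) κ hF.invol]
    exact symplT_psi (isCAR_row κ hF.invol) (rowCre_rowMul κ ν F)
      (fun h => hkl (κ.symm.injective (Function.LeftInverse.injective hF.invol h)).symm) w
  · rw [← etaShift_row_apply κ hF.invol]
    refine apply_eq_of_ann_mul κ hF.invol (b := κ.symm l) ?_ f (by simpa)
    rw [one_smul, sub_neg_eq_add]
    exact d_symplT (isCAR_row κ hF.invol) (hF.map ((lift K _ A).comp (Algebra.lmul K A))) _ w

end Classical

end DeterminantFormulas

/-! ### The leading coefficient -/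

section LeadingCoefficient

variable {K A α : Type*} [Field K] [CharZero K] [Ring A] [Nontrivial A] [Algebra K A]
  [LinearOrder α]

theorem listProd_smul_cre_vac_ne_zero {π : α → α} (hπ : Function.Injective π) :
    ∀ (l : List α) {v : K}, l.Nodup → Generic v →
      listProd (fun k v => v • cre K A (π k)) l v (vac α 1) (l.map π).toFinset ≠ 0
  | [], v, _, _ => by simp [listProd, vac]
  | k :: l, v, hl, hv => by
    rw [List.nodup_cons] at hl
    have h1 : π k ∉ (l.map π).toFinset := by
      simpa [hπ.eq_iff] using hl.1
    have ih := listProd_smul_cre_vac_ne_zero hπ l hl.2 hv.sub_one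
    rw [listProd, Module.End.mul_apply, LinearMap.smul_apply, Fock.smul_apply, cre_apply,
      List.map_cons, List.toFinset_cons, if_pos (Finset.mem_insert_self _ _),
      Finset.erase_insert h1]
    intro h
    rcases smul_eq_zero.1 h with h | h
    · exact hv.ne_zero h
    · refine ih ?_
      have h2 := congrArg (fun x => sgnLt (π k) (insert (π k) (l.map π).toFinset) • x) h
      simpa only [smul_smul, sgnLt_mul_self, one_smul, smul_zero] using h2

/-- The sum is independent of `F`, so take `F = 0` over `ℝ`. The determinant is then an ordered
product of nonzero multiples of distinct creation operators, hence nonzero, while the permutation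
formula writes it as this integer times scalars. -/
theorem sum_sign_mul_prod_ne_zero {N : ℕ} (hN : 0 < N) (a : Equiv.Perm (Fin N)) :
    (∑ p : Equiv.Perm (Fin N), (Equiv.Perm.sign (p * primePerm _ p) : ℤ) *
      ∏ i, if (a (p i)).rev = a (primePerm _ p i) then (1 : ℤ) else 0) ≠ 0 := by
  obtain ⟨M, rfl⟩ : ∃ M, N = M + 1 := ⟨N - 1, by omega⟩
  intro h0
  -- Any non-integral real number would serve as a parameter.
  have hv : Generic (√2 : ℝ) := fun z h => (irrational_sqrt_two).ne_int z h
  have hF : IsClassical Fin.rev (fun _ => (1 : ℝ)) 1 (0 : Fin (M + 1) → Fin (M + 1) → ℝ) :=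
    ⟨Fin.rev_rev, by simp, by simp, by simp, by simp⟩
  have hT : orthFamily (K := ℝ) a.symm (0 : Fin (M + 1) → Fin (M + 1) → ℝ) Fin.rev =
      fun k v => v • cre ℝ ℝ (a.symm (a k).rev) := by
    funext k v
    have h1 : rowMul ℝ (Fin (M + 1)) (0 : Fin (M + 1) → Fin (M + 1) → ℝ) = 0 := by
      funext i j
      simp [rowMul]
    simp [orthFamily, orthT, orthTheta, etaShift, eta, h1, rowCre]
  have h1 := fockDet_orthFamily a.symm hF hv
  rw [hT, fockDet, setProd] at h1
  refine listProd_smul_cre_vac_ne_zero (A := ℝ) (π := fun k => a.symm (a k).rev)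
    (a.symm.injective.comp (Fin.rev_injective.comp a.injective)) (Finset.univ.sort (· ≤ ·))
    (Finset.sort_nodup _ _) hv ?_
  have h2 : ((Finset.univ.sort (· ≤ ·)).map fun k => a.symm (a k).rev).toFinset =
      (Finset.univ : Finset (Fin (M + 1))) := by
    ext k
    simpa using ⟨a.symm (a k).rev, by simp⟩
  rw [h2, h1]
  have h3 : ∀ p : Equiv.Perm (Fin (M + 1)), (List.ofFn fun i : Fin (M + 1) =>
      entry (0 : Fin (M + 1) → Fin (M + 1) → ℝ) (a.symm.symm (p i)).rev
        (a.symm.symm (primePerm _ p i)) (shiftArg 1 M √2 i)).prod =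
      (∏ i : Fin (M + 1), shiftArg 1 M √2 i) *
        ((∏ i, if (a (p i)).rev = a (primePerm _ p i) then (1 : ℤ) else 0 : ℤ) : ℝ) := by
    intro p
    rw [List.prod_ofFn, Int.cast_prod, ← Finset.prod_mul_distrib]
    refine Finset.prod_congr rfl fun i _ => ?_
    simp [entry]
  simp only [h3, zsmul_eq_mul]
  have h4 := congrArg (fun z : ℤ => (z : ℝ) * ∏ i : Fin (M + 1), shiftArg 1 M √2 i) h0
  simp only [Int.cast_sum, Int.cast_mul, Finset.sum_mul, Int.cast_zero, zero_mul] at h4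
  refine smul_eq_zero_of_right _ (Eq.trans (Finset.sum_congr rfl fun p _ => ?_) h4)
  ring

end LeadingCoefficient

end Fermion

namespace FormalSeries

/-! ## Laurent series over a noncommutative algebra -/

section Ring

variable {A : Type*} [Ring A]

/-- The series `x` has no terms of index below `a`. -/
def VanishesBelow (a : ℤ) (x : LaurentSeries A) : Prop := ∀ d < a, x.coeff d = 0

theorem VanishesBelow.mono {a b : ℤ} {x : LaurentSeries A} (h : VanishesBelow a x) (hb : b ≤ a) :
    VanishesBelow b x := fun d hd => h d (hd.trans_le hb)

theorem VanishesBelow.mul {a b : ℤ} {x y : LaurentSeries A} (hx : VanishesBelow a x)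
    (hy : VanishesBelow b y) : VanishesBelow (a + b) (x * y) := by
  intro d hd
  rw [HahnSeries.coeff_mul]
  refine Finset.sum_eq_zero fun ij hij => ?_
  rw [Finset.mem_antidiagonal] at hij
  have : ij.1 < a ∨ ij.2 < b := by omega
  rcases this with h | h
  · rw [hx _ h, zero_mul]
  · rw [hy _ h, mul_zero]

theorem VanishesBelow.sum {ι : Type*} {a : ℤ} {s : Finset ι} {x : ι → LaurentSeries A}
    (h : ∀ i ∈ s, VanishesBelow a (x i)) : VanishesBelow a (∑ i ∈ s, x i) := by
  intro d hd
  rw [HahnSeries.coeff_sum]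
  exact Finset.sum_eq_zero fun i hi => h i hi d hd

theorem vanishesBelow_C (x : A) : VanishesBelow 0 (HahnSeries.C x : LaurentSeries A) := by
  intro d hd
  rw [HahnSeries.C_apply, HahnSeries.coeff_single_of_ne hd.ne]

theorem vanishesBelow_order (x : LaurentSeries A) : VanishesBelow x.order x :=
  fun _ => HahnSeries.coeff_eq_zero_of_lt_order

theorem exists_vanishesBelow {ι : Type*} [Finite ι] (x : ι → LaurentSeries A) :
    ∃ a, ∀ i, VanishesBelow a (x i) := by
  obtain ⟨a, ha⟩ := (Set.finite_range fun i => (x i).order).bddBelow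
  exact ⟨a, fun i => (vanishesBelow_order (x i)).mono (ha ⟨i, rfl⟩)⟩

theorem commute_of_coeff {x : LaurentSeries A} (h : ∀ d a, Commute (x.coeff d) a)
    (y : LaurentSeries A) : Commute x y := by
  ext d
  rw [HahnSeries.coeff_mul, HahnSeries.coeff_mul]
  refine Finset.sum_equiv (Equiv.prodComm _ _) (fun _ => ?_) fun ij _ => h _ _
  rw [Finset.mem_antidiagonal, Finset.mem_antidiagonal, add_comm]
  simp [and_comm, and_left_comm, and_assoc]

/-- The map of series induced by a homomorphism of coefficients. -/
def seriesMap {B : Type*} [Ring B] (f : A →+* B) : LaurentSeries A →+* LaurentSeries B where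
  toFun x := HahnSeries.map x f
  map_one' := by
    ext d
    rw [HahnSeries.map_coeff, HahnSeries.coeff_one, HahnSeries.coeff_one]
    split_ifs <;> simp
  map_mul' x y := HahnSeries.map_mul f.toNonUnitalRingHom
  map_zero' := by ext; simp
  map_add' x y := by ext; simp

theorem coeff_seriesMap {B : Type*} [Ring B] (f : A →+* B) (x : LaurentSeries A) (d : ℤ) :
    (seriesMap f x).coeff d = f (x.coeff d) := rfl

theorem seriesMap_ofPoly {B : Type*} [Ring B] (f : A →+* B) (p : A[X]) :
    seriesMap f (ofPoly p) = ofPoly (p.map f) := by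
  have h1 : seriesMap f (u A) = u B := by
    ext d
    rw [coeff_seriesMap, u, u, HahnSeries.coeff_single, HahnSeries.coeff_single]
    split_ifs <;> simp
  have h2 : (seriesMap f).comp (HahnSeries.C : A →+* LaurentSeries A) =
      (HahnSeries.C : B →+* LaurentSeries B).comp f :=
    RingHom.ext fun a => HahnSeries.map_C a f
  rw [ofPoly, ofPoly, Polynomial.hom_eval₂, Polynomial.eval₂_map, h1, h2]

end Ring

section Algebra

variable (A : Type*) [Ring A] [Algebra ℂ A]

/-- `scalar` as a ring homomorphism. -/
def scalarHom : LaurentSeries ℂ →+* LaurentSeries A := seriesMap (algebraMap ℂ A)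

/-- Laurent series with coefficients in `A` form an algebra over the field of scalar series. -/
abbrev seriesAlgebra : Algebra (LaurentSeries ℂ) (LaurentSeries A) :=
  (scalarHom A).toAlgebra' fun x y =>
    (commute_of_coeff (x := scalar A x) (fun d a => Algebra.commutes (x.coeff d) a) y).eq

end Algebra

attribute [local instance] seriesAlgebra

section

variable {A : Type*} [Ring A] [Algebra ℂ A]

theorem algebraMap_eq_scalar (x : LaurentSeries ℂ) :
    algebraMap (LaurentSeries ℂ) (LaurentSeries A) x = scalar A x := rfl

theorem scalar_u : scalar A (u ℂ) = u A := by
  ext d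
  rw [scalar, u, u, HahnSeries.map_coeff, HahnSeries.coeff_single, HahnSeries.coeff_single]
  split_ifs <;> simp

theorem scalar_C (c : ℂ) : scalar A (HahnSeries.C c) = HahnSeries.C (algebraMap ℂ A c) :=
  HahnSeries.map_C _ _

theorem C_smul (c : ℂ) (x : A) : (HahnSeries.C (c • x) : LaurentSeries A) =
    (HahnSeries.C c : LaurentSeries ℂ) • HahnSeries.C x := by
  rw [Algebra.smul_def c, Algebra.smul_def, map_mul, algebraMap_eq_scalar, scalar_C]

theorem VanishesBelow.scalar {a : ℤ} {x : LaurentSeries ℂ} (h : VanishesBelow a x) :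
    VanishesBelow a (scalar A x) := fun d hd => by
  simp [FormalSeries.scalar, h d hd]

theorem coeff_u_add_C (c : ℂ) : VanishesBelow (-1) (u ℂ + HahnSeries.C c) ∧
    (u ℂ + HahnSeries.C c).coeff (-1) = 1 := by
  constructor
  · intro d hd
    rw [HahnSeries.coeff_add, u, HahnSeries.coeff_single_of_ne hd.ne,
      vanishesBelow_C c d (by omega), add_zero]
  · rw [HahnSeries.coeff_add, u, HahnSeries.coeff_single_same, vanishesBelow_C c _ (by omega),
      add_zero]

theorem u_add_C_ne_zero (c : ℂ) : u ℂ + HahnSeries.C c ≠ 0 := fun h => by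
  have := (coeff_u_add_C c).2
  rw [h] at this
  simp at this

/-- This permits the identities proved for a generic parameter of a field to be applied to the
formal variable. -/
theorem generic_u_add_C (c : ℂ) : Fermion.Generic (u ℂ + HahnSeries.C c) := fun z h => by
  have := u_add_C_ne_zero (c - z)
  rw [map_sub, map_intCast, ← h] at this
  exact this (by abel)

theorem vanishesBelow_inv_pow (c : ℂ) (k : ℕ) : VanishesBelow k ((u ℂ + HahnSeries.C c)⁻¹ ^ k) := by
  have h0 := u_add_C_ne_zero c
  have h1 : (u ℂ + HahnSeries.C c).order = -1 := le_antisymm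
    (HahnSeries.order_le_of_coeff_ne_zero (by rw [(coeff_u_add_C c).2]; exact one_ne_zero))
    ((HahnSeries.le_order_iff_forall h0).2 fun j hj => (coeff_u_add_C c).1 j hj)
  have h2 := HahnSeries.order_mul h0 (inv_ne_zero h0)
  rw [mul_inv_cancel₀ h0, HahnSeries.order_one, h1] at h2
  have h3 : VanishesBelow 1 (u ℂ + HahnSeries.C c)⁻¹ :=
    (vanishesBelow_order _).mono (by omega)
  induction k with
  | zero => simpa using vanishesBelow_C (1 : ℂ)
  | succ k ih =>
    rw [pow_succ]
    exact_mod_cast ih.mul h3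

/-- Evaluation of a polynomial at a scalar series. -/
def evalAt (v : LaurentSeries ℂ) : A[X] →+* LaurentSeries A :=
  Polynomial.eval₂RingHom' HahnSeries.C (scalar A v) fun a =>
    (Algebra.commutes (A := LaurentSeries A) v (HahnSeries.C a)).symm

theorem ofPoly_eq_evalAt (p : A[X]) : ofPoly p = evalAt (u ℂ) p := by
  rw [ofPoly, ← scalar_u]; rfl

theorem evalAt_C (v : LaurentSeries ℂ) (a : A) : evalAt v (C a) = HahnSeries.C a :=
  Polynomial.eval₂_C _ _

theorem evalAt_X (v : LaurentSeries ℂ) : evalAt v (X : A[X]) = scalar A v :=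
  Polynomial.eval₂_X _ _

theorem evalAt_comp (v : LaurentSeries ℂ) (p : A[X]) (c : ℕ) :
    evalAt v (p.comp (X + (c : A[X]))) = evalAt (v + c) p := by
  have h : scalar A (v + c) = scalar A v + c := by
    rw [← algebraMap_eq_scalar, map_add, map_natCast, algebraMap_eq_scalar]
  rw [Polynomial.comp_eq_sum_left, Polynomial.sum, map_sum]
  refine Eq.trans ?_ (Polynomial.eval₂_eq_sum (p := p)).symm
  rw [Polynomial.sum]
  refine Finset.sum_congr rfl fun i _ => ?_
  rw [map_mul, map_pow, map_add, evalAt_C, evalAt_X, map_natCast, h]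

theorem evalAt_shiftedEntry {ι : Type*} [DecidableEq ι] (v : LaurentSeries ℂ) (M : Matrix ι ι A)
    (c : ℂ) (i j : ι) : evalAt v (shiftedEntry M c i j) =
      Fermion.entry (fun i j => HahnSeries.C (M i j)) i j (v + HahnSeries.C c) := by
  rw [shiftedEntry, Fermion.entry, map_add, evalAt_C, add_comm]
  congr 1
  split_ifs
  · rw [map_add, evalAt_C, evalAt_X, map_add, algebraMap_eq_scalar, algebraMap_eq_scalar, scalar_C]
  · rw [map_zero]

theorem ofPoly_eq_sum (p : A[X]) {N : ℕ} (hN : p.natDegree ≤ N) :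
    ofPoly p = ∑ i ∈ Finset.range (N + 1), HahnSeries.single (-i : ℤ) (p.coeff i) := by
  rw [ofPoly, Polynomial.eval₂_eq_sum_range' _ (Nat.lt_succ_of_le hN)]
  refine Finset.sum_congr rfl fun i _ => ?_
  rw [u, HahnSeries.single_pow, HahnSeries.C_apply, HahnSeries.single_mul_single]
  simp

theorem coeff_ofPoly (p : A[X]) (k : ℕ) : (ofPoly p).coeff (-k) = p.coeff k := by
  rw [ofPoly_eq_sum p (le_max_left _ k), HahnSeries.coeff_sum, Finset.sum_eq_single k]
  · simp
  · intro i _ hi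
    exact HahnSeries.coeff_single_of_ne (by simpa using hi.symm)
  · intro h
    simp at h

theorem coeff_ofPoly_of_pos (p : A[X]) {d : ℤ} (hd : ∀ k : ℕ, d ≠ -k) :
    (ofPoly p).coeff d = 0 := by
  rw [ofPoly_eq_sum p le_rfl, HahnSeries.coeff_sum]
  exact Finset.sum_eq_zero fun i _ => HahnSeries.coeff_single_of_ne (hd i)

theorem commute_coeff_of_commute_ofPoly {p : A[X]} {a : A}
    (h : Commute (HahnSeries.C a) (ofPoly p)) (k : ℕ) : Commute a (p.coeff k) := by
  have h1 := congrArg (fun x : LaurentSeries A => x.coeff (-k)) h.eq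
  simpa only [Commute, SemiconjBy, HahnSeries.C_apply, HahnSeries.coeff_single_zero_mul,
    HahnSeries.coeff_mul_single_zero, coeff_ofPoly] using h1

theorem commute_ofPoly {p : A[X]} (h : ∀ k, p.coeff k ∈ Subalgebra.center ℂ A)
    (y : LaurentSeries A) : Commute (ofPoly p) y := by
  refine commute_of_coeff (fun d a => ?_) y
  by_cases hd : ∃ k : ℕ, d = -k
  · obtain ⟨k, rfl⟩ := hd
    rw [coeff_ofPoly]
    exact (Subalgebra.mem_center_iff.1 (h k) a).symm
  · push Not at hd
    rw [coeff_ofPoly_of_pos p hd]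
    exact Commute.zero_left a

/-- Split off `u ^ N`: what remains is a power series in `u⁻¹` with invertible constant coefficient.
No commutativity is needed. -/
theorem isUnit_ofPoly {p : A[X]} {N : ℕ} (hN : p.natDegree ≤ N) (h : IsUnit (p.coeff N)) :
    IsUnit (ofPoly p) := by
  obtain ⟨c, hc⟩ := h
  let q : PowerSeries A := PowerSeries.mk fun i => if i ≤ N then p.coeff (N - i) else 0
  have hq : PowerSeries.constantCoeff q = c := by
    rw [← PowerSeries.coeff_zero_eq_constantCoeff_apply, PowerSeries.coeff_mk]
    simp [hc]
  have hq' : IsUnit q := ⟨⟨q, q.invOfUnit c, PowerSeries.mul_invOfUnit q c hq,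
    PowerSeries.invOfUnit_mul q c hq⟩, rfl⟩
  have hs : IsUnit (HahnSeries.single (-N : ℤ) (1 : A)) :=
    ⟨⟨_, HahnSeries.single (N : ℤ) 1, by simp, by simp⟩, rfl⟩
  have : ofPoly p = HahnSeries.single (-N : ℤ) 1 * HahnSeries.ofPowerSeries ℤ A q := by
    ext d
    rw [HahnSeries.coeff_single_mul, one_mul, sub_neg_eq_add]
    rcases lt_or_ge (d + N) 0 with hd | hd
    · rw [ofPoly_eq_sum p hN, HahnSeries.coeff_sum, Finset.sum_eq_zero fun i hi => ?_]
      · rw [HahnSeries.ofPowerSeries_apply, HahnSeries.embDomain_of_notMem_range]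
        rintro ⟨k, hk⟩
        have : (k : ℤ) = d + N := hk
        omega
      · exact HahnSeries.coeff_single_of_ne (by have := Finset.mem_range.1 hi; omega)
    · obtain ⟨m, hm⟩ := Int.eq_ofNat_of_zero_le hd
      rw [hm, HahnSeries.ofPowerSeries_apply_coeff, PowerSeries.coeff_mk]
      split_ifs with h
      · rw [← coeff_ofPoly]
        congr 1
        omega
      · exact coeff_ofPoly_of_pos p fun k => by omega
  rw [this]
  exact hs.mul (hq'.map (HahnSeries.ofPowerSeries ℤ A))

/-! ## The trace of the resolvent -/

variable {I : Type*} [Fintype I] [DecidableEq I]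

theorem mul_geom_sum {K R : Type*} [Field K] [Ring R] [Algebra K R] (G : R) {w : K}
    (hw : w ≠ 0) (m : ℕ) :
    (G + w • 1) * ∑ k ∈ Finset.range m, ((-1) ^ k / w ^ (k + 1)) • G ^ k =
      1 - ((-1) ^ m / w ^ m) • G ^ m := by
  induction m with
  | zero => simp
  | succ m ih =>
    have h : w * ((-1) ^ m / w ^ (m + 1)) = (-1) ^ m / w ^ m := by
      rw [pow_succ']
      field_simp
    rw [Finset.sum_range_succ, mul_add, ih, add_mul, mul_smul_comm, smul_mul_assoc, one_mul,
      smul_smul, h, ← pow_succ', pow_succ (-1), mul_neg_one, neg_div, neg_smul]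
    abel

theorem trace_smul_eq_scalar_mul (r : LaurentSeries ℂ) (X : Matrix I I (LaurentSeries A)) :
    (r • X).trace = scalar A r * X.trace := by
  rw [Matrix.trace, Matrix.trace, Finset.mul_sum]
  exact Finset.sum_congr rfl fun i _ => Algebra.smul_def r (X i i)

theorem map_C_pow (M : Matrix I I A) (k : ℕ) :
    (M.map HahnSeries.C ^ k : Matrix I I (LaurentSeries A)) = (M ^ k).map HahnSeries.C :=
  (map_pow (HahnSeries.C.mapMatrix : Matrix I I A →+* Matrix I I (LaurentSeries A)) M k).symm

theorem trace_map_C_pow (M : Matrix I I A) (k : ℕ) :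
    (M.map HahnSeries.C ^ k : Matrix I I (LaurentSeries A)).trace =
      HahnSeries.C ((M ^ k).trace) := by
  rw [map_C_pow, Matrix.trace, Matrix.trace, map_sum]
  rfl

/-- Multiply the finite geometric identity for `M + w` by the cofactor matrix, which turns `M + w`
into the scalar matrix `D`, and take traces. Centrality of `D` is not used: `D'` multiplies only
from the left. -/
theorem sum_scalar_mul_trace_pow (M : Matrix I I A) {w : LaurentSeries ℂ} (hw : w ≠ 0)
    {D D' : LaurentSeries A} (hD : D' * D = 1) {c : I → I → LaurentSeries A}
    (h : ∀ i j, ∑ k, c i k * Fermion.entry (fun i j => HahnSeries.C (M i j)) k j w =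
      if i = j then D else 0) (m : ℕ) :
    ∑ k ∈ Finset.range m, scalar A ((-1) ^ k / w ^ (k + 1)) * HahnSeries.C ((M ^ k).trace) =
      D' * ∑ i, c i i - scalar A ((-1) ^ m / w ^ m) *
        ∑ i, ∑ j, (D' * c i j) * HahnSeries.C ((M ^ m) j i) := by
  have h1 : Matrix.of c * (M.map HahnSeries.C + w • 1) = D • 1 := by
    refine Matrix.ext fun i j => ?_
    rw [Matrix.mul_apply, Matrix.smul_apply, Matrix.one_apply, smul_eq_mul, mul_ite, mul_one,
      mul_zero, ← h i j]
    refine Finset.sum_congr rfl fun k _ => ?_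
    rw [Fermion.entry, Matrix.of_apply, Matrix.add_apply, Matrix.smul_apply, Matrix.one_apply,
      smul_ite, smul_zero, ← Algebra.algebraMap_eq_smul_one]
    rfl
  have h3 := congrArg (fun X => Matrix.of c * X) (mul_geom_sum (M.map HahnSeries.C) hw m)
  simp only [← mul_assoc, h1] at h3
  rw [smul_mul_assoc, one_mul, mul_sub, mul_one, mul_smul_comm] at h3
  have h4 := congrArg (fun X => D' * Matrix.trace X) h3
  simp only [Matrix.trace_smul D, smul_eq_mul, ← mul_assoc D' D, hD, one_mul, Matrix.trace_sub,
    Matrix.trace_sum, mul_sub, trace_smul_eq_scalar_mul, trace_map_C_pow] at h4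
  rw [h4]
  have h5 : ∀ r : LaurentSeries ℂ, D' * scalar A r = scalar A r * D' := fun r =>
    (Algebra.commutes (A := LaurentSeries A) r D').symm
  rw [← mul_assoc D', h5, mul_assoc, Matrix.trace, map_C_pow]
  refine congrArg₂ (· - ·) rfl (congrArg _ ?_)
  rw [Matrix.trace, Finset.mul_sum]
  refine Finset.sum_congr rfl fun i _ => ?_
  rw [Matrix.diag_apply, Matrix.mul_apply, Finset.mul_sum]
  exact Finset.sum_congr rfl fun j _ => (mul_assoc _ _ _).symm

/-- If the matrix `(c i j)` satisfies `c (M + w) = D` with an invertible `D`, then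
`∑ k, (-1) ^ k tr (M ^ k) w ^ (-k-1) = D⁻¹ tr c`. -/
theorem hasFormalSum_trace_pow (M : Matrix I I A) (b : ℂ) {w : LaurentSeries ℂ}
    (hw : w = u ℂ + HahnSeries.C b) {D D' : LaurentSeries A} (hD : D' * D = 1)
    {c : I → I → LaurentSeries A}
    (h : ∀ i j, ∑ k, c i k * Fermion.entry (fun i j => HahnSeries.C (M i j)) k j w =
      if i = j then D else 0) :
    HasFormalSum (fun k : ℕ => scalar A ((-1) ^ k / w ^ (k + 1)) * HahnSeries.C ((M ^ k).trace))
      (D' * ∑ i, c i i) := by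
  have hw0 : w ≠ 0 := hw ▸ u_add_C_ne_zero b
  obtain ⟨a, ha⟩ := exists_vanishesBelow fun ij : I × I => D' * c ij.1 ij.2
  intro d
  -- The remainder starts in order at least `m + a`: the scalar factor starts at `m` and the entries
  -- of `D' c` at `a`.
  refine ⟨(d + 1 - a).toNat, fun m hm e he => ?_⟩
  rw [sum_scalar_mul_trace_pow M hw0 hD h, HahnSeries.coeff_sub, sub_eq_self]
  have h5 : VanishesBelow (m : ℤ) ((-1) ^ m / w ^ m : LaurentSeries ℂ) := by
    rw [div_eq_mul_inv, ← inv_pow, hw]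
    rw [← map_one HahnSeries.C, ← map_neg, ← map_pow]
    simpa only [zero_add] using (vanishesBelow_C ((-1 : ℂ) ^ m)).mul (vanishesBelow_inv_pow b m)
  refine (h5.scalar.mul (VanishesBelow.sum fun i _ => VanishesBelow.sum fun j _ =>
    (ha (i, j)).mul (vanishesBelow_C _))) e ?_
  omega

end

end FormalSeries

namespace FormalSeries

open Fermion PermMap

attribute [local instance] seriesAlgebra

instance : CharZero (LaurentSeries ℂ) :=
  charZero_of_injective_ringHom (f := (HahnSeries.C : ℂ →+* LaurentSeries ℂ))
    HahnSeries.C_injective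

/-! ## Capelli-type polynomials -/

section Capelli

variable {A I : Type*} [Ring A] [Algebra ℂ A] [Fintype I] [DecidableEq I]

theorem isGenLin_C {M : I → I → A} (h : IsGenLin M) :
    IsGenLin fun i j => (HahnSeries.C (M i j) : LaurentSeries A) := by
  intro i j k l
  rw [← map_mul, ← map_mul, ← map_sub, h]
  simp only [map_sub, apply_ite (HahnSeries.C (Γ := ℤ)), map_zero]

theorem isClassical_C {ν : I → I} {s : I → ℂ} {ε : ℂ} {M : I → I → A} (h : IsClassical ν s ε M) :
    IsClassical ν (fun i => (HahnSeries.C (s i) : LaurentSeries ℂ)) (HahnSeries.C ε)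
      fun i j => (HahnSeries.C (M i j) : LaurentSeries A) where
  invol := h.invol
  s_sq i := by rw [← map_mul, h.s_sq, map_one]
  s_neg i := by rw [← map_mul, h.s_neg]
  symm i j := by rw [← map_mul, ← C_smul, ← map_neg, ← h.symm i j]
  comm i j k l := by
    rw [← map_mul (HahnSeries.C (Γ := ℤ) (R := A)), ← map_mul (HahnSeries.C (Γ := ℤ) (R := A)),
      ← map_sub, h.comm, map_sub, C_smul, map_mul]
    simp only [map_sub, apply_ite (HahnSeries.C (Γ := ℤ)), map_zero]

theorem natDegree_shiftedEntry_le (M : Matrix I I A) (c : ℂ) (i j : I) :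
    (shiftedEntry M c i j).natDegree ≤ 1 := by
  rw [shiftedEntry]
  split_ifs <;> compute_degree!

theorem coeff_shiftedEntry (M : Matrix I I A) (c : ℂ) (i j : I) :
    (shiftedEntry M c i j).coeff 1 = ((if i = j then 1 else 0 : ℤ) : A) := by
  rw [shiftedEntry]
  split_ifs <;> simp

theorem prod_shiftedEntry {N : ℕ} (M : Matrix I I A) (c : Fin N → ℂ) (i j : Fin N → I) :
    (List.ofFn fun k => shiftedEntry M (c k) (i k) (j k)).prod.natDegree ≤ N ∧
    (List.ofFn fun k => shiftedEntry M (c k) (i k) (j k)).prod.coeff N =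
      ((∏ k, if i k = j k then 1 else 0 : ℤ) : A) := by
  have h : ∀ p ∈ List.ofFn fun k => shiftedEntry M (c k) (i k) (j k), p.natDegree ≤ 1 := by
    intro p hp
    obtain ⟨k, rfl⟩ := List.mem_ofFn.1 hp
    exact natDegree_shiftedEntry_le _ _ _ _
  constructor
  · refine (Polynomial.natDegree_list_prod_le _).trans ?_
    refine (List.sum_le_card_nsmul _ 1 ?_).trans (by simp)
    intro d hd
    obtain ⟨p, hp, rfl⟩ := List.mem_map.1 hd
    exact h p hp
  · have h1 := Polynomial.coeff_list_prod_of_natDegree_le _ 1 h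
    rw [List.length_ofFn, mul_one] at h1
    rw [h1, List.map_ofFn, ← List.prod_ofFn, ← eq_intCast (Int.castRingHom A), map_list_prod,
      List.map_ofFn]
    congr 2
    funext k
    exact coeff_shiftedEntry _ _ _ _

/-- A signed sum of products of entries of `X + c k + M`, with the rows and columns given by
`r` and `t`. -/
def signedSum {P : Type*} [Fintype P] {N : ℕ} (M : Matrix I I A) (c : Fin N → ℂ) (σ : P → ℤ)
    (r t : P → Fin N → I) : A[X] :=
  ∑ p, σ p • (List.ofFn fun k => shiftedEntry M (c k) (r p k) (t p k)).prod

theorem evalAt_signedSum {P : Type*} [Fintype P] {N : ℕ} (M : Matrix I I A) (c : Fin N → ℂ)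
    (σ : P → ℤ) (r t : P → Fin N → I) (v : LaurentSeries ℂ) :
    evalAt v (signedSum M c σ r t) = ∑ p, σ p • (List.ofFn fun k =>
      entry (fun i j => (HahnSeries.C (M i j) : LaurentSeries A)) (r p k) (t p k)
        (v + HahnSeries.C (c k))).prod := by
  rw [signedSum, map_sum]
  refine Finset.sum_congr rfl fun p _ => ?_
  rw [map_zsmul, map_list_prod, List.map_ofFn]
  congr 3
  funext k
  exact evalAt_shiftedEntry _ _ _ _ _

theorem natDegree_signedSum_le {P : Type*} [Fintype P] {N : ℕ} (M : Matrix I I A) (c : Fin N → ℂ)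
    (σ : P → ℤ) (r t : P → Fin N → I) : (signedSum M c σ r t).natDegree ≤ N := by
  refine Polynomial.natDegree_sum_le_of_forall_le _ _ fun p _ => ?_
  exact (Polynomial.natDegree_smul_le _ _).trans (prod_shiftedEntry M c (r p) (t p)).1

theorem coeff_signedSum {P : Type*} [Fintype P] {N : ℕ} (M : Matrix I I A) (c : Fin N → ℂ)
    (σ : P → ℤ) (r t : P → Fin N → I) : (signedSum M c σ r t).coeff N =
      ((∑ p, σ p * ∏ k, (if r p k = t p k then 1 else 0 : ℤ) : ℤ) : A) := by
  rw [signedSum, Polynomial.finsetSum_coeff, Int.cast_sum]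
  refine Finset.sum_congr rfl fun p _ => ?_
  rw [Polynomial.coeff_smul, (prod_shiftedEntry M c (r p) (t p)).2, zsmul_eq_mul, Int.cast_mul]

theorem isUnit_ofPoly_signedSum {P : Type*} [Fintype P] {N : ℕ} (M : Matrix I I A)
    (c : Fin N → ℂ) {σ : P → ℤ} {r t : P → Fin N → I}
    (h : ∑ p, σ p * ∏ k, (if r p k = t p k then 1 else 0 : ℤ) ≠ 0) :
    IsUnit (ofPoly (signedSum M c σ r t)) := by
  refine isUnit_ofPoly (natDegree_signedSum_le M c σ r t) ?_
  rw [coeff_signedSum, ← map_intCast (algebraMap ℂ A)]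
  exact (isUnit_iff_ne_zero.2 (Int.cast_ne_zero.2 h)).map _

theorem sum_sign_mul_prod_ite (N : ℕ) : ∑ p : Equiv.Perm (Fin N),
    (Equiv.Perm.sign p : ℤ) * ∏ i, (if p i = i then 1 else 0 : ℤ) = 1 := by
  have := Matrix.det_apply' (1 : Matrix (Fin N) (Fin N) ℤ)
  simp only [Matrix.det_one, Matrix.one_apply, Int.cast_id] at this
  exact this.symm

/-! ## Newton's formula from the difference equation -/

theorem algebra_one_smul {K R : Type*} [Field K] [Ring R] [Algebra K R] (x : R) :
    (1 : K) • x = x := one_smul K x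

theorem algebra_smul_eq {K R : Type*} [Field K] [Ring R] [Algebra K R] {a b c : K} (x : R)
    (h : a = b * c) : a • x = b • (algebraMap K R c * x) := by
  rw [← Algebra.smul_def, smul_smul, h]

theorem commute_of_commute_smul {K R : Type*} [Field K] [Ring R] [Algebra K R] {a : K}
    (ha : a ≠ 0) {x y : R} (h : Commute x (a • y)) : Commute x y := by
  have := h.smul_right a⁻¹
  rwa [smul_smul, inv_mul_cancel₀ ha, one_smul] at this

/-- The determinants agree with the target series up to the scalars `g` and `h * g`. Dividing these
out of the difference equation leaves `Q = P + (r / g) t`, and centrality of `P` lets its inverse be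
written on the right. -/
theorem inverse_mul_eq_one_and_newton {K R : Type*} [Field K] [Ring R] [Algebra K R]
    {P Q D D' t : R} {g h r : K} (hP : IsUnit P) (hcomm : ∀ y, Commute P y) (hg : g ≠ 0)
    (hh : h ≠ 0) (hD : D = g • P) (hD' : D' = (h * g) • Q) (hstep : D' = h • (D + r • t)) :
    (g⁻¹ • Ring.inverse P) * D = 1 ∧
      1 + algebraMap K R r * ((g⁻¹ • Ring.inverse P) * t) = Q * Ring.inverse P := by
  constructor
  · rw [hD, smul_mul_smul_comm, inv_mul_cancel₀ hg, one_smul, Ring.inverse_mul_cancel _ hP]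
  · have h2 : Q = P + (r * g⁻¹) • t := by
      rw [hD', hD, smul_add, smul_smul, smul_smul] at hstep
      have h3 := congrArg (fun x => (h * g)⁻¹ • x) hstep
      simp only [smul_add, smul_smul] at h3
      rw [inv_mul_cancel₀ (mul_ne_zero hh hg), one_smul, one_smul] at h3
      rw [h3]
      congr 2
      field_simp
    have h3 : Commute (Ring.inverse P) Q := by
      obtain ⟨P, rfl⟩ := hP
      rw [Ring.inverse_unit]
      exact (hcomm Q).units_inv_left
    rw [← h3.eq, h2, mul_add, Ring.inverse_mul_cancel _ hP, ← Algebra.smul_def, mul_smul_comm,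
      smul_mul_assoc, smul_smul]

/-- The cofactor identity involves the last parameter `v - n`, which is therefore the variable `w`
of the geometric series. -/
theorem newton_of_isDetFamily {α : Type*} [LinearOrder α] [Fintype α] {n : ℕ}
    (hn : Fintype.card α = n + 1) {M : Matrix I I A} {κ : I ≃ α} {ν : I → I}
    {T : α → LaurentSeries ℂ → Module.End (LaurentSeries ℂ) (Fock α (LaurentSeries A))}
    (hT : IsDetFamily κ ν (fun i j => (HahnSeries.C (M i j) : LaurentSeries A)) T)
    {v w g h r : LaurentSeries ℂ} {b : ℂ} (hw : w = u ℂ + HahnSeries.C b) (hv : v = w + n)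
    {P Q : LaurentSeries A} (hP : IsUnit P) (hcomm : ∀ y, Commute P y)
    (hg : g ≠ 0) (hh : h ≠ 0) (hvP : fockDet T v = g • P) (hvQ : fockDet T (v + 1) = (h * g) • Q)
    (hstep : fockDet T (v + 1) = h • (fockDet T v + r • ∑ i, fockCof κ ν T v i i)) :
    ∃ S : LaurentSeries A,
      HasFormalSum (fun k : ℕ => scalar A ((-1) ^ k / w ^ (k + 1)) *
        HahnSeries.C ((M ^ k).trace)) S ∧
      1 + scalar A r * S = Q * Ring.inverse P := by
  have hgen : Generic v := by
    rw [hv, hw]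
    simpa using (generic_u_add_C b).add_int n
  obtain ⟨h1, h2⟩ := inverse_mul_eq_one_and_newton hP hcomm hg hh hvP hvQ hstep
  refine ⟨_, hasFormalSum_trace_pow M b hw h1 fun i j => ?_, h2⟩
  have := hT.sum_cof_mul_entry hn hgen i j
  rwa [hv, add_sub_cancel_right, ← hv] at this

/-! ### Newton's formulas from the commutation relations -/

section Fin

variable {N : ℕ} {M : Matrix (Fin N) (Fin N) A} {c : Fin N → ℂ}

variable (M c) in
/-- The signed sum over permutations which involves the map `p ↦ p'`. -/
def primeSum (a : Equiv.Perm (Fin N)) : A[X] :=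
  signedSum M c (fun p : Equiv.Perm (Fin N) => (Equiv.Perm.sign (p * primePerm _ p) : ℤ))
    (fun p i => (a (p i)).rev) (fun p i => a (primePerm _ p i))

theorem isUnit_ofPoly_primeSum (hN : 0 < N) (a : Equiv.Perm (Fin N)) :
    IsUnit (ofPoly (primeSum M c a)) :=
  isUnit_ofPoly_signedSum M c (sum_sign_mul_prod_ne_zero hN a)

theorem isClassical_C_one (hM : IsClassical Fin.rev (fun _ => (1 : ℂ)) 1 M) :
    IsClassical Fin.rev (fun _ => (1 : LaurentSeries ℂ)) 1
      fun i j => (HahnSeries.C (M i j) : LaurentSeries A) := by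
  simpa only [map_one] using isClassical_C hM

theorem isClassical_C_neg_one {s : Fin N → ℂ} (hM : IsClassical Fin.rev s (-1) M) :
    IsClassical Fin.rev (fun i => (HahnSeries.C (s i) : LaurentSeries ℂ)) (-1)
      fun i j => (HahnSeries.C (M i j) : LaurentSeries A) := by
  simpa only [map_one, map_neg] using isClassical_C hM

theorem fockDet_orthFamily_eq (hN : 0 < N) (hM : IsClassical Fin.rev (fun _ => (1 : ℂ)) 1 M)
    (a : Equiv.Perm (Fin N)) {v w : LaurentSeries ℂ} (hv : Generic v)
    (hc : ∀ i : Fin N, w + HahnSeries.C (c i) = shiftArg 1 (N - 1) v i) :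
    fockDet (orthFamily (K := LaurentSeries ℂ) a.symm
      (fun i j => (HahnSeries.C (M i j) : LaurentSeries A)) Fin.rev) v =
      (v / (v - (N / 2 : ℕ))) • evalAt w (primeSum M c a) := by
  obtain ⟨m, rfl⟩ : ∃ m, N = m + 1 := ⟨N - 1, by omega⟩
  rw [fockDet_orthFamily a.symm (isClassical_C_one hM) hv, primeSum, evalAt_signedSum]
  simp only [hc]
  rfl

theorem fockDet_symplFamily_eq (hN : 0 < N) {s : Fin N → ℂ} (hM : IsClassical Fin.rev s (-1) M)
    (a : Equiv.Perm (Fin N)) {v w : LaurentSeries ℂ} (hv : Generic v)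
    (hc : ∀ i : Fin N, w + HahnSeries.C (c i) = shiftArg (-1) (N - 1) v i) :
    fockDet (symplFamily (K := LaurentSeries ℂ) a.symm
      (fun i j => (HahnSeries.C (M i j) : LaurentSeries A)) Fin.rev
      (fun i => HahnSeries.C (s i))) v = evalAt w (primeSum M c a) := by
  obtain ⟨m, rfl⟩ : ∃ m, N = m + 1 := ⟨N - 1, by omega⟩
  rw [fockDet_symplFamily a.symm (isClassical_C_neg_one hM) hv, primeSum, evalAt_signedSum]
  simp only [hc]
  rfl

/-- The entries of `M` generate `A`: whatever commutes with them is central. -/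
def Generates (M : Matrix I I A) : Prop :=
  ∀ x : A, (∀ i j, Commute (M i j) x) → x ∈ Subalgebra.center ℂ A

theorem Generates.coeff_mem_center {M : Matrix I I A} (hM : Generates M) {p : A[X]}
    (h : ∀ i j, Commute (HahnSeries.C (M i j)) (ofPoly p)) (k : ℕ) :
    p.coeff k ∈ Subalgebra.center ℂ A :=
  hM _ fun i j => commute_coeff_of_commute_ofPoly (h i j) k

theorem isUnit_scalar {x : LaurentSeries ℂ} (hx : x ≠ 0) : IsUnit (scalar A x) :=
  IsUnit.map (scalarHom A) (isUnit_iff_ne_zero.2 hx)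

theorem commute_scalar (x : LaurentSeries ℂ) (y : LaurentSeries A) : Commute (scalar A x) y :=
  Algebra.commutes (A := LaurentSeries A) x y

theorem u_add_C_shiftArg (ε x : ℂ) (m i : ℕ) (w : LaurentSeries ℂ) :
    w + HahnSeries.C (shiftArg ε m x i) = shiftArg (HahnSeries.C ε) m (w + HahnSeries.C x) i := by
  rw [shiftArg, shiftArg]
  split_ifs
  · rw [map_sub, map_sub, map_natCast]
    ring
  · rw [map_sub, map_natCast]
    ring

theorem natCast_ne_neg_u (e : ℂ) (m : ℕ) : u ℂ + (m : LaurentSeries ℂ) + HahnSeries.C e ≠ 0 := by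
  have := u_add_C_ne_zero (m + e)
  rwa [map_add, map_natCast, ← add_assoc] at this

/-- Put `v = u + N/2`. The telescoped scalar is `v / (u + e)` with `e` the difference between `N/2`
and its integer part, so `e = 0` or `1/2`. Separating the factor `v / u` leaves `u / (u + e)`, which
for odd `N` is the `2u / (2u + 1)` in the normalised determinant. -/
theorem newton_orthogonal (hN : 0 < N) (hM : IsClassical Fin.rev (fun _ => (1 : ℂ)) 1 M)
    (hgen : Generates M) (a : Equiv.Perm (Fin N)) {b e : ℂ}
    (hc : ∀ i : Fin N, c i = shiftArg 1 (N - 1) ((N : ℂ) / 2) i)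
    (hb : b = 1 - (N : ℂ) / 2) (he : e = (N : ℂ) / 2 - (N / 2 : ℕ)) :
    (∀ k, (primeSum M c a).coeff k ∈ Subalgebra.center ℂ A) ∧
    ∃ S : LaurentSeries A,
      HasFormalSum (fun k : ℕ => scalar A ((-1) ^ k / (u ℂ + HahnSeries.C b) ^ (k + 1)) *
        HahnSeries.C ((M ^ k).trace)) S ∧
      1 + scalar A ((2 * u ℂ + 1) / (2 * u ℂ)) * S =
        (scalar A ((u ℂ + 1) / (u ℂ + 1 + HahnSeries.C e)) *
          ofPoly ((primeSum M c a).comp (X + 1))) *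
          Ring.inverse (scalar A (u ℂ / (u ℂ + HahnSeries.C e)) * ofPoly (primeSum M c a)) := by
  have hF := isClassical_C_one hM
  have hx : (HahnSeries.C ((N : ℂ) / 2) : LaurentSeries ℂ) = N / 2 := by
    rw [map_div₀, map_natCast, map_ofNat]
  obtain ⟨v, hv⟩ : ∃ v : LaurentSeries ℂ, v = u ℂ + N / 2 := ⟨_, rfl⟩
  have hgv : Generic v := by
    rw [hv, ← hx]
    exact generic_u_add_C _
  have hu0 : u ℂ ≠ 0 := by simpa using natCast_ne_neg_u 0 0
  have hu1 : u ℂ + 1 ≠ 0 := by simpa using natCast_ne_neg_u 0 1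
  have hue0 : u ℂ + HahnSeries.C e ≠ 0 := by simpa using natCast_ne_neg_u e 0
  have hue1 : u ℂ + 1 + HahnSeries.C e ≠ 0 := by simpa using natCast_ne_neg_u e 1
  have hev : HahnSeries.C e = (N / 2 - ((N / 2 : ℕ) : LaurentSeries ℂ) : LaurentSeries ℂ) := by
    rw [he, map_sub, hx, map_natCast]
  have h0 := fockDet_orthFamily_eq (c := c) hN hM a hgv (w := u ℂ) fun i => by
    rw [hc, u_add_C_shiftArg, map_one, hx, hv]
  have h1 := fockDet_orthFamily_eq (c := c) hN hM a (v := v + 1) (by simpa using hgv.add_int 1)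
    (w := u ℂ + 1) fun i => by
    rw [hc, u_add_C_shiftArg, map_one, hx, hv]
    congr 1
    ring
  have e0 : v - ((N / 2 : ℕ) : LaurentSeries ℂ) = u ℂ + HahnSeries.C e := by rw [hev, hv]; ring
  have e1 : v + 1 - ((N / 2 : ℕ) : LaurentSeries ℂ) = u ℂ + 1 + HahnSeries.C e := by rw [hev, hv]; ring
  rw [e0, ← ofPoly_eq_evalAt] at h0
  rw [e1, ← Nat.cast_one, ← evalAt_comp, ← ofPoly_eq_evalAt, Nat.cast_one, Nat.cast_one] at h1
  have hcen : ∀ k, (primeSum M c a).coeff k ∈ Subalgebra.center ℂ A := by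
    refine hgen.coeff_mem_center fun i j => ?_
    have h2 := commute_fockDet_orthFamily a.symm _ hF i j hgv
    rw [h0] at h2
    exact commute_of_commute_smul (div_ne_zero hgv.ne_zero hue0) h2
  refine ⟨hcen, ?_⟩
  refine newton_of_isDetFamily (n := N - 1) (by rw [Fintype.card_fin]; omega)
    (isDetFamily_orthFamily a.symm _ hF) (b := b) (v := v) (g := v / u ℂ)
    (h := (v + 1) / v * (u ℂ / (u ℂ + 1))) rfl ?_ ?_ ?_ ?_ ?_ ?_ ?_ ?_
  · rw [hb, map_sub, hx, map_one, hv]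
    push_cast [hN]
    ring
  · exact (isUnit_scalar (div_ne_zero hu0 hue0)).mul (isUnit_ofPoly_primeSum hN a)
  · exact fun y => (commute_scalar _ y).mul_left (commute_ofPoly hcen y)
  · exact div_ne_zero hgv.ne_zero hu0
  · exact mul_ne_zero (div_ne_zero (by simpa using (hgv.add_int 1).ne_zero) hgv.ne_zero)
      (div_ne_zero hu0 hu1)
  · refine h0.trans (algebra_smul_eq _ ?_)
    field_simp
  · refine h1.trans (algebra_smul_eq _ ?_)
    have := hgv.ne_zero
    field_simp
  · refine fockDet_orthFamily_add_one (n := N - 1) a.symm _ ?_ hF hgv ?_ hu0 hu1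
    · rw [Fintype.card_fin]; omega
    · rw [hv]
      push_cast [hN]
      ring

/-- Put `v = u + N/2 - 1`; no scalar factor arises, so both normalising constants are one. -/
theorem newton_symplectic (hN : 0 < N) {s : Fin N → ℂ} (hM : IsClassical Fin.rev s (-1) M)
    (hgen : Generates M) (a : Equiv.Perm (Fin N)) {b : ℂ}
    (hc : ∀ i : Fin N, c i = shiftArg (-1) (N - 1) ((N : ℂ) / 2 - 1) i)
    (hb : b = -((N : ℂ) / 2)) :
    (∀ k, (primeSum M c a).coeff k ∈ Subalgebra.center ℂ A) ∧
    ∃ S : LaurentSeries A,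
      HasFormalSum (fun k : ℕ => scalar A ((-1) ^ k / (u ℂ + HahnSeries.C b) ^ (k + 1)) *
        HahnSeries.C ((M ^ k).trace)) S ∧
      1 + scalar A ((2 * u ℂ + 1) / (2 * (u ℂ + 1))) * S =
        ofPoly ((primeSum M c a).comp (X + 1)) * Ring.inverse (ofPoly (primeSum M c a)) := by
  have hF := isClassical_C_neg_one hM
  have hx : (HahnSeries.C ((N : ℂ) / 2 - 1) : LaurentSeries ℂ) = N / 2 - 1 := by
    rw [map_sub, map_div₀, map_natCast, map_ofNat, map_one]
  obtain ⟨v, hv⟩ : ∃ v : LaurentSeries ℂ, v = u ℂ + (N / 2 - 1) := ⟨_, rfl⟩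
  have hgv : Generic v := by
    rw [hv, ← hx]
    exact generic_u_add_C _
  have hu1 : u ℂ + 1 ≠ 0 := by simpa using natCast_ne_neg_u 0 1
  have h0 := fockDet_symplFamily_eq (c := c) hN hM a hgv (w := u ℂ) fun i => by
    rw [hc, u_add_C_shiftArg, map_neg, map_one, hx, hv]
  have h1 := fockDet_symplFamily_eq (c := c) hN hM a (v := v + 1) (by simpa using hgv.add_int 1)
    (w := u ℂ + 1) fun i => by
    rw [hc, u_add_C_shiftArg, map_neg, map_one, hx, hv]
    congr 1
    ring
  rw [← ofPoly_eq_evalAt] at h0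
  rw [← Nat.cast_one, ← evalAt_comp, ← ofPoly_eq_evalAt, Nat.cast_one, Nat.cast_one] at h1
  have hcen : ∀ k, (primeSum M c a).coeff k ∈ Subalgebra.center ℂ A := by
    refine hgen.coeff_mem_center fun i j => ?_
    have h2 := commute_fockDet_symplFamily a.symm _ hF i j hgv
    rwa [h0] at h2
  refine ⟨hcen, ?_⟩
  refine newton_of_isDetFamily (n := N - 1) (by rw [Fintype.card_fin]; omega)
    (isDetFamily_symplFamily a.symm _ hF) (b := b) (v := v) (g := 1) (h := 1) rfl ?_
    (isUnit_ofPoly_primeSum hN a) (commute_ofPoly hcen) one_ne_zero one_ne_zero ?_ ?_ ?_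
  · rw [hb, map_neg, map_div₀, map_natCast, map_ofNat, hv]
    push_cast [hN]
    ring
  · exact h0.trans (algebra_one_smul _).symm
  · rw [h1, mul_one]
    exact (algebra_one_smul _).symm
  · refine Eq.trans ?_ (algebra_one_smul _).symm
    refine fockDet_symplFamily_add_one (n := N - 1) a.symm _ ?_ hF hgv ?_ hu1
    · rw [Fintype.card_fin]; omega
    · rw [hv]
      push_cast [hN]
      ring

theorem isUnit_newton_genLin {N : ℕ} (hN : 0 < N) {M : Matrix (Fin N) (Fin N) A}
    (hM : IsGenLin M) (hgen : Generates M) {p : A[X]}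
    (hp : p = signedSum M (fun i : Fin N => -((i : ℕ) : ℂ))
      (fun p : Equiv.Perm (Fin N) => (Equiv.Perm.sign p : ℤ)) (fun p i => p i) fun _ i => i) :
    (∀ k, p.coeff k ∈ Subalgebra.center ℂ A) ∧ IsUnit (ofPoly p) ∧
    ∃ S : LaurentSeries A,
      HasFormalSum (fun k : ℕ => scalar A ((-1) ^ k / (u ℂ - N + 1) ^ (k + 1)) *
        HahnSeries.C ((M ^ k).trace)) S ∧
      1 + S = ofPoly (p.comp (X + 1)) * Ring.inverse (ofPoly p) := by
  have hF := isGenLin_C hM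
  have h0 : ∀ w : LaurentSeries ℂ, fockDet (genFamily (K := LaurentSeries ℂ) (Equiv.refl (Fin N))
      (fun i j => (HahnSeries.C (M i j) : LaurentSeries A)) id) w = evalAt w p := by
    intro w
    rw [fockDet_genFamily, hp, evalAt_signedSum]
    simp only [map_neg, map_natCast, ← sub_eq_add_neg]
    rfl
  have h1 := h0 (u ℂ + 1)
  rw [← Nat.cast_one, ← evalAt_comp, ← ofPoly_eq_evalAt, Nat.cast_one, Nat.cast_one] at h1
  have h2 := h0 (u ℂ)
  rw [← ofPoly_eq_evalAt] at h2
  have hu : Generic (u ℂ) := by simpa using generic_u_add_C 0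
  have hcen : ∀ k, p.coeff k ∈ Subalgebra.center ℂ A := by
    refine hgen.coeff_mem_center fun i j => ?_
    rw [← h2]
    exact commute_fockDet_genFamily _ _ hF i j hu
  have hunit : IsUnit (ofPoly p) := by
    rw [hp]
    refine isUnit_ofPoly_signedSum _ _ ?_
    rw [sum_sign_mul_prod_ite]
    exact one_ne_zero
  refine ⟨hcen, hunit, ?_⟩
  obtain ⟨S, hS, h3⟩ := newton_of_isDetFamily (n := N - 1) (by rw [Fintype.card_fin]; omega)
    (isDetFamily_genFamily (Equiv.refl _) _ hF) (b := 1 - N) (v := u ℂ) (w := u ℂ - N + 1)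
    (g := 1) (h := 1) (r := 1) (Q := ofPoly (p.comp (X + 1))) (by
      rw [map_sub, map_one, map_natCast]; ring) (by push_cast [hN]; ring)
    hunit (commute_ofPoly hcen) one_ne_zero one_ne_zero
    (h2.trans (algebra_one_smul _).symm)
    (by rw [h1, mul_one]; exact (algebra_one_smul _).symm) (by
      refine Eq.trans ?_ (algebra_one_smul _).symm
      rw [fockDet_genFamily_add_one (n := N - 1) _ _ (by rw [Fintype.card_fin]; omega) hF hu]
      exact congrArg _ (algebra_one_smul _).symm)
  refine ⟨S, hS, ?_⟩
  rw [← h3, ← algebraMap_eq_scalar, map_one, one_mul]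

end Fin

end Capelli

end FormalSeries

/-! ## Relations in the universal enveloping algebras -/

open Fermion FormalSeries

/-- The centralizer of `x` contains the Lie algebra, so the universal property gives a homomorphism
into it whose composite with the inclusion is the identity. -/
theorem UniversalEnvelopingAlgebra.mem_center_of_commute {L : Type*} [LieRing L] [LieAlgebra ℂ L]
    {x : UniversalEnvelopingAlgebra ℂ L}
    (h : ∀ y, Commute (UniversalEnvelopingAlgebra.ι ℂ y) x) :
    x ∈ Subalgebra.center ℂ (UniversalEnvelopingAlgebra ℂ L) := by
  let Z := Subalgebra.centralizer ℂ {x}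
  have hZ : ∀ y, UniversalEnvelopingAlgebra.ι ℂ y ∈ Z := fun y => by
    rw [Subalgebra.mem_centralizer_iff]
    rintro _ rfl
    exact (h y).symm.eq
  let f : L →ₗ⁅ℂ⁆ Z :=
    { toFun := fun y => ⟨UniversalEnvelopingAlgebra.ι ℂ y, hZ y⟩
      map_add' := fun a b => Subtype.ext (map_add _ a b)
      map_smul' := fun c a => Subtype.ext (map_smul (UniversalEnvelopingAlgebra.ι ℂ) c a)
      map_lie' := fun {a b} => Subtype.ext (LieHom.map_lie _ a b) }
  have h1 : Z.val.comp (UniversalEnvelopingAlgebra.lift ℂ f) = AlgHom.id ℂ _ := by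
    apply UniversalEnvelopingAlgebra.hom_ext
    ext y
    simp [f]
  rw [Subalgebra.mem_center_iff]
  intro b
  have h2 : b ∈ Z := by
    have := DFunLike.congr_fun h1 b
    simp only [AlgHom.comp_apply, AlgHom.id_apply] at this
    rw [← this]
    exact (UniversalEnvelopingAlgebra.lift ℂ f b).2
  exact (Subalgebra.mem_centralizer_iff _).1 h2 x rfl |>.symm

theorem UniversalEnvelopingAlgebra.ι_mul_sub {L : Type*} [LieRing L] [LieAlgebra ℂ L] (x y : L) :
    UniversalEnvelopingAlgebra.ι ℂ x * UniversalEnvelopingAlgebra.ι ℂ y -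
      UniversalEnvelopingAlgebra.ι ℂ y * UniversalEnvelopingAlgebra.ι ℂ x =
      UniversalEnvelopingAlgebra.ι ℂ ⁅x, y⁆ := by
  rw [LieHom.map_lie, LieRing.of_associative_ring_bracket]

namespace Fermion

theorem isGenLin_single (N : ℕ) : IsGenLin fun i j : Fin N => Matrix.single i j (1 : ℂ) := by
  intro i j k l
  have h : ∀ i j k l : Fin N, Matrix.single i j (1 : ℂ) * Matrix.single k l 1 =
      if j = k then Matrix.single i l 1 else 0 := by
    intro i j k l
    split_ifs with h
    · rw [h, Matrix.single_mul_single_same, mul_one]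
    · exact Matrix.single_mul_single_of_ne (α := ℂ) 1 i j k h 1
  simp only [h, eq_comm (a := l)]

/-- Each commutator expands into four commutators of matrix units. Under each Kronecker delta the
product of four signs collapses, since signs square to one. -/
theorem IsGenLin.isClassical {K R I : Type*} [Field K] [CharZero K] [Ring R] [Algebra K R]
    [Fintype I] [DecidableEq I] {e : I → I → R} (he : IsGenLin e) {ν : I → I} {s : I → K} {ε : K}
    (hν : ∀ i, ν (ν i) = i) (hs : ∀ i, s i * s i = 1) (hε : ∀ i, s (ν i) = ε * s i) :
    IsClassical ν s ε fun i j => e i j - (s i * s j) • e (ν j) (ν i) where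
  invol := hν
  s_sq := hs
  s_neg := hε
  symm i j := by
    have h1 : s i * s j * (s (ν j) * s (ν i)) = 1 := by
      have h2 : s (ν j) * s (ν j) = 1 := hs _
      rw [hε] at h2
      rw [hε, hε]
      linear_combination (s i * s i) * h2 + hs i
    rw [smul_sub, smul_smul, h1, hν, hν]
    module
  comm i j k l := by
    have hinj : ∀ a b, ν a = ν b ↔ a = b :=
      fun a b => (Function.LeftInverse.injective hν).eq_iff
    have hflip : ∀ a b, ν a = b ↔ a = ν b := fun a b => by rw [← hinj, hν]
    have hsub : ∀ (c : Prop) [Decidable c] (x y : R) (a : K),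
        (if c then x - a • y else 0) = (if c then x else 0) - a • if c then y else 0 := by
      intro c _ x y a
      split_ifs <;> simp
    have hmul : ∀ (c : Prop) [Decidable c] (y : R) (a b : K), (c → a = b) →
        a • (if c then y else 0) = b • if c then y else 0 := by
      intro c _ y a b h
      split_ifs with hc
      · rw [h hc]
      · simp
    have h1 := he i j k l
    have h2 := he i j (ν l) (ν k)
    have h3 := he (ν j) (ν i) k l
    have h4 := he (ν j) (ν i) (ν l) (ν k)
    simp only [hinj] at h4
    have e1 := hmul (i = l) (e (ν j) (ν k)) ((s i * s j) * (s k * s l)) (s k * s j) (by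
      rintro rfl; linear_combination s j * s k * hs i)
    have e2 := hmul (j = k) (e (ν l) (ν i)) ((s i * s j) * (s k * s l)) (s i * s l) (by
      rintro rfl; linear_combination s i * s l * hs j)
    have e3 := hmul (ν i = k) (e (ν l) j) (s i * s j * (s (ν j) * s l)) (s k * s l) (by
      rintro rfl; rw [hε, hε]; linear_combination s i * ε * s l * hs j)
    have e4 := hmul (l = ν j) (e i (ν k)) (s i * s j * (s k * s (ν i))) (s k * s l) (by
      rintro rfl; rw [hε, hε]; linear_combination s k * ε * s j * hs i)
    simp only [hsub, hν]
    have c2 : (j = ν l) = (l = ν j) := by rw [← hflip]; exact propext eq_comm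
    have c3 : (i = ν k) = (ν i = k) := by rw [hflip]
    have c4 : (ν j = l) = (l = ν j) := propext eq_comm
    simp only [c2, c3] at h2
    simp only [c4] at h3
    have expand : ∀ (a b c d : R) (x y : K), (a - x • b) * (c - y • d) - (c - y • d) * (a - x • b) =
        (a * c - c * a) - y • (a * d - d * a) - x • (b * c - c * b) +
          (x * y) • (b * d - d * b) := by
      intro a b c d x y
      simp only [sub_mul, mul_sub, smul_mul_assoc, mul_smul_comm, smul_sub, smul_smul,
        mul_comm y x]
      abel
    rw [expand, h1, h2, h3, h4, smul_sub (s i * s j * (s k * s l)), e1, e2]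
    simp only [smul_sub, smul_smul, e3, e4]
    abel

end Fermion

namespace GenLin

theorem isGenLin_E (n : ℕ) : IsGenLin (E n) := by
  intro i j k l
  refine (UniversalEnvelopingAlgebra.ι_mul_sub _ _).trans ?_
  rw [LieRing.of_associative_ring_bracket, isGenLin_single n i j k l, map_sub]
  simp only [apply_ite (UniversalEnvelopingAlgebra.ι ℂ), map_zero]
  rfl

theorem generates_E (n : ℕ) : Generates (E n) := by
  intro x hx
  refine UniversalEnvelopingAlgebra.mem_center_of_commute fun y => ?_
  rw [Matrix.matrix_eq_sum_single y, map_sum]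
  refine Commute.sum_left _ _ _ fun i _ => ?_
  rw [map_sum]
  refine Commute.sum_left _ _ _ fun j _ => ?_
  have : Matrix.single i j (y i j) = y i j • Matrix.single i j (1 : ℂ) := by simp
  rw [this, map_smul]
  exact (hx i j).smul_left _

end GenLin

namespace ClassicalType

/-- The sign of an index in the symplectic case. -/
def idxSign (n : ℕ) (i : Fin (C.size n)) : ℂ := ((label C n i).sign : ℤ)

theorem label_C_ne_zero (n : ℕ) (i : Fin (C.size n)) : label C n i ≠ 0 := by
  simp only [label]
  split_ifs <;> omega

/-- The relations are verified for matrices, read inside the Lie subalgebra, and carried to the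
enveloping algebra by `ι`. -/
theorem isClassical_F {t : ClassicalType} {n : ℕ} {s : Fin (t.size n) → ℂ} {ε : ℂ}
    (h : ∀ i j, t.theta n i j = s i * s j) (hs : ∀ i, s i * s i = 1)
    (hε : ∀ i, s i.rev = ε * s i) : IsClassical Fin.rev s ε (t.F n) := by
  have hc := (isGenLin_single (t.size n)).isClassical Fin.rev_rev hs hε
  simp only [← h] at hc
  have hg : ∀ i j, t.gen n i j = Matrix.single i j 1 - t.theta n i j • Matrix.single j.rev i.rev 1 :=
    fun _ _ => rfl
  simp only [← hg] at hc
  refine ⟨Fin.rev_rev, hs, hε, fun i j => ?_, fun i j k l => ?_⟩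
  · refine (congrArg _ (Subtype.ext (hc.symm i j))).trans
      ((map_neg (UniversalEnvelopingAlgebra.ι ℂ) _).trans
        (congrArg _ (map_smul (UniversalEnvelopingAlgebra.ι ℂ) _ _)))
  · have h1 := hc.comm i j k l
    rw [← LieRing.of_associative_ring_bracket] at h1
    let g : Fin (t.size n) → Fin (t.size n) → t.lieAlg n :=
      fun i j => ⟨t.gen n i j, LieSubalgebra.subset_lieSpan ⟨i, j, rfl⟩⟩
    have h2 : ⁅g i j, g k l⁆ = (if j = k then g i l else 0) - (if i = l then g k j else 0) -
        (s i * s j) • ((if i.rev = k then g j.rev l else 0) -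
          (if l = j.rev then g k i.rev else 0)) := by
      apply Subtype.ext
      refine Eq.trans h1 ?_
      split_ifs <;> rfl
    have h3 := congrArg (UniversalEnvelopingAlgebra.ι ℂ) h2
    rw [← UniversalEnvelopingAlgebra.ι_mul_sub] at h3
    simp only [map_sub, map_smul, apply_ite (UniversalEnvelopingAlgebra.ι ℂ),
      map_zero] at h3
    exact h3

theorem isClassical_F_orth {t : ClassicalType} (ht : t ≠ C) (n : ℕ) :
    IsClassical Fin.rev (fun _ => (1 : ℂ)) 1 (t.F n) := by
  refine isClassical_F (fun i j => ?_) (by simp) (by simp)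
  cases t <;> simp_all [theta]

theorem isClassical_F_sympl (n : ℕ) : IsClassical Fin.rev (idxSign n) (-1) (C.F n) := by
  refine isClassical_F (fun i j => ?_) (fun i => ?_) fun i => ?_
  · simp [theta, idxSign]
  · rw [idxSign, ← Int.cast_mul, ← Int.sign_mul,
      Int.sign_eq_one_of_pos (mul_self_pos.2 (label_C_ne_zero n i)), Int.cast_one]
  · rw [idxSign, label_rev, Int.sign_neg, idxSign]
    simp

theorem commute_commutator {R : Type*} [Ring R] {a b x : R} (ha : Commute a x)
    (hb : Commute b x) : Commute (a * b - b * a) x :=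
  (ha.mul_left hb).sub_left (hb.mul_left ha)

theorem generates_F (t : ClassicalType) (n : ℕ) : Generates (t.F n) := by
  intro x hx
  refine UniversalEnvelopingAlgebra.mem_center_of_commute fun y => ?_
  obtain ⟨y, hy⟩ := y
  induction hy using LieSubalgebra.lieSpan_induction with
  | mem y h =>
    obtain ⟨i, j, rfl⟩ := h
    exact hx i j
  | zero =>
    change Commute (UniversalEnvelopingAlgebra.ι ℂ (0 : t.lieAlg n)) x
    rw [map_zero]
    exact Commute.zero_left x
  | add y z hy hz h1 h2 =>
    change Commute (UniversalEnvelopingAlgebra.ι ℂ ((⟨y, hy⟩ : t.lieAlg n) + ⟨z, hz⟩)) x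
    rw [map_add]
    exact h1.add_left h2
  | smul c y hy h1 =>
    change Commute (UniversalEnvelopingAlgebra.ι ℂ (c • (⟨y, hy⟩ : t.lieAlg n))) x
    rw [map_smul]
    exact h1.smul_left c
  | lie y z hy hz h1 h2 =>
    have h3 := commute_commutator h1 h2
    rw [UniversalEnvelopingAlgebra.ι_mul_sub] at h3
    exact h3

end ClassicalType

/-! ## Newton's formulas -/

namespace FormalSeries

theorem hasFormalSum_zero {A : Type*} [Ring A] {f : ℕ → LaurentSeries A} (hf : ∀ k, f k = 0) :
    HasFormalSum f 0 := fun d => ⟨0, fun m _ e _ => by simp [hf]⟩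

theorem trace_pow_eq_zero {A I : Type*} [Ring A] [Fintype I] [DecidableEq I] [IsEmpty I]
    (M : Matrix I I A) (k : ℕ) : (M ^ k).trace = 0 := by
  simp [Matrix.trace]

end FormalSeries

namespace GenLin

theorem newton (n : ℕ) :
    (∀ k, (capelli n).coeff k ∈ Subalgebra.center ℂ (U n)) ∧ IsUnit (ofPoly (capelli n)) ∧
    ∃ S : LaurentSeries (U n),
      HasFormalSum (fun k : ℕ => scalar (U n) ((-1) ^ k / (u ℂ - n + 1) ^ (k + 1)) *
        HahnSeries.C (gelfand n k)) S ∧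
      1 + S = ofPoly ((capelli n).comp (X + 1)) * Ring.inverse (ofPoly (capelli n)) := by
  -- For `n = 0` the determinant is `1` and all traces vanish; the general argument needs at least
  -- one column.
  rcases Nat.eq_zero_or_pos n with rfl | hn
  · have h1 : capelli 0 = 1 := by simp [capelli]
    have h2 : ofPoly (1 : (U 0)[X]) = 1 := by rw [ofPoly_eq_evalAt, map_one]
    rw [h1, one_comp, h2]
    refine ⟨fun k => ?_, isUnit_one, 0, hasFormalSum_zero fun k => ?_, by simp⟩
    · rw [coeff_one]
      split_ifs
      exacts [one_mem _, zero_mem _]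
    · rw [gelfand, trace_pow_eq_zero, map_zero, mul_zero]
  · exact isUnit_newton_genLin hn (isGenLin_E n) (generates_E n) rfl

end GenLin

namespace ClassicalType

theorem rho_of_neg {x : ℤ} (hx : x < 0) :
    B.rho x = -(x : ℂ) - 1 / 2 ∧ C.rho x = -(x : ℂ) ∧ D.rho x = -(x : ℂ) - 1 := by
  simp only [rho, if_pos hx, abs_of_neg hx, Int.cast_neg, and_self]

theorem rho_of_pos {x : ℤ} (hx : 0 < x) :
    B.rho x = 1 / 2 - (x : ℂ) ∧ C.rho x = -(x : ℂ) ∧ D.rho x = 1 - (x : ℂ) := by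
  simp only [rho, if_neg hx.not_gt, if_neg hx.ne', abs_of_pos hx, neg_sub, and_self]

/-- The numbers `ρ` decrease by one from position to position, except for a break at the middle;
this is the break between left and right factors of the expansion. -/
theorem rho_label_B (n : ℕ) (i : Fin (B.size n)) : B.rho (label B n i) =
    shiftArg 1 (B.size n - 1) ((B.size n : ℂ) / 2) i := by
  have hl : label B n i = (i : ℤ) - n := rfl
  simp only [size, shiftArg]
  rw [hl]
  rcases lt_trichotomy ((i : ℕ) : ℤ) n with h | h | h
  · rw [if_pos (by omega), (rho_of_neg (by omega)).1]
    push_cast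
    ring
  · rw [if_neg (by omega), h, sub_self]
    have : ((i : ℕ) : ℂ) = n := by exact_mod_cast h
    rw [this]
    simp only [rho, lt_irrefl, if_false, if_true]
    push_cast
    ring
  · rw [if_neg (by omega), (rho_of_pos (by omega)).1]
    push_cast
    ring

theorem rho_label_C (n : ℕ) (i : Fin (C.size n)) : C.rho (label C n i) =
    shiftArg (-1) (C.size n - 1) ((C.size n : ℂ) / 2 - 1) i := by
  have hl : label C n i = if (i : ℕ) < n then (i : ℤ) - n else (i : ℤ) - n + 1 := rfl
  simp only [size, shiftArg]
  rw [hl]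
  rcases lt_or_ge (i : ℕ) n with h | h
  · rw [if_pos h, if_pos (by omega), (rho_of_neg (by omega)).2.1]
    push_cast
    ring
  · rw [if_neg (by omega), if_neg (by omega), (rho_of_pos (by omega)).2.1]
    push_cast
    ring

theorem rho_label_D (n : ℕ) (i : Fin (D.size n)) : D.rho (label D n i) =
    shiftArg 1 (D.size n - 1) ((D.size n : ℂ) / 2) i := by
  have hl : label D n i = if (i : ℕ) < n then (i : ℤ) - n else (i : ℤ) - n + 1 := rfl
  simp only [size, shiftArg]
  rw [hl]
  rcases lt_or_ge (i : ℕ) n with h | h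
  · rw [if_pos h, if_pos (by omega), (rho_of_neg (by omega)).2.2]
    push_cast
    ring
  · rw [if_neg (by omega), if_neg (by omega), (rho_of_pos (by omega)).2.2]
    push_cast
    ring

theorem rho_B (n : ℕ) : B.rho n = 1 - (B.size n : ℂ) / 2 := by
  rcases Nat.eq_zero_or_pos n with rfl | h
  -- For `n = 0` the relevant value is `ρ_0 = 1/2`.
  · norm_num [rho, size]
  · rw [(rho_of_pos (by omega)).1]
    push_cast [size]
    ring

theorem rho_C {n : ℕ} (h : 0 < n) : C.rho n = -((C.size n : ℂ) / 2) := by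
  rw [(rho_of_pos (by omega)).2.1]
  push_cast [size]
  ring

theorem rho_D {n : ℕ} (h : 0 < n) : D.rho n = 1 - (D.size n : ℂ) / 2 := by
  rw [(rho_of_pos (by omega)).2.2]
  push_cast [size]
  ring

/-- The sum over permutations in the definition of `capelli`, without the sign. -/
def capelliSum (t : ClassicalType) (n : ℕ) (a : Equiv.Perm (Fin (t.size n))) : (t.U n)[X] :=
  primeSum (t.F n) (fun i => t.rho (t.label n i)) a

theorem capelli_eq_or (t : ClassicalType) (n : ℕ) (a : Equiv.Perm (Fin (t.size n))) :
    t.capelli n a = t.capelliSum n a ∨ t.capelli n a = -t.capelliSum n a := by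
  have h : t.capelli n a = (-1) ^ n * t.capelliSum n a := rfl
  rcases neg_one_pow_eq_or (t.U n)[X] n with h1 | h1
  · left; rw [h, h1, one_mul]
  · right; rw [h, h1, neg_one_mul]

theorem inverse_neg_of_isUnit {R : Type*} [Ring R] {x : R} (hx : IsUnit x) :
    Ring.inverse (-x) = -Ring.inverse x := by
  obtain ⟨x, rfl⟩ := hx
  rw [← Units.val_neg, Ring.inverse_unit, Ring.inverse_unit, inv_neg, Units.val_neg]

/-- The global sign `(-1) ^ n` cancels in the ratio and affects neither centrality nor
invertibility. -/
theorem newton_of_capelliSum (t : ClassicalType) (n : ℕ) (a : Equiv.Perm (Fin (t.size n)))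
    {f : LaurentSeries ℂ → LaurentSeries ℂ}
    (hf : ∀ c, t.capelliSeries n a c =
      FormalSeries.scalar (t.U n) (f (u ℂ + (c : LaurentSeries ℂ))) * ofPoly ((t.capelli n a).comp (X + (c : (t.U n)[X]))))
    {b r : LaurentSeries ℂ}
    (hunit : IsUnit (FormalSeries.scalar (t.U n) (f (u ℂ)) * ofPoly (t.capelliSum n a)))
    (h : (∀ k, (t.capelliSum n a).coeff k ∈ Subalgebra.center ℂ (t.U n)) ∧
      ∃ S : LaurentSeries (t.U n),
        HasFormalSum (fun k : ℕ => scalar (t.U n) ((-1) ^ k / (u ℂ + b) ^ (k + 1)) *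
          HahnSeries.C ((t.F n ^ k).trace)) S ∧
        1 + scalar (t.U n) r * S =
          FormalSeries.scalar (t.U n) (f (u ℂ + 1)) * ofPoly ((t.capelliSum n a).comp (X + 1)) *
            Ring.inverse (FormalSeries.scalar (t.U n) (f (u ℂ)) * ofPoly (t.capelliSum n a))) :
    (∀ k, (t.capelli n a).coeff k ∈ Subalgebra.center ℂ (t.U n)) ∧
    IsUnit (t.capelliSeries n a 0) ∧
    ∃ S : LaurentSeries (t.U n),
      HasFormalSum (fun k : ℕ => scalar (t.U n) ((-1) ^ k / (u ℂ + b) ^ (k + 1)) *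
        HahnSeries.C ((t.F n ^ k).trace)) S ∧
      1 + scalar (t.U n) r * S = t.capelliSeries n a 1 * Ring.inverse (t.capelliSeries n a 0) := by
  obtain ⟨h1, S, hS, h2⟩ := h
  have hneg : ∀ p : (t.U n)[X], ofPoly (-p) = -ofPoly p := fun p => by
    rw [ofPoly_eq_evalAt, map_neg, ofPoly_eq_evalAt]
  rw [hf, hf, Nat.cast_zero, Nat.cast_zero, add_zero, add_zero, comp_X, Nat.cast_one, Nat.cast_one]
  rcases t.capelli_eq_or n a with h3 | h3
  · rw [h3]
    exact ⟨h1, hunit, S, hS, h2⟩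
  · rw [h3, neg_comp, hneg, hneg, mul_neg, mul_neg, inverse_neg_of_isUnit hunit, neg_mul_neg]
    refine ⟨fun k => ?_, hunit.neg, S, hS, h2⟩
    rw [coeff_neg]
    exact neg_mem (h1 k)

theorem primeSum_eq_one {A : Type*} [Ring A] [Algebra ℂ A] {N : ℕ} (hN : N = 0)
    (M : Matrix (Fin N) (Fin N) A) (c : Fin N → ℂ) (a : Equiv.Perm (Fin N)) :
    primeSum M c a = 1 := by
  subst hN
  simp [primeSum, signedSum, PermMap.primePerm]

theorem newton_of_capelliSum_eq_one (t : ClassicalType) (n : ℕ) (a : Equiv.Perm (Fin (t.size n)))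
    (h0 : t.size n = 0) (hf : ∀ c, t.capelliSeries n a c =
      ofPoly ((t.capelli n a).comp (X + (c : (t.U n)[X]))))
    {b r : LaurentSeries ℂ} :
    (∀ k, (t.capelli n a).coeff k ∈ Subalgebra.center ℂ (t.U n)) ∧
    IsUnit (t.capelliSeries n a 0) ∧
    ∃ S : LaurentSeries (t.U n),
      HasFormalSum (fun k : ℕ => scalar (t.U n) ((-1) ^ k / (u ℂ + b) ^ (k + 1)) *
        HahnSeries.C ((t.F n ^ k).trace)) S ∧
      1 + scalar (t.U n) r * S = t.capelliSeries n a 1 * Ring.inverse (t.capelliSeries n a 0) := by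
  have h1 : FormalSeries.scalar (t.U n) 1 = 1 := map_one (scalarHom (t.U n))
  have h2 : t.capelliSum n a = 1 := primeSum_eq_one h0 _ _ _
  have h3 : ofPoly (1 : (t.U n)[X]) = 1 := by rw [ofPoly_eq_evalAt, map_one]
  have : IsEmpty (Fin (t.size n)) := by rw [h0]; infer_instance
  refine newton_of_capelliSum t n a (f := fun _ => 1) (fun c => ?_) ?_ ⟨fun k => ?_, 0,
    hasFormalSum_zero fun k => ?_, ?_⟩
  · rw [hf, h1, one_mul]
  · rw [h1, h2, h3, one_mul]
    exact isUnit_one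
  · rw [h2, coeff_one]
    split_ifs
    exacts [one_mem _, zero_mem _]
  · rw [trace_pow_eq_zero, map_zero, mul_zero]
  · rw [h1, h2, one_comp, h3]
    simp

theorem newton (t : ClassicalType) (n : ℕ) (a : Equiv.Perm (Fin (t.size n))) :
    (∀ k, (t.capelli n a).coeff k ∈ Subalgebra.center ℂ (t.U n)) ∧
    IsUnit (t.capelliSeries n a 0) ∧
    ∃ S : LaurentSeries (t.U n),
      HasFormalSum (fun k : ℕ => scalar (t.U n)
        ((-1) ^ k / (u ℂ + HahnSeries.C (t.rho n)) ^ (k + 1)) *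
          HahnSeries.C ((t.F n ^ k).trace)) S ∧
      1 + scalar (t.U n) ((2 * u ℂ + 1) / (2 * u ℂ + 1 - HahnSeries.C t.eps)) * S =
        t.capelliSeries n a 1 * Ring.inverse (t.capelliSeries n a 0) := by
  have h1 : ∀ A : Type, ∀ (_ : Ring A) (_ : Algebra ℂ A), FormalSeries.scalar A 1 = 1 :=
    fun A _ _ => map_one (scalarHom A)
  have hu0 : u ℂ ≠ 0 := by simpa using natCast_ne_neg_u 0 0
  have hu1 : u ℂ + 1 ≠ 0 := by simpa using natCast_ne_neg_u 0 1
  have e1 : (2 * u ℂ + 1) - HahnSeries.C (1 : ℂ) = 2 * u ℂ := by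
    rw [map_one, add_sub_cancel_right]
  have e2 : (2 * u ℂ + 1) - HahnSeries.C (-1 : ℂ) = 2 * (u ℂ + 1) := by
    rw [map_neg, map_one]
    ring
  cases t with
  | B =>
    have hN : 0 < B.size n := Nat.succ_pos _
    have he : (1 / 2 : ℂ) = (B.size n : ℂ) / 2 - (B.size n / 2 : ℕ) := by
      have : B.size n / 2 = n := by simp only [size]; omega
      rw [this]
      push_cast [size]
      ring
    have h2 : (HahnSeries.C (1 / 2 : ℂ) : LaurentSeries ℂ) = 1 / 2 := by
      rw [map_div₀, map_one, map_ofNat]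
    have := newton_orthogonal (c := fun i => B.rho (label B n i)) hN
      (isClassical_F_orth (by simp) n) (generates_F B n) a (rho_label_B n) (rho_B n) he
    -- This matches `2u / (2u + 1)` with the scalar `u / (u + e)` for `e = 1/2`.
    have hf : ∀ x : LaurentSeries ℂ, 2 * x / (2 * x + 1) = x / (x + HahnSeries.C (1 / 2)) := by
      intro x
      rw [h2, ← mul_div_mul_left x (x + 1 / 2) (two_ne_zero (α := LaurentSeries ℂ))]
      congr 1
      ring
    simp only [eps]
    rw [e1]
    refine newton_of_capelliSum B n a (f := fun x => x / (x + HahnSeries.C (1 / 2)))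
      (fun c => ?_) ?_ this
    · rw [← hf]
      rfl
    · refine (isUnit_scalar (div_ne_zero hu0 ?_)).mul (isUnit_ofPoly_primeSum hN a)
      exact u_add_C_ne_zero _
  | C =>
    simp only [eps]
    rw [e2]
    rcases Nat.eq_zero_or_pos n with rfl | hn
    · exact newton_of_capelliSum_eq_one C 0 a rfl fun c => rfl
    have hN : 0 < C.size n := Nat.mul_pos two_pos hn
    have := newton_symplectic (c := fun i => C.rho (label C n i)) hN
      (isClassical_F_sympl n) (generates_F C n) a (rho_label_C n) (rho_C hn)
    refine newton_of_capelliSum C n a (f := fun _ => 1) (fun c => ?_) ?_ ?_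
    · rw [h1, one_mul]
      rfl
    · rw [h1, one_mul]
      exact isUnit_ofPoly_primeSum hN a
    · rw [h1, one_mul, one_mul]
      exact this
  | D =>
    simp only [eps]
    rw [e1]
    rcases Nat.eq_zero_or_pos n with rfl | hn
    · exact newton_of_capelliSum_eq_one D 0 a rfl fun c => rfl
    have hN : 0 < D.size n := Nat.mul_pos two_pos hn
    have he : (0 : ℂ) = (D.size n : ℂ) / 2 - (D.size n / 2 : ℕ) := by
      have : D.size n / 2 = n := by simp only [size]; omega
      rw [this]
      push_cast [size]
      ring
    have := newton_orthogonal (c := fun i => D.rho (label D n i)) hN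
      (isClassical_F_orth (by simp) n) (generates_F D n) a (rho_label_D n) (rho_D hn) he
    rw [map_zero, add_zero, add_zero, div_self hu0, div_self hu1] at this
    refine newton_of_capelliSum D n a (f := fun _ => 1) (fun c => ?_) ?_ this
    · rw [h1, one_mul]
      rfl
    · rw [h1, one_mul]
      exact isUnit_ofPoly_primeSum hN a

end ClassicalType

/-! ## Harish-Chandra images -/

theorem List.prod_ofFn_mul_of_commute {M : Type*} [Monoid M] : ∀ {n : ℕ} (f g : Fin n → M),
    (∀ i j, Commute (f i) (g j)) →
      (List.ofFn fun i => f i * g i).prod = (List.ofFn f).prod * (List.ofFn g).prod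
  | 0, _, _, _ => by simp
  | n + 1, f, g, h => by
    have h1 : Commute (g 0) (List.ofFn fun i : Fin n => f i.succ).prod := by
      refine Commute.list_prod_right _ _ fun x hx => ?_
      obtain ⟨i, rfl⟩ := List.mem_ofFn.1 hx
      exact (h _ _).symm
    simp only [List.ofFn_succ, List.prod_cons]
    rw [List.prod_ofFn_mul_of_commute _ _ fun i j => h i.succ j.succ, mul_assoc, mul_assoc,
      ← mul_assoc (g 0), h1.eq, mul_assoc]

theorem List.prod_ofFn_eq_of_forall_ne {M : Type*} [Monoid M] : ∀ {n : ℕ} (f : Fin n → M)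
    (i : Fin n), (∀ j, j ≠ i → f j = 1) → (List.ofFn f).prod = f i
  | 0, _, i, _ => i.elim0
  | n + 1, f, i, h => by
    rw [List.ofFn_succ, List.prod_cons]
    induction i using Fin.cases with
    | zero =>
      rw [List.prod_eq_one, mul_one]
      intro x hx
      obtain ⟨j, rfl⟩ := List.mem_ofFn.1 hx
      exact h _ (Fin.succ_ne_zero j)
    | succ i =>
      rw [h 0 (Fin.succ_ne_zero i).symm, one_mul]
      exact List.prod_ofFn_eq_of_forall_ne _ i fun j hj => h _ fun e => hj (Fin.succ_injective _ e)

namespace GenLin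

variable {n : ℕ}

theorem commute_E_diag (i j : Fin n) : Commute (E n i i) (E n j j) := by
  have h := isGenLin_E n i i j j
  by_cases hij : i = j
  · subst hij
    exact Commute.refl _
  · rw [if_neg hij, if_neg hij, sub_zero, sub_eq_zero] at h
    exact h

variable (n) in
/-- Monomials in the elements `E i i`. -/
def cartanMonomial : Multiplicative (Fin n →₀ ℕ) →* U n where
  toFun m := (List.ofFn fun i : Fin n => E n i i ^ (m.toAdd i)).prod
  map_one' := by simp
  map_mul' m m' := by
    rw [← List.prod_ofFn_mul_of_commute _ _ fun i j => (commute_E_diag i j).pow_pow _ _]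
    simp only [toAdd_mul, Finsupp.add_apply, pow_add]

variable (n) in
/-- `cartanElement` as an algebra homomorphism. -/
def cartanHom : MvPolynomial (Fin n) ℂ →ₐ[ℂ] U n :=
  AddMonoidAlgebra.lift ℂ (U n) (Fin n →₀ ℕ) (cartanMonomial n)

theorem cartanHom_apply (f : MvPolynomial (Fin n) ℂ) : cartanHom n f = cartanElement n f :=
  AddMonoidAlgebra.lift_apply (cartanMonomial n) f

theorem cartanHom_X (i : Fin n) : cartanHom n (MvPolynomial.X i) = E n i i := by
  refine (AddMonoidAlgebra.lift_single (cartanMonomial n) (Finsupp.single i 1) (1 : ℂ)).trans ?_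
  rw [one_smul]
  refine (List.prod_ofFn_eq_of_forall_ne _ i fun j hj => ?_).trans ?_
  · simp [Finsupp.single_eq_of_ne hj]
  · simp

/-! ### The complement `𝔫⁻ U + U 𝔫⁺` -/

theorem E_mul_mem {i j : Fin n} (h : j < i) (a : U n) : E n i j * a ∈ triangularComplement n :=
  Submodule.subset_span (Or.inl ⟨i, j, a, h, rfl⟩)

theorem mul_E_mem {i j : Fin n} (h : i < j) (a : U n) : a * E n i j ∈ triangularComplement n :=
  Submodule.subset_span (Or.inr ⟨i, j, a, h, rfl⟩)

theorem E_diag_mul (k i j : Fin n) : E n k k * E n i j =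
    E n i j * E n k k + ((if k = i then 1 else 0 : ℂ) - if k = j then 1 else 0) • E n i j := by
  have h := isGenLin_E n k k i j
  rw [sub_eq_iff_eq_add] at h
  rw [h, add_comm]
  congr 1
  rw [sub_smul]
  split_ifs <;> simp_all

variable (n) in
/-- The elements which normalize `𝔫⁻ U + U 𝔫⁺`. -/
def complementNormalizer : Subalgebra ℂ (U n) where
  carrier := {h | ∀ x ∈ triangularComplement n,
    h * x ∈ triangularComplement n ∧ x * h ∈ triangularComplement n}
  mul_mem' := by
    intro a b ha hb x hx
    rw [mul_assoc, ← mul_assoc x]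
    exact ⟨(ha _ (hb x hx).1).1, (hb _ (ha x hx).2).2⟩
  add_mem' := by
    intro a b ha hb x hx
    rw [add_mul, mul_add]
    exact ⟨add_mem (ha x hx).1 (hb x hx).1, add_mem (ha x hx).2 (hb x hx).2⟩
  algebraMap_mem' := by
    intro c x hx
    rw [← Algebra.commutes c x, ← Algebra.smul_def]
    exact ⟨Submodule.smul_mem _ _ hx, Submodule.smul_mem _ _ hx⟩

theorem mem_complementNormalizer_of_center {z : U n} (hz : z ∈ Subalgebra.center ℂ (U n)) :
    z ∈ complementNormalizer n := by
  intro x hx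
  rw [Subalgebra.mem_center_iff.1 hz x, and_self]
  induction hx using Submodule.span_induction with
  | mem x h =>
    rcases h with ⟨i, j, a, h, rfl⟩ | ⟨i, j, a, h, rfl⟩
    · rw [← Subalgebra.mem_center_iff.1 hz, mul_assoc]
      exact E_mul_mem h _
    · rw [← mul_assoc]
      exact mul_E_mem h _
  | zero => rw [mul_zero]; exact zero_mem _
  | add x y _ _ hx hy => rw [mul_add]; exact add_mem hx hy
  | smul c x _ hx => rw [mul_smul_comm]; exact Submodule.smul_mem _ _ hx

theorem E_diag_mem_complementNormalizer (k : Fin n) : E n k k ∈ complementNormalizer n := by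
  intro x hx
  induction hx using Submodule.span_induction with
  | mem x h =>
    rcases h with ⟨i, j, a, h, rfl⟩ | ⟨i, j, a, h, rfl⟩
    · rw [← mul_assoc, E_diag_mul, add_mul, smul_mul_assoc, mul_assoc, mul_assoc]
      exact ⟨add_mem (E_mul_mem h _) (Submodule.smul_mem _ _ (E_mul_mem h _)), E_mul_mem h _⟩
    · have h1 : E n i j * E n k k = E n k k * E n i j -
          ((if k = i then 1 else 0 : ℂ) - if k = j then 1 else 0) • E n i j := by
        rw [E_diag_mul, add_sub_cancel_right]
      rw [← mul_assoc, mul_assoc a, h1, mul_sub, mul_smul_comm, ← mul_assoc]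
      exact ⟨mul_E_mem h _, sub_mem (mul_E_mem h _) (Submodule.smul_mem _ _ (mul_E_mem h _))⟩
  | zero => rw [mul_zero, zero_mul]; exact ⟨zero_mem _, zero_mem _⟩
  | add x y _ _ hx hy =>
    rw [mul_add, add_mul]
    exact ⟨add_mem hx.1 hy.1, add_mem hx.2 hy.2⟩
  | smul c x _ hx =>
    rw [mul_smul_comm, smul_mul_assoc]
    exact ⟨Submodule.smul_mem _ _ hx.1, Submodule.smul_mem _ _ hx.2⟩

theorem cartanHom_mem_complementNormalizer (f : MvPolynomial (Fin n) ℂ) :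
    cartanHom n f ∈ complementNormalizer n := by
  induction f using MvPolynomial.induction_on with
  | C c =>
    rw [← MvPolynomial.algebraMap_eq, AlgHom.commutes]
    exact algebraMap_mem _ _
  | add p q hp hq => rw [map_add]; exact add_mem hp hq
  | mul_X p i hp =>
    rw [map_mul, cartanHom_X]
    exact mul_mem hp (E_diag_mem_complementNormalizer i)

variable (n) in
/-- The pairs consisting of a central element and a Harish-Chandra image of it. -/
def harishChandraGraph : Subalgebra ℂ (U n × MvPolynomial (Fin n) ℂ) where
  carrier := {x | x.1 ∈ Subalgebra.center ℂ (U n) ∧ IsHarishChandraImage n x.1 x.2}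
  mul_mem' := by
    rintro ⟨z, f⟩ ⟨w, g⟩ ⟨hz, hf⟩ ⟨hw, hg⟩
    refine ⟨mul_mem hz hw, ?_⟩
    simp only [IsHarishChandraImage, ← cartanHom_apply] at *
    -- Multiplicativity of the images: central elements and Cartan polynomials both preserve the
    -- complement under multiplication, so each summand lies in it.
    have h : z * w - cartanHom n f * cartanHom n g =
        z * (w - cartanHom n g) + (z - cartanHom n f) * cartanHom n g := by noncomm_ring
    rw [Prod.mk_mul_mk, map_mul, h]
    exact add_mem (mem_complementNormalizer_of_center hz _ hg).1
      (cartanHom_mem_complementNormalizer g _ hf).2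
  add_mem' := by
    rintro ⟨z, f⟩ ⟨w, g⟩ ⟨hz, hf⟩ ⟨hw, hg⟩
    refine ⟨add_mem hz hw, ?_⟩
    simp only [IsHarishChandraImage, ← cartanHom_apply] at *
    rw [Prod.mk_add_mk, map_add, add_sub_add_comm]
    exact add_mem hf hg
  algebraMap_mem' := by
    intro c
    refine ⟨algebraMap_mem _ _, ?_⟩
    simp only [IsHarishChandraImage, ← cartanHom_apply, Prod.algebraMap_apply, AlgHom.commutes,
      sub_self, zero_mem]

/-! ### The image of the Capelli determinant -/

variable (n) in
/-- The polynomial `∏ (u + lᵢ)`. -/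
def capelliImage : (MvPolynomial (Fin n) ℂ)[X] := ∏ i : Fin n, (X + C (l n i))

/-- A lowering entry preceded only by normalizing factors puts the product in the complement: from
that entry on, the product lies in `𝔫⁻U`, whatever follows. -/
theorem prod_ofFn_coeff_mem : ∀ {m : ℕ} (f : Fin m → (U n)[X]) (i : Fin m) (a b : Fin n),
    b < a → f i = C (E n a b) → (∀ j < i, ∀ k, (f j).coeff k ∈ complementNormalizer n) →
      ∀ k, (List.ofFn f).prod.coeff k ∈ triangularComplement n
  | 0, _, i, _, _, _, _, _ => i.elim0
  | m + 1, f, i, a, b, hab, hi, hj => by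
    intro k
    rw [List.ofFn_succ, List.prod_cons]
    induction i using Fin.cases with
    | zero =>
      rw [hi, coeff_C_mul]
      exact E_mul_mem hab _
    | succ i =>
      rw [coeff_mul]
      refine sum_mem fun x _ => (hj 0 (Fin.succ_pos i) x.1 _ ?_).1
      exact prod_ofFn_coeff_mem _ i a b hab hi
        (fun j h => hj j.succ (Fin.succ_lt_succ_iff.2 h)) x.2

theorem coeff_shiftedEntry_diag_mem (c : ℂ) (i : Fin n) (k : ℕ) :
    (shiftedEntry (E n) c i i).coeff k ∈ complementNormalizer n := by
  rw [shiftedEntry, if_pos rfl, coeff_add, coeff_add, coeff_X, coeff_C, coeff_C]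
  refine add_mem (add_mem ?_ ?_) ?_
  · split_ifs
    exacts [one_mem _, zero_mem _]
  · split_ifs
    exacts [algebraMap_mem _ _, zero_mem _]
  · split_ifs
    exacts [E_diag_mem_complementNormalizer i, zero_mem _]

/-- The least point not fixed must move up, as all smaller values are taken. -/
theorem exists_lt_apply {p : Equiv.Perm (Fin n)} (hp : p ≠ 1) :
    ∃ i, i < p i ∧ ∀ j < i, p j = j := by
  obtain ⟨i0, h0⟩ : ∃ i, p i ≠ i := by
    by_contra! h
    exact hp (Equiv.ext h)
  obtain ⟨i, hi, hmin⟩ := WellFounded.has_min (wellFounded_lt (α := Fin n)) {i | p i ≠ i} ⟨i0, h0⟩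
  have hlt : ∀ j < i, p j = j := fun j hj => by
    by_contra h
    exact hmin j h hj
  refine ⟨i, lt_of_le_of_ne (not_lt.1 fun h => hi ?_) (Ne.symm hi), hlt⟩
  exact p.injective (hlt _ h)

/-- For a permutation other than the identity, the factors before its first moved index are diagonal
and the factor there is a lowering entry, so the term dies. The identity contributes `∏ (u + l_i)`.
-/
theorem coeff_capelli_sub_mem (k : ℕ) :
    IsHarishChandraImage n ((capelli n).coeff k) ((capelliImage n).coeff k) := by
  have h1 : (capelliImage n).map (cartanHom n : MvPolynomial (Fin n) ℂ →+* U n) =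
      (List.ofFn fun i : Fin n => shiftedEntry (E n) (-(i : ℂ)) ((1 : Equiv.Perm (Fin n)) i) i).prod := by
    rw [capelliImage, ← List.prod_ofFn, ← Polynomial.coe_mapRingHom, map_list_prod, List.map_ofFn]
    congr 2
    funext i
    have h : cartanHom n (l n i) = E n i i + algebraMap ℂ (U n) (-(i : ℂ)) := by
      rw [l, map_sub, cartanHom_X, ← MvPolynomial.algebraMap_eq, AlgHom.commutes, map_neg,
        sub_eq_add_neg]
    rw [Function.comp_apply, Polynomial.coe_mapRingHom, Polynomial.map_add, Polynomial.map_X,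
      Polynomial.map_C, RingHom.coe_coe, h, shiftedEntry, Equiv.Perm.one_apply, if_pos rfl, C_add,
      add_assoc, add_comm (C (E n i i))]
  rw [IsHarishChandraImage, ← cartanHom_apply]
  have h2 := coeff_map (p := capelliImage n) (cartanHom n : MvPolynomial (Fin n) ℂ →+* U n) k
  rw [RingHom.coe_coe] at h2
  rw [← h2, h1, capelli, ← Finset.add_sum_erase _ _ (Finset.mem_univ 1), Equiv.Perm.sign_one,
    Units.val_one, one_smul, coeff_add, add_sub_cancel_left, finsetSum_coeff]
  refine sum_mem fun p hp => ?_
  rw [coeff_smul]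
  refine zsmul_mem ?_ _
  obtain ⟨i, hi, hlt⟩ := exists_lt_apply (Finset.mem_erase.1 hp).1
  refine prod_ofFn_coeff_mem _ i (p i) i hi ?_ (fun j hj k => ?_) k
  · simp [shiftedEntry, hi.ne']
  · simp only [hlt j hj]
    exact coeff_shiftedEntry_diag_mem _ _ _

theorem mem_harishChandraGraph_coeff_capelli (k : ℕ) :
    ((capelli n).coeff k, (capelliImage n).coeff k) ∈ harishChandraGraph n :=
  ⟨(newton n).1 k, coeff_capelli_sub_mem k⟩

/-! ### The Gelfand invariants -/

/-- The entries of `E ^ k` transform under `𝔤𝔩ₙ` like those of `E`: in the induction the terms at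
the contracted index cancel. The trace is therefore invariant. -/
theorem E_mul_pow_sub (k : ℕ) (i j a b : Fin n) :
    E n i j * (E n ^ k) a b - (E n ^ k) a b * E n i j =
      (if j = a then (E n ^ k) i b else 0) - (if i = b then (E n ^ k) a j else 0) := by
  induction k generalizing a b with
  | zero =>
    simp only [pow_zero, Matrix.one_apply]
    by_cases h : a = b
    · subst h
      by_cases h' : j = a
      · subst h'
        simp
      · by_cases h'' : i = a
        · subst h''
          simp [h', Ne.symm h']
        · simp [h', h'']
    · by_cases h' : j = a
      · subst h'
        by_cases h'' : i = b
        · subst h''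
          simp [h]
        · simp [h, h'']
      · by_cases h'' : i = b
        · subst h''
          simp [h, h', Ne.symm h']
        · simp [h, h', h'']
  | succ k ih =>
    rw [pow_succ, Matrix.mul_apply, Finset.mul_sum, Finset.sum_mul, ← Finset.sum_sub_distrib]
    have h1 : ∀ c, E n i j * ((E n ^ k) a c * E n c b) - (E n ^ k) a c * E n c b * E n i j =
        (if j = a then (E n ^ k) i c * E n c b else 0) -
          (if i = c then (E n ^ k) a j * E n c b else 0) +
        ((if j = c then (E n ^ k) a c * E n i b else 0) -
          (if i = b then (E n ^ k) a c * E n c j else 0)) := by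
      intro c
      have e1 := congrArg (· * E n c b) (ih a c)
      have e2 := congrArg ((E n ^ k) a c * ·) (isGenLin_E n i j c b)
      simp only [sub_mul, mul_sub, ite_mul, zero_mul, mul_ite, mul_zero] at e1 e2
      rw [← e1, ← e2]
      noncomm_ring
    simp only [h1, Finset.sum_add_distrib, Finset.sum_sub_distrib, Finset.sum_ite_eq,
      Finset.mem_univ, if_true, Matrix.mul_apply]
    split_ifs <;> (try simp only [Finset.sum_const_zero]) <;> abel

theorem gelfand_mem_center (k : ℕ) : gelfand n k ∈ Subalgebra.center ℂ (U n) := by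
  refine generates_E n _ fun i j => ?_
  have h : E n i j * gelfand n k - gelfand n k * E n i j = 0 := by
    rw [gelfand, Matrix.trace, Finset.mul_sum, Finset.sum_mul, ← Finset.sum_sub_distrib]
    simp only [Matrix.diag_apply, E_mul_pow_sub, Finset.sum_sub_distrib, Finset.sum_ite_eq,
      Finset.mem_univ, if_true, sub_self]
  exact sub_eq_zero.1 h

end GenLin

/-! ## Uniqueness of Harish-Chandra images -/

namespace Fermion

theorem IsCAR.isGenLin {I R : Type*} [DecidableEq I] [Ring R] {ψ d : I → R} (h : IsCAR ψ d) :
    IsGenLin fun i j => ψ i * d j := by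
  intro i j k l
  have h1 : ψ i * d j * (ψ k * d l) = (if j = k then ψ i * d l else 0) -
      ψ i * ψ k * (d j * d l) := by
    calc _ = ψ i * (d j * ψ k) * d l := by noncomm_ring
      _ = _ := by
        rw [h.d_psi, mul_sub, sub_mul, mul_ite, mul_one, mul_zero, ite_mul, zero_mul]
        noncomm_ring
  have h2 : ψ k * d l * (ψ i * d j) = (if i = l then ψ k * d j else 0) -
      ψ i * ψ k * (d j * d l) := by
    calc _ = ψ k * (d l * ψ i) * d j := by noncomm_ring
      _ = (if i = l then ψ k * d j else 0) - (ψ k * ψ i) * (d l * d j) := by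
        rw [h.d_psi, mul_sub, sub_mul, mul_ite, mul_one, mul_zero, ite_mul, zero_mul]
        simp only [eq_comm (a := l)]
        noncomm_ring
      _ = _ := by
        rw [h.psi_psi k i, h.d_d l j, neg_mul_neg]
  rw [h1, h2, sub_sub_sub_cancel_right]

theorem IsGenLin.sum_diag {I J R : Type*} [DecidableEq I] [DecidableEq J] [Fintype J] [Ring R]
    {T : I × J → I × J → R} (h : IsGenLin T) : IsGenLin fun i j => ∑ a, T (i, a) (j, a) := by
  intro i j k l
  simp only [Finset.sum_mul, Finset.mul_sum]
  rw [Finset.sum_comm (s := Finset.univ) (t := Finset.univ)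
    (f := fun a b => T (k, b) (l, b) * T (i, a) (j, a)), ← Finset.sum_sub_distrib]
  simp only [← Finset.sum_sub_distrib, h _ _ _ _, Prod.mk.injEq]
  simp only [Finset.sum_sub_distrib]
  congr 1
  · by_cases hjk : j = k
    · simp [hjk]
    · simp [hjk]
  · by_cases hil : i = l
    · simp [hil]
    · simp [hil]

end Fermion

/-! ### Highest weight vectors in exterior algebras -/

namespace GenLin

variable {n : ℕ} {R : Type*} [Ring R] [Algebra ℂ R] {T : Fin n → Fin n → R}

/-- The Lie algebra homomorphism attached to a solution of the commutation relations of `𝔤𝔩ₙ`. -/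
def lieHomOfIsGenLin (h : IsGenLin T) : Matrix (Fin n) (Fin n) ℂ →ₗ⁅ℂ⁆ R where
  toFun M := ∑ i, ∑ j, M i j • T i j
  map_add' M N := by simp only [Matrix.add_apply, add_smul, Finset.sum_add_distrib]
  map_smul' c M := by
    simp only [Matrix.smul_apply, smul_eq_mul, mul_smul, Finset.smul_sum, RingHom.id_apply]
  map_lie' := by
    intro M N
    have key : ∀ M N : Matrix (Fin n) (Fin n) ℂ, ∑ i, ∑ j, ∑ k, ∑ l,
        (M i j * N k l) • (if j = k then T i l else 0) = ∑ i, ∑ l, (M * N) i l • T i l := by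
      intro M N
      simp only [smul_ite, smul_zero, Matrix.mul_apply, Finset.sum_smul]
      refine Finset.sum_congr rfl fun i _ => ?_
      simp only [Finset.sum_ite_irrel, Finset.sum_const_zero, Finset.sum_ite_eq, Finset.mem_univ,
        if_true]
      exact Finset.sum_comm
    have h1 : ∀ M N : Matrix (Fin n) (Fin n) ℂ,
        (∑ i, ∑ j, M i j • T i j) * (∑ k, ∑ l, N k l • T k l) =
          ∑ i, ∑ j, ∑ k, ∑ l, (M i j * N k l) • (T i j * T k l) := by
      intro M N
      simp only [Finset.sum_mul]
      simp only [Finset.mul_sum, smul_mul_smul_comm]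
    have h2 : ∀ F : Fin n → Fin n → Fin n → Fin n → R,
        ∑ i, ∑ j, ∑ k, ∑ l, F i j k l = ∑ k, ∑ l, ∑ i, ∑ j, F i j k l := by
      intro F
      simp only [← Fintype.sum_prod_type' (f := fun (i : Fin n) (j : Fin n) => _)]
      exact Finset.sum_comm
    simp only [LieRing.of_associative_ring_bracket, Matrix.sub_apply, sub_smul,
      Finset.sum_sub_distrib]
    rw [← key M N, ← key N M, h1, h1, h2 fun k l i j => (N k l * M i j) • (T k l * T i j),
      h2 fun k l i j => (N k l * M i j) • (if l = i then T k j else 0)]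
    simp only [← Finset.sum_sub_distrib]
    refine Finset.sum_congr rfl fun i _ => Finset.sum_congr rfl fun j _ =>
      Finset.sum_congr rfl fun k _ => Finset.sum_congr rfl fun l _ => ?_
    rw [mul_comm (N k l), ← smul_sub, ← smul_sub, h i j k l]
    simp only [eq_comm (a := l)]

/-- The representation attached to a solution of the commutation relations of `𝔤𝔩ₙ`. -/
def liftOfIsGenLin (h : IsGenLin T) : U n →ₐ[ℂ] R :=
  UniversalEnvelopingAlgebra.lift ℂ (lieHomOfIsGenLin h)

theorem liftOfIsGenLin_E (h : IsGenLin T) (i j : Fin n) : liftOfIsGenLin h (E n i j) = T i j := by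
  rw [liftOfIsGenLin, E, UniversalEnvelopingAlgebra.lift_ι_apply]
  change ∑ k, ∑ l, Matrix.single i j (1 : ℂ) k l • T k l = T i j
  simp [Matrix.single_apply, ite_and]

/-- The matrix units of `𝔤𝔩ₙ` acting on the exterior algebra of `ℂⁿ ⊗ ℂᵐ`. -/
def fockE (n m : ℕ) (i j : Fin n) : Module.End ℂ (Fock (Fin n ×ₗ Fin m) ℂ) :=
  ∑ a, cre ℂ ℂ (toLex (i, a)) * ann ℂ ℂ (toLex (j, a))

theorem isGenLin_fockE (n m : ℕ) : IsGenLin (fockE n m) := by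
  have h := (isCAR_cre_ann (K := ℂ) (B := ℂ) (α := Fin n ×ₗ Fin m)).isGenLin
  exact IsGenLin.sum_diag (I := Fin n) (J := Fin m)
    (T := fun p q => cre ℂ ℂ (toLex p) * ann ℂ ℂ (toLex q))
    fun i j k l => by simpa only [toLex_inj] using h (toLex i) (toLex j) (toLex k) (toLex l)

theorem fockE_apply (m : ℕ) (i j : Fin n) (f : Fock (Fin n ×ₗ Fin m) ℂ)
    (S : Finset (Fin n ×ₗ Fin m)) : fockE n m i j f S = ∑ a : Fin m,
      if toLex (i, a) ∈ S ∧ toLex (j, a) ∉ S.erase (toLex (i, a)) then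
        sgnLt (toLex (i, a)) S • sgnLt (toLex (j, a)) (S.erase (toLex (i, a))) •
          f (insert (toLex (j, a)) (S.erase (toLex (i, a)))) else 0 := by
  rw [fockE, LinearMap.sum_apply, Fock.sum_apply]
  refine Finset.sum_congr rfl fun a _ => ?_
  rw [Module.End.mul_apply, cre_apply, ann_apply]
  split_ifs <;> simp_all

/-- The Young diagram of a weight. -/
def weightSet (m : ℕ) (w : Fin n → ℕ) : Finset (Fin n ×ₗ Fin m) :=
  Finset.univ.filter fun p => ((ofLex p).2 : ℕ) < w (ofLex p).1

@[simp] theorem mem_weightSet {m : ℕ} {w : Fin n → ℕ} {i : Fin n} {a : Fin m} :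
    toLex (i, a) ∈ weightSet m w ↔ (a : ℕ) < w i := by
  simp [weightSet]

/-- The basis vector of a finite set. -/
def basisVector {α : Type*} [DecidableEq α] (S : Finset α) : Fock α ℂ :=
  (fun S' => if S' = S then 1 else 0 : Finset α → ℂ)

theorem basisVector_apply {α : Type*} [DecidableEq α] (S S' : Finset α) :
    basisVector S S' = if S' = S then 1 else 0 := rfl

variable {m : ℕ} {w : Fin n → ℕ}

/-- Producing the diagram by moving a box from row `j` down to row `i` would leave row `j` without a
box above one of row `i`, impossible for decreasing row lengths. Dually, the raising operators
annihilate the diagram vector. -/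
theorem fockE_apply_weightSet (hw : Antitone w) {i j : Fin n} (h : j < i)
    (f : Fock (Fin n ×ₗ Fin m) ℂ) : fockE n m i j f (weightSet m w) = 0 := by
  rw [fockE_apply]
  refine Finset.sum_eq_zero fun a _ => if_neg ?_
  rintro ⟨h1, h2⟩
  rw [mem_weightSet] at h1
  refine h2 (Finset.mem_erase.2 ⟨?_, mem_weightSet.2 (h1.trans_le (hw h.le))⟩)
  simp [h.ne]

theorem fockE_basisVector_of_lt (hw : Antitone w) {i j : Fin n} (h : i < j) :
    fockE n m i j (basisVector (weightSet m w)) = 0 := by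
  ext S
  rw [fockE_apply]
  refine Finset.sum_eq_zero fun a _ => ?_
  rw [basisVector_apply, if_neg (c := insert _ _ = _), smul_zero, smul_zero, ite_self]
  intro h1
  have h2 : toLex (j, a) ∈ weightSet m w := h1 ▸ Finset.mem_insert_self _ _
  have h3 : toLex (i, a) ∈ weightSet m w :=
    mem_weightSet.2 ((mem_weightSet.1 h2).trans_le (hw h.le))
  rw [← h1] at h3
  simp [h.ne] at h3

theorem fockE_basisVector_diag (hm : ∀ i, w i ≤ m) (i : Fin n) :
    fockE n m i i (basisVector (weightSet m w)) = (w i : ℂ) • basisVector (weightSet m w) := by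
  ext S
  rw [fockE_apply, Fock.smul_apply, basisVector_apply]
  have h1 : ∀ a : Fin m, (if toLex (i, a) ∈ S ∧ toLex (i, a) ∉ S.erase (toLex (i, a)) then
        sgnLt (toLex (i, a)) S • sgnLt (toLex (i, a)) (S.erase (toLex (i, a))) •
          basisVector (weightSet m w) (insert (toLex (i, a)) (S.erase (toLex (i, a)))) else 0) =
      if toLex (i, a) ∈ S then (if S = weightSet m w then (1 : ℂ) else 0) else 0 := by
    intro a
    by_cases h : toLex (i, a) ∈ S
    · rw [if_pos ⟨h, Finset.notMem_erase _ _⟩, if_pos h, Finset.insert_erase h, smul_smul,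
        sgnLt_erase h, if_neg (lt_irrefl _), one_mul, sgnLt_mul_self, one_smul, basisVector_apply]
    · rw [if_neg fun h' => h h'.1, if_neg h]
  rw [Finset.sum_congr rfl fun a _ => h1 a]
  by_cases hS : S = weightSet m w
  · simp only [hS, if_true, mem_weightSet, Finset.sum_boole, smul_eq_mul, mul_one]
    congr 1
    rw [Fin.card_filter_val_lt, min_eq_right (hm i)]
  · simp [hS]

variable (m w) in
/-- The diagonal matrix coefficient of a highest weight vector. -/
def weightFunctional : U n →ₗ[ℂ] ℂ :=
  Fock.coeff ℂ (weightSet m w) ∘ₗ LinearMap.applyₗ (basisVector (weightSet m w)) ∘ₗ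
    (liftOfIsGenLin (isGenLin_fockE n m)).toLinearMap

theorem weightFunctional_apply (x : U n) : weightFunctional m w x =
    liftOfIsGenLin (isGenLin_fockE n m) x (basisVector (weightSet m w)) (weightSet m w) := rfl

theorem weightFunctional_of_mem (hw : Antitone w) {x : U n} (hx : x ∈ triangularComplement n) :
    weightFunctional m w x = 0 := by
  induction hx using Submodule.span_induction with
  | mem x h =>
    rw [weightFunctional_apply]
    rcases h with ⟨i, j, a, h, rfl⟩ | ⟨i, j, a, h, rfl⟩
    · rw [map_mul, liftOfIsGenLin_E, Module.End.mul_apply, fockE_apply_weightSet hw h]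
    · rw [map_mul, liftOfIsGenLin_E, Module.End.mul_apply, fockE_basisVector_of_lt hw h, map_zero]
      rfl
  | zero => exact map_zero _
  | add x y _ _ hx hy => rw [map_add, hx, hy, add_zero]
  | smul c x _ hx => rw [map_smul, hx, smul_zero]

theorem weightFunctional_cartanHom (hm : ∀ i, w i ≤ m) (f : MvPolynomial (Fin n) ℂ) :
    weightFunctional m w (cartanHom n f) = MvPolynomial.eval (fun i => (w i : ℂ)) f := by
  have h : liftOfIsGenLin (isGenLin_fockE n m) (cartanHom n f) (basisVector (weightSet m w)) =
      MvPolynomial.eval (fun i => (w i : ℂ)) f • basisVector (weightSet m w) := by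
    induction f using MvPolynomial.induction_on with
    | C c =>
      rw [MvPolynomial.eval_C, ← MvPolynomial.algebraMap_eq, AlgHom.commutes, AlgHom.commutes]
      rfl
    | add p q hp hq => rw [map_add, map_add, LinearMap.add_apply, hp, hq, map_add, add_smul]
    | mul_X p i hp =>
      rw [map_mul, map_mul, cartanHom_X, liftOfIsGenLin_E, Module.End.mul_apply,
        fockE_basisVector_diag hm, map_smul, hp, smul_smul, map_mul, MvPolynomial.eval_X, mul_comm]
  rw [weightFunctional_apply, h, Fock.smul_apply, basisVector_apply, if_pos rfl, smul_eq_mul,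
    mul_one]

/-- The diagonal coefficient at a highest weight vector vanishes on the complement and evaluates a
Cartan polynomial at the weight. Thus `f` vanishes on all decreasing weights, which contain a grid
large enough for its degree. -/
theorem eq_zero_of_cartanHom_mem {f : MvPolynomial (Fin n) ℂ}
    (hf : cartanHom n f ∈ triangularComplement n) : f = 0 := by
  set D := f.totalDegree + 1 with hD
  -- Variable `i` ranges over a block of `D` consecutive integers. Blocks are disjoint and decrease
  -- with `i`, so every point of the grid is a decreasing weight, bounded by `n * D`.
  refine MvPolynomial.eq_zero_of_eval_zero_at_prod_finset f
    (fun i => (Finset.range D).image fun t => (((Fin.rev i : ℕ) * D + t : ℕ) : ℂ)) (fun i => ?_) ?_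
  · rw [Finset.card_image_of_injective, Finset.card_range]
    · exact Nat.lt_succ_of_le (MvPolynomial.degreeOf_le_totalDegree f i)
    · intro s t hst
      simpa using hst
  · intro x hx
    have h1 : ∀ i, ∃ t < D, (((Fin.rev i : ℕ) * D + t : ℕ) : ℂ) = x i := fun i => by
      simpa using hx i
    choose t ht hxt using h1
    have hw : Antitone fun i : Fin n => (Fin.rev i : ℕ) * D + t i := by
      intro i j hij
      rcases hij.eq_or_lt with rfl | hij
      · rfl
      · have h2 : (Fin.rev j : ℕ) + 1 ≤ Fin.rev i := by
          have := Fin.rev_lt_rev.2 hij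
          exact this
        have h3 := Nat.mul_le_mul_right D h2
        have h4 := ht j
        dsimp only
        rw [add_mul, one_mul] at h3
        omega
    have h5 := weightFunctional_of_mem (m := n * D) hw hf
    rw [weightFunctional_cartanHom] at h5
    · rw [← h5]
      congr 1
      · congr 1
        funext i
        exact (hxt i).symm
    · intro i
      have h2 : (Fin.rev i : ℕ) + 1 ≤ n := (Fin.rev i).2
      have h3 := Nat.mul_le_mul_right D h2
      have h4 := ht i
      rw [add_mul, one_mul] at h3
      omega

theorem IsHarishChandraImage.unique {z : U n} {f g : MvPolynomial (Fin n) ℂ}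
    (hf : IsHarishChandraImage n z f) (hg : IsHarishChandraImage n z g) : f = g := by
  rw [IsHarishChandraImage, ← cartanHom_apply] at hf hg
  rw [← sub_eq_zero]
  refine eq_zero_of_cartanHom_mem ?_
  rw [map_sub, ← sub_sub_sub_cancel_left _ _ z]
  exact sub_mem hg hf

end GenLin

/-! ## Harish-Chandra images of the Gelfand invariants -/

namespace FormalSeries

theorem VanishesBelow.pow {A : Type*} [Ring A] {a : ℤ} {x : LaurentSeries A}
    (hx : VanishesBelow a x) (k : ℕ) : VanishesBelow (k * a) (x ^ k) := by
  induction k with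
  | zero => simpa using vanishesBelow_C (1 : A)
  | succ k ih =>
    rw [pow_succ, Nat.cast_succ, add_mul, one_mul]
    exact ih.mul hx

theorem neg_one_pow_div_eq (c : ℂ) (k : ℕ) : (-1) ^ k / (u ℂ + HahnSeries.C c) ^ (k + 1) =
    HahnSeries.C ((-1) ^ k) * (u ℂ + HahnSeries.C c)⁻¹ ^ (k + 1) := by
  rw [map_pow, map_neg, map_one, inv_pow, div_eq_mul_inv]

theorem vanishesBelow_neg_one_pow_div (c : ℂ) (k : ℕ) :
    VanishesBelow (k + 1) ((-1) ^ k / (u ℂ + HahnSeries.C c) ^ (k + 1)) := by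
  rw [neg_one_pow_div_eq]
  simpa using (vanishesBelow_C ((-1 : ℂ) ^ k)).mul (vanishesBelow_inv_pow c (k + 1))

theorem coeff_neg_one_pow_div_ne_zero (c : ℂ) (k : ℕ) :
    ((-1) ^ k / (u ℂ + HahnSeries.C c) ^ (k + 1)).coeff (k + 1) ≠ 0 := by
  intro h
  have h1 : VanishesBelow (k + 2) ((-1) ^ k / (u ℂ + HahnSeries.C c) ^ (k + 1)) := by
    intro d hd
    rcases (show d < k + 1 ∨ d = k + 1 by omega) with h' | rfl
    · exact vanishesBelow_neg_one_pow_div c k d h'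
    · exact h
  have h2 := h1.mul ((coeff_u_add_C c).1.pow (k + 1))
  rw [div_mul_cancel₀ _ (pow_ne_zero _ (u_add_C_ne_zero c))] at h2
  have h3 := h2 0 (by push_cast; omega)
  rcases neg_one_pow_eq_or (LaurentSeries ℂ) k with h4 | h4 <;> simp [h4] at h3

variable {A : Type*} [Ring A] [Algebra ℂ A]

theorem coeff_scalar_mul_C (r : LaurentSeries ℂ) (x : A) (d : ℤ) :
    (scalar A r * HahnSeries.C x).coeff d = r.coeff d • x := by
  rw [HahnSeries.C_apply, HahnSeries.coeff_mul_single_zero, scalar, HahnSeries.map_coeff,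
    Algebra.smul_def]

/-- The terms of a triangular series belong to any subspace containing the coefficients of its
sum. -/
theorem mem_of_hasFormalSum {r : ℕ → LaurentSeries ℂ} (hr : ∀ k : ℕ, VanishesBelow (k + 1) (r k))
    (hr' : ∀ k : ℕ, (r k).coeff (k + 1) ≠ 0) {x : ℕ → A} {S : LaurentSeries A}
    (hS : HasFormalSum (fun k => scalar A (r k) * HahnSeries.C (x k)) S) {V : Submodule ℂ A}
    (hV : ∀ d, S.coeff d ∈ V) (k : ℕ) : x k ∈ V := by
  induction k using Nat.strong_induction_on with
  | _ k ih =>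
    obtain ⟨K, hK⟩ := hS (k + 1)
    have h1 := hK (max K (k + 1)) (le_max_left _ _) _ le_rfl
    simp only [HahnSeries.coeff_sum, coeff_scalar_mul_C] at h1
    rw [← Finset.sum_subset (Finset.range_mono (le_max_right K (k + 1))), Finset.sum_range_succ] at h1
    · have h2 : (r k).coeff (k + 1) • x k ∈ V := by
        rw [← eq_sub_iff_add_eq'] at h1
        rw [h1]
        exact sub_mem (hV _) (sum_mem fun j hj => Submodule.smul_mem _ _ (ih j (Finset.mem_range.1 hj)))
      exact (Submodule.smul_mem_iff _ (hr' k)).1 h2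
    · intro j _ hj
      rw [Finset.mem_range] at hj
      rw [hr j _ (by omega), zero_smul]

theorem prod_one_add_inverse {A I : Type*} [CommRing A] [Fintype I] (x : I → A)
    (hx : ∀ i, IsUnit (x i)) :
    ∏ i, (1 + Ring.inverse (x i)) = (∏ i, (x i + 1)) * Ring.inverse (∏ i, x i) := by
  have h : IsUnit (∏ i, x i) := IsUnit.prod_univ_iff.2 hx
  rw [Ring.eq_mul_inverse_iff_mul_eq _ _ _ h, ← Finset.prod_mul_distrib]
  refine Finset.prod_congr rfl fun i _ => ?_
  rw [add_mul, one_mul, Ring.inverse_mul_cancel _ (hx i)]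

theorem map_ringInverse {A B : Type*} [Ring A] [Ring B] (f : A →+* B) {x : A} (hx : IsUnit x) :
    f (Ring.inverse x) = Ring.inverse (f x) := by
  obtain ⟨x, rfl⟩ := hx
  rw [Ring.inverse_unit]
  exact (Ring.inverse_unit (Units.map (f : A →* B) x)).symm

end FormalSeries

namespace GenLin

variable {n : ℕ}

variable (n) in
theorem natDegree_capelli_le : (capelli n).natDegree ≤ n :=
  natDegree_signedSum_le (E n) (fun i : Fin n => -((i : ℕ) : ℂ))
    (fun p : Equiv.Perm (Fin n) => (Equiv.Perm.sign p : ℤ)) (fun p i => p i) fun _ i => i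

variable (n) in
theorem coeff_capelli_self : (capelli n).coeff n = 1 := by
  have h := coeff_signedSum (E n) (fun i : Fin n => -((i : ℕ) : ℂ))
    (fun p : Equiv.Perm (Fin n) => (Equiv.Perm.sign p : ℤ)) (fun p i => p i) fun _ i => i
  rw [sum_sign_mul_prod_ite, Int.cast_one] at h
  exact h

variable (n) in
theorem natDegree_capelliImage : (capelliImage n).natDegree = n := by
  rw [capelliImage, natDegree_prod_of_monic _ _ fun i _ => monic_X_add_C _]
  simp

variable (n) in
theorem coeff_capelliImage_self : (capelliImage n).coeff n = 1 := by
  have h : (capelliImage n).Monic := monic_prod_of_monic _ _ fun i _ => monic_X_add_C _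
  have h1 := h.coeff_natDegree
  rwa [natDegree_capelliImage] at h1

/-- The ratio `p(u + 1) / p(u)` of formal series. -/
def shiftRatio {A : Type*} [Ring A] (p : A[X]) : LaurentSeries A :=
  ofPoly (p.comp (X + 1)) * Ring.inverse (ofPoly p)

theorem seriesMap_shiftRatio {A B : Type*} [Ring A] [Ring B] (f : A →+* B) {p : A[X]}
    (hp : IsUnit (ofPoly p)) : seriesMap f (shiftRatio p) = shiftRatio (p.map f) := by
  rw [shiftRatio, shiftRatio, map_mul, map_ringInverse _ hp, seriesMap_ofPoly, seriesMap_ofPoly,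
    Polynomial.map_comp]
  simp

/-- Form the determinant over the algebra of pairs itself. Its leading coefficient is `1`, so its
ratio exists there, and the two projections recover both ratios at once. -/
theorem coeff_shiftRatio_mem (d : ℤ) : ((shiftRatio (capelli n)).coeff d,
    (shiftRatio (capelliImage n)).coeff d) ∈ harishChandraGraph n := by
  let H := harishChandraGraph n
  let p : H[X] := ∑ k ∈ Finset.range (n + 1), monomial k ⟨_, mem_harishChandraGraph_coeff_capelli k⟩
  have hc : ∀ k ≤ n, p.coeff k = ⟨_, mem_harishChandraGraph_coeff_capelli k⟩ := by
    intro k hk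
    simp only [p, finsetSum_coeff, coeff_monomial]
    rw [Finset.sum_eq_single k (fun j _ hj => if_neg hj) fun h => ?_, if_pos rfl]
    exact absurd (Finset.mem_range.2 (Nat.lt_succ_of_le hk)) h
  have hd : p.natDegree ≤ n := natDegree_sum_le_of_forall_le _ _ fun k hk =>
    (natDegree_monomial_le _).trans (Nat.lt_succ_iff.1 (Finset.mem_range.1 hk))
  have hp : IsUnit (ofPoly p) := by
    refine isUnit_ofPoly hd ?_
    have h1 : p.coeff n = 1 := by
      rw [hc n le_rfl]
      exact Subtype.ext (Prod.ext (coeff_capelli_self n) (coeff_capelliImage_self n))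
    rw [h1]
    exact isUnit_one
  have hmap : ∀ {B : Type} [Ring B] (f : H →+* B) (q : B[X]), q.natDegree ≤ n →
      (∀ k, f ⟨_, mem_harishChandraGraph_coeff_capelli k⟩ = q.coeff k) → p.map f = q := by
    intro B _ f q hq hf
    ext k
    rw [coeff_map]
    rcases le_or_gt k n with hk | hk
    · rw [hc k hk, hf]
    · rw [coeff_eq_zero_of_natDegree_lt (hd.trans_lt hk),
        coeff_eq_zero_of_natDegree_lt (hq.trans_lt hk), map_zero]
  have h1 := seriesMap_shiftRatio ((RingHom.fst _ _).comp H.val.toRingHom) hp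
  have h2 := seriesMap_shiftRatio ((RingHom.snd _ _).comp H.val.toRingHom) hp
  rw [hmap _ (capelli n) (natDegree_capelli_le n) fun k => rfl] at h1
  rw [hmap _ (capelliImage n) (natDegree_capelliImage n).le fun k => rfl] at h2
  rw [← h1, ← h2]
  exact ((shiftRatio p).coeff d).2

theorem coeff_shiftRatio_sub_one_mem (d : ℤ) : ((shiftRatio (capelli n) - 1).coeff d,
    (shiftRatio (capelliImage n) - 1).coeff d) ∈ harishChandraGraph n := by
  have h : ((1 : LaurentSeries (U n)).coeff d,
      (1 : LaurentSeries (MvPolynomial (Fin n) ℂ)).coeff d) ∈ harishChandraGraph n := by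
    rw [HahnSeries.coeff_one, HahnSeries.coeff_one]
    split_ifs
    exacts [one_mem _, zero_mem _]
  exact sub_mem (coeff_shiftRatio_mem d) h

variable (n) in
theorem hasFormalSum_gelfand :
    HasFormalSum (fun k : ℕ => scalar (U n) ((-1) ^ k / (u ℂ - n + 1) ^ (k + 1)) *
      HahnSeries.C (gelfand n k)) (shiftRatio (capelli n) - 1) := by
  obtain ⟨-, -, S, hS, h⟩ := newton n
  rw [shiftRatio, ← h, add_sub_cancel_left]
  exact hS

/-- Newton's series is triangular in the `tr E^k` with nonzero scalar coefficients, so each of them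
lies in the linear span of the coefficients of the ratio, all of which have images. -/
theorem exists_isHarishChandraImage_gelfand (k : ℕ) :
    ∃ f, IsHarishChandraImage n (gelfand n k) f := by
  have hu : u ℂ - (n : LaurentSeries ℂ) + 1 = u ℂ + HahnSeries.C (1 - n : ℂ) := by
    rw [map_sub, map_one, map_natCast]
    ring
  have h := hasFormalSum_gelfand n
  rw [hu] at h
  obtain ⟨x, hx, hx'⟩ := mem_of_hasFormalSum (vanishesBelow_neg_one_pow_div _)
    (coeff_neg_one_pow_div_ne_zero _) h
    (V := Subalgebra.toSubmodule ((harishChandraGraph n).map (AlgHom.fst ℂ _ _)))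
    (fun d => ⟨_, coeff_shiftRatio_sub_one_mem d, rfl⟩) k
  refine ⟨x.2, ?_⟩
  rw [← hx']
  exact hx.2

theorem isUnit_u_add_C_l (i : Fin n) :
    IsUnit (u (MvPolynomial (Fin n) ℂ) + HahnSeries.C (l n i)) := by
  have h : ofPoly (X + C (l n i)) = u (MvPolynomial (Fin n) ℂ) + HahnSeries.C (l n i) := by
    rw [ofPoly, eval₂_add, eval₂_X, eval₂_C]
  rw [← h]
  refine isUnit_ofPoly (N := 1) (natDegree_X_add_C _).le ?_
  simp

theorem shiftRatio_capelliImage : shiftRatio (capelliImage n) =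
    ∏ i : Fin n, (1 + Ring.inverse
      (u (MvPolynomial (Fin n) ℂ) + HahnSeries.C (l n i))) := by
  rw [prod_one_add_inverse _ isUnit_u_add_C_l, shiftRatio, capelliImage, ofPoly_eq_evalAt,
    ofPoly_eq_evalAt, Polynomial.prod_comp, map_prod, map_prod]
  have h : ∀ i : Fin n, evalAt (u ℂ) (X + C (l n i)) =
      u (MvPolynomial (Fin n) ℂ) + HahnSeries.C (l n i) := fun i => by
    rw [map_add, evalAt_X, scalar_u, evalAt_C]
  have h' : ∀ i : Fin n, evalAt (u ℂ) (X + 1 + C (l n i)) =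
      u (MvPolynomial (Fin n) ℂ) + HahnSeries.C (l n i) + 1 := fun i => by
    rw [add_right_comm, map_add, h, map_one]
  simp only [h, add_comp, X_comp, C_comp, h']

theorem isHarishChandraImage_sum_smul (s : Finset ℕ) (c : ℕ → ℂ) {z : ℕ → U n}
    {f : ℕ → MvPolynomial (Fin n) ℂ} (h : ∀ k, IsHarishChandraImage n (z k) (f k)) :
    IsHarishChandraImage n (∑ k ∈ s, c k • z k) (∑ k ∈ s, c k • f k) := by
  simp only [IsHarishChandraImage, ← cartanHom_apply] at *
  rw [map_sum, ← Finset.sum_sub_distrib]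
  refine sum_mem fun k _ => ?_
  rw [map_smul, ← smul_sub]
  exact Submodule.smul_mem _ _ (h k)

theorem harishChandra_gelfand (n : ℕ) :
    (∀ k, gelfand n k ∈ Subalgebra.center ℂ (U n)) ∧
    (∀ k f, IsHarishChandraImage n (gelfand n k) f ↔ f = chi n (gelfand n k)) ∧
    (∀ i, IsUnit (u (MvPolynomial (Fin n) ℂ) + HahnSeries.C (l n i))) ∧
    ∃ S : LaurentSeries (MvPolynomial (Fin n) ℂ),
      HasFormalSum (fun k : ℕ =>
        scalar (MvPolynomial (Fin n) ℂ) ((-1) ^ k / (u ℂ - n + 1) ^ (k + 1)) *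
          HahnSeries.C (chi n (gelfand n k))) S ∧
      1 + S = ∏ i : Fin n, (1 + Ring.inverse
        (u (MvPolynomial (Fin n) ℂ) + HahnSeries.C (l n i))) := by
  have hchi : ∀ k, IsHarishChandraImage n (gelfand n k) (chi n (gelfand n k)) := fun k =>
    Classical.epsilon_spec (exists_isHarishChandraImage_gelfand k)
  refine ⟨gelfand_mem_center, fun k f => ⟨fun hf => hf.unique (hchi k), ?_⟩, isUnit_u_add_C_l,
    shiftRatio (capelliImage n) - 1, fun d => ?_, ?_⟩
  · rintro rfl
    exact hchi k
  · obtain ⟨K, hK⟩ := hasFormalSum_gelfand n d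
    refine ⟨K, fun m hm e he => ?_⟩
    -- Both sides are images of the same central element, a coefficient of a partial sum that has
    -- already stabilised, so uniqueness transfers convergence from one series to the other.
    refine IsHarishChandraImage.unique ?_ (coeff_shiftRatio_sub_one_mem e).2
    rw [← hK m hm e he]
    simp only [HahnSeries.coeff_sum, coeff_scalar_mul_C]
    exact isHarishChandraImage_sum_smul _ _ hchi
  · rw [add_sub_cancel, shiftRatio_capelliImage]

end GenLin

end

open FormalSeries in
theorem mainTheorem11 :
    (∀ n : ℕ,
      (∀ k, (GenLin.capelli n).coeff k ∈ Subalgebra.center ℂ (GenLin.U n)) ∧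
      IsUnit (ofPoly (GenLin.capelli n)) ∧
      ∃ S : LaurentSeries (GenLin.U n),
        HasFormalSum (fun k : ℕ => scalar (GenLin.U n) ((-1) ^ k / (u ℂ - n + 1) ^ (k + 1)) *
          HahnSeries.C (GenLin.gelfand n k)) S ∧
        1 + S = ofPoly ((GenLin.capelli n).comp (X + 1)) *
          Ring.inverse (ofPoly (GenLin.capelli n))) ∧
    (∀ n : ℕ,
      (∀ k, GenLin.gelfand n k ∈ Subalgebra.center ℂ (GenLin.U n)) ∧
      (∀ k f, GenLin.IsHarishChandraImage n (GenLin.gelfand n k) f ↔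
        f = GenLin.chi n (GenLin.gelfand n k)) ∧
      (∀ i, IsUnit (u (MvPolynomial (Fin n) ℂ) + HahnSeries.C (GenLin.l n i))) ∧
      ∃ S : LaurentSeries (MvPolynomial (Fin n) ℂ),
        HasFormalSum (fun k : ℕ =>
          scalar (MvPolynomial (Fin n) ℂ) ((-1) ^ k / (u ℂ - n + 1) ^ (k + 1)) *
            HahnSeries.C (GenLin.chi n (GenLin.gelfand n k))) S ∧
        1 + S = ∏ i : Fin n, (1 + Ring.inverse
          (u (MvPolynomial (Fin n) ℂ) + HahnSeries.C (GenLin.l n i)))) ∧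
    (∀ (t : ClassicalType) (n : ℕ) (a : Equiv.Perm (Fin (t.size n))),
      (∀ k, (t.capelli n a).coeff k ∈ Subalgebra.center ℂ (t.U n)) ∧
      IsUnit (t.capelliSeries n a 0) ∧
      ∃ S : LaurentSeries (t.U n),
        HasFormalSum (fun k : ℕ => scalar (t.U n)
          ((-1) ^ k / (u ℂ + HahnSeries.C (t.rho n)) ^ (k + 1)) *
            HahnSeries.C ((t.F n ^ k).trace)) S ∧
        1 + scalar (t.U n) ((2 * u ℂ + 1) / (2 * u ℂ + 1 - HahnSeries.C t.eps)) * S =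
          t.capelliSeries n a 1 * Ring.inverse (t.capelliSeries n a 0)) := by
  exact ⟨GenLin.newton, GenLin.harishChandra_gelfand, ClassicalType.newton⟩
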